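/- Let $n\ge 2$, write $x=(x_0,x')=(x_0,x_1,\dots,x_n)\in\mathbb R^{n+1}$ and $D_j=\frac1i\partial_{x_j}$, and let $$P=D_0^3-(D_1^2+x_1^2D_n^2)D_0-b_0x_1^3D_n^3,\qquad b_0\in\mathbb R,\quad 0<|b_0|<\frac{2}{3\sqrt3}.$$ Then the Cauchy problem for $P$ is (locally at the origin) well posed in the Gevrey class of order $2$. Here the Gevrey space $\gamma^{(2)}(\mathbb R^d)$ consists of the $f\in C^\infty(\mathbb R^d)$ such that for every compact $K$ there are $C,h>0$ with $$|\partial^\alpha f(x)|\le C\,h^{|\alpha|}(|\alpha|!)^2\qquad(x\in K,\ \alpha\in\mathbb N^d),\qquad(\ast)$$ and for $\delta>0$ we put $D_\delta=\{x\in\mathbb R^{n+1}: |x'|^2+|x_0|<\delta\}$. Consider the problem $$Pu=f\ \text{ in } D_\delta,\qquad D_0^ju(0,x')=u_j(x')\quad (j=0,1,2)\ \text{ for } (0,x')\in D_\delta .\qquad(\mathrm{CP})$$ Well-posedness means that there is $\varepsilon_0>0$ such that: 1. (Uniqueness) for every $0<\varepsilon<\varepsilon_0$, any two solutions $u,v\in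 C^\infty(D_\varepsilon)$ of (CP) in $D_\varepsilon$ with the same $f,u_0,u_1,u_2$ coincide in $D_\varepsilon$; 2. for all $h>0$ and $r>0$ there is $0<\delta<\varepsilon_0$ such that (a) (Existence) for all $f\in\gamma^{(2)}(\mathbb R^{n+1})$ and $u_0,u_1,u_2\in\gamma^{(2)}(\mathbb R^n)$ that satisfy $(\ast)$, with this $h$ and some $C$, on the closed balls of radius $r$ about the origin, (CP) has a solution $u\in C^\infty(D_\delta)$; (b) (Continuous dependence) for every compact $L\subset D_\delta$ and $k\in\mathbb N$ there is a constant $A$ such that, whenever $f,u_0,u_1,u_2$ are as in (a) and satisfy $(\ast)$ on these balls with constants $C$ and $h$, every solution $u\in C^\infty(D_\delta)$ of (CP) satisfies $\sup_{x\in L}\|\nabla^k u(x)\|\le A\,C$, where $\nabla^k u(x)$ is the $k$-th derivative of $u$ and $\|\cdot\|$ its operator norm as a $k$-linear form. In particular, for all $u_0,u_1,u_2\in\gamma^{(2)}(\mathbb R^n)$ there is a neighbourhood of the origin in which $Pu=0$, $D_0^ju(0,x')=u_j(x')$ $(j=0,1,2)$ has one and only one $C^\infty$ solution. -/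

import Mathlib

open scoped ContDiff Nat

noncomputable section

/-- `ℝᵈ` with its Euclidean norm. -/
abbrev Euc (d : ℕ) : Type := EuclideanSpace ℝ (Fin d)

/-- `D_j = (1/i) ∂/∂x_j`. -/
def Dx {d : ℕ} (j : Fin d) (u : Euc d → ℂ) : Euc d → ℂ :=
  fun x => -Complex.I * fderiv ℝ u x (EuclideanSpace.single j 1)

/-- The operator `P = D_0³ - (D_1² + x_1² D_n²) D_0 - b₀ x_1³ D_n³` on functions of
`x = (x_0, x_1, …, x_n) ∈ ℝⁿ⁺¹`. -/
def modelOp (n : ℕ) (b₀ : ℝ) (u : Euc (n + 1) → ℂ) : Euc (n + 1) → ℂ :=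
  fun x =>
    Dx 0 (Dx 0 (Dx 0 u)) x
      - (Dx 1 (Dx 1 (Dx 0 u)) x
          + (x 1 : ℂ) ^ 2 * Dx (Fin.last n) (Dx (Fin.last n) (Dx 0 u)) x)
      - (b₀ : ℂ) * (x 1 : ℂ) ^ 3
          * Dx (Fin.last n) (Dx (Fin.last n) (Dx (Fin.last n) u)) x

/-- The Gevrey inequality `|∂^α f(x)| ≤ C h^|α| (|α|!)^s` for all `x ∈ K` and all multi-indices `α`.
The partial derivatives of order `k` are `∂_{j_1} ⋯ ∂_{j_k} f`, that is, the value of the `k`-th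
derivative of `f` at the tuple of standard basis vectors `(e_{j_1}, …, e_{j_k})`. -/
def GevreyBound {d : ℕ} (s C h : ℝ) (K : Set (Euc d)) (f : Euc d → ℂ) : Prop :=
  ∀ x ∈ K, ∀ (k : ℕ) (j : Fin k → Fin d),
    ‖iteratedFDeriv ℝ k f x (fun i => EuclideanSpace.single (j i) (1 : ℝ))‖
      ≤ C * h ^ k * (k ! : ℝ) ^ s

/-- `f` belongs to the Gevrey space `γ^(s)(ℝᵈ)`. -/
def IsGevrey {d : ℕ} (s : ℝ) (f : Euc d → ℂ) : Prop :=
  ContDiff ℝ ∞ f ∧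
    ∀ K : Set (Euc d), IsCompact K → ∃ C > 0, ∃ h > 0, GevreyBound s C h K f

/-- The point `x' = (x_1, …, x_n)` of `x = (x_0, x')`. -/
def spacePart {n : ℕ} (x : Euc (n + 1)) : Euc n :=
  WithLp.toLp 2 (fun i : Fin n => x i.succ)

/-- The neighbourhood `{x : |x'|² + |x_0| < δ}` of the origin. -/
def lens (n : ℕ) (δ : ℝ) : Set (Euc (n + 1)) :=
  {x | ‖spacePart x‖ ^ 2 + |x 0| < δ}

/-- `u ∈ C^∞(U)` solves `P u = f` in `U` and `D_0^j u(0, x') = g_j(x')` for `j < m` on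
`U ∩ {x_0 = 0}`. -/
structure SolvesCauchy {n : ℕ} (P : (Euc (n + 1) → ℂ) → Euc (n + 1) → ℂ) (m : ℕ)
    (U : Set (Euc (n + 1))) (f : Euc (n + 1) → ℂ) (g : Fin m → Euc n → ℂ)
    (u : Euc (n + 1) → ℂ) : Prop where
  smooth : ContDiffOn ℝ ∞ u U
  eqn : ∀ x ∈ U, P u x = f x
  init : ∀ x ∈ U, x 0 = 0 → ∀ j : Fin m, ((Dx 0)^[(j : ℕ)] u) x = g j (spacePart x)

/-- The source `f` and the Cauchy data `g` satisfy the Gevrey inequality with the constants `C`, `h`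
on the closed balls of radius `r` about the origin. -/
def DataBound {n m : ℕ} (s C h r : ℝ) (f : Euc (n + 1) → ℂ) (g : Fin m → Euc n → ℂ) : Prop :=
  GevreyBound s C h (Metric.closedBall 0 r) f ∧
    ∀ j, GevreyBound s C h (Metric.closedBall 0 r) (g j)

/-- The Cauchy problem for the operator `P` of order `m`, with data on `x_0 = 0`, is (locally, at the
origin) well posed in the Gevrey class of order `s`: smooth solutions are unique in all small lens
neighbourhoods of the origin; data of class `γ^(s)` have a smooth solution in such a neighbourhood,
whose size depends on the data only through the radius `r` of the balls on which they are
estimated and the constant `h` of the Gevrey inequality; and for fixed `h` the solution depends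
continuously on the data, from the Gevrey norm to the topology of `C^∞`. -/
def GevreyWellPosed {n : ℕ} (P : (Euc (n + 1) → ℂ) → Euc (n + 1) → ℂ) (m : ℕ) (s : ℝ) : Prop :=
  ∃ ε₀ > 0,
    (∀ ε, 0 < ε → ε < ε₀ → ∀ (f : Euc (n + 1) → ℂ) (g : Fin m → Euc n → ℂ)
      (u v : Euc (n + 1) → ℂ),
      SolvesCauchy P m (lens n ε) f g u → SolvesCauchy P m (lens n ε) f g v →
        Set.EqOn u v (lens n ε)) ∧
    ∀ h > 0, ∀ r > 0, ∃ δ > 0, δ < ε₀ ∧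
      (∀ (f : Euc (n + 1) → ℂ) (g : Fin m → Euc n → ℂ),
        IsGevrey s f → (∀ j, IsGevrey s (g j)) → (∃ C, DataBound s C h r f g) →
          ∃ u, SolvesCauchy P m (lens n δ) f g u) ∧
      (∀ L : Set (Euc (n + 1)), IsCompact L → L ⊆ lens n δ → ∀ k : ℕ, ∃ A : ℝ,
        ∀ (f : Euc (n + 1) → ℂ) (g : Fin m → Euc n → ℂ) (u : Euc (n + 1) → ℂ) (C : ℝ),
          IsGevrey s f → (∀ j, IsGevrey s (g j)) → DataBound s C h r f g →
          SolvesCauchy P m (lens n δ) f g u →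
            ∀ x ∈ L, ‖iteratedFDeriv ℝ k u x‖ ≤ A * C)

end

/-!
The operator has real characteristic roots which coincide on `ξ₁ = 0`, `x₁ = 0`. Elsewhere the
condition `27 b₀² < 4` makes the roots of `τ³ - a τ - b₀ x₁³ ξₙ³`, `a = ξ₁² + x₁² ξₙ²`, distinct,
uniformly after division by `√a`. The price of the triple root is a growth `exp (Λ √|ξₙ| |t|)` of
the Fourier modes, which is exactly what data of Gevrey order two can absorb for a short time.

**Existence.** The data are cut off by a Gevrey function and expanded into a Fourier series in the
space variables; the coefficient `x₁` is replaced by a smooth periodic function that agrees with it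
near the origin. The coefficients depend on `x₁` only, so each frequency `η = ξₙ` gives an equation
of third order in time on `ℓ²(ℤ)`, with `D` (the derivative in `x₁`) and `M` (the multiplication):
`D_t³ U = (D² + η² M²) D_t U + b₀ η³ M³ U` up to the source (`ModeSys`). Its energy is the form of
Leray's symmetrizer, the Bezout matrix of the characteristic polynomial, which is positive because
`27 b₀² < 4` (`OscPair.energy_coercive`). In the derivative of the energy only the commutator of
`A = D² + η² M²` with `B = b₀ η³ M³` survives, and it costs a factor `√|η|` (`OscPair.im_osc_cub`).
Commuting with powers of `D` keeps the exponential rate and loses powers of `√|η|`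
(`exists_level_bound`). All this is done for a bounded regularization of `D`, uniformly, so that the
equations are ordinary differential equations; the limit is `exists_mode_solution`. Since the
coefficients of Gevrey data decay like `exp (-2 κ √|k|)` (`BoxFun.norm_boxCoeff_le_exp`), the modes
can be summed for `|t|` small with respect to `κ` (`exists_coeff_solution`), and the sum solves the
Cauchy problem with bounds of all derivatives (`exists_cauchy_solution`).

**Uniqueness.** This has to hold for solutions that are only smooth. With the remaining space
variables fixed, the difference of two solutions is a function `V` of `(t, x, y) = (x₀, x₁, xₙ)`. A
convolution in `y` of a cutoff of `V` with the Gaussian `exp (-l y²)` turns `∂_y^k` into a factor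
`k! / R^k`, by Cauchy's estimate for the Gaussian. The wave operator `∂ₜ² - ∂ₓ²` is integrated along
its characteristics, in a light triangle of height `τ = R / 4`; the remaining terms of the equation
are of order at most three in `∂_y`, and the loss of factorials is compensated by a shrinking radius
as in the Cauchy–Kovalevskaya theorem (`CharSystem.norm_le`). The error made by the cutoff lives far
from the base point and has size `exp (-3 l R²)`. As the means, times a power of `l`, converge to `V`,
the function vanishes at the vertex of the triangle (`eq_zero_at_vertex`). Thin layers of such
triangles sweep out a backward cone (`eq_zero_of_backwardCone`), and cones of this slope fit into
small sets `D_ε` (`eq_zero_of_lens`).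

**Continuous dependence** holds because, by uniqueness, every solution is the constructed one.
-/

/-! ### Operators that behave like differentiation and multiplication -/

noncomputable section

/-- A pair of bounded symmetric operators `D`, `M` that behaves like differentiation and
multiplication by a function: the commutators `[D, M]` and `[D, [D, M]]` are bounded by `c`,
and `[M, [D, M]]`, which vanishes for the exact operators, is of size `c / s`. -/
structure OscPair {H : Type*} [NormedAddCommGroup H] [InnerProductSpace ℂ H]
    (D M : H →L[ℂ] H) (c s : ℝ) : Prop where
  D_symm : ∀ x y, inner ℂ (D x) y = inner ℂ x (D y)
  M_symm : ∀ x y, inner ℂ (M x) y = inner ℂ x (M y)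
  M_le : ∀ x, ‖M x‖ ≤ c * ‖x‖
  comm_le : ∀ x, ‖(D * M - M * D) x‖ ≤ c * ‖x‖
  comm_comm_le : ∀ x, ‖(D * (D * M - M * D) - (D * M - M * D) * D) x‖ ≤ c * ‖x‖
  comm_mul_le : ∀ x, s * ‖(M * (D * M - M * D) - (D * M - M * D) * M) x‖ ≤ c * ‖x‖

/-- The oscillator `D² + η² M²`. -/
def oscOp {H : Type*} [NormedAddCommGroup H] [InnerProductSpace ℂ H]
    (D M : H →L[ℂ] H) (η : ℝ) : H →L[ℂ] H := D * D + ((η ^ 2 : ℝ) : ℂ) • (M * M)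

/-- The zeroth order term `b η³ M³`. -/
def cubOp {H : Type*} [NormedAddCommGroup H] [InnerProductSpace ℂ H]
    (M : H →L[ℂ] H) (b η : ℝ) : H →L[ℂ] H := ((b * η ^ 3 : ℝ) : ℂ) • (M * (M * M))

section Energy
variable {H : Type*} [NormedAddCommGroup H] [InnerProductSpace ℂ H]
  {D M : H →L[ℂ] H} {c s : ℝ}

lemma clm_mul_apply (S T : H →L[ℂ] H) (x : H) : (S * T) x = S (T x) := rfl

lemma oscOp_apply (η : ℝ) (x : H) :
    oscOp D M η x = D (D x) + ((η ^ 2 : ℝ) : ℂ) • M (M x) := by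
  simp [oscOp]

lemma cubOp_apply (b η : ℝ) (x : H) :
    cubOp M b η x = ((b * η ^ 3 : ℝ) : ℂ) • M (M (M x)) := by
  simp [cubOp]

lemma OscPair.osc_symm (h : OscPair D M c s) (η : ℝ) (x y : H) :
    inner ℂ (oscOp D M η x) y = inner ℂ x (oscOp D M η y) := by
  simp only [oscOp_apply, inner_add_left, inner_add_right, inner_smul_left, inner_smul_right,
    h.D_symm, h.M_symm, Complex.conj_ofReal]

lemma OscPair.cub_symm (h : OscPair D M c s) (b η : ℝ) (x y : H) :
    inner ℂ (cubOp M b η x) y = inner ℂ x (cubOp M b η y) := by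
  simp only [cubOp_apply, inner_smul_left, inner_smul_right,
    h.M_symm, Complex.conj_ofReal]

lemma norm_ofReal_smul (r : ℝ) (x : H) : ‖((r : ℝ) : ℂ) • x‖ = |r| * ‖x‖ := by
  rw [norm_smul, Complex.norm_real, Real.norm_eq_abs]

/-- The cross term `2 Re ⟨D² x, M² x⟩` is nonnegative up to a double commutator. -/
lemma OscPair.norm_osc_sq (h : OscPair D M c s) (hc : 0 ≤ c) (η : ℝ) (x : H) :
    ‖D (D x)‖ ^ 2 + η ^ 4 * ‖M (M x)‖ ^ 2 + 2 * η ^ 2 * ‖M (D x)‖ ^ 2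
      ≤ ‖oscOp D M η x‖ ^ 2 + 4 * c ^ 2 * η ^ 2 * ‖x‖ ^ 2 := by
  set C := D * M - M * D with hC
  -- `Z = [D, M²]`
  set Z := C * M + M * C with hZ
  have hCs : ∀ y, D (M y) = M (D y) + C y := fun y => by simp [hC]
  have hCsk : ∀ y z, inner ℂ (C y) z = - inner ℂ y (C z) := fun y z => by
    simp [hC, h.D_symm, h.M_symm]
  have hZsk : ∀ y z, inner ℂ (Z y) z = - inner ℂ y (Z z) := fun y z => by
    simp only [hZ, add_apply, clm_mul_apply, inner_add_left,
      inner_add_right, hCsk, h.M_symm]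
    ring
  have h1 : D (M (M x)) = M (M (D x)) + Z x := by
    simp [hZ, hCs]
    abel
  have h2 : inner ℂ (D (D x)) (M (M x)) = (‖M (D x)‖ ^ 2 : ℂ) + inner ℂ (D x) (Z x) := by
    rw [h.D_symm, h1, inner_add_right, ← h.M_symm, inner_self_eq_norm_sq_to_K]
    simp
  have h3 : inner ℂ (D x) (Z x) + inner ℂ (Z x) (D x) = inner ℂ x ((D * Z - Z * D) x) := by
    rw [hZsk, h.D_symm]
    simp [sub_eq_add_neg]
  have h4 : 2 * (inner ℂ (D x) (Z x)).re = (inner ℂ x ((D * Z - Z * D) x)).re := by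
    rw [← h3, Complex.add_re, ← inner_conj_symm (Z x) (D x), Complex.conj_re]; ring
  have h5 : (D * Z - Z * D) x = (D * C - C * D) (M x) + C (C x) + C (C x)
      + M ((D * C - C * D) x) := by
    simp only [hZ, add_apply, clm_mul_apply,
      sub_apply, map_add, map_sub, hCs]
    abel
  have h6 : ‖(D * Z - Z * D) x‖ ≤ 4 * c ^ 2 * ‖x‖ := by
    rw [h5]
    have a1 := (h.comm_comm_le (M x)).trans (mul_le_mul_of_nonneg_left (h.M_le x) hc)
    have a2 := (h.comm_le (C x)).trans (mul_le_mul_of_nonneg_left (h.comm_le x) hc)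
    have a3 := (h.M_le ((D * C - C * D) x)).trans
      (mul_le_mul_of_nonneg_left (h.comm_comm_le x) hc)
    have := norm_add₃_le (a := (D * C - C * D) (M x)) (b := C (C x)) (c := C (C x))
    have h7 := norm_add_le ((D * C - C * D) (M x) + C (C x) + C (C x)) (M ((D * C - C * D) x))
    nlinarith
  have h8 : |(inner ℂ x ((D * Z - Z * D) x)).re| ≤ 4 * c ^ 2 * ‖x‖ ^ 2 := by
    refine (Complex.abs_re_le_norm _).trans ((norm_inner_le_norm _ _).trans ?_)
    nlinarith [norm_nonneg x]
  have h9 : ‖oscOp D M η x‖ ^ 2 = ‖D (D x)‖ ^ 2 + 2 * (η ^ 2 * (‖M (D x)‖ ^ 2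
      + (inner ℂ (D x) (Z x)).re)) + η ^ 4 * ‖M (M x)‖ ^ 2 := by
    rw [oscOp_apply, norm_add_sq (𝕜 := ℂ), inner_smul_right, h2, norm_ofReal_smul,
      abs_of_nonneg (sq_nonneg η)]
    have : RCLike.re (((η ^ 2 : ℝ) : ℂ) * ((‖M (D x)‖ ^ 2 : ℂ) + inner ℂ (D x) (Z x)))
        = η ^ 2 * (‖M (D x)‖ ^ 2 + (inner ℂ (D x) (Z x)).re) := by
      rw [RCLike.re_eq_complex_re, Complex.re_ofReal_mul, Complex.add_re]
      norm_cast
    rw [this]; ring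
  rw [h9]
  have h10 := neg_le_of_abs_le h8
  nlinarith [sq_nonneg η]

/-- All terms of the same order as `A = D² + η² M²` are controlled by one quantity `Y`, if `D`,
`η M` and `s` count as order one. The last two bounds interpolate, by
`‖D x‖² ≤ ‖D² x‖ ‖x‖` and `‖M x‖² ≤ ‖M² x‖ ‖x‖`. -/
lemma OscPair.basic_bounds (h : OscPair D M c s) (hc : 0 ≤ c) (hs : 1 ≤ s) {η : ℝ}
    (hη : |η| ≤ s ^ 2) (x : H) : ∃ Y : ℝ, 0 ≤ Y ∧
      Y ^ 2 = (1 + 4 * c ^ 2) * (‖oscOp D M η x‖ ^ 2 + s ^ 4 * ‖x‖ ^ 2) ∧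
      ‖D (D x)‖ ≤ Y ∧ |η| ^ 2 * ‖M (M x)‖ ≤ Y ∧ |η| * ‖M (D x)‖ ≤ Y ∧ s ^ 2 * ‖x‖ ≤ Y ∧
      s * ‖D x‖ ≤ Y ∧ s * (|η| * ‖M x‖) ≤ Y := by
  have hη2 : |η| ^ 2 ≤ s ^ 4 := by
    nlinarith [abs_nonneg η, sq_nonneg s]
  have hη4 : η ^ 4 = |η| ^ 4 := (Even.pow_abs (by decide) η).symm
  have hY := h.norm_osc_sq hc η x
  rw [← sq_abs η, hη4] at hY
  have hYY : ‖oscOp D M η x‖ ^ 2 + 4 * c ^ 2 * |η| ^ 2 * ‖x‖ ^ 2 + s ^ 4 * ‖x‖ ^ 2 ≤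
      (1 + 4 * c ^ 2) * (‖oscOp D M η x‖ ^ 2 + s ^ 4 * ‖x‖ ^ 2) := by
    have : 4 * c ^ 2 * |η| ^ 2 * ‖x‖ ^ 2 ≤ 4 * c ^ 2 * s ^ 4 * ‖x‖ ^ 2 := by gcongr
    nlinarith [sq_nonneg (c * ‖oscOp D M η x‖)]
  have hY2n : 0 ≤ (1 + 4 * c ^ 2) * (‖oscOp D M η x‖ ^ 2 + s ^ 4 * ‖x‖ ^ 2) := by positivity
  generalize (1 + 4 * c ^ 2) * (‖oscOp D M η x‖ ^ 2 + s ^ 4 * ‖x‖ ^ 2) = Y2 at *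
  generalize |η| = a at *
  obtain ⟨Y, hYn, rfl⟩ : ∃ Y : ℝ, 0 ≤ Y ∧ Y2 = Y ^ 2 :=
    ⟨Real.sqrt Y2, Real.sqrt_nonneg _, (Real.sq_sqrt hY2n).symm⟩
  have hs0 : 0 < s := by linarith
  have p1 : 0 ≤ ‖D (D x)‖ ^ 2 := by positivity
  have p2 : 0 ≤ a ^ 4 * ‖M (M x)‖ ^ 2 := by positivity
  have p3 : 0 ≤ a ^ 2 * ‖M (D x)‖ ^ 2 := by positivity
  have p4 : 0 ≤ s ^ 4 * ‖x‖ ^ 2 := by positivity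
  have p5 : 0 ≤ ‖oscOp D M η x‖ ^ 2 := by positivity
  have p6 : 0 ≤ 4 * c ^ 2 * a ^ 2 * ‖x‖ ^ 2 := by positivity
  have e1 : ‖D (D x)‖ ≤ Y := le_of_sq_le_sq (by linarith) hYn
  have e2 : a ^ 2 * ‖M (M x)‖ ≤ Y := le_of_sq_le_sq (by rw [mul_pow, ← pow_mul]; norm_num; linarith) hYn
  have e3 : a * ‖M (D x)‖ ≤ Y := le_of_sq_le_sq (by rw [mul_pow]; linarith) hYn
  have e4 : s ^ 2 * ‖x‖ ≤ Y := le_of_sq_le_sq (by rw [mul_pow, ← pow_mul]; norm_num; linarith) hYn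
  refine ⟨Y, hYn, rfl, e1, e2, e3, e4, ?_, ?_⟩
  · apply le_of_sq_le_sq _ hYn
    have : ‖D x‖ ^ 2 ≤ ‖D (D x)‖ * ‖x‖ := by
      have := norm_inner_le_norm (𝕜 := ℂ) (D (D x)) x
      rw [h.D_symm, inner_self_eq_norm_sq_to_K] at this
      simpa using this
    calc (s * ‖D x‖) ^ 2 = s ^ 2 * ‖D x‖ ^ 2 := by ring
      _ ≤ s ^ 2 * (‖D (D x)‖ * ‖x‖) := by gcongr
      _ = ‖D (D x)‖ * (s ^ 2 * ‖x‖) := by ring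
      _ ≤ Y * Y := by gcongr
      _ = Y ^ 2 := by ring
  · apply le_of_sq_le_sq _ hYn
    have : ‖M x‖ ^ 2 ≤ ‖M (M x)‖ * ‖x‖ := by
      have := norm_inner_le_norm (𝕜 := ℂ) (M (M x)) x
      rw [h.M_symm, inner_self_eq_norm_sq_to_K] at this
      simpa using this
    calc (s * (a * ‖M x‖)) ^ 2 = s ^ 2 * (a ^ 2 * ‖M x‖ ^ 2) := by
          rw [mul_pow, mul_pow]
      _ ≤ s ^ 2 * (a ^ 2 * (‖M (M x)‖ * ‖x‖)) := by gcongr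
      _ = (a ^ 2 * ‖M (M x)‖) * (s ^ 2 * ‖x‖) := by ring
      _ ≤ Y * Y := by gcongr
      _ = Y ^ 2 := by ring

/-- Only terms with a commutator remain: `⟨D² x, M³ x⟩ = ⟨D x, M³ D x⟩ + ⟨D x, [D, M³] x⟩`, and the
first summand is real. -/
lemma OscPair.im_inner_eq (h : OscPair D M c s) (b η : ℝ) (x : H) :
    (inner ℂ (oscOp D M η x) (cubOp M b η x)).im = b * η ^ 3 *
      (inner ℂ (D x) ((3 : ℂ) • (D * M - M * D) (M (M x))
        + (2 : ℂ) • (M * (D * M - M * D) - (D * M - M * D) * M) (M x)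
        + M ((M * (D * M - M * D) - (D * M - M * D) * M) x))).im := by
  set C := D * M - M * D with hC
  set N := M * C - C * M with hN
  have hCs : ∀ y, D (M y) = M (D y) + C y := fun y => by simp [hC]
  have hNs : ∀ y, M (C y) = C (M y) + N y := fun y => by simp [hN]
  have hselfM : ∀ y : H, (inner ℂ y (M y)).im = 0 := fun y => by
    have := inner_conj_symm (𝕜 := ℂ) y (M y)
    rw [h.M_symm] at this
    exact Complex.conj_eq_iff_im.mp this
  have hD3 : D (M (M (M x))) = M (M (M (D x))) + ((3 : ℂ) • C (M (M x)) + (2 : ℂ) • N (M x)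
      + M (N x)) := by
    simp only [hCs, hNs, map_add]
    module
  rw [oscOp_apply, cubOp_apply, inner_smul_right, Complex.im_ofReal_mul, inner_add_left,
    Complex.add_im, inner_smul_left, Complex.conj_ofReal, Complex.im_ofReal_mul, hselfM,
    h.D_symm, hD3, inner_add_right, Complex.add_im, ← h.M_symm (D x), hselfM]
  ring

/-- The commutator of the oscillator with `b η³ M³` is controlled with a loss of `√e`, where
`e = s²`. -/
lemma OscPair.im_osc_cub (h : OscPair D M c s) (hc : 0 ≤ c) (hs : 1 ≤ s) {b η : ℝ}
    (hb : |b| ≤ 1) (hη : |η| ≤ s ^ 2) (x : H) :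
    |(inner ℂ (oscOp D M η x) (cubOp M b η x)).im|
      ≤ 6 * c * (1 + 4 * c ^ 2) * s * (‖oscOp D M η x‖ ^ 2 + s ^ 4 * ‖x‖ ^ 2) := by
  obtain ⟨Y, hYn, hYsq, e1, e2, e3, e4, e5, e6⟩ := h.basic_bounds hc hs hη x
  have hs0 : 0 < s := by linarith
  rw [h.im_inner_eq, abs_mul, abs_mul, abs_pow]
  have hN1 := h.comm_mul_le (M x)
  have hN2 := h.comm_mul_le x
  have hC1 := h.comm_le (M (M x))
  have hin : ‖inner ℂ (D x) ((3 : ℂ) • (D * M - M * D) (M (M x))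
        + (2 : ℂ) • (M * (D * M - M * D) - (D * M - M * D) * M) (M x)
        + M ((M * (D * M - M * D) - (D * M - M * D) * M) x))‖
      ≤ 3 * (‖D x‖ * (c * ‖M (M x)‖)) + 2 * (‖D x‖ *
        ‖(M * (D * M - M * D) - (D * M - M * D) * M) (M x)‖) +
        ‖M (D x)‖ * ‖(M * (D * M - M * D) - (D * M - M * D) * M) x‖ := by
    rw [inner_add_right, inner_add_right, inner_smul_right, inner_smul_right, ← h.M_symm]
    refine norm_add₃_le.trans ?_
    rw [norm_mul, norm_mul]
    simp only [Complex.norm_ofNat]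
    gcongr
    · exact (norm_inner_le_norm (𝕜 := ℂ) _ _).trans (by gcongr)
    · exact norm_inner_le_norm (𝕜 := ℂ) _ _
    · exact norm_inner_le_norm (𝕜 := ℂ) _ _
  have him := (Complex.abs_im_le_norm _).trans hin
  have hI := abs_nonneg (inner ℂ (D x) ((3 : ℂ) • (D * M - M * D) (M (M x))
        + (2 : ℂ) • (M * (D * M - M * D) - (D * M - M * D) * M) (M x)
        + M ((M * (D * M - M * D) - (D * M - M * D) * M) x))).im
  generalize |(inner ℂ (D x) ((3 : ℂ) • (D * M - M * D) (M (M x))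
        + (2 : ℂ) • (M * (D * M - M * D) - (D * M - M * D) * M) (M x)
        + M ((M * (D * M - M * D) - (D * M - M * D) * M) x))).im| = I at *
  have hn0 : 0 ≤ ‖(M * (D * M - M * D) - (D * M - M * D) * M) x‖ := norm_nonneg _
  generalize ‖(M * (D * M - M * D) - (D * M - M * D) * M) x‖ = n0 at *
  have hn1 : 0 ≤ ‖(M * (D * M - M * D) - (D * M - M * D) * M) (M x)‖ := norm_nonneg _
  generalize ‖(M * (D * M - M * D) - (D * M - M * D) * M) (M x)‖ = n1 at *
  have ha0 : 0 ≤ |η| := abs_nonneg η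
  generalize |η| = a at *
  have hd : 0 ≤ ‖D x‖ := norm_nonneg _
  generalize ‖D x‖ = d at *
  have hm : 0 ≤ ‖M x‖ := norm_nonneg _
  generalize ‖M x‖ = m at *
  have hmm : 0 ≤ ‖M (M x)‖ := norm_nonneg _
  generalize ‖M (M x)‖ = mm at *
  have hmd : 0 ≤ ‖M (D x)‖ := norm_nonneg _
  generalize ‖M (D x)‖ = md at *
  have hb0 := abs_nonneg b
  generalize |b| = β at *
  have hx : 0 ≤ ‖x‖ := norm_nonneg _
  have t1 : a ^ 3 * (d * mm) ≤ s * Y ^ 2 := by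
    calc a ^ 3 * (d * mm) = a * d * (a ^ 2 * mm) := by ring
      _ ≤ s ^ 2 * d * Y := by gcongr
      _ = s * (s * d) * Y := by ring
      _ ≤ s * Y * Y := by gcongr
      _ = _ := by ring
  -- the factor `1 / s` in the bound of `[M, [D, M]]` makes up for the excess of powers of `η`
  have t2 : a ^ 3 * (d * n1) ≤ c * (s * Y ^ 2) := by
    have : s ^ 2 * (a ^ 3 * (d * n1)) ≤ s ^ 2 * (c * (s * Y ^ 2)) := by
      calc s ^ 2 * (a ^ 3 * (d * n1))
          = a ^ 3 * (s * d) * (s * n1) := by ring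
        _ ≤ a ^ 3 * Y * (c * m) := by gcongr
        _ = c * Y * a ^ 2 * (a * m) := by ring
        _ ≤ c * Y * (s ^ 2) ^ 2 * (a * m) := by gcongr
        _ = c * Y * s ^ 3 * (s * (a * m)) := by ring
        _ ≤ c * Y * s ^ 3 * Y := by gcongr
        _ = _ := by ring
    exact le_of_mul_le_mul_left this (by positivity)
  have t3 : a ^ 3 * (md * n0) ≤ c * (s * Y ^ 2) := by
    have : s * (a ^ 3 * (md * n0)) ≤ s * (c * (s * Y ^ 2)) := by
      calc s * (a ^ 3 * (md * n0))
          = a ^ 2 * (a * md) * (s * n0) := by ring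
        _ ≤ (s ^ 2) ^ 2 * Y * (c * ‖x‖) := by gcongr
        _ = c * s ^ 2 * Y * (s ^ 2 * ‖x‖) := by ring
        _ ≤ c * s ^ 2 * Y * Y := by gcongr
        _ = _ := by ring
    exact le_of_mul_le_mul_left this (by positivity)
  calc β * a ^ 3 * I = β * (a ^ 3 * I) := by ring
    _ ≤ 1 * (a ^ 3 * I) := by gcongr
    _ ≤ 1 * (a ^ 3 * (3 * (d * (c * mm)) + 2 * (d * n1) + md * n0)) := by gcongr
    _ = 3 * c * (a ^ 3 * (d * mm)) + 2 * (a ^ 3 * (d * n1)) + a ^ 3 * (md * n0) := by ring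
    _ ≤ 3 * c * (s * Y ^ 2) + 2 * (c * (s * Y ^ 2)) + c * (s * Y ^ 2) := by gcongr
    _ = 6 * c * s * Y ^ 2 := by ring
    _ = _ := by rw [hYsq]; ring

end Energy
end

/-! ### Leray's symmetrizer and the energy estimate -/

noncomputable section

section Energy
variable {H : Type*} [NormedAddCommGroup H] [InnerProductSpace ℂ H]
  {D M : H →L[ℂ] H} {c s : ℝ}

/-- The sesquilinear form of Leray's symmetrizer, the Bezout matrix of `τ³ - a τ - β` and its
derivative, with `a` and `β` replaced by the operators `A` and `B`. -/
def symmForm (A B : H →L[ℂ] H) (x0 x1 x2 : H) : ℂ :=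
  3 * inner ℂ x2 x2 + 2 * inner ℂ (A x1) x1 + inner ℂ (A x0) (A x0) - 2 * inner ℂ x2 (A x0)
    + 6 * inner ℂ (B x1) x0

lemma hasDerivAt_clm_comp (A : H →L[ℂ] H) {U : ℝ → H} {U' : H} {t : ℝ} (h : HasDerivAt U U' t) :
    HasDerivAt (fun t => A (U t)) (A U') t :=
  (A.restrictScalars ℝ).hasFDerivAt.comp_hasDerivAt t h

/-- The only commutator that survives in the derivative of the symmetrizer form is `[A, B]`. -/
lemma hasDerivAt_symmForm {A B : H →L[ℂ] H}
    (hA : ∀ x y, inner ℂ (A x) y = inner ℂ x (A y))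
    (hB : ∀ x y, inner ℂ (B x) y = inner ℂ x (B y)) {U0 U1 U2 g : ℝ → H} {t : ℝ}
    (h0 : HasDerivAt U0 (Complex.I • U1 t) t) (h1 : HasDerivAt U1 (Complex.I • U2 t) t)
    (h2 : HasDerivAt U2 (Complex.I • (A (U1 t) + B (U0 t) + g t)) t) :
    HasDerivAt (fun t => (symmForm A B (U0 t) (U1 t) (U2 t)).re)
      (2 * (inner ℂ (A (U0 t)) (B (U0 t))).im
        - 2 * (inner ℂ ((3 : ℂ) • U2 t - A (U0 t)) (g t)).im) t := by
  have d1 := (h2.inner ℂ h2).const_mul (3 : ℂ)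
  have d2 := ((hasDerivAt_clm_comp A h1).inner ℂ h1).const_mul (2 : ℂ)
  have d3 := (hasDerivAt_clm_comp A h0).inner ℂ (hasDerivAt_clm_comp A h0)
  have d4 := (h2.inner ℂ (hasDerivAt_clm_comp A h0)).const_mul (2 : ℂ)
  have d5 := ((hasDerivAt_clm_comp B h1).inner ℂ h0).const_mul (6 : ℂ)
  have := Complex.reCLM.hasFDerivAt.comp_hasDerivAt t ((((d1.add d2).add d3).sub d4).add d5)
  refine this.congr_deriv ?_
  have cj : ∀ x y : H, (inner ℂ x y).im = - (inner ℂ y x).im := fun x y => by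
    rw [← inner_conj_symm x y, Complex.conj_im]
  -- by symmetry the terms cancel in pairs, up to `⟨A U0, B U0⟩` and the source
  have s1 : (inner ℂ (U1 t) (B (U1 t))).im = 0 := by
    have := cj (U1 t) (B (U1 t)); rw [hB] at this; linarith
  have s2 := cj (A (U1 t)) (U2 t)
  have s3 := cj (A (U1 t)) (A (U0 t))
  have s4 := cj (B (U0 t)) (A (U0 t))
  have s5 := cj (B (U0 t)) (U2 t)
  have s6 := cj (g t) (A (U0 t))
  have s7 := cj (g t) (U2 t)
  have s8 : (inner ℂ (B (U2 t)) (U0 t)).im = (inner ℂ (U2 t) (B (U0 t))).im := by rw [hB]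
  have s9 : (inner ℂ (B (U1 t)) (U1 t)).im = 0 := by rw [hB, s1]
  have s10 : (inner ℂ (A (U2 t)) (U1 t)).im = (inner ℂ (U2 t) (A (U1 t))).im := by rw [hA]
  simp only [Complex.reCLM_apply, Complex.add_re, Complex.sub_re, map_smul, inner_smul_left,
    inner_smul_right, inner_add_left, inner_add_right, inner_sub_left, Complex.mul_re,
    Complex.I_re, Complex.I_im, Complex.conj_I, Complex.neg_re, Complex.neg_im, Complex.add_im,
    Complex.sub_im, Complex.mul_im, map_ofNat, Complex.re_ofNat, Complex.im_ofNat]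
  linarith

/-- The energy `symmForm + K e ‖U1‖² + K e² ‖U0‖²` with `e = s²`, `K = 1 + 4 c²`. -/
def energy (D M : H →L[ℂ] H) (c s b η : ℝ) (x0 x1 x2 : H) : ℝ :=
  (symmForm (oscOp D M η) (cubOp M b η) x0 x1 x2).re
    + (1 + 4 * c ^ 2) * s ^ 2 * ‖x1‖ ^ 2 + (1 + 4 * c ^ 2) * s ^ 4 * ‖x0‖ ^ 2

/-- The quadratic form that the energy dominates. -/
def energyNorm (D M : H →L[ℂ] H) (s η : ℝ) (x0 x1 x2 : H) : ℝ :=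
  ‖x2‖ ^ 2 + s ^ 2 * ‖x1‖ ^ 2 + ‖oscOp D M η x0‖ ^ 2 + s ^ 4 * ‖x0‖ ^ 2

lemma OscPair.re_symmForm (h : OscPair D M c s) (b η : ℝ) (x0 x1 x2 : H) :
    (symmForm (oscOp D M η) (cubOp M b η) x0 x1 x2).re =
      3 * ‖x2‖ ^ 2 + 2 * (‖D x1‖ ^ 2 + η ^ 2 * ‖M x1‖ ^ 2) + ‖oscOp D M η x0‖ ^ 2
        - 2 * (inner ℂ x2 (oscOp D M η x0)).re
        + 6 * (b * η ^ 3 * (inner ℂ (M x1) (M (M x0))).re) := by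
  have e1 : inner ℂ (oscOp D M η x1) x1 = ((‖D x1‖ ^ 2 + η ^ 2 * ‖M x1‖ ^ 2 : ℝ) : ℂ) := by
    rw [oscOp_apply, inner_add_left, inner_smul_left, h.D_symm, h.M_symm,
      inner_self_eq_norm_sq_to_K, inner_self_eq_norm_sq_to_K, Complex.conj_ofReal]
    push_cast
    rfl
  have e2 : inner ℂ (cubOp M b η x1) x0
      = ((b * η ^ 3 : ℝ) : ℂ) * inner ℂ (M x1) (M (M x0)) := by
    rw [cubOp_apply, inner_smul_left, h.M_symm, h.M_symm, Complex.conj_ofReal]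
  have e3 : ∀ x : H, (inner ℂ x x).re = ‖x‖ ^ 2 := fun x => by
    rw [inner_self_eq_norm_sq_to_K]; norm_cast
  rw [symmForm, e1, e2]
  simp only [Complex.add_re, Complex.sub_re, Complex.mul_re, Complex.re_ofNat, Complex.im_ofNat,
    zero_mul, sub_zero, e3, Complex.ofReal_re, Complex.ofReal_im]

/-- The mixed term of the symmetrizer form is bounded by `|b|` times a product of square roots of two
of its diagonal terms. -/
lemma OscPair.cross_bound (h : OscPair D M c s) (hc : 0 ≤ c) {b η : ℝ}
    (hη : |η| ≤ s ^ 2) (x0 x1 : H) : ∃ x y : ℝ, 0 ≤ x ∧ 0 ≤ y ∧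
    |b * η ^ 3 * (inner ℂ (M x1) (M (M x0))).re| ≤ |b| * (x * y) ∧
    x ^ 2 = η ^ 2 * ‖M x1‖ ^ 2 ∧
    y ^ 2 ≤ ‖oscOp D M η x0‖ ^ 2 + 4 * c ^ 2 * (s ^ 4 * ‖x0‖ ^ 2) := by
  refine ⟨|η| * ‖M x1‖, |η| ^ 2 * ‖M (M x0)‖, by positivity, by positivity, ?_, ?_, ?_⟩
  · rw [abs_mul, abs_mul, abs_pow]
    have := (Complex.abs_re_le_norm _).trans (norm_inner_le_norm (𝕜 := ℂ) (M x1) (M (M x0)))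
    calc |b| * |η| ^ 3 * |(inner ℂ (M x1) (M (M x0))).re|
        ≤ |b| * |η| ^ 3 * (‖M x1‖ * ‖M (M x0)‖) := by gcongr
      _ = _ := by ring
  · rw [mul_pow, sq_abs]
  · have := h.norm_osc_sq hc η x0
    have h2 : η ^ 2 ≤ s ^ 4 := by
      rw [← sq_abs]; nlinarith [abs_nonneg η, sq_nonneg s]
    have h3 : 4 * c ^ 2 * η ^ 2 * ‖x0‖ ^ 2 ≤ 4 * c ^ 2 * (s ^ 4 * ‖x0‖ ^ 2) := by
      rw [mul_assoc]; gcongr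
    have h4 : (|η| ^ 2 * ‖M (M x0)‖) ^ 2 = η ^ 4 * ‖M (M x0)‖ ^ 2 := by
      rw [sq_abs, mul_pow]; ring
    have h5 : 0 ≤ ‖D (D x0)‖ ^ 2 + 2 * η ^ 2 * ‖M (D x0)‖ ^ 2 := by positivity
    rw [h4]; linarith

/-- The energy is positive definite because `27 b² < 4`: the symmetrizer is the Bezout matrix of a
polynomial with distinct real roots. -/
lemma OscPair.energy_coercive (h : OscPair D M c s) (hc : 0 ≤ c) (hs : 1 ≤ s) {b η θ : ℝ}
    (hθ : θ < 1) (hb : 3 * Real.sqrt 3 / 2 * |b| ≤ θ) (hη : |η| ≤ s ^ 2) (x0 x1 x2 : H) :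
    (1 - θ) / 2 * energyNorm D M s η x0 x1 x2 ≤ energy D M c s b η x0 x1 x2 := by
  obtain ⟨x, y, hx, hy, h1, h2, h3⟩ := h.cross_bound (b := b) hc hη x0 x1
  rw [energy, energyNorm, h.re_symmForm, ← h2]
  have h4 := (Complex.abs_re_le_norm _).trans (norm_inner_le_norm (𝕜 := ℂ) x2 (oscOp D M η x0))
  generalize ‖oscOp D M η x0‖ = q at *
  generalize (inner ℂ x2 (oscOp D M η x0)).re = r at *
  generalize b * η ^ 3 * (inner ℂ (M x1) (M (M x0))).re = w at *
  have p0 : 0 ≤ ‖x2‖ := norm_nonneg _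
  generalize ‖x2‖ = p at *
  have hθ0 : 0 ≤ θ := le_trans (by positivity) hb
  -- arithmetic and geometric mean; this is where the bound `2 / (3 √3)` of `|b|` comes from
  have h5 : 6 * (|b| * (x * y)) ≤ θ * (2 * x ^ 2 + 2 / 3 * y ^ 2) := by
    have hr : Real.sqrt 3 ^ 2 = 3 := Real.sq_sqrt (by norm_num)
    have hr0 : 0 < Real.sqrt 3 := by positivity
    have hxy : 4 * (x * y) ≤ Real.sqrt 3 * (2 * x ^ 2 + 2 / 3 * y ^ 2) := by
      nlinarith [mul_nonneg hr0.le (sq_nonneg (3 * x - Real.sqrt 3 * y)), sq_nonneg (Real.sqrt 3 * x - y)]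
    have : Real.sqrt 3 * (6 * (|b| * (x * y))) ≤ Real.sqrt 3 * (θ * (2 * x ^ 2 + 2 / 3 * y ^ 2)) := by
      calc Real.sqrt 3 * (6 * (|b| * (x * y))) = (3 * Real.sqrt 3 / 2 * |b|) * (4 * (x * y)) := by ring
        _ ≤ θ * (Real.sqrt 3 * (2 * x ^ 2 + 2 / 3 * y ^ 2)) := by gcongr
        _ = _ := by ring
    exact le_of_mul_le_mul_left this hr0
  have h6 := neg_le_of_abs_le h1
  have h7 := le_of_abs_le h4
  have h8 : θ * y ^ 2 ≤ θ * q ^ 2 + 4 * c ^ 2 * (s ^ 4 * ‖x0‖ ^ 2) := by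
    have : 0 ≤ 4 * c ^ 2 * (s ^ 4 * ‖x0‖ ^ 2) := by positivity
    nlinarith
  have h9 : (1 - θ) / 2 * (p ^ 2 + q ^ 2) ≤ 3 * p ^ 2 - 2 * (p * q) + q ^ 2 - θ * (2 / 3 * q ^ 2) := by
    nlinarith [sq_nonneg (p - q / 3), sq_nonneg q, mul_nonneg hθ0 (sq_nonneg (p - q / 3)), mul_nonneg (sub_pos.2 hθ).le (sq_nonneg q), mul_nonneg (sub_pos.2 hθ).le (sq_nonneg (p - 2 * q / 3)), mul_nonneg (sub_pos.2 hθ).le (sq_nonneg (p + 2*q / 3))]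
  have h10 : 0 ≤ s ^ 2 * ‖x1‖ ^ 2 := by positivity
  have h11 : 0 ≤ s ^ 4 * ‖x0‖ ^ 2 := by positivity
  have h12 : 0 ≤ c ^ 2 * (s ^ 2 * ‖x1‖ ^ 2) := by positivity
  have h13 : 0 ≤ c ^ 2 * (s ^ 4 * ‖x0‖ ^ 2) := by positivity
  have h14 : 0 ≤ ‖D x1‖ ^ 2 := by positivity
  have h15 : 0 ≤ (1 - θ) * x ^ 2 := mul_nonneg (by linarith) (by positivity)
  have h16 : 0 ≤ θ * (s ^ 2 * ‖x1‖ ^ 2) := by positivity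
  have h17 : 0 ≤ θ * (s ^ 4 * ‖x0‖ ^ 2) := by positivity
  nlinarith

/-- The upper bound of the energy, used for the initial data. -/
lemma OscPair.energy_le (h : OscPair D M c s) (hc : 0 ≤ c) {b η : ℝ}
    (hb : |b| ≤ 1) (hη : |η| ≤ s ^ 2) (x0 x1 x2 : H) :
    energy D M c s b η x0 x1 x2 ≤ (6 + 16 * c ^ 2) *
      (energyNorm D M s η x0 x1 x2 + ‖D x1‖ ^ 2 + η ^ 2 * ‖M x1‖ ^ 2) := by
  obtain ⟨x, y, hx, hy, h1, h2, h3⟩ := h.cross_bound (b := b) hc hη x0 x1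
  rw [energy, energyNorm, h.re_symmForm, ← h2]
  have h4 := (Complex.abs_re_le_norm _).trans (norm_inner_le_norm (𝕜 := ℂ) x2 (oscOp D M η x0))
  have h6 := le_of_abs_le h1
  have h7 := neg_le_of_abs_le h4
  have h8 : |b| * (x * y) ≤ 1 * (x * y) := by gcongr
  generalize ‖oscOp D M η x0‖ = q at *
  generalize (inner ℂ x2 (oscOp D M η x0)).re = r at *
  generalize b * η ^ 3 * (inner ℂ (M x1) (M (M x0))).re = w at *
  generalize ‖x2‖ = p at *
  have h11 : 0 ≤ s ^ 4 * ‖x0‖ ^ 2 := by positivity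
  have k1 : 0 ≤ c ^ 2 * p ^ 2 := by positivity
  have k2 : 0 ≤ c ^ 2 * q ^ 2 := by positivity
  have k3 : 0 ≤ c ^ 2 * (s ^ 2 * ‖x1‖ ^ 2) := by positivity
  have k4 : 0 ≤ c ^ 2 * ‖D x1‖ ^ 2 := by positivity
  have k5 : 0 ≤ c ^ 2 * x ^ 2 := by positivity
  have k6 : 0 ≤ s ^ 2 * ‖x1‖ ^ 2 := by positivity
  have k7 : 0 ≤ ‖D x1‖ ^ 2 := by positivity
  have k8 : 2 * (x * y) ≤ x ^ 2 + y ^ 2 := by nlinarith [sq_nonneg (x - y)]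
  have k9 : 2 * (p * q) ≤ p ^ 2 + q ^ 2 := by nlinarith [sq_nonneg (p - q)]
  have k10 : 0 ≤ c ^ 2 * (s ^ 4 * ‖x0‖ ^ 2) := by positivity
  nlinarith [sq_nonneg p, sq_nonneg q, sq_nonneg x]

/-- The rate of growth of the energy, in units of `√e`. -/
def energyRate (c θ : ℝ) : ℝ := (12 * c * (1 + 4 * c ^ 2) + 10 + 2 * (1 + 4 * c ^ 2)) / (1 - θ)

/-- The arithmetic of the energy inequality, where `p`, `q`, `u`, `v`, `γ` are the norms of `U2`,
`A U0`, `U1`, `U0`, `g`, and `i1, …, i4` are the imaginary parts of the inner products that occur in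
the derivative of the energy `E`. -/
lemma energy_rate_arith {c s θ E i1 i2 i3 i4 p q u v γ : ℝ} (hc : 0 ≤ c) (hs : 1 ≤ s)
    (hθ : θ < 1)
    (hco : (1 - θ) / 2 * (p ^ 2 + s ^ 2 * u ^ 2 + q ^ 2 + s ^ 4 * v ^ 2) ≤ E)
    (b5 : i1 ≤ 6 * c * (1 + 4 * c ^ 2) * s * (q ^ 2 + s ^ 4 * v ^ 2))
    (b6 : -((3 * p + q) * γ) ≤ i2) (b7 : -(u * p) ≤ i3) (b8 : -(v * u) ≤ i4) :
    2 * i1 - 2 * i2 + (1 + 4 * c ^ 2) * s ^ 2 * (-2 * i3) + (1 + 4 * c ^ 2) * s ^ 4 * (-2 * i4)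
      ≤ 2 * (energyRate c θ * s) * E + γ ^ 2 := by
  set Q := p ^ 2 + s ^ 2 * u ^ 2 + q ^ 2 + s ^ 4 * v ^ 2 with hQ
  set K := 1 + 4 * c ^ 2 with hK
  have hs0 : 0 < s := by linarith
  have hK0 : 0 < K := by positivity
  have hQ0 : 0 ≤ Q := by positivity
  have c1 : 2 * (s ^ 2 * (u * p)) ≤ s * Q := by
    have : 2 * (s * u * p) ≤ Q := by
      have e1 : 0 ≤ q ^ 2 + s ^ 4 * v ^ 2 := by positivity
      nlinarith [sq_nonneg (s * u - p)]
    calc 2 * (s ^ 2 * (u * p)) = s * (2 * (s * u * p)) := by ring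
      _ ≤ _ := by gcongr
  have c2 : 2 * (s ^ 4 * (v * u)) ≤ s * Q := by
    have : 2 * (s ^ 2 * v * (s * u)) ≤ Q := by
      have e1 : 0 ≤ q ^ 2 + p ^ 2 := by positivity
      nlinarith [sq_nonneg (s ^ 2 * v - s * u)]
    calc 2 * (s ^ 4 * (v * u)) = s * (2 * (s ^ 2 * v * (s * u))) := by ring
      _ ≤ _ := by gcongr
  have c3 : 2 * ((3 * p + q) * γ) ≤ 10 * (s * Q) + γ ^ 2 := by
    have e1 : 0 ≤ s ^ 2 * u ^ 2 + s ^ 4 * v ^ 2 := by positivity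
    have e2 : (3 * p + q) ^ 2 ≤ 10 * Q := by nlinarith [sq_nonneg (p - 3 * q)]
    nlinarith [sq_nonneg (3 * p + q - γ)]
  have c4 : 2 * i1 ≤ 12 * c * K * (s * Q) := by
    have e1 : 0 ≤ p ^ 2 + s ^ 2 * u ^ 2 := by positivity
    have : 6 * c * K * s * (q ^ 2 + s ^ 4 * v ^ 2) ≤ 6 * c * K * s * Q := by
      gcongr; linarith
    linarith
  have c5 : K * s ^ 2 * (-2 * i3) ≤ K * (s * Q) := by
    calc K * s ^ 2 * (-2 * i3) = K * (s ^ 2 * (-2 * i3)) := by ring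
      _ ≤ K * (s ^ 2 * (2 * (u * p))) :=
          mul_le_mul_of_nonneg_left (mul_le_mul_of_nonneg_left (by linarith) (by positivity)) hK0.le
      _ = K * (2 * (s ^ 2 * (u * p))) := by ring
      _ ≤ _ := by gcongr
  have c6 : K * s ^ 4 * (-2 * i4) ≤ K * (s * Q) := by
    calc K * s ^ 4 * (-2 * i4) = K * (s ^ 4 * (-2 * i4)) := by ring
      _ ≤ K * (s ^ 4 * (2 * (v * u))) :=
          mul_le_mul_of_nonneg_left (mul_le_mul_of_nonneg_left (by linarith) (by positivity)) hK0.le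
      _ = K * (2 * (s ^ 4 * (v * u))) := by ring
      _ ≤ _ := by gcongr
  have c7 : (12 * c * K + 10 + 2 * K) * (s * Q) ≤ 2 * (energyRate c θ * s) * E := by
    have h1θ : 0 < 1 - θ := by linarith
    have e1 : energyRate c θ * (1 - θ) = 12 * c * K + 10 + 2 * K := by
      rw [energyRate, ← hK, div_mul_cancel₀ _ h1θ.ne']
    rw [← e1]
    have : 0 ≤ energyRate c θ := by rw [energyRate]; positivity
    calc energyRate c θ * (1 - θ) * (s * Q) = 2 * (energyRate c θ * s) * ((1 - θ) / 2 * Q) := by ring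
      _ ≤ _ := by gcongr
  linarith

/-- The energy inequality, in differential form. -/
lemma OscPair.hasDerivAt_energy (h : OscPair D M c s) (hc : 0 ≤ c) (hs : 1 ≤ s) {b η θ : ℝ}
    (hθ : θ < 1) (hb1 : |b| ≤ 1) (hb : 3 * Real.sqrt 3 / 2 * |b| ≤ θ) (hη : |η| ≤ s ^ 2)
    {U0 U1 U2 g : ℝ → H} {t : ℝ}
    (h0 : HasDerivAt U0 (Complex.I • U1 t) t) (h1 : HasDerivAt U1 (Complex.I • U2 t) t)
    (h2 : HasDerivAt U2
      (Complex.I • (oscOp D M η (U1 t) + cubOp M b η (U0 t) + g t)) t) :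
    ∃ E', HasDerivAt (fun t => energy D M c s b η (U0 t) (U1 t) (U2 t)) E' t ∧
      E' ≤ 2 * (energyRate c θ * s) * energy D M c s b η (U0 t) (U1 t) (U2 t) + ‖g t‖ ^ 2 := by
  have d1 := hasDerivAt_symmForm (h.osc_symm η) (h.cub_symm b η) h0 h1 h2
  have dn : ∀ {U : ℝ → H} {V : H}, HasDerivAt U (Complex.I • V) t →
      HasDerivAt (fun t => ‖U t‖ ^ 2) (-2 * (inner ℂ (U t) V).im) t := by
    intro U V hU
    have := Complex.reCLM.hasFDerivAt.comp_hasDerivAt t (hU.inner ℂ hU)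
    have e3 : ∀ x : H, (inner ℂ x x).re = ‖x‖ ^ 2 := fun x => by
      rw [inner_self_eq_norm_sq_to_K]; norm_cast
    refine (this.congr_deriv ?_).congr_of_eventuallyEq ?_
    · have : (inner ℂ V (U t)).im = - (inner ℂ (U t) V).im := by
        rw [← inner_conj_symm V (U t), Complex.conj_im]
      simp [inner_smul_left, inner_smul_right, this]
      ring
    · exact Filter.Eventually.of_forall fun t => (e3 (U t)).symm
  have d2 := (dn h1).const_mul ((1 + 4 * c ^ 2) * s ^ 2)
  have d3 := (dn h0).const_mul ((1 + 4 * c ^ 2) * s ^ 4)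
  refine ⟨_, (d1.add d2).add d3, ?_⟩
  have b1 := h.im_osc_cub hc hs hb1 hη (U0 t)
  have hco := h.energy_coercive hc hs hθ hb hη (U0 t) (U1 t) (U2 t)
  generalize energy D M c s b η (U0 t) (U1 t) (U2 t) = E at *
  have b2 : |(inner ℂ ((3 : ℂ) • U2 t - oscOp D M η (U0 t)) (g t)).im|
      ≤ (3 * ‖U2 t‖ + ‖oscOp D M η (U0 t)‖) * ‖g t‖ := by
    refine (Complex.abs_im_le_norm _).trans ((norm_inner_le_norm _ _).trans ?_)
    gcongr
    refine (norm_sub_le _ _).trans ?_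
    rw [norm_smul]; simp
  have b3 := (Complex.abs_im_le_norm _).trans (norm_inner_le_norm (𝕜 := ℂ) (U1 t) (U2 t))
  have b4 := (Complex.abs_im_le_norm _).trans (norm_inner_le_norm (𝕜 := ℂ) (U0 t) (U1 t))
  have b5 := le_of_abs_le b1
  have b6 := neg_le_of_abs_le b2
  have b7 := neg_le_of_abs_le b3
  have b8 := neg_le_of_abs_le b4
  rw [energyNorm] at hco
  generalize (inner ℂ (oscOp D M η (U0 t)) (cubOp M b η (U0 t))).im = i1 at *
  generalize (inner ℂ ((3 : ℂ) • U2 t - oscOp D M η (U0 t)) (g t)).im = i2 at *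
  generalize (inner ℂ (U1 t) (U2 t)).im = i3 at *
  generalize (inner ℂ (U0 t) (U1 t)).im = i4 at *
  have n2 : 0 ≤ ‖U2 t‖ := norm_nonneg _
  have nq : 0 ≤ ‖oscOp D M η (U0 t)‖ := norm_nonneg _
  have n1 : 0 ≤ ‖U1 t‖ := norm_nonneg _
  have n0 : 0 ≤ ‖U0 t‖ := norm_nonneg _
  generalize ‖U2 t‖ = p at *
  generalize ‖oscOp D M η (U0 t)‖ = q at *
  generalize ‖U1 t‖ = u at *
  generalize ‖U0 t‖ = v at *
  generalize ‖g t‖ = γ at *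
  exact energy_rate_arith hc hs hθ hco b5 b6 b7 b8

/-- The energy estimate for positive times. -/
lemma OscPair.energy_growth (h : OscPair D M c s) (hc : 0 ≤ c) (hs : 1 ≤ s) {b η θ : ℝ}
    (hθ : θ < 1) (hb1 : |b| ≤ 1) (hb : 3 * Real.sqrt 3 / 2 * |b| ≤ θ) (hη : |η| ≤ s ^ 2)
    {U0 U1 U2 g : ℝ → H}
    (h0 : ∀ t, HasDerivAt U0 (Complex.I • U1 t) t) (h1 : ∀ t, HasDerivAt U1 (Complex.I • U2 t) t)
    (h2 : ∀ t, HasDerivAt U2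
      (Complex.I • (oscOp D M η (U1 t) + cubOp M b η (U0 t) + g t)) t)
    {l G : ℝ} (hl : energyRate c θ * s ≤ l)
    (hg : ∀ t ∈ Set.Icc (0 : ℝ) 1, ‖g t‖ ≤ G * Real.exp (l * t)) :
    ∀ t ∈ Set.Icc (0 : ℝ) 1, (1 - θ) / 2 * energyNorm D M s η (U0 t) (U1 t) (U2 t)
      ≤ (energy D M c s b η (U0 0) (U1 0) (U2 0) + G ^ 2) * Real.exp (l * t) ^ 2 := by
  choose E' hE' hE'le using fun t => h.hasDerivAt_energy hc hs hθ hb1 hb hη (h0 t) (h1 t) (h2 t)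
  set E := fun t => energy D M c s b η (U0 t) (U1 t) (U2 t) with hEdef
  have hd : ∀ t, HasDerivAt (fun t => Real.exp (-(2 * l) * t) * E t - G ^ 2 * t)
      (Real.exp (-(2 * l) * t) * (E' t - 2 * l * E t) - G ^ 2) t := fun t => by
    have e1 : HasDerivAt (fun t => Real.exp (-(2 * l) * t))
        (Real.exp (-(2 * l) * t) * (-(2 * l))) t := by
      simpa using ((hasDerivAt_id t).const_mul (-(2 * l))).exp
    have e2 : HasDerivAt (fun t => G ^ 2 * t) (G ^ 2) t := by
      simpa using (hasDerivAt_id t).const_mul (G ^ 2)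
    refine ((e1.mul (hE' t)).sub e2).congr_deriv ?_
    ring
  have hE0 : ∀ t, 0 ≤ E t := fun t =>
    le_trans (mul_nonneg (by linarith) (by rw [energyNorm]; positivity))
      (h.energy_coercive hc hs hθ hb hη (U0 t) (U1 t) (U2 t))
  have hanti : AntitoneOn (fun t => Real.exp (-(2 * l) * t) * E t - G ^ 2 * t)
      (Set.Icc (0 : ℝ) 1) := by
    apply antitoneOn_of_deriv_nonpos (convex_Icc _ _)
    · exact fun t _ => (hd t).continuousAt.continuousWithinAt
    · exact fun t _ => (hd t).differentiableAt.differentiableWithinAt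
    · intro t ht
      rw [interior_Icc] at ht
      rw [(hd t).deriv]
      have hgt := hg t ⟨ht.1.le, ht.2.le⟩
      have hg2 : ‖g t‖ ^ 2 ≤ G ^ 2 * Real.exp (2 * l * t) := by
        calc ‖g t‖ ^ 2 ≤ (G * Real.exp (l * t)) ^ 2 := by gcongr
          _ = _ := by rw [mul_pow, ← Real.exp_nat_mul]; push_cast; ring_nf
      have e1 : E' t - 2 * l * E t ≤ G ^ 2 * Real.exp (2 * l * t) := by
        have := hE'le t
        have e2 : 2 * (energyRate c θ * s) * E t ≤ 2 * l * E t := by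
          have := hE0 t
          gcongr
        change E' t ≤ 2 * (energyRate c θ * s) * E t + _ at this
        linarith
      have e3 : Real.exp (-(2 * l) * t) * (E' t - 2 * l * E t)
          ≤ Real.exp (-(2 * l) * t) * (G ^ 2 * Real.exp (2 * l * t)) := by gcongr
      have e4 : Real.exp (-(2 * l) * t) * (G ^ 2 * Real.exp (2 * l * t)) = G ^ 2 := by
        rw [mul_left_comm, ← Real.exp_add]; simp
      linarith
  intro t ht
  have h3 := hanti (Set.left_mem_Icc.2 zero_le_one) ht ht.1
  simp only [mul_zero, Real.exp_zero, one_mul, sub_zero] at h3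
  refine (h.energy_coercive hc hs hθ hb hη (U0 t) (U1 t) (U2 t)).trans ?_
  change E t ≤ (E 0 + G ^ 2) * _
  have h4 : Real.exp (-(2 * l) * t) * E t ≤ E 0 + G ^ 2 := by
    have : G ^ 2 * t ≤ G ^ 2 * 1 := by gcongr; exact ht.2
    linarith
  have h5 : Real.exp (l * t) ^ 2 * Real.exp (-(2 * l) * t) = 1 := by
    rw [← Real.exp_nat_mul, ← Real.exp_add]
    simp; ring
  calc E t = (Real.exp (l * t) ^ 2 * Real.exp (-(2 * l) * t)) * E t := by rw [h5, one_mul]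
    _ = Real.exp (l * t) ^ 2 * (Real.exp (-(2 * l) * t) * E t) := by ring
    _ ≤ Real.exp (l * t) ^ 2 * (E 0 + G ^ 2) := by gcongr
    _ = _ := by ring

end Energy
end

/-! ### Bounds for all powers of the derivative -/

noncomputable section

/-- The commutator `[D, T]`. -/
def adOp {H : Type*} [NormedAddCommGroup H] [InnerProductSpace ℂ H] (D T : H →L[ℂ] H) :
    H →L[ℂ] H := D * T - T * D

/-- The iterated commutators of `T` with `D` are bounded by the sequence `c`. -/
def AdBound {H : Type*} [NormedAddCommGroup H] [InnerProductSpace ℂ H] (D T : H →L[ℂ] H)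
    (c : ℕ → ℝ) : Prop := ∀ i, ‖(adOp D)^[i] T‖ ≤ c i

/-- The first order form, on the Hilbert space of one Fourier mode, of the equation
`D_t³ U = A D_t U + B U + g` with `A = D² + η² M²` and `B = b η³ M³`. -/
structure ModeSys {H : Type*} [NormedAddCommGroup H] [InnerProductSpace ℂ H] (D M : H →L[ℂ] H)
    (b η : ℝ) (U0 U1 U2 g : ℝ → H) : Prop where
  d0 : ∀ t, HasDerivAt U0 (Complex.I • U1 t) t
  d1 : ∀ t, HasDerivAt U1 (Complex.I • U2 t) t
  d2 : ∀ t, HasDerivAt U2 (Complex.I • (oscOp D M η (U1 t) + cubOp M b η (U0 t) + g t)) t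

section Levels
variable {H : Type*} [NormedAddCommGroup H] [InnerProductSpace ℂ H]
  {D M T T' : H →L[ℂ] H} {c c' : ℕ → ℝ}

lemma adOp_mul (D T T' : H →L[ℂ] H) : adOp D (T * T') = adOp D T * T' + T * adOp D T' := by
  simp only [adOp]; noncomm_ring

lemma adOp_add (D T T' : H →L[ℂ] H) : adOp D (T + T') = adOp D T + adOp D T' := by
  simp only [adOp]; noncomm_ring

lemma adOp_iterate_add (D T T' : H →L[ℂ] H) (i : ℕ) :
    (adOp D)^[i] (T + T') = (adOp D)^[i] T + (adOp D)^[i] T' := by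
  induction i generalizing T T' with
  | zero => rfl
  | succ i ih => simp only [Function.iterate_succ_apply, adOp_add, ih]

lemma AdBound.shift (h : AdBound D T c) : AdBound D (adOp D T) (fun i => c (i + 1)) := fun i => by
  simpa only [Function.iterate_succ_apply] using h (i + 1)

end Levels

/-- The Leibniz rule for iterated commutators; the bound depends on `c` and `c'` only. -/
lemma AdBound.exists_mul_bound (i : ℕ) : ∀ c c' : ℕ → ℝ, ∃ K : ℝ,
    ∀ (H : Type) [NormedAddCommGroup H] [InnerProductSpace ℂ H] (D T T' : H →L[ℂ] H),
      AdBound D T c → AdBound D T' c' → ‖(adOp D)^[i] (T * T')‖ ≤ K := by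
  induction i with
  | zero =>
    intro c c'
    refine ⟨|c 0| * |c' 0|, fun H _ _ D T T' h h' => ?_⟩
    exact (norm_mul_le _ _).trans (mul_le_mul ((h 0).trans (le_abs_self _))
      ((h' 0).trans (le_abs_self _)) (norm_nonneg _) (abs_nonneg _))
  | succ i ih =>
    intro c c'
    obtain ⟨K1, h1⟩ := ih (fun i => c (i + 1)) c'
    obtain ⟨K2, h2⟩ := ih c (fun i => c' (i + 1))
    refine ⟨K1 + K2, fun H _ _ D T T' h h' => ?_⟩
    rw [Function.iterate_succ_apply, adOp_mul, adOp_iterate_add]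
    exact (norm_add_le _ _).trans (add_le_add (h1 H D _ _ h.shift h') (h2 H D _ _ h h'.shift))

lemma AdBound.exists_mul (c c' : ℕ → ℝ) : ∃ c'' : ℕ → ℝ,
    ∀ (H : Type) [NormedAddCommGroup H] [InnerProductSpace ℂ H] (D T T' : H →L[ℂ] H),
      AdBound D T c → AdBound D T' c' → AdBound D (T * T') c'' := by
  choose K hK using fun i => AdBound.exists_mul_bound i c c'
  exact ⟨K, fun H _ _ D T T' h h' i => hK i H D T T' h h'⟩

/-- The commutator of `D ^ j` with an operator whose iterated commutators with `D` are bounded has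
order less than `j`. -/
lemma AdBound.exists_comm_pow (j : ℕ) : ∀ c : ℕ → ℝ, ∃ K : ℝ, 0 ≤ K ∧
    ∀ (H : Type) [NormedAddCommGroup H] [InnerProductSpace ℂ H] (D T : H →L[ℂ] H),
      AdBound D T c → ∀ x, ‖(D ^ j) (T x) - T ((D ^ j) x)‖
        ≤ K * ∑ i ∈ Finset.range j, ‖(D ^ i) x‖ := by
  induction j with
  | zero => exact fun c => ⟨0, le_rfl, fun H _ _ D T h x => by simp⟩
  | succ j ih =>
    intro c
    obtain ⟨K1, hK1, h1⟩ := ih (fun i => c (i + 1))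
    obtain ⟨K2, hK2, h2⟩ := ih c
    refine ⟨K1 + |c 1| + K2, by positivity, fun H _ _ D T h x => ?_⟩
    have e1 : (D ^ (j + 1)) (T x) - T ((D ^ (j + 1)) x) =
        ((D ^ j) (adOp D T x) - adOp D T ((D ^ j) x)) + adOp D T ((D ^ j) x)
          + ((D ^ j) (T (D x)) - T ((D ^ j) (D x))) := by
      have : ∀ y, (D ^ (j + 1)) y = (D ^ j) (D y) := fun y => by rw [pow_succ]; rfl
      have e2 : D ((D ^ j) x) = (D ^ j) (D x) := by
        rw [← clm_mul_apply, ← clm_mul_apply, ← pow_succ, ← pow_succ']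
      simp only [this, adOp, sub_apply, clm_mul_apply, map_sub, e2]
      abel
    have b1 := h1 H D _ h.shift x
    have b2 := h2 H D _ h (D x)
    have b3 : ‖adOp D T ((D ^ j) x)‖ ≤ |c 1| * ‖(D ^ j) x‖ :=
      (ContinuousLinearMap.le_opNorm _ _).trans (by
        gcongr
        exact (h 1).trans (le_abs_self _))
    have s1 : ∑ i ∈ Finset.range j, ‖(D ^ i) (D x)‖ ≤ ∑ i ∈ Finset.range (j + 1), ‖(D ^ i) x‖ := by
      rw [Finset.sum_range_succ']
      have : ∀ i, (D ^ i) (D x) = (D ^ (i + 1)) x := fun i => by rw [pow_succ]; rfl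
      simp only [this]
      have := norm_nonneg ((D ^ 0) x)
      linarith
    have s2 : ∑ i ∈ Finset.range (j + 1), ‖(D ^ i) x‖
        = ∑ i ∈ Finset.range j, ‖(D ^ i) x‖ + ‖(D ^ j) x‖ := Finset.sum_range_succ _ _
    have s3 : 0 ≤ ∑ i ∈ Finset.range j, ‖(D ^ i) x‖ := Finset.sum_nonneg fun _ _ => norm_nonneg _
    rw [e1]
    refine norm_add₃_le.trans ?_
    have b4 := norm_nonneg ((D ^ j) x)
    have b5 : K1 * ∑ i ∈ Finset.range j, ‖(D ^ i) x‖ ≤ K1 * ∑ i ∈ Finset.range (j + 1), ‖(D ^ i) x‖ := by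
      gcongr; linarith
    have b6 : |c 1| * ‖(D ^ j) x‖ ≤ |c 1| * ∑ i ∈ Finset.range (j + 1), ‖(D ^ i) x‖ := by
      gcongr; linarith
    have b7 := mul_le_mul_of_nonneg_left s1 hK2
    linarith

section Levels
variable {H : Type} [NormedAddCommGroup H] [InnerProductSpace ℂ H] {D M : H →L[ℂ] H}
  {b η : ℝ} {U0 U1 U2 g : ℝ → H}

/-- Reversal of time changes the sign of `b`. -/
lemma ModeSys.reverse (h : ModeSys D M b η U0 U1 U2 g) :
    ModeSys D M (-b) η (fun t => U0 (-t)) (fun t => -U1 (-t)) (fun t => U2 (-t))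
      (fun t => -g (-t)) := by
  have hn : ∀ t : ℝ, HasDerivAt (fun t => -t) (-1) t := fun t =>
    hasDerivAt_neg t
  refine ⟨fun t => ?_, fun t => ?_, fun t => ?_⟩
  · refine ((h.d0 (-t)).scomp t (hn t)).congr_deriv ?_
    simp
  · refine ((h.d1 (-t)).scomp t (hn t)).neg.congr_deriv ?_
    simp
  · refine ((h.d2 (-t)).scomp t (hn t)).congr_deriv ?_
    rw [cubOp_apply, cubOp_apply, map_neg]
    push_cast
    module

/-- Powers of `D` commute with the system up to a source of lower order. -/
lemma ModeSys.pow (h : ModeSys D M b η U0 U1 U2 g) (j : ℕ) :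
    ModeSys D M b η (fun t => (D ^ j) (U0 t)) (fun t => (D ^ j) (U1 t)) (fun t => (D ^ j) (U2 t))
      (fun t => (D ^ j) (g t)
        + ((η ^ 2 : ℝ) : ℂ) • ((D ^ j) ((M * M) (U1 t)) - (M * M) ((D ^ j) (U1 t)))
        + ((b * η ^ 3 : ℝ) : ℂ) •
          ((D ^ j) ((M * (M * M)) (U0 t)) - (M * (M * M)) ((D ^ j) (U0 t)))) := by
  refine ⟨fun t => ?_, fun t => ?_, fun t => ?_⟩
  · simpa using hasDerivAt_clm_comp (D ^ j) (h.d0 t)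
  · simpa using hasDerivAt_clm_comp (D ^ j) (h.d1 t)
  · refine (hasDerivAt_clm_comp (D ^ j) (h.d2 t)).congr_deriv ?_
    have e2 : ∀ x, D ((D ^ j) x) = (D ^ j) (D x) := fun x => by
      rw [← clm_mul_apply, ← clm_mul_apply, ← pow_succ, ← pow_succ']
    simp only [oscOp_apply, cubOp_apply, map_smul, map_add, clm_mul_apply, e2]
    module

end Levels

/-- One step of the induction over powers of `D` in `exists_level_bound`. -/
lemma exists_level_step (c0 θ : ℝ) (hc0 : 0 ≤ c0) (hθ : θ < 1) (c : ℕ → ℝ) (J : ℕ) (C : ℝ)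
    (hC : 0 ≤ C) (p : ℕ) : ∃ C' : ℝ, 0 ≤ C' ∧
    ∀ (H : Type) [NormedAddCommGroup H] [InnerProductSpace ℂ H] (D M : H →L[ℂ] H) (s b η : ℝ)
      (U0 U1 U2 g : ℝ → H) (l Γ : ℝ), OscPair D M c0 s → AdBound D M c → 1 ≤ s → |b| ≤ 1 →
      3 * Real.sqrt 3 / 2 * |b| ≤ θ → |η| ≤ s ^ 2 → ModeSys D M b η U0 U1 U2 g →
      energyRate c0 θ * s ≤ l → 0 ≤ Γ →
      (∀ i ≤ J + 2, ‖(D ^ i) (U0 0)‖ ≤ Γ ∧ ‖(D ^ i) (U1 0)‖ ≤ Γ ∧ ‖(D ^ i) (U2 0)‖ ≤ Γ) →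
      (∀ t ∈ Set.Icc (0 : ℝ) 1, ‖(D ^ J) (g t)‖ ≤ Γ * Real.exp (l * t)) →
      (∀ i < J, ∀ t ∈ Set.Icc (0 : ℝ) 1, ‖(D ^ i) (U0 t)‖ ≤ C * Γ * s ^ p * Real.exp (l * t) ∧
        ‖(D ^ i) (U1 t)‖ ≤ C * Γ * s ^ p * Real.exp (l * t) ∧
        ‖(D ^ i) (U2 t)‖ ≤ C * Γ * s ^ p * Real.exp (l * t)) →
      ∀ t ∈ Set.Icc (0 : ℝ) 1, ‖(D ^ J) (U0 t)‖ ≤ C' * Γ * s ^ (p + 6) * Real.exp (l * t) ∧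
        ‖(D ^ J) (U1 t)‖ ≤ C' * Γ * s ^ (p + 6) * Real.exp (l * t) ∧
        ‖(D ^ J) (U2 t)‖ ≤ C' * Γ * s ^ (p + 6) * Real.exp (l * t) := by
  obtain ⟨c2, hc2⟩ := AdBound.exists_mul c c
  obtain ⟨c3, hc3⟩ := AdBound.exists_mul c c2
  obtain ⟨K2, hK2, h2⟩ := AdBound.exists_comm_pow J c2
  obtain ⟨K3, hK3, h3⟩ := AdBound.exists_comm_pow J c3
  set C2 := 1 + (K2 + K3) * (J * C) with hC2
  have hC2n : 0 ≤ C2 := by positivity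
  set C1 := (6 + 16 * c0 ^ 2) * (4 + (1 + c0 ^ 2) ^ 2 + c0 ^ 2) with hC1
  refine ⟨Real.sqrt ((C1 + C2 ^ 2) / ((1 - θ) / 2)), Real.sqrt_nonneg _, ?_⟩
  intro H _ _ D M s b η U0 U1 U2 g l Γ hO hA hs hb1 hb hη hU hl hΓ hini hg hlow
  have hκ : 0 < (1 - θ) / 2 := by linarith
  have hs0 : 0 < s := by linarith
  have hsp : ∀ m n : ℕ, m ≤ n → s ^ m ≤ s ^ n := fun m n h => pow_le_pow_right₀ hs h
  -- the source of the system for `D ^ J`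
  have hsrc : ∀ t ∈ Set.Icc (0 : ℝ) 1, ‖(D ^ J) (g t)
        + ((η ^ 2 : ℝ) : ℂ) • ((D ^ J) ((M * M) (U1 t)) - (M * M) ((D ^ J) (U1 t)))
        + ((b * η ^ 3 : ℝ) : ℂ) •
          ((D ^ J) ((M * (M * M)) (U0 t)) - (M * (M * M)) ((D ^ J) (U0 t)))‖
        ≤ C2 * Γ * s ^ (p + 6) * Real.exp (l * t) := by
    intro t ht
    have sum0 : ∑ i ∈ Finset.range J, ‖(D ^ i) (U0 t)‖
        ≤ J * (C * Γ * s ^ p * Real.exp (l * t)) := by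
      refine (Finset.sum_le_card_nsmul _ _ (C * Γ * s ^ p * Real.exp (l * t)) ?_).trans (by simp)
      exact fun i hi => (hlow i (Finset.mem_range.1 hi) t ht).1
    have sum1 : ∑ i ∈ Finset.range J, ‖(D ^ i) (U1 t)‖
        ≤ J * (C * Γ * s ^ p * Real.exp (l * t)) := by
      refine (Finset.sum_le_card_nsmul _ _ (C * Γ * s ^ p * Real.exp (l * t)) ?_).trans (by simp)
      exact fun i hi => (hlow i (Finset.mem_range.1 hi) t ht).2.1
    have b2 := (h2 H D (M * M) (hc2 H D M M hA hA) (U1 t)).trans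
      (mul_le_mul_of_nonneg_left sum1 hK2)
    have b3 := (h3 H D (M * (M * M)) (hc3 H D M _ hA (hc2 H D M M hA hA)) (U0 t)).trans
      (mul_le_mul_of_nonneg_left sum0 hK3)
    refine norm_add₃_le.trans ?_
    rw [norm_ofReal_smul, norm_ofReal_smul]
    have r2 : |η ^ 2| ≤ s ^ 6 := by
      rw [abs_pow]
      calc |η| ^ 2 ≤ (s ^ 2) ^ 2 := by gcongr
        _ = s ^ 4 := by ring
        _ ≤ s ^ 6 := hsp _ _ (by norm_num)
    have r3 : |b * η ^ 3| ≤ s ^ 6 := by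
      rw [abs_mul, abs_pow]
      calc |b| * |η| ^ 3 ≤ 1 * (s ^ 2) ^ 3 := by gcongr
        _ = s ^ 6 := by ring
    have e1 : Γ * Real.exp (l * t) ≤ Γ * s ^ (p + 6) * Real.exp (l * t) := by
      have : 1 ≤ s ^ (p + 6) := one_le_pow₀ hs
      have h : 0 ≤ Γ * Real.exp (l * t) := by positivity
      nlinarith
    calc ‖(D ^ J) (g t)‖ + |η ^ 2| * ‖(D ^ J) ((M * M) (U1 t)) - (M * M) ((D ^ J) (U1 t))‖
        + |b * η ^ 3| * ‖(D ^ J) ((M * (M * M)) (U0 t)) - (M * (M * M)) ((D ^ J) (U0 t))‖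
        ≤ Γ * s ^ (p + 6) * Real.exp (l * t)
          + s ^ 6 * (K2 * (J * (C * Γ * s ^ p * Real.exp (l * t))))
          + s ^ 6 * (K3 * (J * (C * Γ * s ^ p * Real.exp (l * t)))) := by
          gcongr
          exact (hg t ht).trans e1
      _ = _ := by rw [hC2]; ring
  have hgrow := hO.energy_growth hc0 hs hθ hb1 hb hη (hU.pow J).d0 (hU.pow J).d1 (hU.pow J).d2
    hl hsrc
  -- the initial energy
  have hD : ∀ x : H, D ((D ^ J) x) = (D ^ (J + 1)) x := fun x => by rw [pow_succ']; rfl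
  have hD' : ∀ x : H, D ((D ^ (J + 1)) x) = (D ^ (J + 2)) x := fun x => by
    rw [pow_succ' D (J + 1)]; rfl
  have hE0 : energy D M c0 s b η ((D ^ J) (U0 0)) ((D ^ J) (U1 0)) ((D ^ J) (U2 0))
      ≤ C1 * (Γ * s ^ (p + 6)) ^ 2 := by
    refine (hO.energy_le hc0 hb1 hη _ _ _).trans ?_
    rw [hC1, mul_assoc]
    refine mul_le_mul_of_nonneg_left ?_ (by positivity)
    have i0 := (hini J (by omega)).1
    have i1 := (hini J (by omega)).2.1
    have i2 := (hini J (by omega)).2.2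
    have i3 : ‖D ((D ^ J) (U1 0))‖ ≤ Γ := by rw [hD]; exact (hini _ (by omega)).2.1
    have i4 : ‖D (D ((D ^ J) (U0 0)))‖ ≤ Γ := by
      rw [hD, hD']; exact (hini _ (by omega)).1
    have hMM : ∀ x : H, ‖M (M x)‖ ≤ c0 ^ 2 * ‖x‖ := fun x =>
      (hO.M_le _).trans ((mul_le_mul_of_nonneg_left (hO.M_le x) hc0).trans (by rw [sq, mul_assoc]))
    set S := s ^ (p + 6) with hS
    have hS1 : 1 ≤ S := one_le_pow₀ hs
    have hS4 : s ^ 4 ≤ S := hsp _ _ (by omega)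
    have hS2 : s ^ 2 ≤ S := hsp _ _ (by omega)
    have hS1' : s ≤ S := by simpa using hsp 1 (p + 6) (by omega)
    have hη2 : |η ^ 2| ≤ s ^ 4 := by
      rw [abs_pow]
      calc |η| ^ 2 ≤ (s ^ 2) ^ 2 := by gcongr
        _ = s ^ 4 := by ring
    have i5 : ‖oscOp D M η ((D ^ J) (U0 0))‖ ≤ (1 + c0 ^ 2) * (Γ * S) := by
      rw [oscOp_apply]
      refine (norm_add_le _ _).trans ?_
      rw [norm_ofReal_smul]
      calc ‖D (D ((D ^ J) (U0 0)))‖ + |η ^ 2| * ‖M (M ((D ^ J) (U0 0)))‖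
          ≤ Γ * S + S * (c0 ^ 2 * Γ) := by
            gcongr
            · exact i4.trans (le_mul_of_one_le_right hΓ hS1)
            · exact hη2.trans hS4
            · exact (hMM _).trans (by gcongr)
        _ = _ := by ring
    have i6 : η ^ 2 * ‖M ((D ^ J) (U1 0))‖ ^ 2 ≤ c0 ^ 2 * (Γ * S) ^ 2 := by
      calc η ^ 2 * ‖M ((D ^ J) (U1 0))‖ ^ 2 = (|η| * ‖M ((D ^ J) (U1 0))‖) ^ 2 := by
            rw [mul_pow, sq_abs]
        _ ≤ (S * (c0 * Γ)) ^ 2 := by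
            gcongr
            · exact hη.trans hS2
            · exact (hO.M_le _).trans (by gcongr)
        _ = _ := by ring
    have i7 : ‖(D ^ J) (U2 0)‖ ^ 2 ≤ (Γ * S) ^ 2 := by
      gcongr; exact i2.trans (le_mul_of_one_le_right hΓ hS1)
    have i8 : ‖D ((D ^ J) (U1 0))‖ ^ 2 ≤ (Γ * S) ^ 2 := by
      gcongr; exact i3.trans (le_mul_of_one_le_right hΓ hS1)
    have i9 : s ^ 2 * ‖(D ^ J) (U1 0)‖ ^ 2 ≤ (Γ * S) ^ 2 := by
      rw [← mul_pow, mul_comm]; gcongr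
    have i10 : s ^ 4 * ‖(D ^ J) (U0 0)‖ ^ 2 ≤ (Γ * S) ^ 2 := by
      calc s ^ 4 * ‖(D ^ J) (U0 0)‖ ^ 2 = (‖(D ^ J) (U0 0)‖ * s ^ 2) ^ 2 := by ring
        _ ≤ _ := by gcongr
    have i11 : ‖oscOp D M η ((D ^ J) (U0 0))‖ ^ 2 ≤ (1 + c0 ^ 2) ^ 2 * (Γ * S) ^ 2 := by
      rw [← mul_pow]; gcongr
    rw [energyNorm]
    linarith
  intro t ht
  have hfin := hgrow t ht
  have e1 : (1 - θ) / 2 * energyNorm D M s η ((D ^ J) (U0 t)) ((D ^ J) (U1 t)) ((D ^ J) (U2 t))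
      ≤ (C1 + C2 ^ 2) * (Γ * s ^ (p + 6) * Real.exp (l * t)) ^ 2 := by
    refine hfin.trans ?_
    calc _ ≤ (C1 * (Γ * s ^ (p + 6)) ^ 2 + (C2 * Γ * s ^ (p + 6)) ^ 2) * Real.exp (l * t) ^ 2 := by
          gcongr
      _ = _ := by ring
  have e2 : energyNorm D M s η ((D ^ J) (U0 t)) ((D ^ J) (U1 t)) ((D ^ J) (U2 t))
      ≤ (Real.sqrt ((C1 + C2 ^ 2) / ((1 - θ) / 2)) * Γ * s ^ (p + 6) * Real.exp (l * t)) ^ 2 := by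
    have hC1n : 0 ≤ C1 := by positivity
    rw [mul_assoc, mul_assoc, mul_pow, Real.sq_sqrt (by positivity), ← mul_assoc Γ,
      div_mul_eq_mul_div, le_div_iff₀ hκ, mul_comm]
    exact e1
  have hn : 0 ≤ Real.sqrt ((C1 + C2 ^ 2) / ((1 - θ) / 2)) * Γ * s ^ (p + 6) * Real.exp (l * t) := by
    positivity
  rw [energyNorm] at e2
  have z0 := sq_nonneg ‖(D ^ J) (U0 t)‖
  have z1 := sq_nonneg ‖(D ^ J) (U1 t)‖
  have z2 := sq_nonneg ‖(D ^ J) (U2 t)‖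
  have z3 := sq_nonneg ‖oscOp D M η ((D ^ J) (U0 t))‖
  have hs2 : 1 ≤ s ^ 2 := one_le_pow₀ hs
  have hs4 : 1 ≤ s ^ 4 := one_le_pow₀ hs
  have y0 : ‖(D ^ J) (U0 t)‖ ^ 2 ≤ s ^ 4 * ‖(D ^ J) (U0 t)‖ ^ 2 := le_mul_of_one_le_left z0 hs4
  have y1 : ‖(D ^ J) (U1 t)‖ ^ 2 ≤ s ^ 2 * ‖(D ^ J) (U1 t)‖ ^ 2 := le_mul_of_one_le_left z1 hs2
  exact ⟨le_of_sq_le_sq (by linarith) hn, le_of_sq_le_sq (by linarith) hn,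
    le_of_sq_le_sq (by linarith) hn⟩

/-- Bounds for all powers of `D` on the solution, with the same exponential rate for each power and
a polynomial loss in `s`. -/
lemma exists_level_bound (c0 θ : ℝ) (hc0 : 0 ≤ c0) (hθ : θ < 1) (c : ℕ → ℝ) (J : ℕ) :
    ∃ (C : ℝ) (p : ℕ), 0 ≤ C ∧
    ∀ (H : Type) [NormedAddCommGroup H] [InnerProductSpace ℂ H] (D M : H →L[ℂ] H) (s b η : ℝ)
      (U0 U1 U2 g : ℝ → H) (l Γ : ℝ), OscPair D M c0 s → AdBound D M c → 1 ≤ s → |b| ≤ 1 →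
      3 * Real.sqrt 3 / 2 * |b| ≤ θ → |η| ≤ s ^ 2 → ModeSys D M b η U0 U1 U2 g →
      energyRate c0 θ * s ≤ l → 0 ≤ Γ →
      (∀ i < J + 2, ‖(D ^ i) (U0 0)‖ ≤ Γ ∧ ‖(D ^ i) (U1 0)‖ ≤ Γ ∧ ‖(D ^ i) (U2 0)‖ ≤ Γ) →
      (∀ i < J, ∀ t ∈ Set.Icc (0 : ℝ) 1, ‖(D ^ i) (g t)‖ ≤ Γ * Real.exp (l * t)) →
      (∀ i < J, ∀ t ∈ Set.Icc (0 : ℝ) 1, ‖(D ^ i) (U0 t)‖ ≤ C * Γ * s ^ p * Real.exp (l * t) ∧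
        ‖(D ^ i) (U1 t)‖ ≤ C * Γ * s ^ p * Real.exp (l * t) ∧
        ‖(D ^ i) (U2 t)‖ ≤ C * Γ * s ^ p * Real.exp (l * t)) := by
  induction J with
  | zero => exact ⟨0, 0, le_rfl, fun _ _ _ _ _ _ _ _ _ _ _ _ _ _ _ _ _ _ _ _ _ _ _ _ _ i hi =>
      absurd hi (Nat.not_lt_zero i)⟩
  | succ J ih =>
    obtain ⟨C, p, hC, h⟩ := ih
    obtain ⟨C', hC', h'⟩ := exists_level_step c0 θ hc0 hθ c J C hC p
    refine ⟨C + C', p + 6, by positivity, ?_⟩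
    intro H _ _ D M s b η U0 U1 U2 g l Γ hO hA hs hb1 hb hη hU hl hΓ hini hg i hi t ht
    have hlow := h H D M s b η U0 U1 U2 g l Γ hO hA hs hb1 hb hη hU hl hΓ
      (fun i hi => hini i (by omega)) (fun i hi => hg i (by omega))
    have hs0 : 0 < s := by linarith
    rcases Nat.lt_succ_iff_lt_or_eq.1 hi with hi | rfl
    · have hle : C * Γ * s ^ p * Real.exp (l * t)
          ≤ (C + C') * Γ * s ^ (p + 6) * Real.exp (l * t) := by
        gcongr
        · linarith
        · omega
      obtain ⟨a0, a1, a2⟩ := hlow i hi t ht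
      exact ⟨a0.trans hle, a1.trans hle, a2.trans hle⟩
    · have hle : C' * Γ * s ^ (p + 6) * Real.exp (l * t)
          ≤ (C + C') * Γ * s ^ (p + 6) * Real.exp (l * t) := by
        gcongr
        linarith
      obtain ⟨a0, a1, a2⟩ := h' H D M s b η U0 U1 U2 g l Γ hO hA hs hb1 hb hη hU hl hΓ
        (fun j hj => hini j (by omega)) (hg i (by omega)) hlow t ht
      exact ⟨a0.trans hle, a1.trans hle, a2.trans hle⟩

/-- The estimate `exists_level_bound` in both time directions. -/
lemma exists_level_bound_abs (c0 θ : ℝ) (hc0 : 0 ≤ c0) (hθ : θ < 1) (c : ℕ → ℝ) (J : ℕ) :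
    ∃ (C : ℝ) (p : ℕ), 0 ≤ C ∧
    ∀ (H : Type) [NormedAddCommGroup H] [InnerProductSpace ℂ H] (D M : H →L[ℂ] H) (s b η : ℝ)
      (U0 U1 U2 g : ℝ → H) (l Γ : ℝ), OscPair D M c0 s → AdBound D M c → 1 ≤ s → |b| ≤ 1 →
      3 * Real.sqrt 3 / 2 * |b| ≤ θ → |η| ≤ s ^ 2 → ModeSys D M b η U0 U1 U2 g →
      energyRate c0 θ * s ≤ l → 0 ≤ Γ →
      (∀ i < J + 2, ‖(D ^ i) (U0 0)‖ ≤ Γ ∧ ‖(D ^ i) (U1 0)‖ ≤ Γ ∧ ‖(D ^ i) (U2 0)‖ ≤ Γ) →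
      (∀ i < J, ∀ t : ℝ, |t| ≤ 1 → ‖(D ^ i) (g t)‖ ≤ Γ * Real.exp (l * |t|)) →
      (∀ i < J, ∀ t : ℝ, |t| ≤ 1 → ‖(D ^ i) (U0 t)‖ ≤ C * Γ * s ^ p * Real.exp (l * |t|) ∧
        ‖(D ^ i) (U1 t)‖ ≤ C * Γ * s ^ p * Real.exp (l * |t|) ∧
        ‖(D ^ i) (U2 t)‖ ≤ C * Γ * s ^ p * Real.exp (l * |t|)) := by
  obtain ⟨C, p, hC, h⟩ := exists_level_bound c0 θ hc0 hθ c J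
  refine ⟨C, p, hC, ?_⟩
  intro H _ _ D M s b η U0 U1 U2 g l Γ hO hA hs hb1 hb hη hU hl hΓ hini hg i hi t ht
  rcases le_total 0 t with h0 | h0
  · rw [abs_of_nonneg h0] at ht ⊢
    refine h H D M s b η U0 U1 U2 g l Γ hO hA hs hb1 hb hη hU hl hΓ hini
      (fun i hi t ht => ?_) i hi t ⟨h0, ht⟩
    simpa [abs_of_nonneg ht.1] using hg i hi t (by rw [abs_of_nonneg ht.1]; exact ht.2)
  -- the estimate depends on `|b|` only, so it applies to the reversed system
  · rw [abs_of_nonpos h0] at ht ⊢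
    have := h H D M s (-b) η _ _ _ _ l Γ hO hA hs (by rwa [abs_neg]) (by rwa [abs_neg]) hη
      hU.reverse hl hΓ (by simpa using hini)
      (fun i hi t ht => by
        simpa [abs_of_nonneg ht.1] using hg i hi (-t) (by
          rw [abs_neg, abs_of_nonneg ht.1]; exact ht.2)) i hi (-t) ⟨by linarith, ht⟩
    simpa using this

end

/-! ### Truncated multipliers on square-summable sequences -/

noncomputable section

section Truncation

/-- A bounded regularization of the identity function, with Lipschitz constant `1` and second
derivative of size `ε`. -/
def truncId (ε y : ℝ) : ℝ := y / Real.sqrt (1 + (ε * y) ^ 2)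

lemma truncId_sq (ε y : ℝ) : truncId ε y ^ 2 = y ^ 2 / (1 + (ε * y) ^ 2) := by
  rw [truncId, div_pow, Real.sq_sqrt (by positivity)]

lemma abs_truncId_le (ε y : ℝ) : |truncId ε y| ≤ |y| := by
  apply abs_le_of_sq_le_sq' _ (abs_nonneg _) |> abs_le.2
  rw [truncId_sq, sq_abs]
  exact div_le_self (sq_nonneg _) (by nlinarith [sq_nonneg (ε * y)])

lemma abs_truncId_le_inv {ε : ℝ} (hε : 0 < ε) (y : ℝ) : |truncId ε y| ≤ 1 / ε := by
  apply abs_le_of_sq_le_sq' _ (by positivity) |> abs_le.2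
  rw [truncId_sq, div_pow, one_pow, div_le_div_iff₀ (by positivity) (by positivity)]
  nlinarith

lemma hasDerivAt_truncId (ε y : ℝ) :
    HasDerivAt (truncId ε) (1 / Real.sqrt (1 + (ε * y) ^ 2) ^ 3) y := by
  have h0 : 0 < 1 + (ε * y) ^ 2 := by positivity
  have h1 : HasDerivAt (fun y => 1 + (ε * y) ^ 2) (2 * (ε * y) * ε) y := by
    have := (((hasDerivAt_id y).const_mul ε).pow 2).const_add 1
    simpa using this
  have h2 := (hasDerivAt_id y).div (h1.sqrt h0.ne') (Real.sqrt_pos.2 h0).ne'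
  refine h2.congr_deriv ?_
  have h3 : Real.sqrt (1 + (ε * y) ^ 2) ^ 2 = 1 + (ε * y) ^ 2 := Real.sq_sqrt h0.le
  have h4 := Real.sqrt_pos.2 h0
  generalize Real.sqrt (1 + (ε * y) ^ 2) = w at *
  simp only [id]
  field_simp
  rw [h3]; ring

lemma hasDerivAt_deriv_truncId (ε y : ℝ) :
    HasDerivAt (fun y => 1 / Real.sqrt (1 + (ε * y) ^ 2) ^ 3)
      (-3 * ε * (ε * y) / Real.sqrt (1 + (ε * y) ^ 2) ^ 5) y := by
  have h0 : 0 < 1 + (ε * y) ^ 2 := by positivity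
  have h1 : HasDerivAt (fun y => 1 + (ε * y) ^ 2) (2 * (ε * y) * ε) y := by
    have := (((hasDerivAt_id y).const_mul ε).pow 2).const_add 1
    simpa using this
  have h4 := Real.sqrt_pos.2 h0
  have h2 := (hasDerivAt_const y (1 : ℝ)).div ((h1.sqrt h0.ne').pow 3) (pow_pos h4 3).ne'
  refine h2.congr_deriv ?_
  simp only [Pi.pow_apply]
  generalize Real.sqrt (1 + (ε * y) ^ 2) = w at *
  field_simp
  simp
  ring

lemma one_le_sqrt_one_add (a : ℝ) : 1 ≤ Real.sqrt (1 + a ^ 2) :=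
  Real.one_le_sqrt.2 (by nlinarith [sq_nonneg a])

lemma abs_truncId_sub_le (ε y z : ℝ) : |truncId ε y - truncId ε z| ≤ |y - z| := by
  have := Convex.norm_image_sub_le_of_norm_hasDerivWithin_le (f := truncId ε) (C := 1)
    (s := Set.univ) (x := z) (y := y) (fun y _ => (hasDerivAt_truncId ε y).hasDerivWithinAt)
    (fun y _ => by
      rw [Real.norm_eq_abs, abs_of_nonneg (by positivity)]
      exact (div_le_one (pow_pos (zero_lt_one.trans_le (one_le_sqrt_one_add _)) 3)).2
        (one_le_pow₀ (one_le_sqrt_one_add _)))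
    convex_univ trivial trivial
  simpa using this

/-- Mixed second differences of `truncId ε` are small with `ε`, since its second derivative is
bounded by `3 ε`. -/
lemma abs_truncId_second_diff_le {ε : ℝ} (hε : 0 ≤ ε) (y i j : ℝ) :
    |(truncId ε (y - i) - truncId ε (y - i - j)) - (truncId ε y - truncId ε (y - j))|
      ≤ 3 * ε * |j| * |i| := by
  set σ' := fun y => 1 / Real.sqrt (1 + (ε * y) ^ 2) ^ 3 with hσ'
  have h1 : ∀ y z, |σ' y - σ' z| ≤ 3 * ε * |y - z| := fun y z => by
    have := Convex.norm_image_sub_le_of_norm_hasDerivWithin_le (f := σ') (C := 3 * ε)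
      (s := Set.univ) (x := z) (y := y)
      (fun y _ => (hasDerivAt_deriv_truncId ε y).hasDerivWithinAt)
      (fun y _ => by
        have h0 := one_le_sqrt_one_add (ε * y)
        have h5 : 0 < Real.sqrt (1 + (ε * y) ^ 2) := by linarith
        rw [norm_div, div_le_iff₀ (norm_pos_iff.2 (pow_pos h5 5).ne'), Real.norm_eq_abs, Real.norm_eq_abs, abs_mul,
          abs_mul, abs_of_nonneg hε, abs_of_nonneg (a := Real.sqrt _ ^ 5) (by positivity)]
        have h2 : |ε * y| ≤ Real.sqrt (1 + (ε * y) ^ 2) :=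
          Real.le_sqrt_of_sq_le (by rw [sq_abs]; linarith)
        have h3 : Real.sqrt (1 + (ε * y) ^ 2) ≤ Real.sqrt (1 + (ε * y) ^ 2) ^ 5 :=
          le_self_pow₀ h0 (by norm_num)
        have : |(-3 : ℝ)| = 3 := by norm_num
        rw [this]
        gcongr
        exact h2.trans h3)
      convex_univ trivial trivial
    simpa using this
  have h2 : ∀ z : ℝ, HasDerivAt (fun z => truncId ε z - truncId ε (z - j)) (σ' z - σ' (z - j)) z :=
    fun z => (hasDerivAt_truncId ε z).sub
      ((hasDerivAt_truncId ε (z - j)).comp_sub_const z j)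
  have := Convex.norm_image_sub_le_of_norm_hasDerivWithin_le
    (f := fun z => truncId ε z - truncId ε (z - j)) (C := 3 * ε * |j|)
    (s := Set.univ) (x := y) (y := y - i) (fun y _ => (h2 y).hasDerivWithinAt)
    (fun y _ => by simpa using h1 y (y - j)) convex_univ trivial trivial
  simpa using this

/-- Comparison of two regularizations: `1 / truncId ε y ^ 2 = 1 / y ^ 2 + ε ^ 2`. -/
lemma abs_truncId_sq_sub_le {ε ε' : ℝ} (hε' : 0 ≤ ε') (h : ε' ≤ ε) (y : ℝ) :
    |truncId ε' y ^ 2 - truncId ε y ^ 2| ≤ ε ^ 2 * truncId ε' y ^ 4 := by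
  have h4 : truncId ε' y ^ 4 = (y ^ 2 / (1 + (ε' * y) ^ 2)) ^ 2 := by rw [← truncId_sq]; ring
  rw [h4, truncId_sq, truncId_sq]
  have a0 : 0 < 1 + (ε * y) ^ 2 := by positivity
  have a1 : 0 < 1 + (ε' * y) ^ 2 := by positivity
  have a2 : (ε' * y) ^ 2 ≤ (ε * y) ^ 2 := by
    rw [mul_pow, mul_pow]; gcongr
  have e : y ^ 2 / (1 + (ε' * y) ^ 2) - y ^ 2 / (1 + (ε * y) ^ 2)
      = y ^ 2 * ((ε * y) ^ 2 - (ε' * y) ^ 2) / ((1 + (ε' * y) ^ 2) * (1 + (ε * y) ^ 2)) := by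
    field_simp; ring
  rw [e, abs_of_nonneg (div_nonneg (mul_nonneg (sq_nonneg _) (by linarith)) (by positivity)),
    div_pow, ← mul_div_assoc, div_le_div_iff₀ (by positivity) (by positivity)]
  have b1 : y ^ 2 * ((ε * y) ^ 2 - (ε' * y) ^ 2) ≤ ε ^ 2 * (y ^ 2) ^ 2 := by
    have : 0 ≤ y ^ 2 * (ε' * y) ^ 2 := by positivity
    nlinarith
  have b2 : (1 + (ε' * y) ^ 2) ^ 2 ≤ (1 + (ε' * y) ^ 2) * (1 + (ε * y) ^ 2) := by
    rw [sq]; gcongr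
  have : 0 ≤ ε ^ 2 * (y ^ 2) ^ 2 := by positivity
  gcongr

lemma tendsto_truncId (y : ℝ) : Filter.Tendsto (fun ε => truncId ε y) (nhds 0) (nhds y) := by
  have : ContinuousAt (fun ε => truncId ε y) 0 := by
    unfold truncId
    apply ContinuousAt.div continuousAt_const (by fun_prop)
    simp
  simpa [ContinuousAt, truncId] using this

end Truncation

/-- The Hilbert space `ℓ²(ℤ)` of Fourier coefficients. -/
abbrev SeqL2 : Type := lp (fun _ : ℤ => ℂ) 2

section Shifts

lemma seqL2_summable (x : SeqL2) : Summable fun k => ‖x k‖ ^ 2 := by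
  have := (lp.memℓp x).summable (by norm_num)
  simpa using this

lemma seqL2_norm_sq (x : SeqL2) : ‖x‖ ^ 2 = ∑' k, ‖x k‖ ^ 2 := by
  have := lp.norm_rpow_eq_tsum (p := 2) (by norm_num) x
  simpa using this

lemma memℓp_two_of_summable {x : ℤ → ℂ} (h : Summable fun k => ‖x k‖ ^ 2) : Memℓp x 2 :=
  memℓp_gen (by simpa using h)

lemma summable_wshift (j : ℤ) (f : ℤ → ℂ) {c : ℝ} (h : ∀ k, ‖f k‖ ≤ c) (x : SeqL2) :
    Summable fun k => ‖f k * x (k - j)‖ ^ 2 := by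
  refine Summable.of_nonneg_of_le (fun _ => by positivity) (fun k => ?_)
    (((Equiv.subRight j).summable_iff.2 (seqL2_summable x)).mul_left (c ^ 2))
  rw [norm_mul, mul_pow]
  have := h k
  have h0 := norm_nonneg (f k)
  simp only [Function.comp, Equiv.subRight_apply]
  gcongr

/-- The weighted shift `x ↦ (k ↦ f k * x (k - j))`. -/
def wshift (j : ℤ) (f : ℤ → ℂ) (c : ℝ) (h : ∀ k, ‖f k‖ ≤ c) : SeqL2 →L[ℂ] SeqL2 :=
  LinearMap.mkContinuous
    { toFun := fun x => ⟨fun k => f k * x (k - j), memℓp_two_of_summable (summable_wshift j f h x)⟩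
      map_add' := fun x y => by
        ext k
        change f k * ((x + y : SeqL2) (k - j)) = f k * x (k - j) + f k * y (k - j)
        rw [lp.coeFn_add, Pi.add_apply, mul_add]
      map_smul' := fun r x => by
        ext k
        change f k * ((r • x : SeqL2) (k - j)) = r * (f k * x (k - j))
        rw [lp.coeFn_smul, Pi.smul_apply, smul_eq_mul]; ring }
    c fun x => by
      have hc : 0 ≤ c := (norm_nonneg _).trans (h 0)
      apply le_of_sq_le_sq _ (by positivity)
      rw [seqL2_norm_sq, mul_pow, seqL2_norm_sq]
      have e : ∑' k, ‖x k‖ ^ 2 = ∑' k, ‖x (k - j)‖ ^ 2 :=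
        ((Equiv.subRight j).tsum_eq (fun k => ‖x k‖ ^ 2)).symm
      rw [e, ← tsum_mul_left]
      refine Summable.tsum_le_tsum (fun k => ?_) (summable_wshift j f h x)
        (((Equiv.subRight j).summable_iff.2 (seqL2_summable x)).mul_left (c ^ 2))
      change ‖f k * x (k - j)‖ ^ 2 ≤ _
      rw [norm_mul, mul_pow]
      have := h k
      gcongr

lemma wshift_apply (j : ℤ) (f : ℤ → ℂ) (c : ℝ) (h : ∀ k, ‖f k‖ ≤ c) (x : SeqL2) (k : ℤ) :
    wshift j f c h x k = f k * x (k - j) := rfl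

lemma norm_wshift_le (j : ℤ) (f : ℤ → ℂ) (c : ℝ) (h : ∀ k, ‖f k‖ ≤ c) : ‖wshift j f c h‖ ≤ c :=
  LinearMap.mkContinuous_norm_le _ ((norm_nonneg _).trans (h 0)) _

/-- The operator with matrix entries `f j k` in row `k` and column `k - j`. -/
def bandOp (f : ℤ → ℤ → ℂ) (c : ℤ → ℝ) (h : ∀ j k, ‖f j k‖ ≤ c j) : SeqL2 →L[ℂ] SeqL2 :=
  ∑' j, wshift j (f j) (c j) (h j)

variable {f : ℤ → ℤ → ℂ} {c : ℤ → ℝ}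

lemma summable_norm_wshift (h : ∀ j k, ‖f j k‖ ≤ c j) (hc : Summable c) :
    Summable fun j => ‖wshift j (f j) (c j) (h j)‖ :=
  Summable.of_nonneg_of_le (fun _ => norm_nonneg _) (fun _ => norm_wshift_le _ _ _ _) hc

lemma hasSum_bandOp (h : ∀ j k, ‖f j k‖ ≤ c j) (hc : Summable c) :
    HasSum (fun j => wshift j (f j) (c j) (h j)) (bandOp f c h) :=
  (summable_norm_wshift h hc).of_norm.hasSum

lemma norm_bandOp_le (h : ∀ j k, ‖f j k‖ ≤ c j) (hc : Summable c) :
    ‖bandOp f c h‖ ≤ ∑' j, c j :=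
  (norm_tsum_le_tsum_norm (summable_norm_wshift h hc)).trans
    (Summable.tsum_le_tsum (fun _ => norm_wshift_le _ _ _ _) (summable_norm_wshift h hc) hc)

lemma hasSum_bandOp_apply (h : ∀ j k, ‖f j k‖ ≤ c j) (hc : Summable c) (x : SeqL2) (k : ℤ) :
    HasSum (fun j => f j k * x (k - j)) (bandOp f c h x k) := by
  have h1 := (hasSum_bandOp h hc).mapL ((ContinuousLinearMap.apply ℂ SeqL2 x))
  exact h1.mapL (lp.evalCLM ℂ (fun _ : ℤ => ℂ) 2 k)

lemma bandOp_eq_of_apply {T : SeqL2 →L[ℂ] SeqL2} (h : ∀ j k, ‖f j k‖ ≤ c j) (hc : Summable c)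
    (hT : ∀ x k, HasSum (fun j => f j k * x (k - j)) (T x k)) : T = bandOp f c h := by
  ext x k
  exact (hT x k).unique (hasSum_bandOp_apply h hc x k)

/-- The diagonal operator with bounded entries `d k`. -/
def diagOp (d : ℤ → ℝ) (c : ℝ) (h : ∀ k, |d k| ≤ c) : SeqL2 →L[ℂ] SeqL2 :=
  wshift 0 (fun k => (d k : ℂ)) c (fun k => by simpa using h k)

lemma diagOp_apply (d : ℤ → ℝ) (c : ℝ) (h : ∀ k, |d k| ≤ c) (x : SeqL2) (k : ℤ) :
    diagOp d c h x k = d k * x k := by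
  rw [diagOp, wshift_apply, sub_zero]

lemma diagOp_symm (d : ℤ → ℝ) (c : ℝ) (h : ∀ k, |d k| ≤ c) (x y : SeqL2) :
    inner ℂ (diagOp d c h x) y = inner ℂ x (diagOp d c h y) := by
  rw [lp.inner_eq_tsum, lp.inner_eq_tsum]
  congr 1; ext k
  rw [diagOp_apply, diagOp_apply]
  simp only [RCLike.inner_apply, map_mul, Complex.conj_ofReal]
  ring

lemma diagOp_pow_apply (d : ℤ → ℝ) (c : ℝ) (h : ∀ k, |d k| ≤ c) (i : ℕ) (x : SeqL2) (k : ℤ) :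
    (diagOp d c h ^ i) x k = (d k) ^ i * x k := by
  induction i generalizing x with
  | zero => simp
  | succ i ih => rw [pow_succ, clm_mul_apply, ih, diagOp_apply, pow_succ]; ring

lemma adOp_diagOp_bandOp (d : ℤ → ℝ) (cd : ℝ) (hd : ∀ k, |d k| ≤ cd)
    (h : ∀ j k, ‖f j k‖ ≤ c j) (hc : Summable c) {c' : ℤ → ℝ}
    (h' : ∀ j k, ‖f j k * ((d k - d (k - j) : ℝ) : ℂ)‖ ≤ c' j) (hc' : Summable c') :
    adOp (diagOp d cd hd) (bandOp f c h)
      = bandOp (fun j k => f j k * ((d k - d (k - j) : ℝ) : ℂ)) c' h' := by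
  refine bandOp_eq_of_apply h' hc' fun x k => ?_
  have h1 := (hasSum_bandOp_apply h hc x k).mul_left (d k : ℂ)
  have h2 := hasSum_bandOp_apply h hc (diagOp d cd hd x) k
  have h3 := h1.sub h2
  rw [adOp, sub_apply, lp.coeFn_sub, Pi.sub_apply, clm_mul_apply, clm_mul_apply, diagOp_apply]
  refine Eq.mp (congrArg (fun F => HasSum F _) (funext fun j => ?_)) h3
  rw [diagOp_apply]
  push_cast; ring

/-- Convolution with the summable sequence `a`. -/
def convOp (a : ℤ → ℂ) : SeqL2 →L[ℂ] SeqL2 :=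
  bandOp (fun j _ => a j) (fun j => ‖a j‖) (fun _ _ => le_rfl)

variable {a : ℤ → ℂ}

lemma hasSum_convOp_apply (ha : Summable fun j => ‖a j‖) (x : SeqL2) (k : ℤ) :
    HasSum (fun j => a j * x (k - j)) (convOp a x k) :=
  hasSum_bandOp_apply _ ha x k

lemma convOp_symm (ha : Summable fun j => ‖a j‖) (hh : ∀ j, a (-j) = (starRingEnd ℂ) (a j))
    (x y : SeqL2) : inner ℂ (convOp a x) y = inner ℂ x (convOp a y) := by
  have h0 := hasSum_bandOp (f := fun j _ => a j) (c := fun j => ‖a j‖) (fun _ _ => le_rfl) ha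
  have h1 : HasSum (fun j => inner ℂ x (wshift j (fun _ => a j) ‖a j‖ (fun _ => le_rfl) y))
      (inner ℂ x (convOp a y)) :=
    (h0.mapL ((ContinuousLinearMap.apply ℂ SeqL2 y))).mapL (innerSL ℂ x)
  have h2 : HasSum (fun j => inner ℂ y (wshift j (fun _ => a j) ‖a j‖ (fun _ => le_rfl) x))
      (inner ℂ y (convOp a x)) :=
    (h0.mapL ((ContinuousLinearMap.apply ℂ SeqL2 x))).mapL (innerSL ℂ y)
  have h3 := h2.map (starRingEnd ℂ) Complex.continuous_conj
  rw [inner_conj_symm] at h3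
  refine h3.unique ?_
  have h4 := (Equiv.neg ℤ).hasSum_iff.2 h1
  refine Eq.mp (congrArg (fun F => HasSum F _) (funext fun j => ?_)) h4
  simp only [Function.comp, Equiv.neg_apply]
  rw [inner_conj_symm, lp.inner_eq_tsum, lp.inner_eq_tsum,
    ← (Equiv.addRight j).tsum_eq (fun k => inner ℂ (wshift j (fun _ => a j) ‖a j‖
      (fun _ => le_rfl) x k) (y k))]
  refine tsum_congr fun k => ?_
  rw [wshift_apply, wshift_apply]
  simp only [Equiv.coe_addRight, RCLike.inner_apply, map_mul, hh, add_sub_cancel_right,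
    sub_neg_eq_add]
  ring

end Shifts
end

/-! ### The regularized derivative and its commutators -/

noncomputable section

/-- The frequency `2 π k`. -/
def freq (k : ℤ) : ℝ := 2 * Real.pi * k

lemma freq_sub (j k : ℤ) : freq (j - k) = freq j - freq k := by
  simp only [freq]; push_cast; ring

/-- The regularization of `D_x` on Fourier coefficients. -/
def truncD (ε : ℝ) (hε : 0 < ε) : SeqL2 →L[ℂ] SeqL2 :=
  diagOp (fun k => truncId ε (freq k)) (1 / ε) (fun _ => abs_truncId_le_inv hε _)

/-- The Fourier coefficients of a smooth real function: a rapidly decreasing, Hermitian sequence. -/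
structure SmoothCoeff (a : ℤ → ℂ) : Prop where
  summable : ∀ i : ℕ, Summable fun j => ‖a j‖ * |freq j| ^ i
  herm : ∀ j, a (-j) = (starRingEnd ℂ) (a j)

/-- The weighted `ℓ¹` norms of the coefficients. -/
def coeffBound (a : ℤ → ℂ) (i : ℕ) : ℝ := ∑' j, ‖a j‖ * |freq j| ^ i

/-- The constant in `SmoothCoeff.oscPair`. -/
def pairBound (a : ℤ → ℂ) : ℝ :=
  coeffBound a 0 + coeffBound a 1 + coeffBound a 2 + 3 * coeffBound a 1 ^ 2

section
variable {a : ℤ → ℂ} {ε : ℝ}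

lemma coeffBound_nonneg (a : ℤ → ℂ) (i : ℕ) : 0 ≤ coeffBound a i :=
  tsum_nonneg fun _ => by positivity

lemma pairBound_nonneg (a : ℤ → ℂ) : 0 ≤ pairBound a := by
  have := coeffBound_nonneg a
  have h0 := this 0
  have h1 := this 1
  have h2 := this 2
  unfold pairBound
  positivity

lemma SmoothCoeff.summable_norm (h : SmoothCoeff a) : Summable fun j => ‖a j‖ := by
  simpa using h.summable 0

lemma norm_adCoeff_le (a : ℤ → ℂ) (ε : ℝ) (i : ℕ) (j k : ℤ) :
    ‖a j * ((truncId ε (freq k) - truncId ε (freq (k - j)) : ℝ) : ℂ) ^ i‖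
      ≤ ‖a j‖ * |freq j| ^ i := by
  rw [norm_mul, norm_pow, Complex.norm_real, Real.norm_eq_abs]
  refine mul_le_mul_of_nonneg_left (pow_le_pow_left₀ (abs_nonneg _) ?_ i) (norm_nonneg _)
  refine (abs_truncId_sub_le _ _ _).trans (le_of_eq ?_)
  rw [freq_sub]; congr 1; ring

lemma SmoothCoeff.adOp_iterate (h : SmoothCoeff a) (hε : 0 < ε) (i : ℕ) :
    (adOp (truncD ε hε))^[i] (convOp a) =
      bandOp (fun j k => a j * ((truncId ε (freq k) - truncId ε (freq (k - j)) : ℝ) : ℂ) ^ i)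
        (fun j => ‖a j‖ * |freq j| ^ i) (norm_adCoeff_le a ε i) := by
  induction i with
  | zero =>
    simp only [Function.iterate_zero, id]
    refine bandOp_eq_of_apply _ (h.summable 0) fun x k => ?_
    simpa using hasSum_convOp_apply h.summable_norm x k
  | succ i ih =>
    rw [Function.iterate_succ_apply', ih, truncD]
    rw [adOp_diagOp_bandOp _ _ _ _ (h.summable i) (c' := fun j => ‖a j‖ * |freq j| ^ (i + 1))
      _ (h.summable (i + 1))]
    · congr 1; funext j k; rw [pow_succ, mul_assoc]
    · intro j k
      rw [mul_assoc, ← pow_succ]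
      exact norm_adCoeff_le a ε (i + 1) j k

lemma SmoothCoeff.adBound (h : SmoothCoeff a) (hε : 0 < ε) :
    AdBound (truncD ε hε) (convOp a) (coeffBound a) := fun i => by
  rw [h.adOp_iterate hε i]
  exact norm_bandOp_le _ (h.summable i)

/-- The commutator `[M, [D_ε, M]]` is of size `ε`: its matrix entries are mixed second differences
of `truncId ε`, which vanish for the exact derivative. -/
lemma norm_bandOp_comm_le (h : SmoothCoeff a) (hε : 0 < ε) (x : SeqL2) :
    ‖(convOp a * adOp (truncD ε hε) (convOp a) - adOp (truncD ε hε) (convOp a) * convOp a) x‖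
      ≤ ε * (3 * coeffBound a 1 ^ 2) * ‖x‖ := by
  set C := adOp (truncD ε hε) (convOp a) with hC
  have hC1 := h.adOp_iterate hε 1
  simp only [Function.iterate_one, pow_one] at hC1
  rw [← hC] at hC1
  set W : ℤ → SeqL2 →L[ℂ] SeqL2 := fun i => wshift i (fun _ => a i) ‖a i‖ (fun _ => le_rfl)
  have hM : HasSum W (convOp a) := 
    hasSum_bandOp (f := fun j _ => a j) (c := fun j => ‖a j‖) (fun _ _ => le_rfl) h.summable_norm
  have hM1 : ∀ y : SeqL2, HasSum (fun i => W i y) (convOp a y) := fun y =>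
    hM.mapL (ContinuousLinearMap.apply ℂ SeqL2 y)
  have hsum : HasSum (fun i => W i (C x) - C (W i x)) ((convOp a * C - C * convOp a) x) :=
    (hM1 (C x)).sub ((hM1 x).mapL C)
  have hWi : ∀ i, ‖W i (C x) - C (W i x)‖
      ≤ 3 * ε * coeffBound a 1 * ‖x‖ * (‖a i‖ * |freq i| ^ 1) := by
    intro i
    have hb : ∀ j k, ‖a j * (((truncId ε (freq (k - i)) - truncId ε (freq (k - i - j)))
        - (truncId ε (freq k) - truncId ε (freq (k - j))) : ℝ) : ℂ)‖
        ≤ 3 * ε * |freq i| * (‖a j‖ * |freq j| ^ 1) := fun j k => by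
      rw [norm_mul, Complex.norm_real, Real.norm_eq_abs]
      have := abs_truncId_second_diff_le hε.le (freq k) (freq i) (freq j)
      simp only [freq_sub]
      calc _ ≤ ‖a j‖ * (3 * ε * |freq j| * |freq i|) := by gcongr
        _ = _ := by ring
    have hs : Summable fun j => 3 * ε * |freq i| * (‖a j‖ * |freq j| ^ 1) :=
      (h.summable 1).mul_left _
    have e : W i (C x) - C (W i x) = bandOp _ _ hb (W i x) := by
      ext k
      have h1 := hasSum_bandOp_apply hb hs (W i x) k
      have h2 := hasSum_bandOp_apply (norm_adCoeff_le a ε 1) (h.summable 1) x (k - i)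
      have h3 := hasSum_bandOp_apply (norm_adCoeff_le a ε 1) (h.summable 1) (W i x) k
      simp only [pow_one] at h2 h3
      rw [lp.coeFn_sub, Pi.sub_apply, hC1, wshift_apply]
      refine ((h2.mul_left (a i)).sub h3).unique ?_
      refine Eq.mp (congrArg (fun F => HasSum F _) (funext fun j => ?_)) h1
      rw [wshift_apply, show k - i - j = k - j - i by ring]
      push_cast; ring
    rw [e]
    have h1 := norm_bandOp_le hb hs
    rw [tsum_mul_left] at h1
    have h2 : ‖W i x‖ ≤ ‖a i‖ * ‖x‖ :=
      ContinuousLinearMap.le_of_opNorm_le _ (norm_wshift_le _ _ _ _) x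
    refine (ContinuousLinearMap.le_of_opNorm_le _ h1 _).trans ?_
    have h3 := coeffBound_nonneg a 1
    calc (3 * ε * |freq i| * coeffBound a 1) * ‖W i x‖
        ≤ (3 * ε * |freq i| * coeffBound a 1) * (‖a i‖ * ‖x‖) := by gcongr
      _ = _ := by ring
  have hs : Summable fun i => 3 * ε * coeffBound a 1 * ‖x‖ * (‖a i‖ * |freq i| ^ 1) :=
    (h.summable 1).mul_left _
  have h1 := tsum_of_norm_bounded hs.hasSum hWi
  rw [hsum.tsum_eq, tsum_mul_left] at h1
  refine h1.trans (le_of_eq ?_)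
  rw [coeffBound]; ring

/-- Regularized derivative and multiplication form an `OscPair`, with a constant that does not depend
on `ε` as long as `s ε ≤ 1`. -/
lemma SmoothCoeff.oscPair (h : SmoothCoeff a) (hε : 0 < ε) {s : ℝ} (hs : 0 ≤ s)
    (hsε : s * ε ≤ 1) :
    OscPair (truncD ε hε) (convOp a) (pairBound a) s := by
  have h0 := coeffBound_nonneg a 0
  have h1 := coeffBound_nonneg a 1
  have h2 := coeffBound_nonneg a 2
  have h3 := sq_nonneg (coeffBound a 1)
  have key : ∀ (T : SeqL2 →L[ℂ] SeqL2) (r : ℝ), ‖T‖ ≤ r → r ≤ pairBound a →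
      ∀ x, ‖T x‖ ≤ pairBound a * ‖x‖ := fun T r hT hr x =>
    (T.le_opNorm x).trans (by gcongr; exact hT.trans hr)
  refine ⟨diagOp_symm _ _ _, convOp_symm h.summable_norm h.herm,
    key _ _ (h.adBound hε 0) ?_, key _ _ (h.adBound hε 1) ?_, key _ _ (h.adBound hε 2) ?_,
    fun x => ?_⟩
  · unfold pairBound; linarith
  · unfold pairBound; linarith
  · unfold pairBound; linarith
  · have := norm_bandOp_comm_le h hε x
    calc s * _ ≤ s * (ε * (3 * coeffBound a 1 ^ 2) * ‖x‖) := by gcongr; exact this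
      _ = (s * ε) * ((3 * coeffBound a 1 ^ 2) * ‖x‖) := by ring
      _ ≤ 1 * ((3 * coeffBound a 1 ^ 2) * ‖x‖) := by gcongr
      _ ≤ _ := by rw [one_mul]; gcongr; unfold pairBound; linarith

end
end

/-! ### Linear differential equations and rapidly decreasing sequences -/

noncomputable section

/-- Duhamel's formula for a linear differential equation with bounded generator. -/
lemma exists_linear_ode {E : Type*} [NormedAddCommGroup E] [NormedSpace ℝ E] [CompleteSpace E]
    (A : E →L[ℝ] E) {G : ℝ → E} (hG : Continuous G) (x0 : E) :
    ∃ W : ℝ → E, W 0 = x0 ∧ ∀ t, HasDerivAt W (A (W t) + G t) t := by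
  have he : ∀ t : ℝ, HasDerivAt (fun t : ℝ => NormedSpace.exp (t • A)) (A * NormedSpace.exp (t • A)) t :=
    fun t => hasDerivAt_exp_smul_const' A t
  have hec : Continuous fun t : ℝ => NormedSpace.exp (t • A) :=
    continuous_iff_continuousAt.2 fun t => (he t).continuousAt
  have hinv : ∀ t : ℝ, NormedSpace.exp (t • A) * NormedSpace.exp ((-t) • A) = 1 := fun t => by
    let : NormedAlgebra ℚ (E →L[ℝ] E) := NormedAlgebra.restrictScalars ℚ ℝ _
    rw [← NormedSpace.exp_add_of_commute ((Commute.refl A).smul_left t |>.smul_right (-t))]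
    simp
  have hcont : Continuous fun s : ℝ => NormedSpace.exp ((-s) • A) (G s) :=
    (hec.comp continuous_neg).clm_apply hG
  refine ⟨fun t => NormedSpace.exp (t • A) (x0 + ∫ s in (0 : ℝ)..t, NormedSpace.exp ((-s) • A) (G s)),
    by simp, fun t => ?_⟩
  have h1 : HasDerivAt (fun t => x0 + ∫ s in (0 : ℝ)..t, NormedSpace.exp ((-s) • A) (G s))
      (NormedSpace.exp ((-t) • A) (G t)) t :=
    (hcont.integral_hasStrictDerivAt 0 t).hasDerivAt.const_add x0
  refine ((he t).clm_apply h1).congr_deriv ?_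
  have h2 : NormedSpace.exp (t • A) (NormedSpace.exp ((-t) • A) (G t)) = G t := by
    change (NormedSpace.exp (t • A) * NormedSpace.exp ((-t) • A)) (G t) = G t
    rw [hinv]; rfl
  rw [h2]; rfl

/-- Since `D` and `M` are bounded, the mode problem is an ordinary differential equation. -/
lemma exists_modeSys {H : Type} [NormedAddCommGroup H] [InnerProductSpace ℂ H] [CompleteSpace H]
    (D M : H →L[ℂ] H) (b η : ℝ) {g : ℝ → H} (hg : Continuous g) (x0 x1 x2 : H) :
    ∃ U0 U1 U2 : ℝ → H, U0 0 = x0 ∧ U1 0 = x1 ∧ U2 0 = x2 ∧ ModeSys D M b η U0 U1 U2 g := by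
  set P0 : (H × H × H) →L[ℝ] H := ContinuousLinearMap.fst ℝ H (H × H)
  set P1 : (H × H × H) →L[ℝ] H :=
    (ContinuousLinearMap.fst ℝ H H).comp (ContinuousLinearMap.snd ℝ H (H × H))
  set P2 : (H × H × H) →L[ℝ] H :=
    (ContinuousLinearMap.snd ℝ H H).comp (ContinuousLinearMap.snd ℝ H (H × H))
  set J : H →L[ℝ] H := (Complex.I • ContinuousLinearMap.id ℂ H).restrictScalars ℝ
  set 𝓐 : (H × H × H) →L[ℝ] (H × H × H) := (J.comp P1).prod ((J.comp P2).prod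
    (J.comp ((((oscOp D M η).restrictScalars ℝ).comp P1)
      + (((cubOp M b η).restrictScalars ℝ).comp P0))))
  obtain ⟨W, hW0, hW⟩ := exists_linear_ode 𝓐
    (G := fun t => ((0 : H), (0 : H), Complex.I • g t)) (by fun_prop) (x0, x1, x2)
  refine ⟨fun t => P0 (W t), fun t => P1 (W t), fun t => P2 (W t), ?_, ?_, ?_, ?_, ?_, ?_⟩
  · simp only [hW0]; rfl
  · simp only [hW0]; rfl
  · simp only [hW0]; rfl
  · intro t
    refine (P0.hasFDerivAt.comp_hasDerivAt t (hW t)).congr_deriv ?_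
    simp [P0, 𝓐, J]
  · intro t
    refine (P1.hasFDerivAt.comp_hasDerivAt t (hW t)).congr_deriv ?_
    simp [P1, 𝓐, J]
  · intro t
    refine (P2.hasFDerivAt.comp_hasDerivAt t (hW t)).congr_deriv ?_
    simp [P2, 𝓐, J]

/-- All polynomial weights of the sequence `x` are bounded, by the constants `B`. -/
def RapidBound (x : ℤ → ℂ) (B : ℕ → ℝ) : Prop :=
  ∀ (i : ℕ) (k : ℤ), ‖x k‖ * (1 + |(k : ℝ)|) ^ i ≤ B i

lemma summable_one_add_abs_sq : Summable fun k : ℤ => (1 / (1 + |(k : ℝ)|)) ^ 2 := by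
  have h : Summable fun k : ℤ => 1 / |(k : ℝ)| ^ 2 := by
    simpa using Real.summable_one_div_int_pow.2 one_lt_two
  refine ((hasSum_ite_eq (0 : ℤ) (1 : ℝ)).summable.add h).of_nonneg_of_le
    (fun _ => by positivity) fun k => ?_
  by_cases hk : k = 0
  · simp [hk]
  · have : 0 < |(k : ℝ)| := abs_pos.2 (by exact_mod_cast hk)
    rw [if_neg hk, zero_add, div_pow, one_pow]
    gcongr
    linarith

/-- The constant in `RapidBound.norm_pow_le`. -/
def weightConst (i : ℕ) : ℝ :=
  (2 * Real.pi) ^ i * Real.sqrt (∑' k : ℤ, (1 / (1 + |(k : ℝ)|)) ^ 2)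

lemma weightConst_nonneg (i : ℕ) : 0 ≤ weightConst i := by unfold weightConst; positivity

lemma abs_freq (k : ℤ) : |freq k| = 2 * Real.pi * |(k : ℝ)| := by
  rw [freq, abs_mul, abs_of_nonneg (by positivity)]

lemma RapidBound.weighted_le {x : ℤ → ℂ} {B : ℕ → ℝ} (h : RapidBound x B) (i : ℕ) (k : ℤ) :
    |freq k| ^ i * ‖x k‖ ≤ (2 * Real.pi) ^ i * B (i + 1) * (1 / (1 + |(k : ℝ)|)) := by
  have h1 := h (i + 1) k
  have h0 : 0 < 1 + |(k : ℝ)| := by positivity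
  rw [abs_freq, mul_one_div, le_div_iff₀ h0, mul_pow]
  calc (2 * Real.pi) ^ i * |(k : ℝ)| ^ i * ‖x k‖ * (1 + |(k : ℝ)|)
      ≤ (2 * Real.pi) ^ i * (1 + |(k : ℝ)|) ^ i * ‖x k‖ * (1 + |(k : ℝ)|) := by
        gcongr; linarith
    _ = (2 * Real.pi) ^ i * (‖x k‖ * (1 + |(k : ℝ)|) ^ (i + 1)) := by ring
    _ ≤ _ := by gcongr

lemma RapidBound.nonneg {x : ℤ → ℂ} {B : ℕ → ℝ} (h : RapidBound x B) (i : ℕ) : 0 ≤ B i :=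
  le_trans (by positivity) (h i 0)

lemma RapidBound.summable {x : ℤ → ℂ} {B : ℕ → ℝ} (h : RapidBound x B) :
    Summable fun k => ‖x k‖ ^ 2 := by
  refine (summable_one_add_abs_sq.mul_left (B 1 ^ 2)).of_nonneg_of_le (fun _ => by positivity)
    fun k => ?_
  have := h.weighted_le 0 k
  simp only [pow_zero, one_mul, zero_add] at this
  rw [← mul_pow]
  gcongr

/-- Rapid decrease controls all powers of the regularized derivative, uniformly in `ε`, because
`|truncId ε y| ≤ |y|`. -/
lemma RapidBound.norm_pow_le {x : SeqL2} {B : ℕ → ℝ} (h : RapidBound x B) {ε : ℝ} (hε : 0 < ε)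
    (i : ℕ) : ‖(truncD ε hε ^ i) x‖ ≤ weightConst i * B (i + 1) := by
  have hB := h.nonneg (i + 1)
  apply le_of_sq_le_sq _ (mul_nonneg (weightConst_nonneg i) hB)
  rw [seqL2_norm_sq, weightConst, mul_right_comm, mul_pow, Real.sq_sqrt (tsum_nonneg fun _ => by positivity), ← tsum_mul_left]
  refine Summable.tsum_le_tsum (fun k => ?_) (seqL2_summable _) (summable_one_add_abs_sq.mul_left _)
  rw [truncD, diagOp_pow_apply, norm_mul, norm_pow, Complex.norm_real, Real.norm_eq_abs, ← mul_pow]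
  have := h.weighted_le i k
  have h2 : |truncId ε (freq k)| ^ i * ‖x k‖ ≤ |freq k| ^ i * ‖x k‖ := by
    exact mul_le_mul_of_nonneg_right
      (pow_le_pow_left₀ (abs_nonneg _) (abs_truncId_le _ _) i) (norm_nonneg _)
  have h3 := h2.trans this
  gcongr

/-- A rapidly decreasing sequence as an element of `ℓ²`. -/
def RapidBound.toL2 {x : ℤ → ℂ} {B : ℕ → ℝ} (h : RapidBound x B) : SeqL2 :=
  ⟨x, memℓp_two_of_summable h.summable⟩

lemma RapidBound.toL2_apply {x : ℤ → ℂ} {B : ℕ → ℝ} (h : RapidBound x B) (k : ℤ) :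
    h.toL2 k = x k := rfl

/-- Componentwise differentiability with rapidly decreasing derivatives gives continuity in `ℓ²`,
even Lipschitz continuity. -/
lemma RapidBound.continuous_toL2 {g g' : ℝ → ℤ → ℂ} {B : ℕ → ℝ} (h : ∀ t, RapidBound (g t) B)
    (h' : ∀ t, RapidBound (g' t) B) (hd : ∀ t k, HasDerivAt (fun t => g t k) (g' t k) t) :
    Continuous fun t => (h t).toL2 := by
  have hB := (h 0).nonneg 1
  have hlip : ∀ t t', ‖(h t).toL2 - (h t').toL2‖ ≤
      Real.sqrt (B 1 ^ 2 * ∑' k : ℤ, (1 / (1 + |(k : ℝ)|)) ^ 2) * |t - t'| := fun t t' => by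
    apply le_of_sq_le_sq _ (by positivity)
    rw [seqL2_norm_sq, mul_pow, Real.sq_sqrt (mul_nonneg (sq_nonneg _) (tsum_nonneg fun _ => by positivity)),
      ← tsum_mul_left, ← tsum_mul_right]
    refine Summable.tsum_le_tsum (fun k => ?_) (seqL2_summable _)
      ((summable_one_add_abs_sq.mul_left _).mul_right _)
    rw [lp.coeFn_sub, Pi.sub_apply, RapidBound.toL2_apply, RapidBound.toL2_apply, ← mul_pow, ← mul_pow]
    have := Convex.norm_image_sub_le_of_norm_hasDerivWithin_le (f := fun t => g t k)
      (C := B 1 * (1 / (1 + |(k : ℝ)|))) (s := Set.univ) (x := t') (y := t)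
      (fun y _ => (hd y k).hasDerivWithinAt)
      (fun y _ => by simpa using (h' y).weighted_le 0 k) convex_univ trivial trivial
    rw [Real.norm_eq_abs] at this
    gcongr
  refine LipschitzWith.continuous (K := Real.toNNReal (Real.sqrt (B 1 ^ 2 * ∑' k : ℤ, (1 / (1 + |(k : ℝ)|)) ^ 2)))
    (LipschitzWith.of_dist_le_mul fun t t' => ?_)
  rw [dist_eq_norm, Real.coe_toNNReal _ (Real.sqrt_nonneg _), Real.dist_eq]
  exact hlip t t'

/-- Convolution of two sequences. -/
def seqConv (a x : ℤ → ℂ) (k : ℤ) : ℂ := ∑' j, a j * x (k - j)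

lemma convOp_apply {a : ℤ → ℂ} (ha : SmoothCoeff a) (x : SeqL2) (k : ℤ) :
    convOp a x k = seqConv a x k := (hasSum_convOp_apply ha.summable_norm x k).tsum_eq.symm

lemma norm_seqL2_apply_le (x : SeqL2) (k : ℤ) : ‖x k‖ ≤ ‖x‖ := lp.norm_apply_le_norm (by norm_num) x k

end

/-! ### The mode problem in the Hilbert space -/

noncomputable section
open Filter Topology

lemma tendstoUniformlyOn_of_norm_sub_le {α : Type*} {f : ℕ → α → ℂ} {h : α → ℂ} {s : Set α}
    {δ : ℕ → ℝ} (hδ : Tendsto δ atTop (𝓝 0)) (hf : ∀ n, ∀ t ∈ s, ‖f n t - h t‖ ≤ δ n) :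
    TendstoUniformlyOn f h atTop s := by
  rw [Metric.tendstoUniformlyOn_iff]
  intro ε hε
  filter_upwards [hδ.eventually_lt_const hε] with n hn t ht
  rw [dist_comm, dist_eq_norm]
  exact (hf n t ht).trans_lt hn

/-- The solution of the mode problem with the regularization `D_ε` of the derivative:
bounds that are uniform in `ε` and comparison of two values of `ε`. -/
lemma exists_truncated_solutions {a : ℤ → ℂ} (ha : SmoothCoeff a) {θ : ℝ} (hθ : θ < 1)
    (J : ℕ) : ∃ (C : ℝ) (p : ℕ), 0 ≤ C ∧
    ∀ (s b η Γ l : ℝ) (x0 x1 x2 : SeqL2) (g : ℝ → SeqL2) (ε : ℝ) (hε : 0 < ε)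
      (U0 U1 U2 : ℝ → SeqL2), 1 ≤ s → s * ε ≤ 1 → |b| ≤ 1 →
      3 * Real.sqrt 3 / 2 * |b| ≤ θ → |η| ≤ s ^ 2 →
      energyRate (pairBound a) θ * s ≤ l → 0 ≤ l → 0 ≤ Γ →
      (∀ i < J + 2, ‖(truncD ε hε ^ i) x0‖ ≤ Γ ∧ ‖(truncD ε hε ^ i) x1‖ ≤ Γ ∧
        ‖(truncD ε hε ^ i) x2‖ ≤ Γ) →
      (∀ i < J, ∀ t : ℝ, |t| ≤ 1 → ‖(truncD ε hε ^ i) (g t)‖ ≤ Γ) →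
      U0 0 = x0 → U1 0 = x1 → U2 0 = x2 → ModeSys (truncD ε hε) (convOp a) b η U0 U1 U2 g →
      ∀ i < J, ∀ t : ℝ, |t| ≤ 1 →
        ‖(truncD ε hε ^ i) (U0 t)‖ ≤ C * Γ * s ^ p * Real.exp (l * |t|) ∧
        ‖(truncD ε hε ^ i) (U1 t)‖ ≤ C * Γ * s ^ p * Real.exp (l * |t|) ∧
        ‖(truncD ε hε ^ i) (U2 t)‖ ≤ C * Γ * s ^ p * Real.exp (l * |t|) := by
  obtain ⟨C, p, hC, h⟩ := exists_level_bound_abs (pairBound a) θ (pairBound_nonneg a) hθ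
    (coeffBound a) J
  refine ⟨C, p, hC, ?_⟩
  intro s b η Γ l x0 x1 x2 g ε hε U0 U1 U2 hs hsε hb1 hb hη hl hl0 hΓ hx hg h0 h1 h2 hU
  refine h SeqL2 _ _ s b η U0 U1 U2 g l Γ (ha.oscPair hε (by linarith) hsε) (ha.adBound hε) hs hb1
    hb hη hU hl hΓ ?_ ?_
  · rwa [h0, h1, h2]
  · intro i hi t ht
    refine (hg i hi t ht).trans (le_mul_of_one_le_right hΓ ?_)
    exact Real.one_le_exp (by positivity)

/-- Two regularizations of `D²` are close on elements with bounded fourth derivative; the fourth power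
is that of the finer regularization. -/
lemma truncD_sq_sub_le {ε ε' : ℝ} (hε : 0 < ε) (hε' : 0 < ε') (h : ε' ≤ ε) (x : SeqL2) :
    ‖truncD ε hε (truncD ε hε x) - truncD ε' hε' (truncD ε' hε' x)‖
      ≤ ε ^ 2 * ‖(truncD ε' hε' ^ 4) x‖ := by
  apply le_of_sq_le_sq _ (by positivity)
  rw [seqL2_norm_sq, mul_pow, seqL2_norm_sq, ← tsum_mul_left]
  refine Summable.tsum_le_tsum (fun k => ?_) (seqL2_summable _) ((seqL2_summable _).mul_left _)
  rw [truncD, truncD, diagOp_pow_apply, lp.coeFn_sub, Pi.sub_apply]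
  simp only [diagOp_apply]
  rw [← mul_pow]
  have e : (truncId ε (freq k) : ℂ) * (truncId ε (freq k) * x k)
      - truncId ε' (freq k) * (truncId ε' (freq k) * x k)
      = -((truncId ε' (freq k) ^ 2 - truncId ε (freq k) ^ 2 : ℝ) : ℂ) * x k := by
    push_cast; ring
  have h1 := abs_truncId_sq_sub_le hε'.le h (freq k)
  rw [e, norm_mul, norm_neg, Complex.norm_real, Real.norm_eq_abs, norm_mul, norm_pow,
    Complex.norm_real, Real.norm_eq_abs, ← mul_assoc, (Even.pow_abs (by decide) (truncId ε' (freq k)) : _ ^ 4 = _ ^ 4)]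
  gcongr

/-- The difference of two solutions for different derivatives solves the system with zero data and
the source `(D² - D'²) V1`. -/
lemma ModeSys.sub {H : Type} [NormedAddCommGroup H] [InnerProductSpace ℂ H] {D D' M : H →L[ℂ] H}
    {b η : ℝ} {U0 U1 U2 V0 V1 V2 g : ℝ → H} (hU : ModeSys D M b η U0 U1 U2 g)
    (hV : ModeSys D' M b η V0 V1 V2 g) :
    ModeSys D M b η (fun t => U0 t - V0 t) (fun t => U1 t - V1 t) (fun t => U2 t - V2 t)
      (fun t => D (D (V1 t)) - D' (D' (V1 t))) := by
  refine ⟨fun t => ?_, fun t => ?_, fun t => ?_⟩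
  · exact ((hU.d0 t).sub (hV.d0 t)).congr_deriv (by module)
  · exact ((hU.d1 t).sub (hV.d1 t)).congr_deriv (by module)
  · refine ((hU.d2 t).sub (hV.d2 t)).congr_deriv ?_
    simp only [oscOp_apply, map_sub]
    module

/-- The mode problem has a solution for the exact derivative, with the bounds of the regularized
problem; the loss is a power of `s` and the exponential rate is proportional to `s = √e`. -/
theorem exists_mode_solution_L2 {a : ℤ → ℂ} (ha : SmoothCoeff a) {θ : ℝ} (hθ : θ < 1) :
    ∃ (C : ℕ → ℝ) (p : ℕ → ℕ), (∀ i, 0 ≤ C i) ∧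
    ∀ (s b η l : ℝ) (Γ : ℕ → ℝ) (x0 x1 x2 : SeqL2) (g : ℝ → SeqL2), 1 ≤ s → |b| ≤ 1 →
      3 * Real.sqrt 3 / 2 * |b| ≤ θ → |η| ≤ s ^ 2 →
      energyRate (pairBound a) θ * s ≤ l → 0 ≤ l → (∀ J, 0 ≤ Γ J) → Continuous g →
      (∀ J, ∀ i < J + 2, ∀ (ε : ℝ) (hε : 0 < ε), ‖(truncD ε hε ^ i) x0‖ ≤ Γ J ∧
        ‖(truncD ε hε ^ i) x1‖ ≤ Γ J ∧ ‖(truncD ε hε ^ i) x2‖ ≤ Γ J ∧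
        ∀ t, ‖(truncD ε hε ^ i) (g t)‖ ≤ Γ J) →
      ∃ V0 V1 V2 : ℝ → SeqL2, V0 0 = x0 ∧ V1 0 = x1 ∧ V2 0 = x2 ∧
        (∀ t ∈ Set.Ioo (-1 : ℝ) 1, ∀ k,
          HasDerivAt (fun t => V0 t k) (Complex.I * V1 t k) t ∧
          HasDerivAt (fun t => V1 t k) (Complex.I * V2 t k) t ∧
          HasDerivAt (fun t => V2 t k) (Complex.I * ((freq k : ℂ) ^ 2 * V1 t k
            + ((η ^ 2 : ℝ) : ℂ) * convOp a (convOp a (V1 t)) k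
            + ((b * η ^ 3 : ℝ) : ℂ) * convOp a (convOp a (convOp a (V0 t))) k + g t k)) t) ∧
        ∀ i k, ∀ t ∈ Set.Ioo (-1 : ℝ) 1,
          |freq k| ^ i * ‖V0 t k‖ ≤ C i * Γ (i + 1) * s ^ p i * Real.exp (l * |t|) ∧
          |freq k| ^ i * ‖V1 t k‖ ≤ C i * Γ (i + 1) * s ^ p i * Real.exp (l * |t|) ∧
          |freq k| ^ i * ‖V2 t k‖ ≤ C i * Γ (i + 1) * s ^ p i * Real.exp (l * |t|) := by
  choose C p hC hlev using fun J => exists_truncated_solutions ha hθ J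
  refine ⟨fun i => C (i + 1), fun i => p (i + 1), fun i => hC _, ?_⟩
  intro s b η l Γ x0 x1 x2 g hs hb1 hb hη hl hl0 hΓ hgc hx
  have hs0 : 0 < s := by linarith
  -- the sequence of regularization parameters
  set ε : ℕ → ℝ := fun n => 1 / (s * (n + 1)) with hεdef
  have hε : ∀ n, 0 < ε n := fun n => by positivity
  have hsε : ∀ n, s * ε n ≤ 1 := fun n => by
    rw [hεdef, mul_one_div, mul_comm s, div_mul_cancel_right₀ hs0.ne']
    exact inv_le_one_of_one_le₀ (by linarith [(Nat.cast_nonneg n : (0 : ℝ) ≤ n)])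
  have hεanti : ∀ m n, m ≤ n → ε n ≤ ε m := fun m n h => by
    simp only [hεdef]; gcongr
  have hεlim : Tendsto ε atTop (𝓝 0) := by
    have := (tendsto_one_div_add_atTop_nhds_zero_nat (𝕜 := ℝ)).const_mul (1 / s)
    rw [mul_zero] at this
    refine this.congr fun n => ?_
    rw [hεdef]; field_simp
  choose U0 U1 U2 h0 h1 h2 hU using fun n =>
    exists_modeSys (truncD (ε n) (hε n)) (convOp a) b η hgc x0 x1 x2
  have hbound : ∀ n i t, |t| ≤ 1 → ‖(truncD (ε n) (hε n) ^ i) (U0 n t)‖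
        ≤ C (i + 1) * Γ (i + 1) * s ^ p (i + 1) * Real.exp (l * |t|) ∧
      ‖(truncD (ε n) (hε n) ^ i) (U1 n t)‖
        ≤ C (i + 1) * Γ (i + 1) * s ^ p (i + 1) * Real.exp (l * |t|) ∧
      ‖(truncD (ε n) (hε n) ^ i) (U2 n t)‖
        ≤ C (i + 1) * Γ (i + 1) * s ^ p (i + 1) * Real.exp (l * |t|) := fun n i t ht =>
    hlev (i + 1) s b η (Γ (i + 1)) l x0 x1 x2 g (ε n) (hε n) (U0 n) (U1 n) (U2 n) hs (hsε n) hb1 hb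
      hη hl hl0 (hΓ _) (fun j hj => ⟨(hx _ j hj _ _).1, (hx _ j hj _ _).2.1, (hx _ j hj _ _).2.2.1⟩)
      (fun j hj t _ => (hx _ j (by omega) _ _).2.2.2 t) (h0 n) (h1 n) (h2 n) (hU n) i
      (Nat.lt_succ_self i) t ht
  -- the solutions form a Cauchy sequence
  -- `K` bounds the first four powers of `D` on the solutions
  set K := C 5 * Γ 5 * s ^ p 5 * Real.exp l with hK
  have hK0 : 0 ≤ K := mul_nonneg (mul_nonneg (mul_nonneg (hC _) (hΓ _)) (by positivity)) (by positivity)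
  set K' := C 1 * s ^ p 1 * Real.exp l * K with hK'
  have hcau : ∀ m n t, m ≤ n → |t| ≤ 1 → ‖U0 m t - U0 n t‖ ≤ K' * ε m ^ 2 ∧
      ‖U1 m t - U1 n t‖ ≤ K' * ε m ^ 2 ∧ ‖U2 m t - U2 n t‖ ≤ K' * ε m ^ 2 := by
    intro m n t hmn ht
    have hexp : Real.exp (l * |t|) ≤ Real.exp l :=
      Real.exp_le_exp.2 (mul_le_of_le_one_right hl0 ht)
    have := hlev 1 s b η (ε m ^ 2 * K) l 0 0 0
      (fun t => truncD (ε m) (hε m) (truncD (ε m) (hε m) (U1 n t))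
        - truncD (ε n) (hε n) (truncD (ε n) (hε n) (U1 n t))) (ε m) (hε m) _ _ _ hs (hsε m) hb1 hb
      hη hl hl0 (by positivity) (fun i _ => by simp only [map_zero, norm_zero]; exact ⟨by positivity, by positivity, by positivity⟩)
      (fun i hi t ht => ?_) (by rw [h0, h0, sub_self]) (by rw [h1, h1, sub_self])
      (by rw [h2, h2, sub_self]) ((hU m).sub (hU n)) 0 zero_lt_one t ht
    · simp only [pow_zero, one_apply_eq_self] at this
      have hle : C 1 * (ε m ^ 2 * K) * s ^ p 1 * Real.exp (l * |t|) ≤ K' * ε m ^ 2 := by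
        have := hC 1
        calc _ ≤ C 1 * (ε m ^ 2 * K) * s ^ p 1 * Real.exp l := by gcongr
          _ = _ := by rw [hK']; ring
      exact ⟨this.1.trans hle, this.2.1.trans hle, this.2.2.trans hle⟩
    · obtain rfl : i = 0 := by omega
      simp only [pow_zero, one_apply_eq_self]
      refine (truncD_sq_sub_le (hε m) (hε n) (hεanti m n hmn) _).trans ?_
      refine mul_le_mul_of_nonneg_left (((hbound n 4 t ht).2.1).trans ?_) (by positivity)
      have hexp : Real.exp (l * |t|) ≤ Real.exp l :=
        Real.exp_le_exp.2 (mul_le_of_le_one_right hl0 ht)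
      have := hC 5
      have := hΓ 5
      rw [hK]; gcongr
  have hδ : Tendsto (fun n => K' * ε n ^ 2) atTop (𝓝 0) := by
    simpa using (hεlim.pow 2).const_mul K'
  have hlim : ∀ U : ℕ → ℝ → SeqL2, (∀ m n t, m ≤ n → |t| ≤ 1 → ‖U m t - U n t‖ ≤ K' * ε m ^ 2) →
      ∃ V : ℝ → SeqL2, ∀ t, |t| ≤ 1 → Tendsto (fun n => U n t) atTop (𝓝 (V t)) ∧
        ∀ n, ‖U n t - V t‖ ≤ K' * ε n ^ 2 := by
    intro U hUc
    have : ∀ t, ∃ v, |t| ≤ 1 → Tendsto (fun n => U n t) atTop (𝓝 v) ∧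
        ∀ n, ‖U n t - v‖ ≤ K' * ε n ^ 2 := fun t => by
      by_cases ht : |t| ≤ 1
      · have hc : CauchySeq fun n => U n t :=
          cauchySeq_of_le_tendsto_0' (fun n => K' * ε n ^ 2)
            (fun m n hmn => by rw [dist_eq_norm]; exact hUc m n t hmn ht) hδ
        obtain ⟨v, hv⟩ := cauchySeq_tendsto_of_complete hc
        refine ⟨v, fun _ => ⟨hv, fun n => ?_⟩⟩
        refine le_of_tendsto ((tendsto_const_nhds.sub hv).norm) ?_
        filter_upwards [eventually_ge_atTop n] with m hm
        exact hUc n m t hm ht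
      · exact ⟨0, fun h => absurd h ht⟩
    choose V hV using this
    exact ⟨V, hV⟩
  obtain ⟨V0, hV0⟩ := hlim U0 fun m n t h ht => (hcau m n t h ht).1
  obtain ⟨V1, hV1⟩ := hlim U1 fun m n t h ht => (hcau m n t h ht).2.1
  obtain ⟨V2, hV2⟩ := hlim U2 fun m n t h ht => (hcau m n t h ht).2.2
  have hIoo : ∀ {t : ℝ}, t ∈ Set.Ioo (-1 : ℝ) 1 → |t| ≤ 1 := fun ht => abs_le.2 ⟨ht.1.le, ht.2.le⟩
  have hap : ∀ {U : ℕ → SeqL2} {v : SeqL2}, Tendsto U atTop (𝓝 v) → ∀ k,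
      Tendsto (fun n => U n k) atTop (𝓝 (v k)) := fun h k =>
    ((lp.evalCLM ℂ (fun _ : ℤ => ℂ) 2 k).continuous.tendsto _).comp h
  have hcomp : ∀ {U V : SeqL2} {r : ℝ} (k : ℤ), ‖U - V‖ ≤ r → ‖U k - V k‖ ≤ r := fun {U V r} k h => by
    have := norm_seqL2_apply_le (U - V) k
    rw [lp.coeFn_sub, Pi.sub_apply] at this
    exact this.trans h
  have hder : ∀ {U : ℕ → ℝ → SeqL2} {U' : ℕ → ℝ → SeqL2} (k : ℤ),
      (∀ n t, HasDerivAt (U n) (U' n t) t) →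
      ∀ n t, HasDerivAt (fun t => U n t k) (U' n t k) t := fun k h n t =>
    ((lp.evalCLM ℂ (fun _ : ℤ => ℂ) 2 k).restrictScalars ℝ).hasFDerivAt.comp_hasDerivAt t (h n t)
  refine ⟨V0, V1, V2, ?_, ?_, ?_, fun t ht k => ⟨?_, ?_, ?_⟩, fun i k t ht => ?_⟩
  · exact tendsto_nhds_unique (hV0 0 (by simp)).1 (by simp [h0])
  · exact tendsto_nhds_unique (hV1 0 (by simp)).1 (by simp [h1])
  · exact tendsto_nhds_unique (hV2 0 (by simp)).1 (by simp [h2])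
  · refine hasDerivAt_of_tendstoUniformlyOn isOpen_Ioo
      (tendstoUniformlyOn_of_norm_sub_le (f := fun n t => Complex.I * U1 n t k)
        (h := fun t => Complex.I * V1 t k) hδ ?_)
      (Eventually.of_forall fun n t _ => hder k (fun n => (hU n).d0) n t)
      (fun t ht => hap (hV0 t (hIoo ht)).1 k) ht
    intro n t ht
    rw [← mul_sub, norm_mul, Complex.norm_I, one_mul]
    exact hcomp k ((hV1 t (hIoo ht)).2 n)
  · refine hasDerivAt_of_tendstoUniformlyOn isOpen_Ioo
      (tendstoUniformlyOn_of_norm_sub_le (f := fun n t => Complex.I * U2 n t k)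
        (h := fun t => Complex.I * V2 t k) hδ ?_)
      (Eventually.of_forall fun n t _ => hder k (fun n => (hU n).d1) n t)
      (fun t ht => hap (hV1 t (hIoo ht)).1 k) ht
    intro n t ht
    rw [← mul_sub, norm_mul, Complex.norm_I, one_mul]
    exact hcomp k ((hV2 t (hIoo ht)).2 n)
  · set M2 : SeqL2 →L[ℂ] SeqL2 := ((η ^ 2 : ℝ) : ℂ) • (convOp a * convOp a) with hM2
    set B3 : SeqL2 →L[ℂ] SeqL2 := cubOp (convOp a) b η with hB3
    have hnV1 : ∀ t ∈ Set.Ioo (-1 : ℝ) 1, ‖V1 t k‖ ≤ C 1 * Γ 1 * s ^ p 1 * Real.exp l := by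
      intro t ht
      refine le_of_tendsto (hap (hV1 t (hIoo ht)).1 k).norm (Eventually.of_forall fun n => ?_)
      have := (hbound n 0 t (hIoo ht)).2.1
      refine (norm_seqL2_apply_le _ _).trans (this.trans ?_)
      have hexp : Real.exp (l * |t|) ≤ Real.exp l :=
        Real.exp_le_exp.2 (mul_le_of_le_one_right hl0 (hIoo ht))
      have := hC 1
      have := hΓ 1
      simp only [zero_add]
      gcongr
    -- the multiplier `truncId ε (freq k) ^ 2` converges for each fixed `k` only, therefore the limit
    -- is taken componentwise
    have hδ' : Tendsto (fun n => freq k ^ 2 * (K' * ε n ^ 2)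
        + |truncId (ε n) (freq k) ^ 2 - freq k ^ 2| * (C 1 * Γ 1 * s ^ p 1 * Real.exp l)
        + ‖M2‖ * (K' * ε n ^ 2) + ‖B3‖ * (K' * ε n ^ 2)) atTop (𝓝 0) := by
      have e1 : Tendsto (fun n => |truncId (ε n) (freq k) ^ 2 - freq k ^ 2|) atTop (𝓝 0) := by
        have := (((tendsto_truncId (freq k)).comp hεlim).pow 2).sub_const (freq k ^ 2)
        simpa using this.abs
      simpa using (((hδ.const_mul (freq k ^ 2)).add (e1.mul_const _)).add (hδ.const_mul ‖M2‖)).add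
        (hδ.const_mul ‖B3‖)
    refine hasDerivAt_of_tendstoUniformlyOn isOpen_Ioo
      (tendstoUniformlyOn_of_norm_sub_le (f := fun n t => Complex.I *
        ((oscOp (truncD (ε n) (hε n)) (convOp a) η (U1 n t) + B3 (U0 n t) + g t : SeqL2) k))
        (h := fun t => Complex.I * ((freq k : ℂ) ^ 2 * V1 t k
            + ((η ^ 2 : ℝ) : ℂ) * convOp a (convOp a (V1 t)) k
            + ((b * η ^ 3 : ℝ) : ℂ) * convOp a (convOp a (convOp a (V0 t))) k + g t k)) hδ' ?_)
      (Eventually.of_forall fun n t _ => hder k (fun n => (hU n).d2) n t)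
      (fun t ht => hap (hV2 t (hIoo ht)).1 k) ht
    intro n t ht
    have e : Complex.I *
        ((oscOp (truncD (ε n) (hε n)) (convOp a) η (U1 n t) + B3 (U0 n t) + g t : SeqL2) k)
        - Complex.I * ((freq k : ℂ) ^ 2 * V1 t k
            + ((η ^ 2 : ℝ) : ℂ) * convOp a (convOp a (V1 t)) k
            + ((b * η ^ 3 : ℝ) : ℂ) * convOp a (convOp a (convOp a (V0 t))) k + g t k)
        = Complex.I * (((truncId (ε n) (freq k) ^ 2 : ℝ) : ℂ) * (U1 n t k - V1 t k)
          + ((truncId (ε n) (freq k) ^ 2 - freq k ^ 2 : ℝ) : ℂ) * V1 t k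
          + (M2 (U1 n t) k - M2 (V1 t) k) + (B3 (U0 n t) k - B3 (V0 t) k)) := by
      have f1 : (oscOp (truncD (ε n) (hε n)) (convOp a) η (U1 n t) + B3 (U0 n t) + g t : SeqL2) k
          = truncId (ε n) (freq k) * (truncId (ε n) (freq k) * U1 n t k) + M2 (U1 n t) k
            + B3 (U0 n t) k + g t k := by
        rw [oscOp_apply]
        simp only [lp.coeFn_add, Pi.add_apply, truncD, diagOp_apply]
        rfl
      have f2 : ∀ v : SeqL2, M2 v k = ((η ^ 2 : ℝ) : ℂ) * convOp a (convOp a v) k := fun v => rfl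
      have f3 : ∀ v : SeqL2, B3 v k
          = ((b * η ^ 3 : ℝ) : ℂ) * convOp a (convOp a (convOp a v)) k := fun v => rfl
      rw [f1, f2 (V1 t), f3 (V0 t)]
      push_cast; ring
    rw [e, norm_mul, Complex.norm_I, one_mul]
    refine (norm_add_le _ _).trans (add_le_add ((norm_add₃_le).trans (add_le_add (add_le_add ?_ ?_) ?_)) ?_)
    · rw [norm_mul, Complex.norm_real, Real.norm_eq_abs, abs_pow]
      refine mul_le_mul ?_ (hcomp k ((hV1 t (hIoo ht)).2 n)) (norm_nonneg _) (sq_nonneg _)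
      rw [← sq_abs (freq k)]
      exact pow_le_pow_left₀ (abs_nonneg _) (abs_truncId_le _ _) 2
    · rw [norm_mul, Complex.norm_real, Real.norm_eq_abs]
      exact mul_le_mul_of_nonneg_left (hnV1 t ht) (abs_nonneg _)
    · refine hcomp k ?_
      rw [← map_sub]
      exact (M2.le_opNorm _).trans (by gcongr; exact (hV1 t (hIoo ht)).2 n)
    · refine hcomp k ?_
      rw [← map_sub]
      exact (B3.le_opNorm _).trans (by gcongr; exact (hV0 t (hIoo ht)).2 n)
  · have key : ∀ (U : ℕ → SeqL2) (V : SeqL2) (R : ℝ), Tendsto U atTop (𝓝 V) →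
        (∀ n, ‖(truncD (ε n) (hε n) ^ i) (U n)‖ ≤ R) → |freq k| ^ i * ‖V k‖ ≤ R := by
      intro U V R hUV hR
      have e1 : Tendsto (fun n => |truncId (ε n) (freq k)| ^ i * ‖U n k‖) atTop
          (𝓝 (|freq k| ^ i * ‖V k‖)) :=
        ((((tendsto_truncId (freq k)).comp hεlim).abs).pow i).mul (hap hUV k).norm
      refine le_of_tendsto e1 (Eventually.of_forall fun n => ?_)
      have := (norm_seqL2_apply_le ((truncD (ε n) (hε n) ^ i) (U n)) k).trans (hR n)
      rwa [truncD, diagOp_pow_apply, norm_mul, norm_pow, Complex.norm_real,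
        Real.norm_eq_abs] at this
    exact ⟨key _ _ _ (hV0 t (hIoo ht)).1 fun n => (hbound n i t (hIoo ht)).1,
      key _ _ _ (hV1 t (hIoo ht)).1 fun n => (hbound n i t (hIoo ht)).2.1,
      key _ _ _ (hV2 t (hIoo ht)).1 fun n => (hbound n i t (hIoo ht)).2.2⟩

end

/-! ### The mode problem for rapidly decreasing sequences -/

noncomputable section
open Filter Topology

/-- Weighted `ℓ¹` norm of the coefficients, with the weights of `RapidBound`. -/
def convBound (a : ℤ → ℂ) (q : ℕ) : ℝ := ∑' j, ‖a j‖ * (1 + |(j : ℝ)|) ^ q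

lemma convBound_nonneg (a : ℤ → ℂ) (q : ℕ) : 0 ≤ convBound a q :=
  tsum_nonneg fun _ => by positivity

lemma one_add_abs_pow_le (q : ℕ) (k : ℤ) :
    (1 + |(k : ℝ)|) ^ q ≤ 2 ^ q * (1 + |freq k| ^ q) := by
  have h1 : |(k : ℝ)| ≤ |freq k| := by
    rw [abs_freq]
    exact le_mul_of_one_le_left (abs_nonneg _) (by linarith [Real.pi_gt_three])
  have h2 : 1 + |(k : ℝ)| ≤ 2 * max 1 |freq k| := by
    have := le_max_left 1 |freq k|
    have := le_max_right 1 |freq k|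
    linarith
  have h3 : (max 1 |freq k|) ^ q ≤ 1 + |freq k| ^ q := by
    rcases max_cases 1 |freq k| with h | h <;> rw [h.1]
    · simp
    · simp
  calc (1 + |(k : ℝ)|) ^ q ≤ (2 * max 1 |freq k|) ^ q := by gcongr
    _ = 2 ^ q * (max 1 |freq k|) ^ q := mul_pow _ _ _
    _ ≤ _ := by gcongr

lemma SmoothCoeff.summable_weight {a : ℤ → ℂ} (ha : SmoothCoeff a) (q : ℕ) :
    Summable fun j => ‖a j‖ * (1 + |(j : ℝ)|) ^ q := by
  refine (((ha.summable 0).add (ha.summable q)).mul_left (2 ^ q)).of_nonneg_of_le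
    (fun _ => by positivity) fun j => ?_
  calc ‖a j‖ * (1 + |(j : ℝ)|) ^ q ≤ ‖a j‖ * (2 ^ q * (1 + |freq j| ^ q)) := by
        gcongr; exact one_add_abs_pow_le q j
    _ = _ := by ring

lemma weight_submul (q : ℕ) (j k : ℤ) :
    (1 + |(k : ℝ)|) ^ q ≤ (1 + |(j : ℝ)|) ^ q * (1 + |((k - j : ℤ) : ℝ)|) ^ q := by
  rw [← mul_pow]
  refine pow_le_pow_left₀ (by positivity) ?_ q
  have : |(k : ℝ)| ≤ |(j : ℝ)| + |((k - j : ℤ) : ℝ)| := by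
    have := abs_add_le (j : ℝ) ((k - j : ℤ) : ℝ)
    push_cast at this ⊢
    rwa [add_sub_cancel] at this
  nlinarith [mul_nonneg (abs_nonneg (j : ℝ)) (abs_nonneg ((k - j : ℤ) : ℝ))]

lemma norm_conv_term_le (a : ℤ → ℂ) {x : ℤ → ℂ} {q : ℕ} {R : ℝ}
    (hx : ∀ k : ℤ, ‖x k‖ * (1 + |(k : ℝ)|) ^ q ≤ R) (k j : ℤ) :
    ‖a j * x (k - j)‖ * (1 + |(k : ℝ)|) ^ q ≤ ‖a j‖ * (1 + |(j : ℝ)|) ^ q * R := by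
  rw [norm_mul]
  calc ‖a j‖ * ‖x (k - j)‖ * (1 + |(k : ℝ)|) ^ q
      ≤ ‖a j‖ * ‖x (k - j)‖ * ((1 + |(j : ℝ)|) ^ q * (1 + |((k - j : ℤ) : ℝ)|) ^ q) := by
        gcongr; exact weight_submul q j k
    _ = ‖a j‖ * (1 + |(j : ℝ)|) ^ q * (‖x (k - j)‖ * (1 + |((k - j : ℤ) : ℝ)|) ^ q) := by ring
    _ ≤ _ := by gcongr; exact hx _

lemma SmoothCoeff.summable_conv {a : ℤ → ℂ} (ha : SmoothCoeff a) {x : ℤ → ℂ} {R : ℝ}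
    (hx : ∀ k : ℤ, ‖x k‖ ≤ R) (k : ℤ) : Summable fun j => ‖a j * x (k - j)‖ := by
  refine (ha.summable_norm.mul_right R).of_nonneg_of_le (fun _ => norm_nonneg _) fun j => ?_
  rw [norm_mul]; gcongr; exact hx _

lemma SmoothCoeff.seqConv_le {a : ℤ → ℂ} (ha : SmoothCoeff a) {x : ℤ → ℂ} {q : ℕ} {R : ℝ}
    (hx : ∀ k : ℤ, ‖x k‖ * (1 + |(k : ℝ)|) ^ q ≤ R) (k : ℤ) :
    ‖seqConv a x k‖ * (1 + |(k : ℝ)|) ^ q ≤ convBound a q * R := by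
  have hx' : ∀ k : ℤ, ‖x k‖ ≤ R := fun k =>
    (le_mul_of_one_le_right (norm_nonneg _) (one_le_pow₀ (by linarith [abs_nonneg (k : ℝ)]))).trans (hx k)
  calc ‖seqConv a x k‖ * (1 + |(k : ℝ)|) ^ q
      ≤ (∑' j, ‖a j * x (k - j)‖) * (1 + |(k : ℝ)|) ^ q := by
        gcongr; exact norm_tsum_le_tsum_norm (ha.summable_conv hx' k)
    _ = ∑' j, ‖a j * x (k - j)‖ * (1 + |(k : ℝ)|) ^ q := tsum_mul_right.symm
    _ ≤ ∑' j, ‖a j‖ * (1 + |(j : ℝ)|) ^ q * R :=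
        Summable.tsum_le_tsum (norm_conv_term_le a hx k) ((ha.summable_conv hx' k).mul_right _)
          ((ha.summable_weight q).mul_right _)
    _ = _ := tsum_mul_right

lemma SmoothCoeff.hasDerivAt_seqConv {a : ℤ → ℂ} (ha : SmoothCoeff a) {U U' : ℝ → ℤ → ℂ} {R T : ℝ}
    (hU : ∀ t ∈ Set.Ioo (-T) T, ∀ k, HasDerivAt (fun t => U t k) (Complex.I * U' t k) t)
    (hR : ∀ t ∈ Set.Ioo (-T) T, ∀ k, ‖U t k‖ ≤ R) (hR' : ∀ t ∈ Set.Ioo (-T) T, ∀ k, ‖U' t k‖ ≤ R)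
    {t : ℝ} (ht : t ∈ Set.Ioo (-T) T) (k : ℤ) :
    HasDerivAt (fun t => seqConv a (U t) k) (Complex.I * seqConv a (U' t) k) t := by
  have := hasDerivAt_tsum_of_isPreconnected (𝕜 := ℝ) (g := fun j t => a j * U t (k - j))
    (g' := fun j t => a j * (Complex.I * U' t (k - j))) (ha.summable_norm.mul_right R) isOpen_Ioo
    isPreconnected_Ioo (fun j y hy => (hU y hy (k - j)).const_mul (a j))
    (fun j y hy => by
      rw [norm_mul, norm_mul, Complex.norm_I, one_mul]; gcongr; exact hR' y hy _)
    ht (ha.summable_conv (hR t ht) k).of_norm ht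
  refine this.congr_deriv ?_
  rw [seqConv, ← tsum_mul_left]
  exact tsum_congr fun j => by ring

/-- The sequence of all `D_t`-derivatives of the solution of the mode problem, obtained from the
first three by means of the equation; `g i` is the `i`-th `D_t`-derivative of the source. -/
def modeChain (a : ℤ → ℂ) (b η : ℝ) (V0 V1 V2 : ℝ → ℤ → ℂ) (g : ℕ → ℝ → ℤ → ℂ) :
    ℕ → ℝ → ℤ → ℂ
  | 0 => V0
  | 1 => V1
  | 2 => V2
  | i + 3 => fun t k => (freq k : ℂ) ^ 2 * modeChain a b η V0 V1 V2 g (i + 1) t k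
      + ((η ^ 2 : ℝ) : ℂ) * seqConv a (seqConv a (modeChain a b η V0 V1 V2 g (i + 1) t)) k
      + ((b * η ^ 3 : ℝ) : ℂ) * seqConv a (seqConv a (seqConv a (modeChain a b η V0 V1 V2 g i t))) k
      + g i t k

/-- The constants and exponents in the bounds of `modeChain`. -/
lemma exists_modeChain_bound {a : ℤ → ℂ} (ha : SmoothCoeff a) (C : ℕ → ℝ) (p : ℕ → ℕ)
    (hC : ∀ q, 0 ≤ C q) (G : ℕ → ℕ → ℝ) (i q : ℕ) :
    ∃ (K : ℝ) (r : ℕ), 0 ≤ K ∧ ∀ (s b η Γ : ℝ) (w : ℝ → ℝ) (V0 V1 V2 : ℝ → ℤ → ℂ)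
      (g : ℕ → ℝ → ℤ → ℂ) (I : Set ℝ), 1 ≤ s → |b| ≤ 1 → |η| ≤ s ^ 2 → 0 ≤ Γ → (∀ t, 1 ≤ w t) →
      (∀ q, ∀ t ∈ I, ∀ k : ℤ, ‖V0 t k‖ * (1 + |(k : ℝ)|) ^ q ≤ C q * Γ * s ^ p q * w t ∧
        ‖V1 t k‖ * (1 + |(k : ℝ)|) ^ q ≤ C q * Γ * s ^ p q * w t ∧
        ‖V2 t k‖ * (1 + |(k : ℝ)|) ^ q ≤ C q * Γ * s ^ p q * w t) →
      (∀ i q, ∀ t ∈ I, ∀ k : ℤ, ‖g i t k‖ * (1 + |(k : ℝ)|) ^ q ≤ G i q * Γ) →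
      ∀ t ∈ I, ∀ k : ℤ, ‖modeChain a b η V0 V1 V2 g i t k‖ * (1 + |(k : ℝ)|) ^ q
        ≤ K * Γ * s ^ r * w t := by
  induction i using Nat.strong_induction_on generalizing q with
  | _ i ih =>
  match i, ih with
  | 0, _ => exact ⟨C q, p q, hC q, fun s b η Γ w V0 V1 V2 g I _ _ _ _ _ hV _ t ht k => (hV q t ht k).1⟩
  | 1, _ => exact ⟨C q, p q, hC q, fun s b η Γ w V0 V1 V2 g I _ _ _ _ _ hV _ t ht k => (hV q t ht k).2.1⟩
  | 2, _ => exact ⟨C q, p q, hC q, fun s b η Γ w V0 V1 V2 g I _ _ _ _ _ hV _ t ht k => (hV q t ht k).2.2⟩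
  | i + 3, ih =>
    obtain ⟨K1, r1, hK1, h1⟩ := ih (i + 1) (by omega) (q + 2)
    obtain ⟨K2, r2, hK2, h2⟩ := ih (i + 1) (by omega) q
    obtain ⟨K3, r3, hK3, h3⟩ := ih i (by omega) q
    have hc := convBound_nonneg a q
    refine ⟨(2 * Real.pi) ^ 2 * K1 + convBound a q * (convBound a q * K2)
      + convBound a q * (convBound a q * (convBound a q * K3)) + |G i q|,
      r1 + r2 + r3 + 6, by positivity, ?_⟩
    intro s b η Γ w V0 V1 V2 g I hs hb hη hΓ hw hV hg t ht k
    have e1 := h1 s b η Γ w V0 V1 V2 g I hs hb hη hΓ hw hV hg t ht k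
    have e2 := ha.seqConv_le (ha.seqConv_le (h2 s b η Γ w V0 V1 V2 g I hs hb hη hΓ hw hV hg t ht)) k
    have e3 := ha.seqConv_le (ha.seqConv_le
      (ha.seqConv_le (h3 s b η Γ w V0 V1 V2 g I hs hb hη hΓ hw hV hg t ht))) k
    have e4 := hg i q t ht k
    have hw' := hw t
    have hw0 : 0 ≤ w t := by linarith
    set W := (1 + |(k : ℝ)|) ^ q with hW
    have hW0 : 0 ≤ W := by positivity
    have hsr : ∀ m, m ≤ r1 + r2 + r3 + 6 → s ^ m ≤ s ^ (r1 + r2 + r3 + 6) := fun m hm =>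
      pow_le_pow_right₀ hs hm
    set S := s ^ (r1 + r2 + r3 + 6) with hS
    have hη2 : |η| ^ 2 ≤ s ^ 4 := by
      calc |η| ^ 2 ≤ (s ^ 2) ^ 2 := by gcongr
        _ = _ := by ring
    have hη3 : |b| * |η| ^ 3 ≤ s ^ 6 := by
      calc |b| * |η| ^ 3 ≤ 1 * (s ^ 2) ^ 3 := by gcongr
        _ = _ := by ring
    have t1 : ‖(freq k : ℂ) ^ 2 * modeChain a b η V0 V1 V2 g (i + 1) t k‖ * W
        ≤ (2 * Real.pi) ^ 2 * K1 * Γ * S * w t := by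
      have : ‖(freq k : ℂ) ^ 2‖ ≤ (2 * Real.pi) ^ 2 * (1 + |(k : ℝ)|) ^ 2 := by
        rw [norm_pow, Complex.norm_real, Real.norm_eq_abs, abs_freq, mul_pow]
        gcongr; linarith
      calc _ = ‖(freq k : ℂ) ^ 2‖ * ‖modeChain a b η V0 V1 V2 g (i + 1) t k‖ * W := by rw [norm_mul]
        _ ≤ (2 * Real.pi) ^ 2 * (1 + |(k : ℝ)|) ^ 2
            * ‖modeChain a b η V0 V1 V2 g (i + 1) t k‖ * W := by gcongr
        _ = (2 * Real.pi) ^ 2 * (‖modeChain a b η V0 V1 V2 g (i + 1) t k‖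
            * (1 + |(k : ℝ)|) ^ (q + 2)) := by rw [hW]; ring
        _ ≤ (2 * Real.pi) ^ 2 * (K1 * Γ * s ^ r1 * w t) := by gcongr
        _ ≤ (2 * Real.pi) ^ 2 * (K1 * Γ * S * w t) := by gcongr; exact hsr _ (by omega)
        _ = _ := by ring
    have t2 : ‖((η ^ 2 : ℝ) : ℂ)
        * seqConv a (seqConv a (modeChain a b η V0 V1 V2 g (i + 1) t)) k‖ * W
        ≤ convBound a q * (convBound a q * K2) * Γ * S * w t := by
      calc _ = |η| ^ 2 * (‖seqConv a (seqConv a (modeChain a b η V0 V1 V2 g (i + 1) t)) k‖ * W) := by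
            rw [norm_mul, Complex.norm_real, Real.norm_eq_abs, abs_pow, mul_assoc]
        _ ≤ s ^ 4 * (convBound a q * (convBound a q * (K2 * Γ * s ^ r2 * w t))) := by gcongr
        _ = convBound a q * (convBound a q * K2) * Γ * s ^ (r2 + 4) * w t := by ring
        _ ≤ _ := by gcongr; exact hsr _ (by omega)
    have t3 : ‖((b * η ^ 3 : ℝ) : ℂ)
        * seqConv a (seqConv a (seqConv a (modeChain a b η V0 V1 V2 g i t))) k‖ * W
        ≤ convBound a q * (convBound a q * (convBound a q * K3)) * Γ * S * w t := by
      calc _ = |b| * |η| ^ 3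
            * (‖seqConv a (seqConv a (seqConv a (modeChain a b η V0 V1 V2 g i t))) k‖ * W) := by
            rw [norm_mul, Complex.norm_real, Real.norm_eq_abs, abs_mul, abs_pow, mul_assoc]
        _ ≤ s ^ 6 * (convBound a q * (convBound a q * (convBound a q * (K3 * Γ * s ^ r3 * w t)))) := by
            gcongr
        _ = convBound a q * (convBound a q * (convBound a q * K3)) * Γ * s ^ (r3 + 6) * w t := by ring
        _ ≤ _ := by gcongr; exact hsr _ (by omega)
    have t4 : ‖g i t k‖ * W ≤ |G i q| * Γ * S * w t := by
      have hS1 : 1 ≤ S := one_le_pow₀ hs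
      calc _ ≤ G i q * Γ := e4
        _ ≤ |G i q| * Γ := by gcongr; exact le_abs_self _
        _ = |G i q| * Γ * 1 * 1 := by ring
        _ ≤ _ := by gcongr
    have tri : ‖modeChain a b η V0 V1 V2 g (i + 3) t k‖
        ≤ ‖(freq k : ℂ) ^ 2 * modeChain a b η V0 V1 V2 g (i + 1) t k‖
        + ‖((η ^ 2 : ℝ) : ℂ) * seqConv a (seqConv a (modeChain a b η V0 V1 V2 g (i + 1) t)) k‖
        + ‖((b * η ^ 3 : ℝ) : ℂ)
          * seqConv a (seqConv a (seqConv a (modeChain a b η V0 V1 V2 g i t))) k‖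
        + ‖g i t k‖ := by
      rw [modeChain]
      exact (norm_add_le _ _).trans (add_le_add_left norm_add₃_le _)
    calc _ ≤ (‖(freq k : ℂ) ^ 2 * modeChain a b η V0 V1 V2 g (i + 1) t k‖
        + ‖((η ^ 2 : ℝ) : ℂ) * seqConv a (seqConv a (modeChain a b η V0 V1 V2 g (i + 1) t)) k‖
        + ‖((b * η ^ 3 : ℝ) : ℂ)
          * seqConv a (seqConv a (seqConv a (modeChain a b η V0 V1 V2 g i t))) k‖
        + ‖g i t k‖) * W := by gcongr
      _ ≤ _ := by linarith

/-- Solution of the mode problem on rapidly decreasing sequences, with all its derivatives. The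
loss is polynomial in `s`, apart from the factor `exp (Λ s |t|)`. -/
theorem exists_mode_solution {a : ℤ → ℂ} (ha : SmoothCoeff a) {b : ℝ} (hb : |b| ≤ 1)
    (hb' : 3 * Real.sqrt 3 / 2 * |b| < 1) :
    ∃ Λ : ℝ, 0 ≤ Λ ∧ ∀ (B : ℕ → ℝ) (G : ℕ → ℝ), ∃ (C : ℕ → ℕ → ℝ) (p : ℕ → ℕ → ℕ),
      (∀ i q, 0 ≤ C i q) ∧ ∀ (s η Γ : ℝ) (x0 x1 x2 : ℤ → ℂ) (g : ℕ → ℝ → ℤ → ℂ),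
      1 ≤ s → |η| ≤ s ^ 2 → 0 ≤ Γ → RapidBound x0 (fun q => Γ * B q) →
      RapidBound x1 (fun q => Γ * B q) → RapidBound x2 (fun q => Γ * B q) →
      (∀ i t, RapidBound (g i t) (fun q => G i * Γ * B q)) →
      (∀ i t k, HasDerivAt (fun t => g i t k) (Complex.I * g (i + 1) t k) t) →
      ∃ U : ℕ → ℝ → ℤ → ℂ, U 0 0 = x0 ∧ U 1 0 = x1 ∧ U 2 0 = x2 ∧
        (∀ i, ∀ t ∈ Set.Ioo (-1 : ℝ) 1, ∀ k,
          HasDerivAt (fun t => U i t k) (Complex.I * U (i + 1) t k) t) ∧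
        (∀ t k, U 3 t k = (freq k : ℂ) ^ 2 * U 1 t k
            + ((η ^ 2 : ℝ) : ℂ) * seqConv a (seqConv a (U 1 t)) k
            + ((b * η ^ 3 : ℝ) : ℂ) * seqConv a (seqConv a (seqConv a (U 0 t))) k + g 0 t k) ∧
        ∀ i q, ∀ t ∈ Set.Ioo (-1 : ℝ) 1, ∀ k : ℤ, ‖U i t k‖ * (1 + |(k : ℝ)|) ^ q
          ≤ C i q * Γ * s ^ p i q * Real.exp (Λ * s * |t|) := by
  obtain ⟨C1, p1, hC1, hsol⟩ := exists_mode_solution_L2 ha hb'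
  set Λ := max 0 (energyRate (pairBound a) (3 * Real.sqrt 3 / 2 * |b|)) with hΛ
  have hΛ0 : 0 ≤ Λ := le_max_left _ _
  refine ⟨Λ, hΛ0, fun B G => ?_⟩
  -- a common bound of the regularized norms of the data and the source
  set Sg : ℕ → ℝ := fun J => (1 + |G 0|) * ∑ m ∈ Finset.range (J + 2), weightConst m * |B (m + 1)|
    with hSdef
  have hS0 : ∀ J, 0 ≤ Sg J := fun J => mul_nonneg (by positivity)
    (Finset.sum_nonneg fun m _ => mul_nonneg (weightConst_nonneg m) (abs_nonneg _))
  set C2 : ℕ → ℝ := fun q => 2 ^ q * (C1 0 * Sg 1 + C1 q * Sg (q + 1)) with hC2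
  have hC2' : ∀ q, 0 ≤ C2 q := fun q => by
    have := hC1 q; have := hC1 0; have := hS0 1; have := hS0 (q + 1); positivity
  choose C p hC hchain using fun i q => exists_modeChain_bound ha C2 (fun q => p1 0 + p1 q) hC2'
    (fun i q => G i * B q) i q
  refine ⟨C, p, hC, ?_⟩
  intro s η Γ x0 x1 x2 g hs hη hΓ hx0 hx1 hx2 hg hgd
  have hs0 : 0 < s := by linarith
  have hgd' : ∀ t k, HasDerivAt (fun t => g 0 t k) (Complex.I * g 1 t k) t := hgd 0
  have hrap : ∀ t, RapidBound (fun k => Complex.I * g 1 t k) (fun q => (|G 0| + |G 1|) * Γ * |B q|) :=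
    fun t i k => by
      rw [norm_mul, Complex.norm_I, one_mul]
      refine (hg 1 t i k).trans ?_
      calc G 1 * Γ * B i ≤ |G 1 * Γ * B i| := le_abs_self _
        _ = |G 1| * Γ * |B i| := by rw [abs_mul, abs_mul, abs_of_nonneg hΓ]
        _ ≤ (|G 0| + |G 1|) * Γ * |B i| := by gcongr; exact le_add_of_nonneg_left (abs_nonneg _)
  have hrap0 : ∀ t, RapidBound (g 0 t) (fun q => (|G 0| + |G 1|) * Γ * |B q|) :=
    fun t i k => by
      refine (hg 0 t i k).trans ?_
      calc G 0 * Γ * B i ≤ |G 0 * Γ * B i| := le_abs_self _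
        _ = |G 0| * Γ * |B i| := by rw [abs_mul, abs_mul, abs_of_nonneg hΓ]
        _ ≤ (|G 0| + |G 1|) * Γ * |B i| := by gcongr; exact le_add_of_nonneg_right (abs_nonneg _)
  have hcont := RapidBound.continuous_toL2 hrap0 hrap hgd'
  have hmem : ∀ J, ∀ m < J + 2, weightConst m * |B (m + 1)|
      ≤ ∑ m ∈ Finset.range (J + 2), weightConst m * |B (m + 1)| := fun J m hm =>
    Finset.single_le_sum (f := fun m => weightConst m * |B (m + 1)|)
      (fun m _ => mul_nonneg (weightConst_nonneg m) (abs_nonneg _)) (Finset.mem_range.2 hm)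
  have hx : ∀ {x : ℤ → ℂ} (c : ℝ) (y : SeqL2), (∀ k, y k = x k) → |c| ≤ 1 + |G 0| →
      RapidBound x (fun q => c * Γ * B q) → ∀ J, ∀ m < J + 2, ∀ (ε : ℝ) (hε : 0 < ε),
      ‖(truncD ε hε ^ m) y‖ ≤ Γ * Sg J := by
    intro x c y hy hc hxb J m hm ε hε
    have hyb : RapidBound y (fun q => c * Γ * B q) := fun i k => by rw [hy]; exact hxb i k
    refine (hyb.norm_pow_le hε m).trans ?_
    have h1 := hmem J m hm
    have h2 := weightConst_nonneg m
    calc weightConst m * (c * Γ * B (m + 1)) ≤ weightConst m * (|c| * Γ * |B (m + 1)|) := by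
          refine mul_le_mul_of_nonneg_left ((le_abs_self _).trans_eq ?_) h2
          rw [abs_mul, abs_mul, abs_of_nonneg hΓ]
      _ = |c| * Γ * (weightConst m * |B (m + 1)|) := by ring
      _ ≤ (1 + |G 0|) * Γ * ∑ m ∈ Finset.range (J + 2), weightConst m * |B (m + 1)| := by gcongr
      _ = _ := by simp only [hSdef]; ring
  have h1G : |(1 : ℝ)| ≤ 1 + |G 0| := by rw [abs_one]; linarith [abs_nonneg (G 0)]
  have hone : ∀ {x : ℤ → ℂ}, RapidBound x (fun q => Γ * B q) →
      RapidBound x (fun q => 1 * Γ * B q) := fun h => by simpa using h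
  obtain ⟨V0, V1, V2, e0, e1, e2, hV, hVb⟩ := hsol s b η (Λ * s) (fun J => Γ * Sg J) hx0.toL2 hx1.toL2
    hx2.toL2 (fun t => (hrap0 t).toL2) hs hb le_rfl hη
    (mul_le_mul_of_nonneg_right (le_max_right _ _) hs0.le) (by positivity)
    (fun J => mul_nonneg hΓ (hS0 J)) hcont
    (fun J m hm ε hε => ⟨hx 1 _ (fun _ => rfl) h1G (hone hx0) J m hm ε hε,
      hx 1 _ (fun _ => rfl) h1G (hone hx1) J m hm ε hε,
      hx 1 _ (fun _ => rfl) h1G (hone hx2) J m hm ε hε,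
      fun t => hx (G 0) _ (fun _ => rfl) (by linarith) (hg 0 t) J m hm ε hε⟩)
  set U := modeChain a b η (fun t k => V0 t k) (fun t k => V1 t k) (fun t k => V2 t k) g with hU
  have hVq : ∀ (V : ℝ → SeqL2), (∀ i k, ∀ t ∈ Set.Ioo (-1 : ℝ) 1, |freq k| ^ i * ‖V t k‖
      ≤ C1 i * (Γ * Sg (i + 1)) * s ^ p1 i * Real.exp (Λ * s * |t|)) →
      ∀ q, ∀ t ∈ Set.Ioo (-1 : ℝ) 1, ∀ k : ℤ, ‖V t k‖ * (1 + |(k : ℝ)|) ^ q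
        ≤ C2 q * Γ * s ^ (p1 0 + p1 q) * Real.exp (Λ * s * |t|) := by
    intro V hV q t ht k
    have b0 := hV 0 k t ht
    have bq := hV q k t ht
    rw [pow_zero, one_mul, zero_add] at b0
    have s0 : s ^ p1 0 ≤ s ^ (p1 0 + p1 q) := pow_le_pow_right₀ hs (by omega)
    have sq : s ^ p1 q ≤ s ^ (p1 0 + p1 q) := pow_le_pow_right₀ hs (by omega)
    have := hC1 q; have := hC1 0; have := hS0 1; have := hS0 (q + 1)
    calc ‖V t k‖ * (1 + |(k : ℝ)|) ^ q ≤ ‖V t k‖ * (2 ^ q * (1 + |freq k| ^ q)) := by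
          gcongr; exact one_add_abs_pow_le q k
      _ = 2 ^ q * (‖V t k‖ + |freq k| ^ q * ‖V t k‖) := by ring
      _ ≤ 2 ^ q * (C1 0 * (Γ * Sg 1) * s ^ p1 0 * Real.exp (Λ * s * |t|)
          + C1 q * (Γ * Sg (q + 1)) * s ^ p1 q * Real.exp (Λ * s * |t|)) := by gcongr
      _ ≤ 2 ^ q * (C1 0 * (Γ * Sg 1) * s ^ (p1 0 + p1 q) * Real.exp (Λ * s * |t|)
          + C1 q * (Γ * Sg (q + 1)) * s ^ (p1 0 + p1 q) * Real.exp (Λ * s * |t|)) := by gcongr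
      _ = _ := by simp only [hC2]; ring
  have hUb : ∀ i q, ∀ t ∈ Set.Ioo (-1 : ℝ) 1, ∀ k : ℤ, ‖U i t k‖ * (1 + |(k : ℝ)|) ^ q
      ≤ C i q * Γ * s ^ p i q * Real.exp (Λ * s * |t|) := fun i q =>
    hchain i q s b η Γ (fun t => Real.exp (Λ * s * |t|)) _ _ _ g (Set.Ioo (-1) 1) hs hb hη hΓ
      (fun t => Real.one_le_exp (by positivity))
      (fun q t ht k => ⟨hVq V0 (fun i k t ht => (hVb i k t ht).1) q t ht k,
        hVq V1 (fun i k t ht => (hVb i k t ht).2.1) q t ht k,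
        hVq V2 (fun i k t ht => (hVb i k t ht).2.2) q t ht k⟩)
      (fun i q t ht k => (hg i t q k).trans_eq (by ring))
  have hUn : ∀ i, ∃ R, ∀ t ∈ Set.Ioo (-1 : ℝ) 1, ∀ k, ‖U i t k‖ ≤ R := fun i => by
    refine ⟨C i 0 * Γ * s ^ p i 0 * Real.exp (Λ * s), fun t ht k => ?_⟩
    have := hUb i 0 t ht k
    rw [pow_zero, mul_one] at this
    have hC' := hC i 0
    refine this.trans ?_
    have : |t| ≤ 1 := abs_le.2 ⟨ht.1.le, ht.2.le⟩
    have : Λ * s * |t| ≤ Λ * s := mul_le_of_le_one_right (by positivity) this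
    gcongr
  have hconv : ∀ x : SeqL2, convOp a x = seqConv a x := fun x => funext (convOp_apply ha x)
  have hder : ∀ i, ∀ t ∈ Set.Ioo (-1 : ℝ) 1, ∀ k,
      HasDerivAt (fun t => U i t k) (Complex.I * U (i + 1) t k) t := by
    intro i
    induction i using Nat.strong_induction_on with
    | _ i ih =>
    match i, ih with
    | 0, _ => exact fun t ht k => (hV t ht k).1
    | 1, _ => exact fun t ht k => (hV t ht k).2.1
    | 2, _ =>
      intro t ht k
      refine ((hV t ht k).2.2).congr_deriv ?_
      rw [hconv, hconv, hconv, hconv, hconv]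
      rfl
    | i + 3, ih =>
      intro t ht k
      have hconvd : ∀ {W W' : ℝ → ℤ → ℂ},
          (∃ R, ∀ t ∈ Set.Ioo (-1 : ℝ) 1, ∀ k, ‖W t k‖ ≤ R) →
          (∃ R, ∀ t ∈ Set.Ioo (-1 : ℝ) 1, ∀ k, ‖W' t k‖ ≤ R) →
          (∀ t ∈ Set.Ioo (-1 : ℝ) 1, ∀ k, HasDerivAt (fun t => W t k) (Complex.I * W' t k) t) →
          ∀ t ∈ Set.Ioo (-1 : ℝ) 1, ∀ k,
            HasDerivAt (fun t => seqConv a (W t) k) (Complex.I * seqConv a (W' t) k) t := by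
        rintro W W' ⟨R, hR⟩ ⟨R', hR'⟩ hW t ht k
        exact ha.hasDerivAt_seqConv (R := max R R') hW (fun t ht k => (hR t ht k).trans (le_max_left _ _))
          (fun t ht k => (hR' t ht k).trans (le_max_right _ _)) ht k
      have hconvn : ∀ {W : ℝ → ℤ → ℂ}, (∃ R, ∀ t ∈ Set.Ioo (-1 : ℝ) 1, ∀ k, ‖W t k‖ ≤ R) →
          (∃ R, ∀ t ∈ Set.Ioo (-1 : ℝ) 1, ∀ k, ‖seqConv a (W t) k‖ ≤ R) := by
        rintro W ⟨R, hR⟩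
        refine ⟨convBound a 0 * R, fun t ht k => ?_⟩
        simpa using ha.seqConv_le (q := 0) (R := R) (fun k => by simpa using hR t ht k) k
      have n0 := hUn i
      have n1 := hUn (i + 1)
      have n2 := hUn (i + 2)
      have d0 := ih i (by omega)
      have d1 := ih (i + 1) (by omega)
      have D1 := hconvd (hconvn n1) (hconvn n2) (hconvd n1 n2 d1) t ht k
      have D0 := hconvd (hconvn (hconvn n0)) (hconvn (hconvn n1))
        (hconvd (hconvn n0) (hconvn n1) (hconvd n0 n1 d0)) t ht k
      refine (((((d1 t ht k).const_mul ((freq k : ℂ) ^ 2)).add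
        (D1.const_mul ((η ^ 2 : ℝ) : ℂ))).add (D0.const_mul ((b * η ^ 3 : ℝ) : ℂ))).add
        (hgd i t k)).congr_deriv ?_
      simp only [hU, modeChain]
      ring
  refine ⟨U, ?_, ?_, ?_, hder, fun t k => rfl, hUb⟩
  · funext k
    change V0 0 k = _
    rw [e0]; rfl
  · funext k
    change V1 0 k = _
    rw [e1]; rfl
  · funext k
    change V2 0 k = _
    rw [e2]; rfl

end

/-! ### Fourier series with smooth coefficients -/

noncomputable section
open Filter Topology

lemma summable_prod_of_summable {f : ℤ → ℝ} (hf : Summable f) (h0 : ∀ k, 0 ≤ f k) (n : ℕ) :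
    Summable fun k : Fin n → ℤ => ∏ j, f (k j) := by
  induction n with
  | zero => exact .of_finite
  | succ n ih =>
    have h := hf.mul_of_nonneg ih h0 (fun k => Finset.prod_nonneg fun _ _ => h0 _)
    rw [← (Fin.consEquiv fun _ : Fin (n + 1) => ℤ).summable_iff]
    refine h.congr fun p => ?_
    simp [Fin.prod_univ_succ, Fin.consEquiv]

lemma norm_int_coord_le {n : ℕ} (k : Fin n → ℤ) (j : Fin n) : |((k j : ℤ) : ℝ)| ≤ ‖k‖ :=
  (Int.norm_eq_abs (k j)) ▸ norm_le_pi_norm k j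

lemma summable_weight_pi (n : ℕ) : Summable fun k : Fin n → ℤ => ((1 + ‖k‖) ^ (2 * n))⁻¹ := by
  refine (summable_prod_of_summable summable_one_add_abs_sq (fun _ => by positivity)
    n).of_nonneg_of_le (fun _ => by positivity) fun k => ?_
  calc ((1 + ‖k‖) ^ (2 * n))⁻¹ = ∏ _j : Fin n, (1 / (1 + ‖k‖)) ^ 2 := by
        rw [Finset.prod_const, Finset.card_univ, Fintype.card_fin, ← pow_mul, one_div, inv_pow]
    _ ≤ _ := by
        refine Finset.prod_le_prod (fun _ _ => by positivity) fun j _ => ?_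
        have := norm_int_coord_le k j
        gcongr

/-- The phase `∑ 2 π k_j x_j` of the character `k` of the torus, in the space variables. -/
def phase {n : ℕ} (k : Fin n → ℤ) (x : Euc (n + 1)) : ℝ := ∑ j, freq (k j) * x j.succ

/-- The character `exp (2 π i k · x')`. -/
def chr {n : ℕ} (k : Fin n → ℤ) (x : Euc (n + 1)) : ℂ := Complex.exp (Complex.I * phase k x)

lemma norm_chr {n : ℕ} (k : Fin n → ℤ) (x : Euc (n + 1)) : ‖chr k x‖ = 1 := by
  rw [chr, mul_comm, Complex.norm_exp_ofReal_mul_I]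

/-- The Fourier series in the space variables with the coefficients `c`. -/
def fourierSum {n : ℕ} (c : (Fin n → ℤ) → ℂ) (x : Euc (n + 1)) : ℂ := ∑' k, c k * chr k x

/-- The coordinate `x_i`, as a complex valued linear form. -/
def coordForm {d : ℕ} (i : Fin d) : Euc d →L[ℝ] ℂ :=
  Complex.ofRealCLM.comp (EuclideanSpace.proj i)

lemma coordForm_apply {d : ℕ} (i : Fin d) (x : Euc d) : coordForm i x = (x i : ℂ) := rfl

lemma coordForm_single {d : ℕ} (i j : Fin d) :
    coordForm i (EuclideanSpace.single j 1) = if i = j then 1 else 0 := by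
  rw [coordForm_apply, PiLp.single_apply]; split_ifs <;> simp

lemma norm_coordForm_le {d : ℕ} (i : Fin d) : ‖coordForm i‖ ≤ 1 := by
  refine ContinuousLinearMap.opNorm_le_bound _ zero_le_one fun x => ?_
  rw [coordForm_apply, Complex.norm_real, one_mul]
  exact PiLp.norm_apply_le x i

/-- A family of Fourier coefficients depending on time, together with its `D_t`-derivatives:
`c i` is the `i`-th one; all polynomial weights are bounded, by `Γ` times constants. -/
structure CoeffFamily {n : ℕ} (T Γ : ℝ) (B : ℕ → ℕ → ℝ) (c : ℕ → ℝ → (Fin n → ℤ) → ℂ) : Prop where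
  deriv : ∀ i, ∀ t ∈ Set.Ioo (-T) T, ∀ k,
    HasDerivAt (fun t => c i t k) (Complex.I * c (i + 1) t k) t
  bound : ∀ i q, ∀ t ∈ Set.Ioo (-T) T, ∀ k, ‖c i t k‖ * (1 + ‖k‖) ^ q ≤ Γ * B i q

/-- The coefficients of `D_i u`, where `c` are the coefficients of `u`. -/
def coeffD {n : ℕ} (i : Fin (n + 1)) (c : ℕ → ℝ → (Fin n → ℤ) → ℂ) : ℕ → ℝ → (Fin n → ℤ) → ℂ :=
  Fin.cases (fun l => c (l + 1)) (fun j l t k => freq (k j) * c l t k) i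

/-- The bounds of `coeffD i c`. -/
def boundD {n : ℕ} (i : Fin (n + 1)) (B : ℕ → ℕ → ℝ) : ℕ → ℕ → ℝ :=
  Fin.cases (fun l => B (l + 1)) (fun _ l q => 2 * Real.pi * B l (q + 1)) i

section Family
variable {n : ℕ} {T Γ : ℝ} {B : ℕ → ℕ → ℝ} {c : ℕ → ℝ → (Fin n → ℤ) → ℂ}

lemma CoeffFamily.coeffD (h : CoeffFamily T Γ B c) (i : Fin (n + 1)) :
    CoeffFamily T Γ (boundD i B) (coeffD i c) := by
  refine Fin.cases ?_ (fun j => ?_) i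
  · exact ⟨fun l => h.deriv (l + 1), fun l => h.bound (l + 1)⟩
  · refine ⟨fun l t ht k => ((h.deriv l t ht k).const_mul (freq (k j) : ℂ)).congr_deriv ?_,
      fun l q t ht k => ?_⟩
    · simp only [_root_.coeffD, Fin.cases_succ]; ring
    · simp only [_root_.coeffD, boundD, Fin.cases_succ]
      rw [norm_mul, Complex.norm_real, Real.norm_eq_abs, abs_freq]
      have h1 := norm_int_coord_le k j
      calc 2 * Real.pi * |((k j : ℤ) : ℝ)| * ‖c l t k‖ * (1 + ‖k‖) ^ q
          ≤ 2 * Real.pi * (1 + ‖k‖) * ‖c l t k‖ * (1 + ‖k‖) ^ q := by gcongr; linarith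
        _ = 2 * Real.pi * (‖c l t k‖ * (1 + ‖k‖) ^ (q + 1)) := by ring
        _ ≤ 2 * Real.pi * (Γ * B l (q + 1)) := 
          mul_le_mul_of_nonneg_left (h.bound l (q + 1) t ht k) (by positivity)
        _ = _ := by ring

lemma CoeffFamily.norm_le (h : CoeffFamily T Γ B c) (i : ℕ) {t : ℝ} (ht : t ∈ Set.Ioo (-T) T)
    (k : Fin n → ℤ) : ‖c i t k‖ ≤ Γ * B i (2 * n) * ((1 + ‖k‖) ^ (2 * n))⁻¹ := by
  rw [← div_eq_mul_inv, le_div_iff₀ (by positivity)]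
  exact h.bound i (2 * n) t ht k

lemma CoeffFamily.summable (h : CoeffFamily T Γ B c) (i : ℕ) {t : ℝ} (ht : t ∈ Set.Ioo (-T) T) :
    Summable fun k => ‖c i t k‖ :=
  ((summable_weight_pi n).mul_left _).of_nonneg_of_le (fun _ => norm_nonneg _) (h.norm_le i ht)

lemma summable_mul_chr {c : (Fin n → ℤ) → ℂ} (h : Summable fun k => ‖c k‖) (x : Euc (n + 1)) :
    Summable fun k => ‖c k * chr k x‖ := by
  simpa only [norm_mul, norm_chr, mul_one] using h

/-- The slab `|x_0| < T`. -/
def slab (n : ℕ) (T : ℝ) : Set (Euc (n + 1)) := {x | x 0 ∈ Set.Ioo (-T) T}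

lemma continuous_coord {d : ℕ} (i : Fin d) : Continuous fun x : Euc d => x i :=
  (EuclideanSpace.proj (𝕜 := ℝ) i).continuous

lemma isOpen_slab : IsOpen (slab n T) := isOpen_Ioo.preimage (continuous_coord 0)

lemma isPreconnected_slab : IsPreconnected (slab n T) :=
  ((convex_Ioo (-T) T).linear_preimage
    (EuclideanSpace.proj (𝕜 := ℝ) (0 : Fin (n + 1))).toLinearMap).isPreconnected

lemma hasFDerivAt_term (h : CoeffFamily T Γ B c) {x : Euc (n + 1)} (hx : x ∈ slab n T)
    (k : Fin n → ℤ) : HasFDerivAt (fun x => c 0 (x 0) k * chr k x)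
      (∑ i, (Complex.I * (coeffD i c 0 (x 0) k * chr k x)) • coordForm i) x := by
  have h1 : HasFDerivAt (fun x : Euc (n + 1) => c 0 (x 0) k)
      ((EuclideanSpace.proj (𝕜 := ℝ) (0 : Fin (n + 1))).smulRight (Complex.I * c 1 (x 0) k)) x := by
    have := (h.deriv 0 (x 0) hx k).hasFDerivAt.comp x
      (EuclideanSpace.proj (𝕜 := ℝ) (0 : Fin (n + 1))).hasFDerivAt
    refine this.congr_fderiv ?_
    ext v; simp
  have h2 : HasFDerivAt (fun x : Euc (n + 1) => (phase k x : ℂ))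
      (∑ j : Fin n, (freq (k j) : ℂ) • coordForm j.succ) x := by
    have : (fun x : Euc (n + 1) => (phase k x : ℂ))
        = (∑ j : Fin n, (freq (k j) : ℂ) • coordForm j.succ : Euc (n + 1) →L[ℝ] ℂ) := by
      funext y
      simp [phase, coordForm_apply]
    rw [this]
    exact ContinuousLinearMap.hasFDerivAt _
  refine (h1.mul (h2.const_mul Complex.I).cexp).congr_fderiv ?_
  rw [Fin.sum_univ_succ]
  ext v
  simp only [_root_.coeffD, Fin.cases_zero, Fin.cases_succ, add_apply, smul_apply,
    ContinuousLinearMap.smulRight_apply, sum_apply, smul_eq_mul, chr,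
    coordForm_apply, Finset.mul_sum, Complex.real_smul]
  have hv : EuclideanSpace.proj (𝕜 := ℝ) (0 : Fin (n + 1)) v = v 0 := rfl
  rw [hv]
  rw [add_comm]
  congr 1
  · ring
  · exact Finset.sum_congr rfl fun j _ => by ring

lemma hasFDerivAt_fourierSum (h : CoeffFamily T Γ B c) {x : Euc (n + 1)} (hx : x ∈ slab n T) :
    HasFDerivAt (fun x => fourierSum (c 0 (x 0)) x)
      (∑ i, (Complex.I * fourierSum (coeffD i c 0 (x 0)) x) • coordForm i) x := by
  have key := hasFDerivAt_tsum_of_isPreconnected (𝕜 := ℝ)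
    (f := fun k (x : Euc (n + 1)) => c 0 (x 0) k * chr k x)
    (f' := fun k x => ∑ i, (Complex.I * (coeffD i c 0 (x 0) k * chr k x)) • coordForm i)
    (u := fun k => ∑ i : Fin (n + 1), Γ * boundD i B 0 (2 * n) * ((1 + ‖k‖) ^ (2 * n))⁻¹)
    (summable_sum fun i _ => (summable_weight_pi n).mul_left _) isOpen_slab isPreconnected_slab
    (fun k y hy => hasFDerivAt_term h hy k) (fun k y hy => ?_) hx
    (summable_mul_chr (h.summable 0 hx) x).of_norm hx
  · refine key.congr_fderiv ?_
    refine (hasSum_sum fun i _ => ?_).tsum_eq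
    exact (((summable_mul_chr ((h.coeffD i).summable 0 hx) x).of_norm.hasSum).mul_left
      Complex.I).smul_const (coordForm i)
  · refine (norm_sum_le _ _).trans (Finset.sum_le_sum fun i _ => ?_)
    rw [norm_smul, norm_mul, Complex.norm_I, one_mul, norm_mul, norm_chr, mul_one]
    exact (mul_le_of_le_one_right (norm_nonneg _) (norm_coordForm_le i)).trans
      ((h.coeffD i).norm_le 0 hy k)

lemma Dx_fourierSum (h : CoeffFamily T Γ B c) (i : Fin (n + 1)) {x : Euc (n + 1)}
    (hx : x ∈ slab n T) : Dx i (fun x => fourierSum (c 0 (x 0)) x) x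
      = fourierSum (coeffD i c 0 (x 0)) x := by
  rw [Dx, (hasFDerivAt_fourierSum h hx).fderiv]
  simp only [sum_apply, smul_apply, coordForm_single,
    smul_eq_mul, mul_ite, mul_one, mul_zero, Finset.sum_ite_eq', Finset.mem_univ, if_true]
  rw [← mul_assoc, neg_mul, Complex.I_mul_I, neg_neg, one_mul]

/-- The operator norms of the derivatives of a Fourier series are bounded by the weights. -/
lemma exists_iteratedFDeriv_fourierSum_le (n m : ℕ) (B : ℕ → ℕ → ℝ) : ∃ A : ℝ,
    ∀ (T Γ : ℝ) (c : ℕ → ℝ → (Fin n → ℤ) → ℂ), CoeffFamily T Γ B c → ∀ x ∈ slab n T,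
      ContDiffAt ℝ m (fun x => fourierSum (c 0 (x 0)) x) x ∧
        ‖iteratedFDeriv ℝ m (fun x => fourierSum (c 0 (x 0)) x) x‖ ≤ A * Γ := by
  induction m generalizing B with
  | zero =>
    refine ⟨B 0 (2 * n) * ∑' k : Fin n → ℤ, ((1 + ‖k‖) ^ (2 * n))⁻¹, fun T Γ c h x hx => ⟨?_, ?_⟩⟩
    · rw [Nat.cast_zero, contDiffAt_zero]
      exact ⟨slab n T, isOpen_slab.mem_nhds hx, fun y hy =>
        (hasFDerivAt_fourierSum h hy).continuousAt.continuousWithinAt⟩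
    · rw [norm_iteratedFDeriv_zero]
      refine (norm_tsum_le_tsum_norm (summable_mul_chr (h.summable 0 hx) x)).trans ?_
      simp only [norm_mul, norm_chr, mul_one]
      calc ∑' k, ‖c 0 (x 0) k‖ ≤ ∑' k : Fin n → ℤ, Γ * B 0 (2 * n) * ((1 + ‖k‖) ^ (2 * n))⁻¹ :=
            Summable.tsum_le_tsum (h.norm_le 0 hx) (h.summable 0 hx)
              ((summable_weight_pi n).mul_left _)
        _ = _ := by rw [tsum_mul_left]; ring
  | succ m ih =>
    choose A hA using fun i : Fin (n + 1) => ih (boundD i B)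
    set L : Fin (n + 1) → ℂ →L[ℝ] (Euc (n + 1) →L[ℝ] ℂ) := fun i =>
      ((ContinuousLinearMap.id ℂ ℂ).smulRight (coordForm i)).restrictScalars ℝ ∘L
        ((Complex.I • ContinuousLinearMap.id ℂ ℂ).restrictScalars ℝ) with hL
    refine ⟨∑ i, ‖L i‖ * A i, fun T Γ c h x hx => ?_⟩
    have hd : ∀ i, ContDiffAt ℝ m (L i ∘ fun x => fourierSum (coeffD i c 0 (x 0)) x) x := fun i =>
      (L i).contDiff.contDiffAt.comp x (hA i T Γ _ (h.coeffD i) x hx).1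
    set F' : Euc (n + 1) → Euc (n + 1) →L[ℝ] ℂ := fun x =>
      ∑ i, (L i ∘ fun x => fourierSum (coeffD i c 0 (x 0)) x) x with hF'
    have hF : ∀ y ∈ slab n T, HasFDerivAt (fun x => fourierSum (c 0 (x 0)) x) (F' y) y :=
      fun y hy => hasFDerivAt_fourierSum h hy
    refine ⟨?_, ?_⟩
    · exact contDiffAt_succ_iff_hasFDerivAt.2 ⟨F', ⟨slab n T, isOpen_slab.mem_nhds hx, hF⟩,
        ContDiffAt.sum fun i _ => hd i⟩
    · have heq : fderiv ℝ (fun x => fourierSum (c 0 (x 0)) x) =ᶠ[𝓝 x] F' := by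
        filter_upwards [isOpen_slab.mem_nhds hx] with y hy using (hF y hy).fderiv
      rw [← norm_iteratedFDeriv_fderiv, (heq.iteratedFDeriv ℝ m).eq_of_nhds, hF',
        iteratedFDeriv_fun_sum_apply fun i _ => hd i, Finset.sum_mul]
      refine (norm_sum_le _ _).trans (Finset.sum_le_sum fun i _ => ?_)
      refine ((L i).norm_iteratedFDeriv_comp_left (hA i T Γ _ (h.coeffD i) x hx).1 le_rfl).trans ?_
      rw [mul_assoc]
      exact mul_le_mul_of_nonneg_left (hA i T Γ _ (h.coeffD i) x hx).2 (norm_nonneg _)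

end Family

/-- Convolution with `a` in the index `j`. -/
def convAt {n : ℕ} (j : Fin n) (a : ℤ → ℂ) (c : (Fin n → ℤ) → ℂ) (k : Fin n → ℤ) : ℂ :=
  seqConv a (fun l => c (Function.update k j l)) (k j)

/-- The periodic function with the Fourier coefficients `a`. -/
def periodicFun (a : ℤ → ℂ) (y : ℝ) : ℂ := ∑' l, a l * Complex.exp (Complex.I * (freq l * y : ℝ))

/-- Convolution of the coefficients in the `j`-th index is multiplication by the periodic function
with the coefficients `a`, in the variable `x_j`. -/
lemma hasSum_convAt {n : ℕ} (j : Fin n) {a : ℤ → ℂ} (ha : Summable fun l => ‖a l‖)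
    {c : (Fin n → ℤ) → ℂ} (hc : Summable fun k => ‖c k‖) (x : Euc (n + 1)) :
    Summable (fun k => ‖convAt j a c k‖) ∧
    fourierSum (convAt j a c) x = periodicFun a (x j.succ) * fourierSum c x := by
  have hcc := summable_mul_chr hc x
  have haa : Summable fun l => ‖a l * Complex.exp (Complex.I * (freq l * x j.succ : ℝ))‖ := by
    refine ha.congr fun l => ?_
    rw [norm_mul, mul_comm Complex.I, Complex.norm_exp_ofReal_mul_I, mul_one]
  let σ : (Fin n → ℤ) × ℤ ≃ ℤ × (Fin n → ℤ) :=
    { toFun := fun p => (p.2, Function.update p.1 j (p.1 j - p.2))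
      invFun := fun p => (Function.update p.2 j (p.2 j + p.1), p.1)
      left_inv := fun p => by simp
      right_inv := fun p => by simp }
  have hterm : ∀ p : (Fin n → ℤ) × ℤ,
      (a (σ p).1 * Complex.exp (Complex.I * (freq (σ p).1 * x j.succ : ℝ)))
        * (c (σ p).2 * chr (σ p).2 x)
      = (a p.2 * c (Function.update p.1 j (p.1 j - p.2))) * chr p.1 x := by
    rintro ⟨k, l⟩
    have hph : phase k x = freq l * x j.succ + phase (Function.update k j (k j - l)) x := by
      rw [phase, phase, ← Finset.add_sum_erase _ _ (Finset.mem_univ j),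
        ← Finset.add_sum_erase _ _ (Finset.mem_univ j), Function.update_self, freq_sub, ← add_assoc]
      congr 1
      · ring
      · exact Finset.sum_congr rfl fun i hi => by
          rw [Function.update_of_ne (Finset.ne_of_mem_erase hi)]
    simp only [σ, Equiv.coe_fn_mk, chr]
    rw [hph, Complex.ofReal_add, mul_add, Complex.exp_add]
    ring
  have hsum := summable_mul_of_summable_norm haa hcc
  have hnsum : Summable fun p : (Fin n → ℤ) × ℤ =>
      ‖(a p.2 * c (Function.update p.1 j (p.1 j - p.2))) * chr p.1 x‖ := by
    refine (σ.summable_iff.2 hsum.norm).congr fun p => ?_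
    rw [← hterm]; rfl
  have hfac : ∀ k, Summable fun l => a l * c (Function.update k j (k j - l)) := fun k => by
    have := (hnsum.prod_factor k)
    simp only [norm_mul, norm_chr, mul_one] at this
    exact Summable.of_norm (by simpa only [norm_mul] using this)
  constructor
  · have h2 := hnsum.prod
    refine h2.of_nonneg_of_le (fun _ => norm_nonneg _) fun k => ?_
    have h3 := hnsum.prod_factor k
    simp only [norm_mul, norm_chr, mul_one] at h3 ⊢
    rw [convAt, seqConv]
    refine (norm_tsum_le_tsum_norm (by simpa only [norm_mul] using h3)).trans_eq ?_
    simp only [norm_mul]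
  · have h1 := (tsum_mul_tsum_of_summable_norm haa hcc)
    rw [periodicFun, fourierSum, fourierSum, h1, ← σ.tsum_eq, tsum_congr hterm,
      hnsum.of_norm.tsum_prod]
    refine tsum_congr fun k => ?_
    rw [convAt, seqConv, ← tsum_mul_right]

end

/-! ### The Cauchy problem on the side of Fourier coefficients -/

noncomputable section
open Filter Topology

lemma one_add_pow_mul_exp_neg_le {κ : ℝ} (hκ : 0 < κ) (N : ℕ) {y : ℝ} (hy : 0 ≤ y) :
    (1 + y) ^ N * Real.exp (-(κ * y)) ≤ Real.exp κ * (N ! / κ ^ N) := by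
  have h := Real.pow_div_factorial_le_exp (κ * (1 + y)) (by positivity) N
  have hN : (0 : ℝ) < N ! := by positivity
  rw [div_le_iff₀ hN, mul_pow] at h
  have hpow : (0 : ℝ) < κ ^ N := by positivity
  have he : Real.exp (κ * (1 + y)) * Real.exp (-(κ * y)) = Real.exp κ := by
    rw [← Real.exp_add]; congr 1; ring
  rw [← mul_div_assoc, le_div_iff₀ hpow]
  calc (1 + y) ^ N * Real.exp (-(κ * y)) * κ ^ N = κ ^ N * (1 + y) ^ N * Real.exp (-(κ * y)) := by ring
    _ ≤ Real.exp (κ * (1 + y)) * N ! * Real.exp (-(κ * y)) := by gcongr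
    _ = Real.exp κ * N ! := by rw [← he]; ring

lemma convAt_update {n : ℕ} (j : Fin n) (a : ℤ → ℂ) (c : (Fin n → ℤ) → ℂ) (k : Fin n → ℤ) (l : ℤ) :
    convAt j a c (Function.update k j l) = seqConv a (fun l => c (Function.update k j l)) l := by
  simp [convAt]

lemma convAt_convAt {n : ℕ} (j : Fin n) (a : ℤ → ℂ) (c : (Fin n → ℤ) → ℂ) (k : Fin n → ℤ) :
    convAt j a (convAt j a c) k
      = seqConv a (seqConv a (fun l => c (Function.update k j l))) (k j) := by
  rw [convAt]
  simp only [convAt_update]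

lemma convAt_convAt_convAt {n : ℕ} (j : Fin n) (a : ℤ → ℂ) (c : (Fin n → ℤ) → ℂ) (k : Fin n → ℤ) :
    convAt j a (convAt j a (convAt j a c)) k
      = seqConv a (seqConv a (seqConv a (fun l => c (Function.update k j l)))) (k j) := by
  rw [convAt_convAt]
  simp only [convAt_update]

lemma norm_update_zero_le {n : ℕ} (k : Fin n → ℤ) (j : Fin n) (l : ℤ) :
    ‖Function.update k j 0‖ ≤ ‖Function.update k j l‖ := by
  refine (pi_norm_le_iff_of_nonneg (norm_nonneg _)).2 fun i => ?_
  by_cases h : i = j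
  · subst h; simp
  · rw [Function.update_of_ne h]
    simpa [Function.update_of_ne h] using norm_le_pi_norm (Function.update k j l) i

lemma one_add_norm_le_mul {n : ℕ} (k : Fin n → ℤ) (j : Fin n) :
    1 + ‖k‖ ≤ (1 + |((k j : ℤ) : ℝ)|) * (1 + ‖Function.update k j 0‖) := by
  have h : ‖k‖ ≤ |((k j : ℤ) : ℝ)| + ‖Function.update k j 0‖ := by
    refine (pi_norm_le_iff_of_nonneg (by positivity)).2 fun i => ?_
    by_cases h : i = j
    · subst h; rw [Int.norm_eq_abs]; linarith [norm_nonneg (Function.update k i 0)]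
    · have := norm_le_pi_norm (Function.update k j 0) i
      rw [Function.update_of_ne h] at this
      linarith [abs_nonneg ((k j : ℤ) : ℝ)]
  nlinarith [mul_nonneg (abs_nonneg ((k j : ℤ) : ℝ)) (norm_nonneg (Function.update k j 0))]

/-- Data whose Fourier coefficients decay like `exp (-2 κ √|k|)` have a solution on a time interval
that depends only on `κ`: the growth `exp (Λ √|η| |t|)` of the modes is absorbed. -/
theorem exists_coeff_solution {n : ℕ} {j₁ j₂ : Fin n} (hj : j₂ ≠ j₁) {a : ℤ → ℂ} (ha : SmoothCoeff a)
    {b : ℝ} (hb : |b| ≤ 1) (hb' : 3 * Real.sqrt 3 / 2 * |b| < 1) {κ : ℝ} (hκ : 0 < κ) :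
    ∃ T > 0, T ≤ 1 ∧ ∀ G : ℕ → ℝ, ∃ B : ℕ → ℕ → ℝ, ∀ (Γ : ℝ) (x0 x1 x2 : (Fin n → ℤ) → ℂ)
      (g : ℕ → ℝ → (Fin n → ℤ) → ℂ), 0 ≤ Γ →
      (∀ k, ‖x0 k‖ ≤ Γ * Real.exp (-(2 * κ * Real.sqrt ‖k‖))) →
      (∀ k, ‖x1 k‖ ≤ Γ * Real.exp (-(2 * κ * Real.sqrt ‖k‖))) →
      (∀ k, ‖x2 k‖ ≤ Γ * Real.exp (-(2 * κ * Real.sqrt ‖k‖))) →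
      (∀ i t k, ‖g i t k‖ ≤ G i * Γ * Real.exp (-(2 * κ * Real.sqrt ‖k‖))) →
      (∀ i t k, HasDerivAt (fun t => g i t k) (Complex.I * g (i + 1) t k) t) →
      ∃ c : ℕ → ℝ → (Fin n → ℤ) → ℂ, CoeffFamily T Γ B c ∧ c 0 0 = x0 ∧ c 1 0 = x1 ∧ c 2 0 = x2 ∧
        ∀ t k, c 3 t k = (freq (k j₁) : ℂ) ^ 2 * c 1 t k
          + (freq (k j₂) : ℂ) ^ 2 * convAt j₁ a (convAt j₁ a (c 1 t)) k
          + (b : ℂ) * (freq (k j₂) : ℂ) ^ 3 * convAt j₁ a (convAt j₁ a (convAt j₁ a (c 0 t))) k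
          + g 0 t k := by
  obtain ⟨Λ, hΛ, hsol⟩ := exists_mode_solution ha hb hb'
  -- `3 Λ T ≤ κ / 2`, so that half of the decay `exp (-κ √|k'|)` of the row through `k'` absorbs
  -- the growth of its solution
  refine ⟨min 1 (κ / (6 * (Λ + 1))), by positivity, min_le_left _ _, fun G => ?_⟩
  set T := min 1 (κ / (6 * (Λ + 1))) with hT
  have hT1 : T ≤ 1 := min_le_left _ _
  have hTκ : 3 * Λ * T ≤ κ / 2 := by
    have : T * (6 * (Λ + 1)) ≤ κ := (le_div_iff₀ (by positivity)).1 (min_le_right _ _)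
    have hT0 : 0 < T := by positivity
    nlinarith
  set B0 : ℕ → ℝ := fun q => Real.exp κ * ((2 * q)! / κ ^ (2 * q)) with hB0
  obtain ⟨C, p, hC, hsol⟩ := hsol B0 G
  set M : ℕ → ℝ := fun N => Real.exp (κ / 2) * (N ! / (κ / 2) ^ N) with hM
  refine ⟨fun i q => C i q * Real.exp Λ * (3 ^ p i q * M (p i q + 2 * q)), ?_⟩
  intro Γ x0 x1 x2 g hΓ hx0 hx1 hx2 hg hgd
  -- the row through `k` in the direction `j₁`
  have hrow : ∀ {x : (Fin n → ℤ) → ℂ} {Γ' : ℝ} (k : Fin n → ℤ),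
      (∀ k, ‖x k‖ ≤ Γ' * Real.exp (-(2 * κ * Real.sqrt ‖k‖))) →
      RapidBound (fun l => x (Function.update k j₁ l)) (fun q =>
        Γ' * Real.exp (-(κ * Real.sqrt ‖Function.update k j₁ 0‖)) * B0 q) := by
    intro x Γ' k hx q l
    have hΓ' : 0 ≤ Γ' := by
      have := (norm_nonneg _).trans (hx 0)
      exact nonneg_of_mul_nonneg_left this (Real.exp_pos _)
    have h1 : Real.sqrt ‖Function.update k j₁ 0‖ ≤ Real.sqrt ‖Function.update k j₁ l‖ :=
      Real.sqrt_le_sqrt (norm_update_zero_le k j₁ l)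
    have h2 : Real.sqrt |(l : ℝ)| ≤ Real.sqrt ‖Function.update k j₁ l‖ := by
      refine Real.sqrt_le_sqrt ?_
      simpa using norm_int_coord_le (Function.update k j₁ l) j₁
    set z := Real.sqrt |(l : ℝ)| with hz
    have hz0 : 0 ≤ z := Real.sqrt_nonneg _
    have hzl : |(l : ℝ)| = z ^ 2 := (Real.sq_sqrt (abs_nonneg _)).symm
    have h3 : Real.exp (-(2 * κ * Real.sqrt ‖Function.update k j₁ l‖))
        ≤ Real.exp (-(κ * Real.sqrt ‖Function.update k j₁ 0‖)) * Real.exp (-(κ * z)) := by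
      rw [← Real.exp_add, Real.exp_le_exp]
      nlinarith
    have h4 : (1 + |(l : ℝ)|) ^ q ≤ (1 + z) ^ (2 * q) := by
      rw [pow_mul]
      refine pow_le_pow_left₀ (by positivity) ?_ q
      rw [hzl]; nlinarith
    calc ‖x (Function.update k j₁ l)‖ * (1 + |(l : ℝ)|) ^ q
        ≤ Γ' * (Real.exp (-(κ * Real.sqrt ‖Function.update k j₁ 0‖)) * Real.exp (-(κ * z)))
          * (1 + z) ^ (2 * q) := by
          gcongr
          exact (hx _).trans (by gcongr)
      _ = Γ' * Real.exp (-(κ * Real.sqrt ‖Function.update k j₁ 0‖))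
          * ((1 + z) ^ (2 * q) * Real.exp (-(κ * z))) := by ring
      _ ≤ Γ' * Real.exp (-(κ * Real.sqrt ‖Function.update k j₁ 0‖)) * B0 q := by
          refine mul_le_mul_of_nonneg_left ?_ (by positivity)
          exact one_add_pow_mul_exp_neg_le hκ (2 * q) hz0
  -- `s` depends on the row only, as the mode problem couples all indices of the row; it satisfies
  -- `|η| ≤ s²` because `2 π ≤ 9`
  set s : (Fin n → ℤ) → ℝ := fun k => 1 + 3 * Real.sqrt ‖Function.update k j₁ 0‖ with hs
  have hs1 : ∀ k, 1 ≤ s k := fun k => by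
    simp only [hs]; linarith [Real.sqrt_nonneg ‖Function.update k j₁ 0‖]
  have hη : ∀ k, |freq (k j₂)| ≤ s k ^ 2 := fun k => by
    have h1 := norm_int_coord_le (Function.update k j₁ 0) j₂
    rw [Function.update_of_ne hj] at h1
    have h2 := Real.sq_sqrt (norm_nonneg (Function.update k j₁ 0))
    have h3 := Real.sqrt_nonneg ‖Function.update k j₁ 0‖
    rw [abs_freq]
    have h4 : 2 * Real.pi * |((k j₂ : ℤ) : ℝ)| ≤ 9 * ‖Function.update k j₁ 0‖ := by
      have := Real.pi_lt_four
      gcongr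
      linarith
    simp only [hs]
    nlinarith
  choose U hU0 hU1 hU2 hUd hUe hUb using fun k => hsol (s k) (freq (k j₂))
    (Γ * Real.exp (-(κ * Real.sqrt ‖Function.update k j₁ 0‖)))
    (fun l => x0 (Function.update k j₁ l)) (fun l => x1 (Function.update k j₁ l))
    (fun l => x2 (Function.update k j₁ l)) (fun i t l => g i t (Function.update k j₁ l)) (hs1 k)
    (hη k) (by positivity) (hrow k hx0) (hrow k hx1) (hrow k hx2)
    (fun i t => by simpa only [mul_assoc] using hrow k (hg i t)) (fun i t l => hgd i t _)
  have hT' : ∀ {t : ℝ}, t ∈ Set.Ioo (-T) T → t ∈ Set.Ioo (-1 : ℝ) 1 := fun ht =>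
    ⟨by linarith [ht.1], by linarith [ht.2]⟩
  have hupd : ∀ (k : Fin n → ℤ) l,
      Function.update (Function.update k j₁ l) j₁ 0 = Function.update k j₁ 0 := fun k l => by simp
  refine ⟨fun i t k => U (Function.update k j₁ 0) i t (k j₁), ⟨fun i t ht k => ?_, fun i q t ht k => ?_⟩,
    ?_, ?_, ?_, fun t k => ?_⟩
  · exact hUd _ i t (hT' ht) _
  · set y := Real.sqrt ‖Function.update k j₁ 0‖ with hy
    have hy0 : 0 ≤ y := Real.sqrt_nonneg _
    have hy2 : ‖Function.update k j₁ 0‖ = y ^ 2 := (Real.sq_sqrt (norm_nonneg _)).symm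
    have h1 := hUb (Function.update k j₁ 0) i q t (hT' ht) (k j₁)
    simp only [hs, hupd, ← hy] at h1
    have ht' : |t| ≤ T := abs_le.2 ⟨ht.1.le, ht.2.le⟩
    have h2 : Real.exp (Λ * (1 + 3 * y) * |t|) ≤ Real.exp Λ * Real.exp (κ / 2 * y) := by
      rw [← Real.exp_add, Real.exp_le_exp]
      have : Λ * (1 + 3 * y) * |t| ≤ Λ * (1 + 3 * y) * T := by gcongr
      have e : Λ * (1 + 3 * y) * T = Λ * T + 3 * Λ * T * y := by ring
      have : Λ * T ≤ Λ := mul_le_of_le_one_right hΛ hT1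
      have := mul_le_mul_of_nonneg_right hTκ hy0
      linarith
    have h3 : (1 + 3 * y) ^ p i q ≤ 3 ^ p i q * (1 + y) ^ p i q := by
      rw [← mul_pow]
      exact pow_le_pow_left₀ (by positivity) (by linarith) _
    have h4 : (1 + ‖k‖) ^ q ≤ (1 + |((k j₁ : ℤ) : ℝ)|) ^ q * (1 + y) ^ (2 * q) := by
      calc (1 + ‖k‖) ^ q ≤ ((1 + |((k j₁ : ℤ) : ℝ)|) * (1 + ‖Function.update k j₁ 0‖)) ^ q :=
            pow_le_pow_left₀ (by positivity) (one_add_norm_le_mul k j₁) q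
        _ = (1 + |((k j₁ : ℤ) : ℝ)|) ^ q * (1 + y ^ 2) ^ q := by rw [mul_pow, hy2]
        _ ≤ _ := by
          rw [pow_mul (1 + y)]
          gcongr
          nlinarith
    have h5 := one_add_pow_mul_exp_neg_le (half_pos hκ) (p i q + 2 * q) hy0
    have hCq := hC i q
    have e1 : Real.exp (-(κ * y)) * Real.exp (κ / 2 * y) = Real.exp (-(κ / 2 * y)) := by
      rw [← Real.exp_add]; congr 1; ring
    calc ‖U (Function.update k j₁ 0) i t (k j₁)‖ * (1 + ‖k‖) ^ q
        ≤ ‖U (Function.update k j₁ 0) i t (k j₁)‖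
          * ((1 + |((k j₁ : ℤ) : ℝ)|) ^ q * (1 + y) ^ (2 * q)) := by gcongr
      _ = ‖U (Function.update k j₁ 0) i t (k j₁)‖ * (1 + |((k j₁ : ℤ) : ℝ)|) ^ q
          * (1 + y) ^ (2 * q) := by ring
      _ ≤ C i q * (Γ * Real.exp (-(κ * y))) * (1 + 3 * y) ^ p i q
          * Real.exp (Λ * (1 + 3 * y) * |t|) * (1 + y) ^ (2 * q) := by gcongr
      _ ≤ C i q * (Γ * Real.exp (-(κ * y))) * (3 ^ p i q * (1 + y) ^ p i q)
          * (Real.exp Λ * Real.exp (κ / 2 * y)) * (1 + y) ^ (2 * q) := by gcongr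
      _ = Γ * (C i q * Real.exp Λ * (3 ^ p i q * ((1 + y) ^ (p i q + 2 * q)
          * (Real.exp (-(κ * y)) * Real.exp (κ / 2 * y))))) := by ring
      _ ≤ _ := by rw [e1]; gcongr
  · funext k
    have := congrFun (hU0 (Function.update k j₁ 0)) (k j₁)
    simpa using this
  · funext k
    have := congrFun (hU1 (Function.update k j₁ 0)) (k j₁)
    simpa using this
  · funext k
    have := congrFun (hU2 (Function.update k j₁ 0)) (k j₁)
    simpa using this
  · have := hUe (Function.update k j₁ 0) t (k j₁)
    rw [convAt_convAt, convAt_convAt_convAt]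
    simp only [hupd, Function.update_self, Function.update_of_ne hj, Function.update_idem,
      Function.update_eq_self] at this ⊢
    rw [this]
    push_cast
    ring

end

/-! ### Summation of the modes -/

noncomputable section
open Filter Topology

lemma Dx_congr {d : ℕ} {u v : Euc d → ℂ} {x : Euc d} (h : u =ᶠ[𝓝 x] v) (i : Fin d) :
    Dx i u x = Dx i v x := by
  rw [Dx, Dx, h.fderiv_eq]

lemma Dx_congr_of_eqOn {d : ℕ} {u v : Euc d → ℂ} {U : Set (Euc d)} (hU : IsOpen U)
    (h : Set.EqOn u v U) (i : Fin d) : Set.EqOn (Dx i u) (Dx i v) U := fun _ hx =>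
  Dx_congr (Filter.eventuallyEq_of_mem (hU.mem_nhds hx) h) i

/-- The function with the family of Fourier coefficients `c`. -/
def familySum {n : ℕ} (c : ℕ → ℝ → (Fin n → ℤ) → ℂ) (x : Euc (n + 1)) : ℂ :=
  fourierSum (c 0 (x 0)) x

lemma Dx_familySum {n : ℕ} {T Γ : ℝ} {B : ℕ → ℕ → ℝ} {c : ℕ → ℝ → (Fin n → ℤ) → ℂ}
    (h : CoeffFamily T Γ B c) (i : Fin (n + 1)) :
    Set.EqOn (Dx i (familySum c)) (familySum (coeffD i c)) (slab n T) :=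
  fun _ hx => Dx_fourierSum h i hx

lemma Dx_Dx_familySum {n : ℕ} {T Γ : ℝ} {B : ℕ → ℕ → ℝ} {c : ℕ → ℝ → (Fin n → ℤ) → ℂ}
    (h : CoeffFamily T Γ B c) (i j : Fin (n + 1)) :
    Set.EqOn (Dx i (Dx j (familySum c))) (familySum (coeffD i (coeffD j c))) (slab n T) :=
  (Dx_congr_of_eqOn isOpen_slab (Dx_familySum h j) i).trans (Dx_familySum (h.coeffD j) i)

lemma Dx_Dx_Dx_familySum {n : ℕ} {T Γ : ℝ} {B : ℕ → ℕ → ℝ} {c : ℕ → ℝ → (Fin n → ℤ) → ℂ}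
    (h : CoeffFamily T Γ B c) (i j l : Fin (n + 1)) :
    Set.EqOn (Dx i (Dx j (Dx l (familySum c)))) (familySum (coeffD i (coeffD j (coeffD l c))))
      (slab n T) :=
  (Dx_congr_of_eqOn isOpen_slab (Dx_Dx_familySum h j l) i).trans
    (Dx_familySum ((h.coeffD l).coeffD j) i)

lemma fourierSum_add {n : ℕ} {c d : (Fin n → ℤ) → ℂ} (hc : Summable fun k => ‖c k‖)
    (hd : Summable fun k => ‖d k‖) (x : Euc (n + 1)) :
    fourierSum (fun k => c k + d k) x = fourierSum c x + fourierSum d x := by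
  rw [fourierSum, fourierSum, fourierSum, ← (summable_mul_chr hc x).of_norm.tsum_add
    (summable_mul_chr hd x).of_norm]
  exact tsum_congr fun k => add_mul _ _ _

lemma fourierSum_const_mul {n : ℕ} (z : ℂ) (c : (Fin n → ℤ) → ℂ) (x : Euc (n + 1)) :
    fourierSum (fun k => z * c k) x = z * fourierSum c x := by
  rw [fourierSum, fourierSum, ← tsum_mul_left]
  exact tsum_congr fun k => mul_assoc _ _ _

lemma convAt_mul {n : ℕ} {j₁ j₂ : Fin n} (hj : j₂ ≠ j₁) (a : ℤ → ℂ) (f : ℤ → ℂ)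
    (c : (Fin n → ℤ) → ℂ) :
    convAt j₁ a (fun k => f (k j₂) * c k) = fun k => f (k j₂) * convAt j₁ a c k := by
  funext k
  rw [convAt, convAt, seqConv, seqConv, ← tsum_mul_left]
  refine tsum_congr fun l => ?_
  rw [Function.update_of_ne hj]
  ring

/-- If the coefficients satisfy the mode equations with source `g`, then the series solves the
equation with source `∑ g e^{2 π i k · x'}`, at the points where the periodic function with the
coefficients `a` is equal to the coordinate `x_1`. -/
theorem modelOp_familySum {n : ℕ} {j₁ j₂ : Fin n} (hj : j₂ ≠ j₁) (h1 : (1 : Fin (n + 1)) = j₁.succ)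
    (h2 : Fin.last n = j₂.succ) {a : ℤ → ℂ} (ha : SmoothCoeff a) {b T Γ : ℝ} {B : ℕ → ℕ → ℝ}
    {c : ℕ → ℝ → (Fin n → ℤ) → ℂ} (h : CoeffFamily T Γ B c) {g : ℝ → (Fin n → ℤ) → ℂ}
    (hc : ∀ t k, c 3 t k = (freq (k j₁) : ℂ) ^ 2 * c 1 t k
          + (freq (k j₂) : ℂ) ^ 2 * convAt j₁ a (convAt j₁ a (c 1 t)) k
          + (b : ℂ) * (freq (k j₂) : ℂ) ^ 3 * convAt j₁ a (convAt j₁ a (convAt j₁ a (c 0 t))) k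
          + g t k) {x : Euc (n + 1)} (hx : x ∈ slab n T)
    (hg : Summable fun k => ‖g (x 0) k‖) (hx1 : periodicFun a (x 1) = x 1) :
    modelOp n b (familySum c) x = fourierSum (g (x 0)) x := by
  rw [modelOp, Dx_Dx_Dx_familySum h 0 0 0 hx, Dx_Dx_Dx_familySum h 1 1 0 hx,
    Dx_Dx_Dx_familySum h (Fin.last n) (Fin.last n) 0 hx,
    Dx_Dx_Dx_familySum h (Fin.last n) (Fin.last n) (Fin.last n) hx]
  have s0 := (((h.coeffD j₂.succ).coeffD j₂.succ).coeffD j₂.succ).summable 0 hx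
  have s1 := (((h.coeffD 0).coeffD j₂.succ).coeffD j₂.succ).summable 0 hx
  have s2 := (((h.coeffD 0).coeffD j₁.succ).coeffD j₁.succ).summable 0 hx
  rw [h1, h2]
  rw [h1] at hx1
  set t := x 0 with ht
  simp only [familySum, coeffD, Fin.cases_zero, Fin.cases_succ, zero_add, ← ht] at s0 s1 s2 ⊢
  obtain ⟨p1, q1⟩ := hasSum_convAt j₁ ha.summable_norm s1 x
  obtain ⟨p2, q2⟩ := hasSum_convAt j₁ ha.summable_norm p1 x
  obtain ⟨r1, w1⟩ := hasSum_convAt j₁ ha.summable_norm s0 x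
  obtain ⟨r2, w2⟩ := hasSum_convAt j₁ ha.summable_norm r1 x
  obtain ⟨r3, w3⟩ := hasSum_convAt j₁ ha.summable_norm r2 x
  rw [q1, hx1] at q2
  rw [w1, hx1] at w2
  rw [w2, hx1] at w3
  set d1 := convAt j₁ a (convAt j₁ a fun k => (freq (k j₂) : ℂ) * ((freq (k j₂) : ℂ) * c 1 t k))
    with hd1
  set d0 := convAt j₁ a (convAt j₁ a (convAt j₁ a fun k =>
    (freq (k j₂) : ℂ) * ((freq (k j₂) : ℂ) * ((freq (k j₂) : ℂ) * c 0 t k)))) with hd0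
  have e1 : ∀ k, d1 k = (freq (k j₂) : ℂ) ^ 2 * convAt j₁ a (convAt j₁ a (c 1 t)) k := by
    intro k
    have : (fun k : Fin n → ℤ => (freq (k j₂) : ℂ) * ((freq (k j₂) : ℂ) * c 1 t k))
        = fun k => (fun l : ℤ => (freq l : ℂ) ^ 2) (k j₂) * c 1 t k := by
      funext k; ring
    rw [hd1, this, convAt_mul hj a (fun l => (freq l : ℂ) ^ 2), convAt_mul hj a (fun l => (freq l : ℂ) ^ 2)]
  have e0 : ∀ k, d0 k
      = (freq (k j₂) : ℂ) ^ 3 * convAt j₁ a (convAt j₁ a (convAt j₁ a (c 0 t))) k := by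
    intro k
    have : (fun k : Fin n → ℤ =>
        (freq (k j₂) : ℂ) * ((freq (k j₂) : ℂ) * ((freq (k j₂) : ℂ) * c 0 t k)))
        = fun k => (fun l : ℤ => (freq l : ℂ) ^ 3) (k j₂) * c 0 t k := by
      funext k; ring
    rw [hd0, this, convAt_mul hj a (fun l => (freq l : ℂ) ^ 3),
      convAt_mul hj a (fun l => (freq l : ℂ) ^ 3), convAt_mul hj a (fun l => (freq l : ℂ) ^ 3)]
  have e3 : c 3 t = fun k => (((freq (k j₁) : ℂ) * ((freq (k j₁) : ℂ) * c 1 t k) + d1 k)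
      + b * d0 k) + g t k := by
    funext k
    rw [hc, e1, e0]; ring
  have r3' : Summable fun k => ‖(b : ℂ) * d0 k‖ := by
    simpa only [norm_mul] using r3.mul_left ‖(b : ℂ)‖
  have hs1 := (s2.add p2).of_nonneg_of_le (fun k => norm_nonneg _) (fun k => norm_add_le
    ((freq (k j₁) : ℂ) * ((freq (k j₁) : ℂ) * c 1 t k)) (d1 k))
  have hs2 := (hs1.add r3').of_nonneg_of_le (fun k => norm_nonneg _) (fun k => norm_add_le
    ((freq (k j₁) : ℂ) * ((freq (k j₁) : ℂ) * c 1 t k) + d1 k) (b * d0 k))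
  rw [e3, fourierSum_add hs2 hg, fourierSum_add hs1 r3', fourierSum_add s2 p2,
    fourierSum_const_mul, q2, w3]
  ring

lemma Dx_zero_iterate_familySum {n : ℕ} {T Γ : ℝ} {B : ℕ → ℕ → ℝ} {c : ℕ → ℝ → (Fin n → ℤ) → ℂ}
    (h : CoeffFamily T Γ B c) (j : Fin 3) {x : Euc (n + 1)} (hx : x ∈ slab n T) :
    ((Dx 0)^[(j : ℕ)] (familySum c)) x = fourierSum (c j (x 0)) x := by
  fin_cases j
  · rfl
  · exact Dx_familySum h 0 hx
  · exact Dx_Dx_familySum h 0 0 hx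

end

/-! ### Gevrey estimates and Gevrey cutoffs -/

noncomputable section
open Filter Topology

lemma iteratedDeriv_comp_ofReal {f : ℂ → ℂ} {U : Set ℂ} (hU : IsOpen U) (hf : DifferentiableOn ℂ f U)
    (k : ℕ) {x : ℝ} (hx : (x : ℂ) ∈ U) :
    iteratedDeriv k (fun y : ℝ => f y) x = iteratedDeriv k f x := by
  induction k generalizing x with
  | zero => rfl
  | succ k ih =>
    have han : AnalyticOnNhd ℂ (iteratedDeriv k f) U := by
      have := (hf.analyticOnNhd hU).iterated_deriv k
      rwa [← iteratedDeriv_eq_iterate] at this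
    have hev : iteratedDeriv k (fun y : ℝ => f y) =ᶠ[𝓝 x] fun y : ℝ => iteratedDeriv k f y := by
      filter_upwards [(hU.preimage Complex.continuous_ofReal).mem_nhds hx] with y hy using ih hy
    rw [iteratedDeriv_succ, iteratedDeriv_succ, hev.deriv_eq]
    exact ((han _ hx).differentiableAt.hasDerivAt.comp_ofReal).deriv

/-- The Gevrey inequality of order two for the operator norms of the derivatives. -/
def OpGevrey {E F : Type*} [NormedAddCommGroup E] [NormedSpace ℝ E] [NormedAddCommGroup F]
    [NormedSpace ℝ F] (A h : ℝ) (K : Set E) (f : E → F) : Prop :=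
  ∀ x ∈ K, ∀ m : ℕ, ‖iteratedFDeriv ℝ m f x‖ ≤ A * h ^ m * (m ! : ℝ) ^ 2

/-- The function `exp (-1 / x)`, extended by zero, belongs to the Gevrey class of order two. -/
lemma iteratedDeriv_expNegInvGlue_le (m : ℕ) (x : ℝ) :
    ‖iteratedDeriv m expNegInvGlue x‖ ≤ 9 ^ m * (m ! : ℝ) ^ 2 := by
  -- on the right half line, by Cauchy's estimate on the disc of radius `x / 2`
  have hpos : ∀ x : ℝ, 0 < x → ‖iteratedDeriv m expNegInvGlue x‖ ≤ 9 ^ m * (m ! : ℝ) ^ 2 := by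
    intro x hx
    have hdiff : DifferentiableOn ℂ (fun z : ℂ => Complex.exp (-z⁻¹)) {0}ᶜ := fun z hz =>
      ((differentiableAt_inv (by simpa using hz)).neg.cexp).differentiableWithinAt
    have h1 : iteratedDeriv m (fun y : ℝ => Complex.exp (-(y : ℂ)⁻¹)) x
        = iteratedDeriv m (fun z : ℂ => Complex.exp (-z⁻¹)) x :=
      iteratedDeriv_comp_ofReal isOpen_compl_singleton hdiff m (by simpa using hx.ne')
    have h2 : (fun y : ℝ => ((expNegInvGlue y : ℝ) : ℂ)) =ᶠ[𝓝 x]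
        fun y : ℝ => Complex.exp (-(y : ℂ)⁻¹) := by
      filter_upwards [lt_mem_nhds hx] with y hy
      rw [expNegInvGlue, if_neg hy.not_ge]; push_cast; rfl
    have h3 : ‖iteratedDeriv m expNegInvGlue x‖
        = ‖iteratedDeriv m (fun z : ℂ => Complex.exp (-z⁻¹)) x‖ := by
      rw [← h1, ← h2.iteratedDeriv_eq m, ← norm_iteratedFDeriv_eq_norm_iteratedDeriv,
        ← norm_iteratedFDeriv_eq_norm_iteratedDeriv]
      exact (Complex.ofRealLI.norm_iteratedFDeriv_comp_left
        (expNegInvGlue.contDiff (n := ⊤)).contDiffAt (by exact_mod_cast le_top)).symm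
    have hball : Metric.closedBall (x : ℂ) (x / 2) ⊆ {0}ᶜ := fun z hz h0 => by
      rw [Set.mem_singleton_iff] at h0
      rw [h0, Metric.mem_closedBall, dist_zero_left, Complex.norm_real, Real.norm_eq_abs,
        abs_of_pos hx] at hz
      linarith
    have hc := Complex.norm_iteratedDeriv_le_of_forall_mem_sphere_norm_le (c := (x : ℂ))
      (R := x / 2) (C := Real.exp (-(2 / (9 * x)))) m (by positivity)
      (hdiff.diffContOnCl_ball hball) (fun z hz => ?_)
    · rw [h3]
      refine hc.trans ?_
      have hs : 0 ≤ 2 / (9 * x) := by positivity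
      have he := Real.pow_div_factorial_le_exp (2 / (9 * x)) hs m
      have hm : (0 : ℝ) < m ! := by positivity
      rw [div_le_iff₀ hm] at he
      have hee : Real.exp (-(2 / (9 * x))) * Real.exp (2 / (9 * x)) = 1 := by
        rw [← Real.exp_add]; simp
      have hx2 : (2 / (9 * x)) ^ m * 9 ^ m * (x / 2) ^ m = 1 := by
        rw [← mul_pow, ← mul_pow]
        have : 2 / (9 * x) * 9 * (x / 2) = 1 := by field_simp
        rw [this, one_pow]
      rw [div_le_iff₀ (by positivity)]
      calc (m ! : ℝ) * Real.exp (-(2 / (9 * x)))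
          = m ! * Real.exp (-(2 / (9 * x))) * ((2 / (9 * x)) ^ m * 9 ^ m * (x / 2) ^ m) := by
            rw [hx2, mul_one]
        _ ≤ m ! * Real.exp (-(2 / (9 * x)))
            * (Real.exp (2 / (9 * x)) * m ! * 9 ^ m * (x / 2) ^ m) := by gcongr
        _ = (Real.exp (-(2 / (9 * x))) * Real.exp (2 / (9 * x)))
            * (9 ^ m * (m ! : ℝ) ^ 2 * (x / 2) ^ m) := by ring
        _ = _ := by rw [hee, one_mul]
    · rw [Complex.norm_exp, Real.exp_le_exp, Complex.neg_re, neg_le_neg_iff, Complex.inv_re]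
      have hd : ‖z - x‖ = x / 2 := by simpa [dist_eq_norm] using hz
      have hre : x / 2 ≤ z.re := by
        have := (Complex.abs_re_le_norm (z - x)).trans hd.le
        rw [Complex.sub_re, Complex.ofReal_re] at this
        linarith [(abs_le.1 this).1]
      have hn : ‖z‖ ≤ 3 * x / 2 := by
        calc ‖z‖ = ‖(z - x) + x‖ := by ring_nf
          _ ≤ ‖z - x‖ + ‖(x : ℂ)‖ := norm_add_le _ _
          _ = 3 * x / 2 := by rw [hd, Complex.norm_real, Real.norm_eq_abs, abs_of_pos hx]; ring
      have hz0 : 0 < Complex.normSq z := by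
        rw [Complex.normSq_pos]; intro h0; rw [h0, Complex.zero_re] at hre; linarith
      have hn2 : Complex.normSq z ≤ (3 * x / 2) ^ 2 := by
        rw [Complex.normSq_eq_norm_sq]; gcongr
      calc 2 / (9 * x) = (x / 2) / (3 * x / 2) ^ 2 := by field_simp; norm_num
        _ ≤ z.re / Complex.normSq z := by gcongr; linarith
  have hcont : Continuous (iteratedDeriv m expNegInvGlue) :=
    (expNegInvGlue.contDiff (n := ⊤)).continuous_iteratedDeriv m (by exact_mod_cast le_top)
  rcases lt_or_ge 0 x with hx | hx
  · exact hpos x hx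
  · have hneg : ∀ x : ℝ, x < 0 → ‖iteratedDeriv m expNegInvGlue x‖ ≤ 9 ^ m * (m ! : ℝ) ^ 2 := by
      intro x hx
      have : expNegInvGlue =ᶠ[𝓝 x] fun _ => (0 : ℝ) := by
        filter_upwards [gt_mem_nhds hx] with y hy using expNegInvGlue.zero_of_nonpos hy.le
      rw [this.iteratedDeriv_eq m, iteratedDeriv_const]
      split_ifs <;> simp
    rcases hx.lt_or_eq with hx | rfl
    · exact hneg x hx
    · have hcl : IsClosed {x : ℝ | ‖iteratedDeriv m expNegInvGlue x‖ ≤ 9 ^ m * (m ! : ℝ) ^ 2} :=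
        isClosed_le hcont.norm continuous_const
      have : closure (Set.Ioi (0 : ℝ)) ⊆ _ := hcl.closure_subset_iff.2 fun x hx => hpos x hx
      rw [closure_Ioi] at this
      exact this Set.self_mem_Ici

lemma opGevrey_expNegInvGlue : OpGevrey 1 9 Set.univ expNegInvGlue := fun x _ m => by
  rw [norm_iteratedFDeriv_eq_norm_iteratedDeriv, one_mul]
  exact iteratedDeriv_expNegInvGlue_le m x

section Closure
variable {E F : Type*} [NormedAddCommGroup E] [NormedSpace ℝ E] [NormedAddCommGroup F]
  [NormedSpace ℝ F]

lemma OpGevrey.nonneg {A h : ℝ} {K : Set E} {f : E → F} (hf : OpGevrey A h K f) (hK : K.Nonempty) :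
    0 ≤ A := by
  obtain ⟨x, hx⟩ := hK
  simpa using (norm_nonneg _).trans (hf x hx 0)

/-- The Leibniz rule for the Gevrey inequality; outside of `K` the first factor vanishes. -/
lemma OpGevrey.smul {A h A' h' : ℝ} {K : Set E} {θ : E → ℝ} {f : E → F} (hh : 0 ≤ h) (hh' : 0 ≤ h')
    (hA : 0 ≤ A) (hA' : 0 ≤ A')
    (hθ : OpGevrey A h Set.univ θ) (hf : OpGevrey A' h' K f) (hK : tsupport θ ⊆ K)
    (hθc : ContDiff ℝ ∞ θ) (hfc : ContDiff ℝ ∞ f) :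
    OpGevrey (A * A') (2 * max h h') Set.univ (fun x => θ x • f x) := by
  intro x _ m
  set H := max h h' with hH
  have hH0 : 0 ≤ H := hh.trans (le_max_left _ _)
  have hterm : ∀ i ∈ Finset.range (m + 1), (m.choose i : ℝ) * ‖iteratedFDeriv ℝ i θ x‖
      * ‖iteratedFDeriv ℝ (m - i) f x‖ ≤ A * A' * H ^ m * (m ! : ℝ) ^ 2 := by
    intro i hi
    have him : i ≤ m := Nat.lt_succ_iff.1 (Finset.mem_range.1 hi)
    by_cases hx : x ∈ K
    · have e : (m.choose i : ℝ) * i ! * (m - i)! = m ! := by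
        exact_mod_cast Nat.choose_mul_factorial_mul_factorial him
      have e2 : (i ! : ℝ) * (m - i)! ≤ m ! := by
        exact_mod_cast Nat.le_of_dvd (Nat.factorial_pos _) (Nat.factorial_mul_factorial_dvd_factorial him)
      have h1 : h ^ i ≤ H ^ i := pow_le_pow_left₀ hh (le_max_left _ _) _
      have h2 : h' ^ (m - i) ≤ H ^ (m - i) := pow_le_pow_left₀ hh' (le_max_right _ _) _
      calc (m.choose i : ℝ) * ‖iteratedFDeriv ℝ i θ x‖ * ‖iteratedFDeriv ℝ (m - i) f x‖
          ≤ m.choose i * (A * h ^ i * (i ! : ℝ) ^ 2) * (A' * h' ^ (m - i) * ((m - i)! : ℝ) ^ 2) := by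
            gcongr
            · exact hθ x trivial i
            · exact hf x hx _
        _ ≤ m.choose i * (A * H ^ i * (i ! : ℝ) ^ 2) * (A' * H ^ (m - i) * ((m - i)! : ℝ) ^ 2) := by
            gcongr
        _ = A * A' * (H ^ i * H ^ (m - i)) * ((m.choose i * i ! * (m - i)!) * (i ! * (m - i)!)) := by
            ring
        _ ≤ A * A' * (H ^ i * H ^ (m - i)) * ((m.choose i * i ! * (m - i)!) * m !) := by gcongr
        _ = _ := by rw [e, ← pow_add, Nat.add_sub_cancel' him]; ring
    · have : iteratedFDeriv ℝ i θ x = 0 := by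
        by_contra hne
        exact hx (hK (support_iteratedFDeriv_subset i hne))
      rw [this, norm_zero, mul_zero, zero_mul]
      positivity
  refine (norm_iteratedFDeriv_smul_le hθc hfc x (by exact_mod_cast le_top)).trans
    ((Finset.sum_le_sum hterm).trans ?_)
  rw [Finset.sum_const, Finset.card_range, nsmul_eq_mul, mul_pow]
  have h2 : ((m + 1 : ℕ) : ℝ) ≤ 2 ^ m := by exact_mod_cast Nat.lt_two_pow_self
  calc ((m + 1 : ℕ) : ℝ) * (A * A' * H ^ m * (m ! : ℝ) ^ 2)
      ≤ 2 ^ m * (A * A' * H ^ m * (m ! : ℝ) ^ 2) := by gcongr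
    _ = _ := by ring

lemma OpGevrey.comp_clm {G : Type*} [NormedAddCommGroup G] [NormedSpace ℝ G] {A h c : ℝ} {K : Set E}
    {f : E → F} (hA : 0 ≤ A) (hh : 0 ≤ h) (hf : OpGevrey A h K f) (hfc : ContDiff ℝ ∞ f)
    (L : G →L[ℝ] E) (hL : ‖L‖ ≤ c) : OpGevrey A (c * h) (L ⁻¹' K) (f ∘ L) := by
  intro x hx m
  rw [L.iteratedFDeriv_comp_right hfc x (by exact_mod_cast le_top)]
  refine (ContinuousMultilinearMap.norm_compContinuousLinearMap_le _ _).trans ?_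
  rw [Finset.prod_const, Finset.card_univ, Fintype.card_fin, mul_pow]
  calc _ ≤ A * h ^ m * (m ! : ℝ) ^ 2 * c ^ m := by
        gcongr
        exact hf _ hx m
    _ = _ := by ring

end Closure

/-- A primitive of a Gevrey function. -/
lemma opGevrey_of_hasDerivAt {A h M : ℝ} {S s : ℝ → ℝ} (hA : 0 ≤ A) (hh : 1 ≤ h)
    (hs : OpGevrey A h Set.univ s) (hS : ∀ x, HasDerivAt S (s x) x) (hM : ∀ x, |S x| ≤ M) :
    OpGevrey (max A M) h Set.univ S := by
  intro x _ m
  rw [norm_iteratedFDeriv_eq_norm_iteratedDeriv]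
  rcases m with _ | m
  · simpa using (hM x).trans (le_max_right _ _)
  · rw [iteratedDeriv_succ', funext fun x => (hS x).deriv, ← norm_iteratedFDeriv_eq_norm_iteratedDeriv]
    refine (hs x trivial m).trans ?_
    have : (m ! : ℝ) ≤ (m + 1)! := by exact_mod_cast Nat.factorial_le (Nat.le_succ m)
    have h0 : 0 ≤ h := by linarith
    have hA' : 0 ≤ max A M := hA.trans (le_max_left _ _)
    gcongr
    · exact le_max_left _ _
    · exact Nat.le_succ m

/-- A Gevrey function of one variable that is `1` near the origin and has its support in
`[-1, 1]`. -/
lemma exists_gevrey_bump : ∃ (θ : ℝ → ℝ) (A h : ℝ), 0 ≤ A ∧ 0 ≤ h ∧ ContDiff ℝ ∞ θ ∧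
    OpGevrey A h Set.univ θ ∧ (∀ x, |x| ≤ 1 / 2 → θ x = 1) ∧ ∀ x, 1 ≤ |x| → θ x = 0 := by
  have hψc : ContDiff ℝ ∞ expNegInvGlue := expNegInvGlue.contDiff
  let R : ℝ → ℝ := fun x => expNegInvGlue (1 - x)
  have hRc : ContDiff ℝ ∞ R := hψc.comp (contDiff_const.sub contDiff_id)
  have hR : OpGevrey 1 9 Set.univ R := fun x _ m => by
    have : R = fun x => expNegInvGlue (1 - x) := rfl
    rw [norm_iteratedFDeriv_eq_norm_iteratedDeriv, this, iteratedDeriv_comp_const_sub, norm_smul]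
    simpa using iteratedDeriv_expNegInvGlue_le m (1 - x)
  let s : ℝ → ℝ := fun x => expNegInvGlue x • R x
  have hsc : ContDiff ℝ ∞ s := hψc.smul hRc
  have hs : OpGevrey (1 * 1) (2 * max 9 9) Set.univ s :=
    opGevrey_expNegInvGlue.smul (by norm_num) (by norm_num) zero_le_one zero_le_one hR
      (Set.subset_univ _) hψc hRc
  have hs0 : ∀ x, 0 ≤ s x := fun x => mul_nonneg (expNegInvGlue.nonneg _) (expNegInvGlue.nonneg _)
  have hsz : ∀ x, x ≤ 0 ∨ 1 ≤ x → s x = 0 := by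
    rintro x (hx | hx)
    · simp [s, expNegInvGlue.zero_of_nonpos hx]
    · simp [s, R, expNegInvGlue.zero_of_nonpos (show 1 - x ≤ 0 by linarith)]
  -- a primitive of a bump: a smooth step from `0` to `S 1`
  let S : ℝ → ℝ := fun x => ∫ t in (0 : ℝ)..x, s t
  have hS : ∀ x, HasDerivAt S (s x) x := fun x =>
    intervalIntegral.integral_hasDerivAt_right (hsc.continuous.intervalIntegrable _ _)
      (hsc.continuous.stronglyMeasurableAtFilter _ _) hsc.continuous.continuousAt
  have hSc : ContDiff ℝ ∞ S := by
    rw [show (∞ : WithTop ℕ∞) = ∞ + 1 from rfl, contDiff_succ_iff_deriv]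
    refine ⟨fun x => (hS x).differentiableAt, by simp, ?_⟩
    rw [funext fun x => (hS x).deriv]
    exact hsc
  have hmono : Monotone S := monotone_of_hasDerivAt_nonneg hS hs0
  have hneg : ∀ x, x ≤ 0 → S x = 0 := fun x hx => by
    refine (intervalIntegral.integral_congr (g := fun _ => 0) fun t ht => ?_).trans (by simp)
    rw [Set.uIcc_of_ge hx] at ht
    exact hsz t (Or.inl ht.2)
  have hone : ∀ x, 1 ≤ x → S x = S 1 := fun x hx => by
    have h1 : S x - S 1 = ∫ t in (1 : ℝ)..x, s t :=
      intervalIntegral.integral_interval_sub_left (hsc.continuous.intervalIntegrable _ _)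
        (hsc.continuous.intervalIntegrable _ _)
    have h2 : ∫ t in (1 : ℝ)..x, s t = 0 := by
      refine (intervalIntegral.integral_congr (g := fun _ => 0) fun t ht => ?_).trans (by simp)
      rw [Set.uIcc_of_le hx] at ht
      exact hsz t (Or.inr ht.1)
    linarith
  have hpos : 0 < S 1 := by
    refine intervalIntegral.intervalIntegral_pos_of_pos_on (hsc.continuous.intervalIntegrable _ _)
      (fun x hx => ?_) zero_lt_one
    exact mul_pos (expNegInvGlue.pos_of_pos hx.1) (expNegInvGlue.pos_of_pos (by linarith [hx.2]))
  have hSb : ∀ x, |S x| ≤ S 1 := fun x => by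
    rcases le_total x 0 with hx | hx
    · rw [hneg x hx, abs_zero]; exact hpos.le
    · rw [abs_of_nonneg ((hneg 0 le_rfl).symm.le.trans (hmono hx))]
      rcases le_total x 1 with h1 | h1
      · exact hmono h1
      · exact (hone x h1).le
  have hSg := opGevrey_of_hasDerivAt (by norm_num) (by norm_num) hs hS hSb
  set A := max (1 * 1) (S 1) with hA
  have hA0 : 0 ≤ A := by positivity
  set h := 2 * max (9 : ℝ) 9 with hh
  have hh0 : 0 ≤ h := by positivity
  -- the rising and the falling edge
  have hup : OpGevrey A (2 * h) Set.univ (fun x => S (2 * (x + 1))) := fun x _ m => by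
    have e : (fun x => S (2 * (x + 1))) = fun x => (fun y => S (2 * y)) (x + 1) := rfl
    rw [norm_iteratedFDeriv_eq_norm_iteratedDeriv, e,
      iteratedDeriv_comp_add_const m (fun y => S (2 * y)) 1,
      iteratedDeriv_comp_const_mul (hSc.of_le (by exact_mod_cast le_top)), norm_mul, norm_pow,
      ← norm_iteratedFDeriv_eq_norm_iteratedDeriv, mul_pow]
    calc _ ≤ ‖(2 : ℝ)‖ ^ m * (A * h ^ m * (m ! : ℝ) ^ 2) := by gcongr; exact hSg _ trivial m
      _ = _ := by rw [Real.norm_eq_abs, abs_two]; ring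
  have hdown : OpGevrey A (2 * h) Set.univ (fun x => S (2 * (1 - x))) := fun x _ m => by
    have e : (fun x => S (2 * (1 - x))) = fun x => (fun y => S (2 * y)) (1 - x) := rfl
    rw [norm_iteratedFDeriv_eq_norm_iteratedDeriv, e,
      iteratedDeriv_comp_const_sub m (fun y => S (2 * y)) 1, norm_smul,
      iteratedDeriv_comp_const_mul (hSc.of_le (by exact_mod_cast le_top)), norm_mul, norm_pow, norm_pow,
      ← norm_iteratedFDeriv_eq_norm_iteratedDeriv, mul_pow]
    calc _ ≤ ‖(-1 : ℝ)‖ ^ m * (‖(2 : ℝ)‖ ^ m * (A * h ^ m * (m ! : ℝ) ^ 2)) := by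
          gcongr; exact hSg _ trivial m
      _ = _ := by rw [norm_neg, norm_one, one_pow, Real.norm_eq_abs, abs_two]; ring
  have hupc : ContDiff ℝ ∞ (fun x => S (2 * (x + 1))) := hSc.comp (by fun_prop)
  have hdownc : ContDiff ℝ ∞ (fun x => S (2 * (1 - x))) := hSc.comp (by fun_prop)
  have hpc : ContDiff ℝ ∞ (fun x => S (2 * (x + 1)) • S (2 * (1 - x))) := hupc.smul hdownc
  have hprod := hup.smul (by positivity) (by positivity) hA0 hA0 hdown (Set.subset_univ _) hupc hdownc
  refine ⟨fun x => ((S 1)⁻¹ ^ 2) • (S (2 * (x + 1)) • S (2 * (1 - x))), (S 1)⁻¹ ^ 2 * (A * A),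
    2 * max (2 * h) (2 * h), by positivity, by positivity, (hupc.smul hdownc).const_smul _, ?_, ?_, ?_⟩
  · intro x _ m
    rw [iteratedFDeriv_const_smul_apply' (hpc.of_le (by exact_mod_cast le_top)).contDiffAt,
      norm_smul, Real.norm_of_nonneg (by positivity), mul_assoc, mul_assoc]
    gcongr
    have := hprod x trivial m
    rwa [mul_assoc] at this
  · intro x hx
    have := abs_le.1 hx
    simp only [smul_eq_mul]
    rw [hone (2 * (x + 1)) (by linarith), hone (2 * (1 - x)) (by linarith)]
    field_simp
  · intro x hx
    simp only [smul_eq_mul]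
    rcases le_abs.1 hx with h | h
    · rw [hneg (2 * (1 - x)) (by linarith), mul_zero, mul_zero]
    · rw [hneg (2 * (x + 1)) (by linarith), zero_mul, mul_zero]

end

/-! ### Fourier coefficients of functions supported in a cube -/

noncomputable section
open Filter Topology MeasureTheory

/-- `F` is smooth and vanishes outside of the cube `|x_i| ≤ 1/4`. -/
structure BoxFun {d : ℕ} (F : Euc d → ℂ) : Prop where
  smooth : ContDiff ℝ ∞ F
  supp : ∀ x i, 1 / 4 < |x i| → F x = 0

lemma BoxFun.Dx {d : ℕ} {F : Euc d → ℂ} (hF : BoxFun F) (i : Fin d) : BoxFun (Dx i F) := by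
  refine ⟨?_, fun x j hx => ?_⟩
  · have h := hF.smooth.fderiv_right (m := ∞) (by simp)
    exact contDiff_const.mul (h.clm_apply contDiff_const)
  · have : F =ᶠ[𝓝 x] fun _ => 0 := by
      filter_upwards [(isOpen_lt continuous_const (continuous_coord j).abs).mem_nhds hx] with y hy
        using hF.supp y j hy
    rw [_root_.Dx, this.fderiv_eq, fderiv_const_apply]
    simp

lemma BoxFun.Dx_iterate {d : ℕ} {F : Euc d → ℂ} (hF : BoxFun F) (i : Fin d) (m : ℕ) :
    BoxFun ((_root_.Dx i)^[m] F) := by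
  induction m with
  | zero => exact hF
  | succ m ih => rw [Function.iterate_succ_apply']; exact ih.Dx i

lemma norm_iteratedFDeriv_Dx_le {d : ℕ} {F : Euc d → ℂ} (hF : BoxFun F) (i : Fin d) (m : ℕ)
    (x : Euc d) : ‖iteratedFDeriv ℝ m (Dx i F) x‖ ≤ ‖iteratedFDeriv ℝ (m + 1) F x‖ := by
  set L : (Euc d →L[ℝ] ℂ) →L[ℝ] ℂ :=
    (-Complex.I) • ContinuousLinearMap.apply ℝ ℂ (EuclideanSpace.single i (1 : ℝ)) with hL
  have hLn : ‖L‖ ≤ 1 := by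
    refine L.opNorm_le_bound zero_le_one fun T => ?_
    rw [hL, smul_apply, norm_smul, norm_neg, Complex.norm_I, one_mul, one_mul]
    simpa using T.le_opNorm (EuclideanSpace.single i (1 : ℝ))
  have e : Dx i F = L ∘ fderiv ℝ F := rfl
  have hc : ContDiff ℝ ∞ (fderiv ℝ F) := hF.smooth.fderiv_right (by simp)
  rw [e, ← norm_iteratedFDeriv_fderiv]
  refine (L.norm_iteratedFDeriv_comp_left hc.contDiffAt (by exact_mod_cast le_top)).trans ?_
  exact mul_le_of_le_one_left (norm_nonneg _) hLn

lemma norm_iteratedFDeriv_Dx_iterate_le {d : ℕ} {F : Euc d → ℂ} (hF : BoxFun F) (i : Fin d)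
    (p m : ℕ) (x : Euc d) :
    ‖iteratedFDeriv ℝ m ((Dx i)^[p] F) x‖ ≤ ‖iteratedFDeriv ℝ (m + p) F x‖ := by
  induction p generalizing m with
  | zero => rfl
  | succ p ih =>
    rw [Function.iterate_succ_apply']
    refine (norm_iteratedFDeriv_Dx_le (hF.Dx_iterate i p) i m x).trans ((ih (m + 1)).trans_eq ?_)
    rw [add_right_comm, add_assoc]

/-- The point with time coordinate `t` and space coordinates `y`. -/
def timeSpace {n : ℕ} (t : ℝ) (y : Fin n → ℝ) : Euc (n + 1) := WithLp.toLp 2 (Fin.cons t y)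

lemma timeSpace_zero {n : ℕ} (t : ℝ) (y : Fin n → ℝ) : timeSpace t y 0 = t := rfl

lemma timeSpace_succ {n : ℕ} (t : ℝ) (y : Fin n → ℝ) (j : Fin n) : timeSpace t y j.succ = y j := rfl

lemma hasFDerivAt_timeSpace {n : ℕ} (t : ℝ) (y : Fin n → ℝ) :
    ∃ L : (Fin n → ℝ) →L[ℝ] Euc (n + 1), HasFDerivAt (timeSpace t) L y ∧
      ∀ j, L (Pi.single j 1) = EuclideanSpace.single j.succ 1 := by
  let L0 : (Fin n → ℝ) →ₗ[ℝ] Euc (n + 1) :=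
    { toFun := fun y => timeSpace 0 y
      map_add' := fun y z => by
        ext i; refine Fin.cases ?_ (fun j => ?_) i <;> simp [timeSpace]
      map_smul' := fun c z => by
        ext i; refine Fin.cases ?_ (fun j => ?_) i <;> simp [timeSpace] }
  refine ⟨LinearMap.toContinuousLinearMap L0, ?_, fun j => ?_⟩
  · have e : timeSpace t = fun y : Fin n → ℝ =>
        LinearMap.toContinuousLinearMap L0 y + timeSpace t 0 := by
      funext y
      ext i; refine Fin.cases ?_ (fun j => ?_) i <;> simp [timeSpace, L0]
    rw [e]
    exact (ContinuousLinearMap.hasFDerivAt _).add_const _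
  · change timeSpace 0 (Pi.single j 1) = _
    ext i
    refine Fin.cases ?_ (fun l => ?_) i
    · simp [timeSpace, (Fin.succ_ne_zero j).symm]
    · simp [timeSpace, PiLp.single_apply, Pi.single_apply]

lemma continuous_timeSpace {n : ℕ} (t : ℝ) : Continuous (timeSpace t : (Fin n → ℝ) → Euc (n + 1)) :=
  continuous_iff_continuousAt.2 fun y => by
    obtain ⟨L, hL, -⟩ := hasFDerivAt_timeSpace t y
    exact hL.continuousAt

lemma hasDerivAt_timeSpace {n : ℕ} (t : ℝ) (y : Fin n → ℝ) :
    HasDerivAt (fun t => timeSpace t y) (EuclideanSpace.single 0 1 : Euc (n + 1)) t := by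
  have e : (fun t => timeSpace t y) = fun t : ℝ =>
      t • (EuclideanSpace.single 0 1 : Euc (n + 1)) + timeSpace 0 y := by
    funext t
    ext i; refine Fin.cases ?_ (fun j => ?_) i <;> simp [timeSpace]
  rw [e]
  simpa using ((hasDerivAt_id t).smul_const (EuclideanSpace.single 0 1 : Euc (n + 1))).add_const
    (timeSpace 0 y)

/-- The conjugate character. -/
def conjChr {n : ℕ} (k : Fin n → ℤ) (y : Fin n → ℝ) : ℂ :=
  Complex.exp (-(Complex.I * (∑ j, freq (k j) * y j : ℝ)))

lemma norm_conjChr {n : ℕ} (k : Fin n → ℤ) (y : Fin n → ℝ) : ‖conjChr k y‖ = 1 := by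
  rw [conjChr, mul_comm, ← neg_mul, ← Complex.ofReal_neg, Complex.norm_exp_ofReal_mul_I]

lemma hasFDerivAt_conjChr {n : ℕ} (k : Fin n → ℤ) (y : Fin n → ℝ) :
    ∃ L : (Fin n → ℝ) →L[ℝ] ℂ, HasFDerivAt (conjChr k) L y ∧
      ∀ j, L (Pi.single j 1) = -Complex.I * freq (k j) * conjChr k y := by
  let l : (Fin n → ℝ) →L[ℝ] ℝ := ∑ j, freq (k j) • ContinuousLinearMap.proj j
  have hl : ∀ y, l y = ∑ j, freq (k j) * y j := fun y => by
    simp [l, sum_apply]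
  have h1 : HasFDerivAt (fun y : Fin n → ℝ => -(Complex.I * ((∑ j, freq (k j) * y j : ℝ) : ℂ)))
      (-(Complex.I • Complex.ofRealCLM.comp l)) y := by
    have := ((Complex.ofRealCLM.comp l).hasFDerivAt (x := y)).const_mul Complex.I |>.neg
    refine this.congr_of_eventuallyEq (Eventually.of_forall fun y => ?_)
    simp [hl]
  refine ⟨_, h1.cexp, fun j => ?_⟩
  rw [smul_apply, smul_eq_mul, mul_comm]
  change -(Complex.I * ((l (Pi.single j 1) : ℝ) : ℂ)) * conjChr k y = _
  rw [hl]
  simp [Pi.single_apply]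

lemma continuous_conjChr {n : ℕ} (k : Fin n → ℤ) : Continuous (conjChr k) :=
  continuous_iff_continuousAt.2 fun y => by
    obtain ⟨L, hL, -⟩ := hasFDerivAt_conjChr k y
    exact hL.continuousAt

/-- The Fourier coefficients in the space variables of a function supported in the cube. -/
def boxCoeff {n : ℕ} (F : Euc (n + 1) → ℂ) (t : ℝ) (k : Fin n → ℤ) : ℂ :=
  ∫ y : Fin n → ℝ, conjChr k y * F (timeSpace t y)

section Coeff
variable {n : ℕ} {F : Euc (n + 1) → ℂ}

lemma BoxFun.eq_zero (hF : BoxFun F) (t : ℝ) {y : Fin n → ℝ}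
    (hy : y ∉ Set.Icc (fun _ => -(1 / 4) : Fin n → ℝ) (fun _ => 1 / 4)) :
    F (timeSpace t y) = 0 := by
  by_contra h
  refine hy ⟨fun j => ?_, fun j => ?_⟩
  all_goals
    by_contra hj
    rw [not_le] at hj
    refine h (hF.supp _ j.succ ?_)
    rw [timeSpace_succ]
  · exact lt_abs.2 (Or.inr (by linarith))
  · exact lt_abs.2 (Or.inl hj)

lemma BoxFun.integrable (hF : BoxFun F) (t : ℝ) {e : (Fin n → ℝ) → ℂ} (he : Continuous e) :
    Integrable fun y => e y * F (timeSpace t y) := by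
  refine Continuous.integrable_of_hasCompactSupport
    (he.mul (hF.smooth.continuous.comp (continuous_timeSpace t))) ?_
  refine HasCompactSupport.intro (isCompact_Icc (a := (fun _ => -(1 / 4) : Fin n → ℝ))
    (b := fun _ => 1 / 4)) fun y hy => ?_
  rw [hF.eq_zero t hy, mul_zero]

lemma BoxFun.norm_boxCoeff_le (hF : BoxFun F) {M : ℝ} (hM : ∀ x, ‖F x‖ ≤ M) (t : ℝ)
    (k : Fin n → ℤ) : ‖boxCoeff F t k‖ ≤ M := by
  have hM0 : 0 ≤ M := (norm_nonneg _).trans (hM 0)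
  set K := Set.Icc (fun _ => -(1 / 4) : Fin n → ℝ) (fun _ => 1 / 4) with hK
  have hbd : ∀ y, ‖conjChr k y * F (timeSpace t y)‖ ≤ K.indicator (fun _ => M) y := fun y => by
    by_cases hy : y ∈ K
    · rw [Set.indicator_of_mem hy, norm_mul, norm_conjChr, one_mul]; exact hM _
    · rw [hF.eq_zero t hy, mul_zero, norm_zero, Set.indicator_of_notMem hy]
  have hint : Integrable (K.indicator fun _ => M) :=
    (integrable_indicator_iff measurableSet_Icc).2
      (integrableOn_const (isCompact_Icc.measure_lt_top.ne))
  refine (norm_integral_le_of_norm_le hint (Eventually.of_forall hbd)).trans ?_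
  rw [integral_indicator_const _ measurableSet_Icc, Measure.real, Real.volume_Icc_pi_toReal
    (fun _ => by norm_num), smul_eq_mul]
  refine mul_le_of_le_one_left hM0 ?_
  exact Finset.prod_le_one (fun _ _ => by norm_num) fun _ _ => by norm_num

lemma BoxFun.boxCoeff_Dx_succ (hF : BoxFun F) (j : Fin n) (t : ℝ) (k : Fin n → ℤ) :
    boxCoeff (_root_.Dx j.succ F) t k = freq (k j) * boxCoeff F t k := by
  have hg : ∀ y, HasFDerivAt (fun y => F (timeSpace t y))
      ((fderiv ℝ F (timeSpace t y)).comp (hasFDerivAt_timeSpace t y).choose) y := fun y =>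
    ((hF.smooth.differentiable (by simp) _).hasFDerivAt).comp y
      (hasFDerivAt_timeSpace t y).choose_spec.1
  have hgv : ∀ y, fderiv ℝ (fun y => F (timeSpace t y)) y (Pi.single j 1)
      = Complex.I * _root_.Dx j.succ F (timeSpace t y) := fun y => by
    rw [(hg y).fderiv, ContinuousLinearMap.comp_apply, (hasFDerivAt_timeSpace t y).choose_spec.2,
      _root_.Dx, ← mul_assoc, mul_neg, Complex.I_mul_I, neg_neg, one_mul]
  have hev : ∀ y, fderiv ℝ (conjChr k) y (Pi.single j 1) = -Complex.I * freq (k j) * conjChr k y :=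
    fun y => by
      rw [(hasFDerivAt_conjChr k y).choose_spec.1.fderiv, (hasFDerivAt_conjChr k y).choose_spec.2]
  have hDx := hF.Dx j.succ
  have key := integral_mul_fderiv_eq_neg_fderiv_mul_of_integrable (μ := (volume : Measure (Fin n → ℝ)))
    (f := conjChr k) (g := fun y => F (timeSpace t y)) (v := Pi.single j 1) ?_ ?_ ?_
    (fun y _ => (hasFDerivAt_conjChr k y).choose_spec.1.differentiableAt)
    (fun y _ => (hg y).differentiableAt)
  · simp only [hgv, hev] at key
    have e1 : ∀ y, conjChr k y * (Complex.I * _root_.Dx j.succ F (timeSpace t y))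
        = Complex.I * (conjChr k y * _root_.Dx j.succ F (timeSpace t y)) := fun y => by ring
    have e2 : ∀ y, -Complex.I * freq (k j) * conjChr k y * F (timeSpace t y)
        = (-Complex.I * freq (k j)) * (conjChr k y * F (timeSpace t y)) := fun y => by ring
    simp only [e1, e2, integral_const_mul] at key
    change Complex.I * boxCoeff (_root_.Dx j.succ F) t k = -(-Complex.I * freq (k j) * boxCoeff F t k) at key
    have := congrArg (fun z => -Complex.I * z) key
    simp only [← mul_assoc, neg_mul, Complex.I_mul_I, neg_neg, one_mul] at this
    rw [this]
  · simp only [hev]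
    exact hF.integrable t (continuous_const.mul (continuous_conjChr k))
  · simp only [hgv]
    refine ((hDx.integrable t (e := fun y => conjChr k y * Complex.I)
      ((continuous_conjChr k).mul continuous_const))).congr (Eventually.of_forall fun y => ?_)
    simp only [mul_assoc]
  · exact hF.integrable t (continuous_conjChr k)

lemma BoxFun.bounded {d : ℕ} {F : Euc d → ℂ} (hF : BoxFun F) : ∃ M, ∀ x, ‖F x‖ ≤ M := by
  have hc : HasCompactSupport F := by
    refine HasCompactSupport.intro (K := (WithLp.toLp 2) '' (Set.Icc (fun _ => -(1 / 4) : Fin d → ℝ)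
      (fun _ => 1 / 4))) (isCompact_Icc.image (PiLp.continuous_toLp 2 _)) fun x hx => ?_
    by_contra h
    refine hx ⟨x.ofLp, ⟨fun j => ?_, fun j => ?_⟩, rfl⟩
    all_goals
      by_contra hj
      rw [not_le] at hj
      refine h (hF.supp _ j ?_)
    · exact lt_abs.2 (Or.inr (by linarith))
    · exact lt_abs.2 (Or.inl hj)
  exact hF.smooth.continuous.bounded_above_of_compact_support hc

lemma BoxFun.hasDerivAt_boxCoeff (hF : BoxFun F) (k : Fin n → ℤ) (t : ℝ) :
    HasDerivAt (fun t => boxCoeff F t k) (Complex.I * boxCoeff (_root_.Dx 0 F) t k) t := by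
  have hDx := hF.Dx 0
  obtain ⟨M, hM⟩ := hDx.bounded
  set K := Set.Icc (fun _ => -(1 / 4) : Fin n → ℝ) (fun _ => 1 / 4) with hK
  have hint : Integrable (K.indicator fun _ => M) :=
    (integrable_indicator_iff measurableSet_Icc).2
      (integrableOn_const (isCompact_Icc.measure_lt_top.ne))
  have hd := hasDerivAt_integral_of_dominated_loc_of_deriv_le (μ := (volume : Measure (Fin n → ℝ)))
    (F := fun t y => conjChr k y * F (timeSpace t y))
    (F' := fun t y => Complex.I * (conjChr k y * _root_.Dx 0 F (timeSpace t y)))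
    (x₀ := t) (s := Set.univ) (bound := K.indicator fun _ => M) univ_mem
    (Eventually.of_forall fun s => (hF.integrable s (continuous_conjChr k)).aestronglyMeasurable)
    (hF.integrable t (continuous_conjChr k))
    ((hDx.integrable t (continuous_conjChr k)).const_mul _).aestronglyMeasurable
    (Eventually.of_forall fun y s _ => ?_) hint (Eventually.of_forall fun y s _ => ?_)
  · refine hd.2.congr_deriv ?_
    rw [integral_const_mul]; rfl
  · rw [norm_mul, Complex.norm_I, one_mul]
    by_cases hy : y ∈ K
    · rw [Set.indicator_of_mem hy, norm_mul, norm_conjChr, one_mul]; exact hM _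
    · rw [hDx.eq_zero s hy, mul_zero, norm_zero, Set.indicator_of_notMem hy]
  · have h1 := ((hF.smooth.differentiable (by simp) (timeSpace s y)).hasFDerivAt).comp_hasDerivAt s
      (hasDerivAt_timeSpace s y)
    refine (h1.const_mul (conjChr k y)).congr_deriv ?_
    rw [_root_.Dx]
    linear_combination (conjChr k y * fderiv ℝ F (timeSpace s y) (EuclideanSpace.single 0 1)) *
      Complex.I_mul_I

lemma BoxFun.freq_pow_mul_boxCoeff (hF : BoxFun F) (j : Fin n) (p : ℕ) (t : ℝ) (k : Fin n → ℤ) :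
    (freq (k j) : ℂ) ^ p * boxCoeff F t k = boxCoeff ((_root_.Dx j.succ)^[p] F) t k := by
  induction p with
  | zero => simp
  | succ p ih =>
    rw [Function.iterate_succ_apply', (hF.Dx_iterate _ _).boxCoeff_Dx_succ, ← ih]; ring

/-- Fourier inversion: the function is the sum of its Fourier series in the cube. -/
lemma BoxFun.fourierSum_boxCoeff (hF : BoxFun F) (x : Euc (n + 1))
    (hs : Summable fun k => ‖boxCoeff F (x 0) k‖) (hx : ∀ j : Fin n, |x j.succ| ≤ 1 / 4) :
    fourierSum (boxCoeff F (x 0)) x = F x := by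
  set t := x 0 with ht
  have hfact : Fact (0 < (1 : ℝ)) := ⟨one_pos⟩
  let rep : UnitAddCircle → ℝ := fun z => AddCircle.equivIoc 1 (-(1 / 2)) z
  have hrep : ∀ z : UnitAddCircle, ((rep z : ℝ) : UnitAddCircle) = z := fun z =>
    AddCircle.coe_equivIoc (p := (1 : ℝ)) (a := -(1 / 2))
  have hrepm : ∀ z, rep z ∈ Set.Ioc (-(1 / 2) : ℝ) (-(1 / 2) + 1) := fun z =>
    (AddCircle.equivIoc 1 (-(1 / 2)) z).2
  have hrep_coe : ∀ y ∈ Set.Ioc (-(1 / 2) : ℝ) (-(1 / 2) + 1), rep (y : UnitAddCircle) = y :=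
    fun y hy => AddCircle.equivIoc_coe_of_mem hy
  have hrepn : ∀ z, |rep z| = ‖z‖ := fun z => by
    conv_rhs => rw [← hrep z]
    refine ((AddCircle.norm_coe_eq_abs_iff (1 : ℝ) one_ne_zero).2 ?_).symm
    have := hrepm z
    rw [abs_one, abs_le]
    constructor <;> linarith [this.1, this.2]
  have hcj : ∀ j, Continuous fun z : UnitAddTorus (Fin n) => z j := fun j => continuous_apply j
  -- the periodic extension
  let f : C(UnitAddTorus (Fin n), ℂ) :=
    { toFun := fun z => F (timeSpace t fun j => rep (z j))
      continuous_toFun := by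
        rw [continuous_iff_continuousAt]
        intro z
        by_cases hz : ∃ j, z j = ((-(1 / 2) : ℝ) : UnitAddCircle)
        · obtain ⟨j, hj⟩ := hz
          have hzj : 1 / 4 < ‖z j‖ := by
            rw [hj, (AddCircle.norm_coe_eq_abs_iff (1 : ℝ) one_ne_zero).2 (by norm_num [abs_of_pos])]
            norm_num [abs_of_pos]
          have : (fun z : UnitAddTorus (Fin n) => F (timeSpace t fun j => rep (z j)))
              =ᶠ[𝓝 z] fun _ => 0 := by
            filter_upwards [(isOpen_lt continuous_const (hcj j).norm).mem_nhds hzj]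
              with w hw
            refine hF.supp _ j.succ ?_
            rw [timeSpace_succ, hrepn]
            exact hw
          exact continuousAt_const.congr this.symm
        · push Not at hz
          refine (hF.smooth.continuous.comp (continuous_timeSpace t)).continuousAt.comp ?_
          refine tendsto_pi_nhds.2 fun j => ?_
          have := AddCircle.continuousAt_equivIoc (1 : ℝ) (-(1 / 2)) (hz j)
          exact (continuous_subtype_val.continuousAt.comp this).comp_of_eq (hcj j).continuousAt rfl }
  have hfour : ∀ (k : Fin n → ℤ) (y : Fin n → ℝ),
      UnitAddTorus.mFourier (-k) (fun i => (y i : UnitAddCircle)) = conjChr k y := fun k y => by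
    rw [UnitAddTorus.mFourier, ContinuousMap.coe_mk, conjChr]
    simp only [fourier_coe_apply]
    rw [← Complex.exp_sum]
    congr 1
    push_cast
    rw [Finset.mul_sum, ← Finset.sum_neg_distrib]
    refine Finset.sum_congr rfl fun i _ => ?_
    simp only [freq, Pi.neg_apply]
    push_cast
    ring
  have hfour' : ∀ (k : Fin n → ℤ),
      UnitAddTorus.mFourier k (fun i => (x i.succ : UnitAddCircle)) = chr k x := fun k => by
    rw [UnitAddTorus.mFourier, ContinuousMap.coe_mk, chr, phase]
    simp only [fourier_coe_apply]
    rw [← Complex.exp_sum]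
    congr 1
    push_cast
    rw [Finset.mul_sum]
    refine Finset.sum_congr rfl fun i _ => ?_
    simp only [freq]
    push_cast
    ring
  have hcoef : ∀ k, UnitAddTorus.mFourierCoeff f k = boxCoeff F t k := fun k => by
    rw [UnitAddTorus.mFourierCoeff_eq_integral f k (fun _ => -(1 / 2))]
    have hcongr : ∀ y ∈ {y : Fin n → ℝ | ∀ i, y i ∈ Set.Ioc (-(1 / 2) : ℝ) (-(1 / 2) + 1)},
        UnitAddTorus.mFourier (-k) (fun i => (y i : UnitAddCircle)) • f (fun i => (y i : UnitAddCircle))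
          = conjChr k y * F (timeSpace t y) := fun y hy => by
      rw [hfour, smul_eq_mul]
      congr 1
      change F (timeSpace t fun j => rep (y j)) = _
      rw [funext fun j => hrep_coe (y j) (hy j)]
    have hmeas : MeasurableSet {y : Fin n → ℝ | ∀ i, y i ∈ Set.Ioc (-(1 / 2) : ℝ) (-(1 / 2) + 1)} := by
      have : {y : Fin n → ℝ | ∀ i, y i ∈ Set.Ioc (-(1 / 2) : ℝ) (-(1 / 2) + 1)}
          = Set.pi Set.univ fun _ => Set.Ioc (-(1 / 2) : ℝ) (-(1 / 2) + 1) := by ext; simp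
      rw [this]
      exact MeasurableSet.univ_pi fun _ => measurableSet_Ioc
    rw [setIntegral_congr_fun hmeas hcongr]
    refine setIntegral_eq_integral_of_forall_compl_eq_zero fun y hy => ?_
    rw [hF.eq_zero t, mul_zero]
    intro hmem
    refine hy fun i => ⟨?_, ?_⟩
    · have := hmem.1 i; simp only at this; linarith
    · have := hmem.2 i; simp only at this; linarith
  have hsum : Summable (UnitAddTorus.mFourierCoeff f) := by
    rw [funext hcoef]; exact hs.of_norm
  have key := UnitAddTorus.hasSum_mFourier_series_apply_of_summable hsum
    (fun i => (x i.succ : UnitAddCircle))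
  have hfx : f (fun i => (x i.succ : UnitAddCircle)) = F x := by
    change F (timeSpace t fun j => rep (x j.succ)) = _
    have : (fun j : Fin n => rep (x j.succ)) = fun j => x j.succ := funext fun j =>
      hrep_coe _ ⟨by linarith [(abs_le.1 (hx j)).1], by linarith [(abs_le.1 (hx j)).2]⟩
    rw [this]
    congr 1
    ext i
    refine Fin.cases ?_ (fun j => ?_) i <;> simp [timeSpace, ht]
  rw [hfx] at key
  rw [fourierSum, ← key.tsum_eq]
  refine tsum_congr fun k => ?_
  rw [hcoef, hfour', smul_eq_mul]

end Coeff

end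

/-! ### Decay of the Fourier coefficients of Gevrey functions -/

noncomputable section
open Filter Topology MeasureTheory

/-- Gevrey bounds of order two for all powers amount to a decay `exp (-√(z / H))`. -/
lemma le_exp_neg_sqrt_of_pow_le {z Y M H : ℝ} (hz : 0 ≤ z) (hY : 0 ≤ Y) (hM : 0 ≤ M) (hH : 0 < H)
    (h : ∀ p : ℕ, z ^ p * Y ≤ M * H ^ p * (p ! : ℝ) ^ 2) :
    Y ≤ 4 * M * Real.exp (-(Real.sqrt z / Real.sqrt H)) := by
  set s := Real.sqrt z / Real.sqrt H with hs
  have hs0 : 0 ≤ s := by positivity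
  have hs2 : s ^ 2 = z / H := by rw [hs, div_pow, Real.sq_sqrt hz, Real.sq_sqrt hH.le]
  have hterm : ∀ p : ℕ, Real.sqrt Y * ((s / 2) ^ p / p !) ≤ Real.sqrt M * (1 / 2) ^ p := by
    intro p
    have hp : (0 : ℝ) < p ! := by positivity
    have h1 : Real.sqrt Y * (s ^ p / p !) ≤ Real.sqrt M := by
      apply le_of_sq_le_sq _ (Real.sqrt_nonneg _)
      rw [mul_pow, Real.sq_sqrt hY, Real.sq_sqrt hM, div_pow, ← pow_mul, mul_comm p 2, pow_mul, hs2,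
        div_pow, ← mul_div_assoc, div_le_iff₀ (by positivity), ← mul_div_assoc,
        div_le_iff₀ (by positivity)]
      linarith [h p]
    calc _ = Real.sqrt Y * (s ^ p / p !) * (1 / 2) ^ p := by
          rw [show s / 2 = s * (1 / 2) by ring, mul_pow]; ring
      _ ≤ _ := by gcongr
  have hexp : HasSum (fun p : ℕ => Real.sqrt Y * ((s / 2) ^ p / p !)) (Real.sqrt Y * Real.exp (s / 2)) := by
    have := NormedSpace.expSeries_div_hasSum_exp (s / 2)
    rw [← Real.exp_eq_exp_ℝ] at this
    exact this.mul_left _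
  have hgeo : HasSum (fun p : ℕ => Real.sqrt M * (1 / 2 : ℝ) ^ p) (Real.sqrt M * 2) :=
    hasSum_geometric_two.mul_left _
  have hle : Real.sqrt Y * Real.exp (s / 2) ≤ Real.sqrt M * 2 := hasSum_le hterm hexp hgeo
  have hsq : Y * Real.exp s ≤ 4 * M := by
    have h2 : (Real.sqrt Y * Real.exp (s / 2)) ^ 2 ≤ (Real.sqrt M * 2) ^ 2 := by gcongr
    rw [mul_pow, mul_pow, Real.sq_sqrt hY, Real.sq_sqrt hM, ← Real.exp_nat_mul] at h2
    have e : ((2 : ℕ) : ℝ) * (s / 2) = s := by push_cast; ring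
    rw [e] at h2
    linarith
  rw [Real.exp_neg, ← div_eq_mul_inv, le_div_iff₀ (Real.exp_pos _)]
  exact hsq

lemma factorial_add_sq_le (p i : ℕ) :
    ((p + i)! : ℝ) ^ 2 ≤ 4 ^ (p + i) * (p ! : ℝ) ^ 2 * (i ! : ℝ) ^ 2 := by
  have h : ((p + i)! : ℝ) ≤ 2 ^ (p + i) * (p ! * i !) := by
    have h1 := Nat.add_choose_mul_factorial_mul_factorial p i
    have h2 : (p + i).choose i ≤ 2 ^ (p + i) := Nat.choose_le_two_pow _ _
    have h3 : (p + i)! ≤ 2 ^ (p + i) * (p ! * i !) := by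
      rw [← h1, mul_assoc]
      exact Nat.mul_le_mul_right _ h2
    exact_mod_cast h3
  calc ((p + i)! : ℝ) ^ 2 ≤ (2 ^ (p + i) * (p ! * i !)) ^ 2 := by gcongr
    _ = _ := by rw [mul_pow, ← pow_mul, mul_comm (p + i) 2, pow_mul]; norm_num; ring

lemma abs_le_abs_freq (k : ℤ) : |(k : ℝ)| ≤ |freq k| := by
  rw [abs_freq]
  exact le_mul_of_one_le_left (abs_nonneg _) (by linarith [Real.pi_gt_three])

/-- The Fourier coefficients of a Gevrey function of order two decay like `exp (-κ √|k|)`. -/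
lemma BoxFun.norm_boxCoeff_le_exp {n : ℕ} (hn : 0 < n) {F : Euc (n + 1) → ℂ} (hF : BoxFun F)
    {A h : ℝ} (hh : 0 < h) (hG : OpGevrey A h Set.univ F) (i : ℕ) (t : ℝ) (k : Fin n → ℤ) :
    ‖boxCoeff ((_root_.Dx 0)^[i] F) t k‖ ≤ ((4 * h) ^ i * (i ! : ℝ) ^ 2) * (4 * A)
      * Real.exp (-(Real.sqrt ‖k‖ / Real.sqrt (4 * h))) := by
  have hA : 0 ≤ A := hG.nonneg Set.univ_nonempty
  have : Nonempty (Fin n) := ⟨⟨0, hn⟩⟩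
  obtain ⟨j, hj⟩ := Finite.exists_max fun j => ‖k j‖
  have hk : ‖k‖ ≤ |((k j : ℤ) : ℝ)| := by
    rw [← Int.norm_eq_abs]
    exact (pi_norm_le_iff_of_nonneg (norm_nonneg _)).2 hj
  have hFi := hF.Dx_iterate 0 i
  refine (le_exp_neg_sqrt_of_pow_le (norm_nonneg k) (norm_nonneg _)
    (M := A * ((4 * h) ^ i * (i ! : ℝ) ^ 2)) (by positivity) (by positivity : 0 < 4 * h)
    fun p => ?_).trans_eq (by ring)
  have h1 : ‖k‖ ^ p ≤ |freq (k j)| ^ p :=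
    pow_le_pow_left₀ (norm_nonneg _) (hk.trans (abs_le_abs_freq _)) p
  have h2 : |freq (k j)| ^ p * ‖boxCoeff ((_root_.Dx 0)^[i] F) t k‖
      = ‖boxCoeff ((_root_.Dx j.succ)^[p] ((_root_.Dx 0)^[i] F)) t k‖ := by
    rw [← hFi.freq_pow_mul_boxCoeff, norm_mul, norm_pow, Complex.norm_real, Real.norm_eq_abs]
  calc ‖k‖ ^ p * ‖boxCoeff ((_root_.Dx 0)^[i] F) t k‖
      ≤ |freq (k j)| ^ p * ‖boxCoeff ((_root_.Dx 0)^[i] F) t k‖ := by gcongr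
    _ ≤ A * h ^ (p + i) * ((p + i)! : ℝ) ^ 2 := by
        rw [h2]
        refine (hFi.Dx_iterate j.succ p).norm_boxCoeff_le (fun x => ?_) t k
        have e1 := norm_iteratedFDeriv_Dx_iterate_le hFi j.succ p 0 x
        have e2 := norm_iteratedFDeriv_Dx_iterate_le hF 0 i (0 + p) x
        rw [norm_iteratedFDeriv_zero] at e1
        refine (e1.trans e2).trans ?_
        rw [zero_add]
        exact hG x trivial (p + i)
    _ ≤ A * h ^ (p + i) * (4 ^ (p + i) * (p ! : ℝ) ^ 2 * (i ! : ℝ) ^ 2) := by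
        gcongr; exact factorial_add_sq_le p i
    _ = _ := by rw [mul_pow, mul_pow, pow_add, pow_add]; ring

lemma BoxFun.summable_boxCoeff_weight {F : Euc 2 → ℂ} (hF : BoxFun F) (t : ℝ) (i : ℕ) :
    Summable fun j : ℤ => ‖boxCoeff F t (fun _ : Fin 1 => j)‖ * |freq j| ^ i := by
  have hb : ∀ p : ℕ, ∃ M, ∀ j : ℤ, |freq j| ^ p * ‖boxCoeff F t (fun _ : Fin 1 => j)‖ ≤ M := fun p => by
    obtain ⟨M, hM⟩ := (hF.Dx_iterate (Fin.succ 0) p).bounded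
    refine ⟨M, fun j => ?_⟩
    have := (hF.Dx_iterate (Fin.succ 0) p).norm_boxCoeff_le hM t (fun _ => j)
    rwa [← hF.freq_pow_mul_boxCoeff, norm_mul, norm_pow, Complex.norm_real, Real.norm_eq_abs] at this
  obtain ⟨M0, h0⟩ := hb i
  obtain ⟨M2, h2⟩ := hb (i + 2)
  refine ((summable_one_add_abs_sq.mul_left (2 * (M0 + M2)))).of_nonneg_of_le
    (fun _ => by positivity) fun j => ?_
  have hj := abs_le_abs_freq j
  have hj0 := abs_nonneg (j : ℝ)
  rw [div_pow, one_pow, mul_one_div, le_div_iff₀ (by positivity)]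
  set Y := ‖boxCoeff F t (fun _ : Fin 1 => j)‖ with hY
  have e : (1 + |(j : ℝ)|) ^ 2 ≤ 2 * (1 + |freq j| ^ 2) := by nlinarith [sq_nonneg (1 - |(j : ℝ)|)]
  calc Y * |freq j| ^ i * (1 + |(j : ℝ)|) ^ 2 ≤ Y * |freq j| ^ i * (2 * (1 + |freq j| ^ 2)) := by
        gcongr
    _ = 2 * (|freq j| ^ i * Y + |freq j| ^ (i + 2) * Y) := by ring
    _ ≤ _ := by gcongr; exacts [h0 j, h2 j]

lemma boxCoeff_neg_of_real {F : Euc 2 → ℂ} (hreal : ∀ x, (starRingEnd ℂ) (F x) = F x) (t : ℝ)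
    (k : Fin 1 → ℤ) : boxCoeff F t (-k) = (starRingEnd ℂ) (boxCoeff F t k) := by
  rw [boxCoeff, boxCoeff, ← integral_conj]
  refine integral_congr_ae (Eventually.of_forall fun y => ?_)
  simp only
  rw [map_mul, hreal, conjChr, conjChr, ← Complex.exp_conj]
  have e : ∑ j, freq ((-k) j) * y j = -∑ j, freq (k j) * y j := by simp [freq]
  rw [e, map_neg, map_mul, Complex.conj_I, Complex.conj_ofReal, Complex.ofReal_neg]
  congr 2
  ring

/-- The Fourier coefficients of a real smooth periodic function that is equal to the coordinate
near the origin. -/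
theorem exists_smoothCoeff : ∃ a : ℤ → ℂ, SmoothCoeff a ∧
    ∀ y : ℝ, |y| ≤ 1 / 8 → periodicFun a y = y := by
  obtain ⟨θ, -, -, -, -, hθ, -, h1, h0⟩ := exists_gevrey_bump
  -- the one dimensional function `y θ(4 y)`, with a factor `θ(4 t)` since `BoxFun` asks for compact
  -- support in time
  set F : Euc 2 → ℂ := fun x => ((x 1 * (θ (4 * x 0) * θ (4 * x 1)) : ℝ) : ℂ) with hFdef
  have hco : ∀ i : Fin 2, ContDiff ℝ ∞ fun x : Euc 2 => x i := fun i =>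
    (EuclideanSpace.proj (𝕜 := ℝ) i).contDiff
  have hF : BoxFun F := by
    refine ⟨Complex.ofRealCLM.contDiff.comp ((hco 1).mul ((hθ.comp (contDiff_const.mul (hco 0))).mul
      (hθ.comp (contDiff_const.mul (hco 1))))), fun x i hx => ?_⟩
    have hz : θ (4 * x i) = 0 := h0 _ (by rw [abs_mul, abs_of_pos (by norm_num : (0 : ℝ) < 4)]; linarith)
    rw [hFdef]
    fin_cases i
    · simp only [Fin.zero_eta] at hz; simp [hz]
    · simp only [Fin.mk_one] at hz; simp [hz]
  refine ⟨fun j => boxCoeff F 0 (fun _ : Fin 1 => j), ⟨hF.summable_boxCoeff_weight 0, fun j =>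
    boxCoeff_neg_of_real (fun x => Complex.conj_ofReal _) 0 (fun _ => j)⟩, fun y hy => ?_⟩
  let e := (Equiv.funUnique (Fin 1) ℤ).symm
  have he : ∀ j, e j = fun _ => j := fun j => rfl
  have hs : Summable fun k => ‖boxCoeff F 0 k‖ := by
    rw [← e.summable_iff]
    exact (hF.summable_boxCoeff_weight 0 0).congr fun j => by simp [he]
  have key := hF.fourierSum_boxCoeff (timeSpace 0 fun _ => y) hs
    (fun j => by rw [timeSpace_succ]; linarith)
  rw [timeSpace_zero] at key
  have hFy : F (timeSpace 0 fun _ => y) = y := by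
    have e1 : timeSpace (n := 1) 0 (fun _ => y) 1 = y := rfl
    rw [hFdef]
    simp only [timeSpace_zero, e1]
    rw [h1 (4 * 0) (by norm_num), h1 (4 * y) (by
      rw [abs_mul, abs_of_pos (by norm_num : (0 : ℝ) < 4)]; linarith)]
    simp
  rw [hFy] at key
  rw [← key, periodicFun, fourierSum, ← e.tsum_eq]
  refine tsum_congr fun j => ?_
  rw [he, chr, phase]
  simp [timeSpace_succ]

end

/-! ### Existence and bounds for Gevrey data -/

noncomputable section
open Filter Topology MeasureTheory

/-- The operator norm of an `m`-linear form is bounded by its values on the standard basis. -/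
lemma norm_le_of_basis {d m : ℕ} (T : ContinuousMultilinearMap ℝ (fun _ : Fin m => Euc d) ℂ) {M : ℝ}
    (hM0 : 0 ≤ M) (hM : ∀ j : Fin m → Fin d, ‖T (fun i => EuclideanSpace.single (j i) 1)‖ ≤ M) :
    ‖T‖ ≤ (d : ℝ) ^ m * M := by
  refine T.opNorm_le_bound (by positivity) fun v => ?_
  have hv : v = fun i => ∑ l, v i l • (EuclideanSpace.single l 1 : Euc d) := by
    funext i
    ext q
    simp [Pi.single_apply]
  have e : T v = ∑ r : Fin m → Fin d, (∏ i, v i (r i)) • T (fun i => EuclideanSpace.single (r i) 1) := by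
    conv_lhs => rw [hv]
    rw [T.map_sum]
    exact Finset.sum_congr rfl fun r _ => T.map_smul_univ _ _
  rw [e]
  refine (norm_sum_le _ _).trans ((Finset.sum_le_sum (g := fun _ => (∏ i, ‖v i‖) * M) fun r _ => ?_).trans_eq ?_)
  · rw [norm_smul, norm_prod]
    gcongr with i
    · exact PiLp.norm_apply_le (v i) (r i)
    · exact hM r
  · rw [Finset.sum_const, Finset.card_univ, Fintype.card_fun, Fintype.card_fin, Fintype.card_fin,
      nsmul_eq_mul]
    push_cast; ring

/-- The Gevrey inequality for partial derivatives implies that for operator norms, with `h` replaced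
by `d h`. -/
lemma GevreyBound.opGevrey {d : ℕ} {C h : ℝ} {K : Set (Euc d)} {f : Euc d → ℂ} (hC : 0 ≤ C)
    (hh : 0 ≤ h) (hf : GevreyBound 2 C h K f) : OpGevrey C (d * h) K f := fun x hx m => by
  refine (norm_le_of_basis _ (by positivity) fun j => hf x hx m j).trans_eq ?_
  rw [Real.rpow_two]; ring

lemma OpGevrey.mono {E F : Type*} [NormedAddCommGroup E] [NormedSpace ℝ E] [NormedAddCommGroup F]
    [NormedSpace ℝ F] {A h h' : ℝ} {K K' : Set E} {f : E → F} (hf : OpGevrey A h K f) (hA : 0 ≤ A)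
    (hh : 0 ≤ h) (hle : h ≤ h') (hK : K' ⊆ K) : OpGevrey A h' K' f := fun x hx m =>
  (hf x (hK hx) m).trans (by gcongr)

/-- The projection onto the space variables. -/
def spaceCLM (n : ℕ) : Euc (n + 1) →L[ℝ] Euc n :=
  LinearMap.mkContinuous
    { toFun := spacePart
      map_add' := fun x y => by ext i; simp [spacePart]
      map_smul' := fun c x => by ext i; simp [spacePart] } 1 fun x => by
    rw [one_mul]
    apply le_of_sq_le_sq _ (norm_nonneg _)
    rw [EuclideanSpace.norm_sq_eq, EuclideanSpace.norm_sq_eq, Fin.sum_univ_succ]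
    exact le_add_of_nonneg_left (sq_nonneg _)

lemma spaceCLM_apply {n : ℕ} (x : Euc (n + 1)) : spaceCLM n x = spacePart x := rfl

lemma norm_spaceCLM_le (n : ℕ) : ‖spaceCLM n‖ ≤ 1 := LinearMap.mkContinuous_norm_le _ zero_le_one _

/-- A Gevrey cutoff with support in the ball of radius `r` and in the cube `|x_i| ≤ 1 / 4`. -/
lemma exists_gevrey_cutoff (d : ℕ) {r : ℝ} (hr : 0 < r) : ∃ (X : Euc d → ℝ) (A h ρ : ℝ), 0 ≤ A ∧ 0 ≤ h ∧
    0 < ρ ∧ ContDiff ℝ ∞ X ∧ OpGevrey A h Set.univ X ∧ tsupport X ⊆ Metric.closedBall 0 r ∧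
    (∀ x i, 1 / 4 < |x i| → X x = 0) ∧ ∀ x, (∀ i, |x i| ≤ ρ) → X x = 1 := by
  obtain ⟨θ, A, h, hA, hh, hθ, hG, h1, h0⟩ := exists_gevrey_bump
  set R := min (1 / 4) (r / (d + 1)) with hR
  have hR0 : 0 < R := by positivity
  let L : Fin d → Euc d →L[ℝ] ℝ := fun i => R⁻¹ • EuclideanSpace.proj i
  have hL : ∀ i x, L i x = R⁻¹ * x i := fun i x => rfl
  have hprod : ∀ s : Finset (Fin d), ∃ A h : ℝ, 0 ≤ A ∧ 0 ≤ h ∧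
      ContDiff ℝ ∞ (fun x => ∏ i ∈ s, θ (L i x)) ∧
      OpGevrey A h Set.univ (fun x => ∏ i ∈ s, θ (L i x)) := by
    intro s
    induction s using Finset.induction_on with
    | empty =>
      refine ⟨1, 0, zero_le_one, le_rfl, by simpa using contDiff_const, fun x _ m => ?_⟩
      simp only [Finset.prod_empty]
      rcases m with _ | m
      · simp
      · rw [iteratedFDeriv_const_of_ne (Nat.succ_ne_zero m)]; simp
    | insert j s hj ih =>
      obtain ⟨A', h', hA', hh', hc', hG'⟩ := ih
      have hc : ContDiff ℝ ∞ (θ ∘ L j) := hθ.comp (L j).contDiff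
      have hGj : OpGevrey A (‖L j‖ * h) Set.univ (θ ∘ L j) := hG.comp_clm hA hh hθ (L j) le_rfl
      refine ⟨A * A', 2 * max (‖L j‖ * h) h', by positivity, by positivity, ?_, ?_⟩
      · simp only [Finset.prod_insert hj]
        exact hc.mul hc'
      · simp only [Finset.prod_insert hj]
        exact hGj.smul (by positivity) hh' hA hA' hG' (Set.subset_univ _) hc hc'
  obtain ⟨A', h', hA', hh', hc', hG'⟩ := hprod Finset.univ
  have hz : ∀ x : Euc d, ∀ i, R ≤ |x i| → ∏ i, θ (L i x) = 0 := fun x i hx => by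
    refine Finset.prod_eq_zero (Finset.mem_univ i) (h0 _ ?_)
    rw [hL, abs_mul, abs_of_pos (inv_pos.2 hR0), ← div_eq_inv_mul, le_div_iff₀ hR0, one_mul]
    exact hx
  refine ⟨fun x => ∏ i, θ (L i x), A', h', R / 2, hA', hh', half_pos hR0, hc', hG', ?_, ?_, ?_⟩
  · refine closure_minimal (fun x hx => ?_) Metric.isClosed_closedBall
    have hxi : ∀ i, |x i| ≤ R := fun i => by
      by_contra hi
      exact hx (hz x i (not_le.1 hi).le)
    rw [mem_closedBall_zero_iff]
    have h2 : ‖x‖ ^ 2 ≤ ((d + 1) * R) ^ 2 := by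
      rw [EuclideanSpace.norm_sq_eq]
      calc ∑ i, ‖x i‖ ^ 2 ≤ ∑ _i : Fin d, R ^ 2 := Finset.sum_le_sum fun i _ => by
            have := hxi i
            rw [Real.norm_eq_abs]
            exact pow_le_pow_left₀ (abs_nonneg _) this 2
        _ = d * R ^ 2 := by simp
        _ ≤ _ := by
          rw [mul_pow]
          have hd : (0 : ℝ) ≤ d := Nat.cast_nonneg d
          gcongr
          nlinarith
    have h3 : ‖x‖ ≤ (d + 1) * R := le_of_sq_le_sq h2 (by positivity)
    have h4 : R * (d + 1) ≤ r := (le_div_iff₀ (by positivity)).1 (min_le_right _ _)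
    linarith
  · exact fun x i hx => hz x i ((min_le_left _ _).trans hx.le)
  · intro x hx
    refine Finset.prod_eq_one fun i _ => h1 _ ?_
    rw [hL, abs_mul, abs_of_pos (inv_pos.2 hR0), ← div_eq_inv_mul, div_le_iff₀ hR0]
    linarith [hx i]

lemma summable_exp_neg_sqrt (n : ℕ) {c : ℝ} (hc : 0 < c) :
    Summable fun k : Fin n → ℤ => Real.exp (-(c * Real.sqrt ‖k‖)) := by
  refine ((summable_weight_pi n).mul_left (Real.exp c * ((4 * n)! / c ^ (4 * n)))).of_nonneg_of_le
    (fun _ => (Real.exp_pos _).le) fun k => ?_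
  rw [← div_eq_mul_inv, le_div_iff₀ (by positivity)]
  have hy := Real.sqrt_nonneg ‖k‖
  have hy2 := Real.sq_sqrt (norm_nonneg k)
  refine le_trans ?_ (one_add_pow_mul_exp_neg_le hc (4 * n) hy)
  rw [mul_comm]
  gcongr
  calc (1 + ‖k‖) ^ (2 * n) ≤ ((1 + Real.sqrt ‖k‖) ^ 2) ^ (2 * n) := by
        gcongr; nlinarith
    _ = _ := by rw [← pow_mul]; congr 1; ring

/-- Existence of a solution of the Cauchy problem, with bounds of all its derivatives by the Gevrey
constant of the data. -/
theorem exists_cauchy_solution {n : ℕ} (hn : 2 ≤ n) {b : ℝ} (hb : |b| ≤ 1)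
    (hb' : 3 * Real.sqrt 3 / 2 * |b| < 1) {ε₀ h r : ℝ} (hε₀ : 0 < ε₀) (hh : 0 < h) (hr : 0 < r) :
    ∃ δ > 0, δ < ε₀ ∧ ∃ A : ℕ → ℝ, ∀ (f : Euc (n + 1) → ℂ) (g : Fin 3 → Euc n → ℂ) (C : ℝ),
      ContDiff ℝ ∞ f → (∀ j, ContDiff ℝ ∞ (g j)) → DataBound 2 C h r f g →
      ∃ u, SolvesCauchy (modelOp n b) 3 (lens n δ) f g u ∧
        ∀ m, ∀ x ∈ lens n δ, ‖iteratedFDeriv ℝ m u x‖ ≤ A m * C := by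
  obtain ⟨X, AX, hX, ρ, hAX, hhX, hρ, hXc, hXG, hXs, hXb, hX1⟩ := exists_gevrey_cutoff (n + 1) hr
  obtain ⟨a, ha, hper⟩ := exists_smoothCoeff
  set j₁ : Fin n := ⟨0, by omega⟩ with hj₁
  set j₂ : Fin n := ⟨n - 1, by omega⟩ with hj₂
  have hj : j₂ ≠ j₁ := by simp [hj₁, hj₂, Fin.ext_iff]; omega
  have e1 : (1 : Fin (n + 1)) = j₁.succ := by
    ext
    simp [hj₁, Nat.mod_eq_of_lt (show 1 < n + 1 by omega)]
  have e2 : Fin.last n = j₂.succ := by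
    ext
    simp [hj₂]; omega
  -- the Gevrey constant of the cut off data
  set h' := 2 * max hX (((n + 1 : ℕ) : ℝ) * h) with hh'
  have hh'0 : 0 < h' := by positivity
  -- chosen such that `√z / √(4 h') = 2 κ √z`
  set κ := 1 / (2 * Real.sqrt (4 * h')) with hκ
  have hκ0 : 0 < κ := by positivity
  have hκ2 : ∀ z, Real.sqrt z / Real.sqrt (4 * h') = 2 * κ * Real.sqrt z := fun z => by
    rw [hκ]; field_simp
  obtain ⟨T, hT, -, hsol⟩ := exists_coeff_solution hj ha hb hb' hκ0
  obtain ⟨B, hsol⟩ := hsol fun i => (4 * h') ^ i * (i ! : ℝ) ^ 2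
  choose A hA using fun m => exists_iteratedFDeriv_fourierSum_le n m B
  -- in the lens of size `δ` the cutoff is `1` and, as `δ ≤ 1 / 64`, the coordinates are at most
  -- `1 / 8`, where the periodic coefficient is the coordinate
  set δ := min (ε₀ / 2) (min T (min (1 / 64) (min ρ (ρ ^ 2)))) with hδ
  have hδ0 : 0 < δ := by positivity
  have d1 : δ ≤ ε₀ / 2 := min_le_left _ _
  have d2 : δ ≤ T := (min_le_right _ _).trans (min_le_left _ _)
  have d3 : δ ≤ 1 / 64 := (min_le_right _ _).trans ((min_le_right _ _).trans (min_le_left _ _))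
  have d4 : δ ≤ ρ := (min_le_right _ _).trans
    ((min_le_right _ _).trans ((min_le_right _ _).trans (min_le_left _ _)))
  have d5 : δ ≤ ρ ^ 2 := (min_le_right _ _).trans
    ((min_le_right _ _).trans ((min_le_right _ _).trans (min_le_right _ _)))
  have hlens : ∀ x ∈ lens n δ, |x 0| < δ ∧ ∀ j : Fin n, |x j.succ| ^ 2 < δ := by
    intro x hx
    have hx' : ‖spacePart x‖ ^ 2 + |x 0| < δ := hx
    refine ⟨by nlinarith [sq_nonneg ‖spacePart x‖], fun j => ?_⟩
    have : |x j.succ| ≤ ‖spacePart x‖ := by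
      have := PiLp.norm_apply_le (spacePart x) j
      rwa [Real.norm_eq_abs] at this
    nlinarith [abs_nonneg (x 0), abs_nonneg (x j.succ), norm_nonneg (spacePart x)]
  refine ⟨δ, hδ0, by linarith, fun m => A m * (4 * AX), fun f g C hf hg hdata => ?_⟩
  have hC : 0 ≤ C := by
    have := (norm_nonneg _).trans (hdata.1 0 (Metric.mem_closedBall_self hr.le) 0 Fin.elim0)
    simpa using this
  have hd0 : (0 : ℝ) ≤ ((n + 1 : ℕ) : ℝ) * h := by positivity
  have hcut : ∀ F : Euc (n + 1) → ℂ, ContDiff ℝ ∞ F →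
      OpGevrey C (((n + 1 : ℕ) : ℝ) * h) (Metric.closedBall 0 r) F →
      BoxFun (fun x => X x • F x) ∧ OpGevrey (AX * C) h' Set.univ (fun x => X x • F x) :=
    fun F hFc hFG => ⟨⟨hXc.smul hFc, fun x i hx => by rw [hXb x i hx, zero_smul]⟩,
      hXG.smul hhX hd0 hAX hC hFG hXs hXc hFc⟩
  obtain ⟨hF, hFG⟩ := hcut f hf (hdata.1.opGevrey hC hh.le)
  have hgc : ∀ j, ContDiff ℝ ∞ (g j ∘ spaceCLM n) := fun j => (hg j).comp (spaceCLM n).contDiff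
  have hgG : ∀ j, OpGevrey C (((n + 1 : ℕ) : ℝ) * h) (Metric.closedBall 0 r) (g j ∘ spaceCLM n) := by
    intro j
    have h1 := ((hdata.2 j).opGevrey hC hh.le).comp_clm hC (by positivity) (hg j) (spaceCLM n)
      (norm_spaceCLM_le n)
    refine h1.mono hC (by positivity) ?_ fun x hx => ?_
    · rw [one_mul]; push_cast; nlinarith
    · rw [mem_closedBall_zero_iff] at hx
      rw [Set.mem_preimage, mem_closedBall_zero_iff]
      exact ((spaceCLM n).le_of_opNorm_le (norm_spaceCLM_le n) x).trans (by rwa [one_mul])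
  choose hGb hGG using fun j => hcut (g j ∘ spaceCLM n) (hgc j) (hgG j)
  set F : Euc (n + 1) → ℂ := fun x => X x • f x with hFdef
  set G : Fin 3 → Euc (n + 1) → ℂ := fun j x => X x • (g j ∘ spaceCLM n) x with hGdef
  have hn0 : 0 < n := by omega
  have hbd : ∀ {F : Euc (n + 1) → ℂ}, BoxFun F → OpGevrey (AX * C) h' Set.univ F → ∀ t k,
      ‖boxCoeff F t k‖ ≤ 4 * (AX * C) * Real.exp (-(2 * κ * Real.sqrt ‖k‖)) := by
    intro F hF hFG t k
    have := hF.norm_boxCoeff_le_exp hn0 hh'0 hFG 0 t k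
    rw [hκ2] at this
    simpa using this
  have hsum : ∀ {F : Euc (n + 1) → ℂ}, BoxFun F → OpGevrey (AX * C) h' Set.univ F → ∀ t,
      Summable fun k => ‖boxCoeff F t k‖ := fun hF hFG t =>
    ((summable_exp_neg_sqrt n (c := 2 * κ) (by positivity)).mul_left _).of_nonneg_of_le
      (fun _ => norm_nonneg _) (hbd hF hFG t)
  obtain ⟨c, hc, c0, c1, c2, hc3⟩ := hsol (4 * (AX * C)) (boxCoeff (G 0) 0) (boxCoeff (G 1) 0)
    (boxCoeff (G 2) 0) (fun i t => boxCoeff ((Dx 0)^[i] F) t) (by positivity)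
    (hbd (hGb 0) (hGG 0) 0) (hbd (hGb 1) (hGG 1) 0) (hbd (hGb 2) (hGG 2) 0)
    (fun i t k => by
      have := hF.norm_boxCoeff_le_exp hn0 hh'0 hFG i t k
      rwa [hκ2] at this)
    (fun i t k => by
      have := (hF.Dx_iterate 0 i).hasDerivAt_boxCoeff k t
      rwa [Function.iterate_succ_apply'])
  have hslab : ∀ x ∈ lens n δ, x ∈ slab n T := fun x hx =>
    ⟨by linarith [(abs_lt.1 (hlens x hx).1).1], by linarith [(abs_lt.1 (hlens x hx).1).2]⟩
  have hx8 : ∀ x ∈ lens n δ, ∀ j : Fin n, |x j.succ| ≤ 1 / 8 := fun x hx j =>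
    le_of_sq_le_sq (by linarith [(hlens x hx).2 j]) (by norm_num)
  have hxX : ∀ x ∈ lens n δ, X x = 1 := fun x hx => hX1 x fun i =>
    Fin.cases ((hlens x hx).1.le.trans d4)
      (fun j => le_of_sq_le_sq (by linarith [(hlens x hx).2 j]) hρ.le) i
  refine ⟨familySum c, ⟨?_, fun x hx => ?_, fun x hx hx0 j => ?_⟩, fun m x hx => ?_⟩
  · exact contDiffOn_infty.2 fun m x hx => ((hA m T _ c hc x (hslab x hx)).1).contDiffWithinAt
  · rw [modelOp_familySum hj e1 e2 ha hc hc3 (hslab x hx) (hsum hF hFG _)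
      (hper _ (by rw [e1]; exact hx8 x hx j₁))]
    change fourierSum (boxCoeff F (x 0)) x = f x
    rw [hF.fourierSum_boxCoeff x (hsum hF hFG _) fun j => (hx8 x hx j).trans (by norm_num), hFdef]
    simp [hxX x hx]
  · rw [Dx_zero_iterate_familySum hc j (hslab x hx), hx0]
    have hcj : c j 0 = boxCoeff (G j) 0 := by
      fin_cases j
      exacts [c0, c1, c2]
    have hinv := (hGb j).fourierSum_boxCoeff x (hsum (hGb j) (hGG j) _)
      fun j => (hx8 x hx j).trans (by norm_num)
    rw [hx0] at hinv
    rw [hcj]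
    refine hinv.trans ?_
    simp [hxX x hx, spaceCLM_apply]
  · refine ((hA m T _ c hc x (hslab x hx)).2).trans_eq ?_
    ring

end

/-! ### A characteristic system on a light triangle -/

noncomputable section
open Filter Topology MeasureTheory

/-- A function that vanishes at `0` and whose derivative is of size `(m + 1)! / ρ ^ (m + 2)`, with
the shrinking radius `ρ = R - 2 t`, is of size `m! / ρ ^ (m + 1)`. -/
lemma norm_le_of_shrinking_radius {f f' : ℝ → ℂ} {τ R c : ℝ} {m : ℕ} (hc : 0 ≤ c) (hR : 2 * τ < R)
    (h0 : f 0 = 0) (hd : ∀ t ∈ Set.Icc 0 τ, HasDerivAt f (f' t) t)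
    (hb : ∀ t ∈ Set.Icc 0 τ, ‖f' t‖ ≤ c * ((m + 1)! : ℝ) / (R - 2 * t) ^ (m + 2)) :
    ∀ t ∈ Set.Icc 0 τ, ‖f t‖ ≤ c / 2 * (m ! : ℝ) / (R - 2 * t) ^ (m + 1) := by
  have hpos : ∀ t ∈ Set.Icc 0 τ, 0 < R - 2 * t := fun t ht => by linarith [ht.2]
  have hB : ∀ t ∈ Set.Icc 0 τ, HasDerivAt (fun t => c / 2 * (m ! : ℝ) / (R - 2 * t) ^ (m + 1))
      (c * ((m + 1)! : ℝ) / (R - 2 * t) ^ (m + 2)) t := fun t ht => by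
    have h1 : HasDerivAt (fun t : ℝ => R - 2 * t) (-2) t := by
      simpa using ((hasDerivAt_id t).const_mul (2 : ℝ)).const_sub R
    have h2 := (hasDerivAt_const t (c / 2 * (m ! : ℝ))).div (h1.pow (m + 1)) (pow_pos (hpos t ht) _).ne'
    refine h2.congr_deriv ?_
    have := (hpos t ht).ne'
    rw [Nat.factorial_succ]
    push_cast
    simp only [Pi.pow_apply]
    rw [div_eq_div_iff (pow_ne_zero _ (pow_ne_zero _ this)) (pow_ne_zero _ this)]
    ring
  intro t ht
  refine image_norm_le_of_norm_deriv_right_le_deriv_boundary' (f' := f') (a := 0) (b := τ)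
    (fun t ht => (hd t ht).continuousAt.continuousWithinAt)
    (fun t ht => (hd t ⟨ht.1, ht.2.le⟩).hasDerivWithinAt) ?_
    (fun t ht => (hB t ht).continuousAt.continuousWithinAt)
    (fun t ht => (hB t ⟨ht.1, ht.2.le⟩).hasDerivWithinAt) (fun t ht => hb t ⟨ht.1, ht.2.le⟩) ht
  rw [h0, norm_zero]
  have := hpos 0 ⟨le_rfl, ht.1.trans ht.2⟩
  positivity

/-- The backward light triangle with vertex `(s + τ, x₁)` and base on `t = s`. -/
def triangle (s τ x₁ : ℝ) : Set (ℝ × ℝ) := {z | s ≤ z.1 ∧ |z.2 - x₁| ≤ s + τ - z.1}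

/-- An infinite system on the backward light triangle with vertex `(s + τ, x₁)`, with vanishing
data at time `s`: `∂ₜ w_k = φ_k`, `∂ₜ φ_k = (p_k + q_k) / 2`, and
`(∂ₜ - ∂ₓ) p_k = (∂ₜ + ∂ₓ) q_k = x² φ_{k+2} + b x³ w_{k+3} + e_k`. -/
structure CharSystem (b s τ x₁ : ℝ) (w p f q e : ℕ → ℝ → ℝ → ℂ) : Prop where
  w0 : ∀ k x, |x - x₁| ≤ τ → w k s x = 0
  f0 : ∀ k x, |x - x₁| ≤ τ → f k s x = 0
  p0 : ∀ k x, |x - x₁| ≤ τ → p k s x = 0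
  q0 : ∀ k x, |x - x₁| ≤ τ → q k s x = 0
  dw : ∀ k t x, HasDerivAt (fun t => w k t x) (f k t x) t
  df : ∀ k t x, HasDerivAt (fun t => f k t x) ((p k t x + q k t x) / 2) t
  dp : ∀ k t x, (t, x) ∈ triangle s τ x₁ → HasDerivAt (fun t' => p k t' (x + t - t'))
    ((x : ℂ) ^ 2 * f (k + 2) t x + b * (x : ℂ) ^ 3 * w (k + 3) t x + e k t x) t
  dq : ∀ k t x, (t, x) ∈ triangle s τ x₁ → HasDerivAt (fun t' => q k t' (x - t + t'))
    ((x : ℂ) ^ 2 * f (k + 2) t x + b * (x : ℂ) ^ 3 * w (k + 3) t x + e k t x) t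

section
variable {b s τ x₁ R ε : ℝ} {w p f q e : ℕ → ℝ → ℝ → ℂ}

/-- The preceding estimate with base time `s`. -/
lemma norm_le_on_triangle {F F' : ℝ → ℂ} {c : ℝ} {m : ℕ} (hc : 0 ≤ c) (hR : 2 * τ < R)
    {t : ℝ} (ht : s ≤ t) (htτ : t ≤ s + τ) (h0 : F s = 0)
    (hd : ∀ t' ∈ Set.Icc s t, HasDerivAt F (F' t') t')
    (hb : ∀ t' ∈ Set.Icc s t, ‖F' t'‖ ≤ c * ((m + 1)! : ℝ) / (R - 2 * (t' - s)) ^ (m + 2)) :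
    ‖F t‖ ≤ c / 2 * (m ! : ℝ) / (R - 2 * (t - s)) ^ (m + 1) := by
  have key := norm_le_of_shrinking_radius (f := fun t' => F (s + t')) (f' := fun t' => F' (s + t'))
    (τ := t - s) (R := R) (m := m) hc (by linarith) (by simpa using h0)
    (fun t' ht' => HasDerivAt.comp_const_add s t' (hd (s + t') ⟨by linarith [ht'.1], by linarith [ht'.2]⟩))
    (fun t' ht' => by
      have := hb (s + t') ⟨by linarith [ht'.1], by linarith [ht'.2]⟩
      rwa [add_sub_cancel_left] at this) (t - s) ⟨by linarith, le_rfl⟩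
  simpa using key

/-- One round of integration along the characteristics improves the constant. -/
lemma CharSystem.improve (h : CharSystem b s τ x₁ w p f q e) (hτ : 0 < τ) (hR : R = 4 * τ) (hR1 : R ≤ 1)
    (hb : |b| ≤ 1) (hx : ∀ z ∈ triangle s τ x₁, |z.2| ≤ 1) (hε : 0 ≤ ε)
    (he : ∀ k, ∀ z ∈ triangle s τ x₁, ‖e k z.1 z.2‖ ≤ ε * (k ! : ℝ) / R ^ k)
    {μ : ℝ} (hμ : 0 ≤ μ) (hf : ∀ k, ∀ z ∈ triangle s τ x₁,
      ‖f k z.1 z.2‖ ≤ μ * (k ! : ℝ) / (R - 2 * (z.1 - s)) ^ (k + 1)) :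
    ∀ k, ∀ z ∈ triangle s τ x₁,
      ‖w (k + 1) z.1 z.2‖ ≤ μ / 2 * (k ! : ℝ) / (R - 2 * (z.1 - s)) ^ (k + 1) ∧
      ‖p k z.1 z.2‖ ≤ (2 * μ + ε) / 2 * ((k + 1)! : ℝ) / (R - 2 * (z.1 - s)) ^ (k + 2) ∧
      ‖q k z.1 z.2‖ ≤ (2 * μ + ε) / 2 * ((k + 1)! : ℝ) / (R - 2 * (z.1 - s)) ^ (k + 2) ∧
      ‖f k z.1 z.2‖ ≤ (μ / 2 + ε / 4) * (k ! : ℝ) / (R - 2 * (z.1 - s)) ^ (k + 1) := by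
  have hRτ : 2 * τ < R := by linarith
  have hle : ∀ z ∈ triangle s τ x₁, z.1 ≤ s + τ := fun z hz => by
    linarith [abs_nonneg (z.2 - x₁), hz.2]
  have hbase : ∀ z ∈ triangle s τ x₁, ∀ x', |x' - z.2| ≤ z.1 - s → |x' - x₁| ≤ τ := fun z hz x' hx' => by
    have := abs_sub_le x' z.2 x₁
    linarith [hz.2]
  have hvert : ∀ z ∈ triangle s τ x₁, ∀ t' ∈ Set.Icc s z.1, ∀ x', |x' - z.2| ≤ z.1 - t' →
      (t', x') ∈ triangle s τ x₁ := fun z hz t' ht' x' hx' => by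
    refine ⟨ht'.1, ?_⟩
    have := abs_sub_le x' z.2 x₁
    simp only
    linarith [hz.2]
  have hw : ∀ k, ∀ z ∈ triangle s τ x₁,
      ‖w (k + 1) z.1 z.2‖ ≤ μ / 2 * (k ! : ℝ) / (R - 2 * (z.1 - s)) ^ (k + 1) := fun k z hz =>
    norm_le_on_triangle (F := fun t => w (k + 1) t z.2) (F' := fun t => f (k + 1) t z.2) hμ hRτ hz.1
      (hle z hz) (h.w0 _ _ (hbase z hz _ (by simpa using hz.1))) (fun t' _ => h.dw _ _ _)
      (fun t' ht' => hf (k + 1) (t', z.2) (hvert z hz t' ht' _ (by simpa using ht'.2)))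
  have hr : ∀ k, ∀ z ∈ triangle s τ x₁, ‖(z.2 : ℂ) ^ 2 * f (k + 2) z.1 z.2
      + b * (z.2 : ℂ) ^ 3 * w (k + 3) z.1 z.2 + e k z.1 z.2‖
      ≤ (2 * μ + ε) * ((k + 1 + 1)! : ℝ) / (R - 2 * (z.1 - s)) ^ (k + 1 + 2) := by
    intro k z hz
    have hρ : 0 < R - 2 * (z.1 - s) := by linarith [hle z hz]
    have hρR : R - 2 * (z.1 - s) ≤ R := by linarith [hz.1]
    set ρ := R - 2 * (z.1 - s) with hρdef
    have hX := hx z hz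
    have a1 : ‖(z.2 : ℂ) ^ 2 * f (k + 2) z.1 z.2‖ ≤ μ * ((k + 2)! : ℝ) / ρ ^ (k + 3) := by
      rw [norm_mul, norm_pow, Complex.norm_real, Real.norm_eq_abs]
      exact (mul_le_of_le_one_left (norm_nonneg _) (pow_le_one₀ (abs_nonneg _) hX)).trans
        (hf (k + 2) z hz)
    have a2 : ‖b * (z.2 : ℂ) ^ 3 * w (k + 3) z.1 z.2‖ ≤ μ / 2 * ((k + 2)! : ℝ) / ρ ^ (k + 3) := by
      rw [norm_mul, norm_mul, norm_pow, Complex.norm_real, Complex.norm_real, Real.norm_eq_abs,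
        Real.norm_eq_abs]
      exact (mul_le_of_le_one_left (norm_nonneg _)
        (mul_le_one₀ hb (by positivity) (pow_le_one₀ (abs_nonneg _) hX))).trans (hw (k + 2) z hz)
    have a3 : ‖e k z.1 z.2‖ ≤ ε * ((k + 2)! : ℝ) / ρ ^ (k + 3) := by
      refine (he k z hz).trans ?_
      have f1 : (k ! : ℝ) ≤ ((k + 2)! : ℝ) := by exact_mod_cast Nat.factorial_le (by omega)
      have f2 : ρ ^ (k + 3) ≤ R ^ k := by
        calc ρ ^ (k + 3) ≤ R ^ (k + 3) := by gcongr
          _ ≤ R ^ k := pow_le_pow_of_le_one (by linarith) hR1 (by omega)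
      gcongr
    refine (norm_add₃_le).trans ((add_le_add (add_le_add a1 a2) a3).trans ?_)
    rw [← add_div, ← add_div]
    have e1 : k + 1 + 1 = k + 2 := rfl
    have e2 : k + 1 + 2 = k + 3 := rfl
    rw [e1, e2]
    gcongr
    nlinarith [mul_nonneg hμ (Nat.cast_nonneg (α := ℝ) (k + 2)!)]
  have hc : 0 ≤ 2 * μ + ε := by linarith
  have hp : ∀ k, ∀ z ∈ triangle s τ x₁,
      ‖p k z.1 z.2‖ ≤ (2 * μ + ε) / 2 * ((k + 1)! : ℝ) / (R - 2 * (z.1 - s)) ^ (k + 2) := by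
    intro k z hz
    have hmem : ∀ t' ∈ Set.Icc s z.1, (t', z.2 + z.1 - t') ∈ triangle s τ x₁ := fun t' ht' =>
      hvert z hz t' ht' _ (by
        rw [show z.2 + z.1 - t' - z.2 = z.1 - t' by ring, abs_of_nonneg (by linarith [ht'.2])])
    have := norm_le_on_triangle (F := fun t' => p k t' (z.2 + z.1 - t'))
      (F' := fun t' => ((z.2 + z.1 - t' : ℝ) : ℂ) ^ 2 * f (k + 2) t' (z.2 + z.1 - t')
        + b * ((z.2 + z.1 - t' : ℝ) : ℂ) ^ 3 * w (k + 3) t' (z.2 + z.1 - t') + e k t' (z.2 + z.1 - t'))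
      (m := k + 1) hc hRτ hz.1
      (hle z hz) (h.p0 _ _ (by simpa using (hmem s ⟨le_rfl, hz.1⟩).2)) (fun t' ht' => ?_)
      (fun t' ht' => hr k _ (hmem t' ht'))
    · simpa using this
    · have := h.dp k t' (z.2 + z.1 - t') (hmem t' ht')
      rwa [sub_add_cancel] at this
  have hq : ∀ k, ∀ z ∈ triangle s τ x₁,
      ‖q k z.1 z.2‖ ≤ (2 * μ + ε) / 2 * ((k + 1)! : ℝ) / (R - 2 * (z.1 - s)) ^ (k + 2) := by
    intro k z hz
    have hmem : ∀ t' ∈ Set.Icc s z.1, (t', z.2 - z.1 + t') ∈ triangle s τ x₁ := fun t' ht' =>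
      hvert z hz t' ht' _ (by
        rw [show z.2 - z.1 + t' - z.2 = -(z.1 - t') by ring, abs_neg,
          abs_of_nonneg (by linarith [ht'.2])])
    have := norm_le_on_triangle (F := fun t' => q k t' (z.2 - z.1 + t'))
      (F' := fun t' => ((z.2 - z.1 + t' : ℝ) : ℂ) ^ 2 * f (k + 2) t' (z.2 - z.1 + t')
        + b * ((z.2 - z.1 + t' : ℝ) : ℂ) ^ 3 * w (k + 3) t' (z.2 - z.1 + t') + e k t' (z.2 - z.1 + t'))
      (m := k + 1) hc hRτ hz.1
      (hle z hz) (h.q0 _ _ (by simpa using (hmem s ⟨le_rfl, hz.1⟩).2)) (fun t' ht' => ?_)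
      (fun t' ht' => hr k _ (hmem t' ht'))
    · simpa using this
    · have := h.dq k t' (z.2 - z.1 + t') (hmem t' ht')
      rwa [add_sub_cancel_right] at this
  intro k z hz
  refine ⟨hw k z hz, hp k z hz, hq k z hz, ?_⟩
  have := norm_le_on_triangle (F := fun t => f k t z.2) (F' := fun t => (p k t z.2 + q k t z.2) / 2)
    (m := k) (c := (2 * μ + ε) / 2) (by linarith) hRτ hz.1 (hle z hz)
    (h.f0 _ _ (hbase z hz _ (by simpa using hz.1))) (fun t' _ => h.df _ _ _)
    (fun t' ht' => ?_)
  · refine this.trans_eq ?_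
    ring
  · have hm := hvert z hz t' ht' z.2 (by simpa using ht'.2)
    have h1 := hp k _ hm
    have h2 := hq k _ hm
    rw [norm_div, Complex.norm_ofNat, div_le_iff₀ two_pos]
    refine (norm_add_le _ _).trans ((add_le_add h1 h2).trans_eq ?_)
    ring

/-- The solution of the system is of the size of the error terms `e`. -/
theorem CharSystem.norm_le (h : CharSystem b s τ x₁ w p f q e) (hτ : 0 < τ) (hR : R = 4 * τ)
    (hR1 : R ≤ 1) (hb : |b| ≤ 1) (hx : ∀ z ∈ triangle s τ x₁, |z.2| ≤ 1) (hε : 0 ≤ ε)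
    (he : ∀ k, ∀ z ∈ triangle s τ x₁, ‖e k z.1 z.2‖ ≤ ε * (k ! : ℝ) / R ^ k)
    {μ : ℝ} (hμ : 0 ≤ μ) (hf : ∀ k, ∀ z ∈ triangle s τ x₁,
      ‖f k z.1 z.2‖ ≤ μ * (k ! : ℝ) / R ^ k) :
    ‖w 0 (s + τ) x₁‖ ≤ 32 * ε / R ^ 2 ∧ ‖f 0 (s + τ) x₁‖ ≤ 32 * ε / R ^ 2 ∧
      ‖p 0 (s + τ) x₁ + q 0 (s + τ) x₁‖ ≤ 32 * ε / R ^ 2 := by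
  have hR0 : 0 < R := by linarith
  -- The system is linear with vanishing data: each round halves `μ`, so the a priori bound `μ`, which
  -- only has to be finite, disappears from the result.
  have hiter : ∀ m : ℕ, ∀ k, ∀ z ∈ triangle s τ x₁,
      ‖f k z.1 z.2‖ ≤ (μ / 2 ^ m + ε) * (k ! : ℝ) / (R - 2 * (z.1 - s)) ^ (k + 1) := by
    intro m
    induction m with
    | zero =>
      intro k z hz
      refine (hf k z hz).trans ?_
      have hz1 : z.1 ≤ s + τ := by linarith [abs_nonneg (z.2 - x₁), hz.2]
      have hρ : 0 < R - 2 * (z.1 - s) := by linarith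
      have hle : (R - 2 * (z.1 - s)) ^ (k + 1) ≤ R ^ k := by
        calc _ ≤ R ^ (k + 1) := by gcongr; linarith [hz.1]
          _ ≤ R ^ k := pow_le_pow_of_le_one hR0.le hR1 (by omega)
      gcongr
      simpa using hε
    | succ m ih =>
      intro k z hz
      refine ((h.improve hτ hR hR1 hb hx hε he (by positivity) ih k z hz).2.2.2).trans ?_
      have hz1 : z.1 ≤ s + τ := by linarith [abs_nonneg (z.2 - x₁), hz.2]
      have hρ : 0 < R - 2 * (z.1 - s) := by linarith
      have hcoef : (μ / 2 ^ m + ε) / 2 + ε / 4 ≤ μ / 2 ^ (m + 1) + ε := by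
        rw [pow_succ, ← div_div]
        linarith
      exact div_le_div_of_nonneg_right (mul_le_mul_of_nonneg_right hcoef (by positivity))
        (by positivity)
  have hlim : ∀ k, ∀ z ∈ triangle s τ x₁,
      ‖f k z.1 z.2‖ ≤ ε * (k ! : ℝ) / (R - 2 * (z.1 - s)) ^ (k + 1) := by
    intro k z hz
    have ht : Tendsto (fun m : ℕ => μ / 2 ^ m + ε) atTop (𝓝 ε) := by
      have := (tendsto_pow_atTop_nhds_zero_of_lt_one (r := (1 / 2 : ℝ)) (by norm_num)
        (by norm_num)).const_mul μ |>.add_const ε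
      rw [mul_zero, zero_add] at this
      refine this.congr fun m => ?_
      rw [one_div, inv_pow, div_eq_mul_inv]
    exact ge_of_tendsto' ((ht.mul_const _).div_const _) fun m => hiter m k z hz
  have hv : (s + τ, x₁) ∈ triangle s τ x₁ := ⟨by simp only; linarith, by simp⟩
  have himp := h.improve hτ hR hR1 hb hx hε he hε hlim
  have hρ : R - 2 * (s + τ - s) = R / 2 := by rw [hR]; ring
  have hR2 : R ^ 2 ≤ R := by nlinarith
  refine ⟨?_, ?_, ?_⟩
  · -- the zeroth function is integrated in time only
    have hmem : ∀ t ∈ Set.Icc s (s + τ), (t, x₁) ∈ triangle s τ x₁ := fun t ht =>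
      ⟨ht.1, by simpa using ht.2⟩
    have hb' : ∀ t ∈ Set.Icc s (s + τ), ‖f 0 t x₁‖ ≤ 2 * ε / R := fun t ht => by
      have := hlim 0 _ (hmem t ht)
      simp only [Nat.factorial_zero, Nat.cast_one, mul_one, zero_add, pow_one] at this
      refine this.trans ?_
      rw [div_le_div_iff₀ (by linarith [ht.2]) hR0]
      nlinarith [ht.2]
    have := Convex.norm_image_sub_le_of_norm_hasDerivWithin_le (f := fun t => w 0 t x₁)
      (f' := fun t => f 0 t x₁) (s := Set.Icc s (s + τ)) (x := s) (y := s + τ)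
      (fun t _ => (h.dw 0 t x₁).hasDerivWithinAt) hb' (convex_Icc _ _) ⟨le_rfl, by linarith⟩
      ⟨by linarith, le_rfl⟩
    rw [h.w0 0 x₁ (by simpa using hτ.le), sub_zero, add_sub_cancel_left, Real.norm_eq_abs,
      abs_of_pos hτ] at this
    refine this.trans ?_
    rw [show τ = R / 4 by linarith, div_mul_div_comm, div_le_div_iff₀ (by positivity) (by positivity)]
    nlinarith [mul_nonneg hε hR0.le, mul_nonneg (mul_nonneg hε hR0.le) (sub_nonneg.2 hR1),
      mul_nonneg hε (sub_nonneg.2 hR2)]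
  · have := hlim 0 _ hv
    simp only [hρ, Nat.factorial_zero, Nat.cast_one, mul_one, zero_add, pow_one] at this
    refine this.trans ?_
    rw [div_le_div_iff₀ (by positivity) (by positivity)]
    nlinarith [mul_nonneg hε (sub_nonneg.2 hR2), mul_nonneg hε hR0.le]
  · obtain ⟨-, h1, h2, -⟩ := himp 0 _ hv
    simp only [hρ, zero_add, Nat.factorial_one, Nat.cast_one, mul_one] at h1 h2
    refine (norm_add_le _ _).trans ((add_le_add h1 h2).trans ?_)
    rw [div_pow, ← add_div, div_le_div_iff₀ (by positivity) (by positivity)]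
    nlinarith [mul_nonneg hε (sq_nonneg R)]

end

end

/-! ### Gaussian means -/

noncomputable section
open Filter Topology MeasureTheory

/-- The derivatives of the Gaussian `exp (-l y²)`. -/
def gaussK (l : ℝ) (k : ℕ) : ℝ → ℂ := iteratedDeriv k fun y : ℝ => Complex.exp (-(l * (y : ℂ) ^ 2))

lemma contDiff_gauss (l : ℝ) : ContDiff ℝ ∞ fun y : ℝ => Complex.exp (-(l * (y : ℂ) ^ 2)) :=
  ((contDiff_const.mul (Complex.ofRealCLM.contDiff.pow 2)).neg).cexp

lemma hasDerivAt_gaussK (l : ℝ) (k : ℕ) (y : ℝ) : HasDerivAt (gaussK l k) (gaussK l (k + 1) y) y := by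
  rw [gaussK, gaussK, iteratedDeriv_succ]
  exact ((contDiff_gauss l).differentiable_iteratedDeriv k (by exact_mod_cast ENat.natCast_lt_top k)
    y).hasDerivAt

lemma continuous_gaussK (l : ℝ) (k : ℕ) : Continuous (gaussK l k) :=
  continuous_iff_continuousAt.2 fun y => (hasDerivAt_gaussK l k y).continuousAt

/-- Cauchy's estimate on the disc of radius `R`. -/
lemma norm_gaussK_le_of_re {l R B y : ℝ} (hR : 0 < R) (k : ℕ)
    (hB : ∀ z : ℂ, ‖z - y‖ = R → -(l * (z ^ 2).re) ≤ B) :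
    ‖gaussK l k y‖ ≤ Real.exp B * (k ! : ℝ) / R ^ k := by
  have hd : Differentiable ℂ fun z : ℂ => Complex.exp (-(l * z ^ 2)) := by fun_prop
  rw [gaussK, iteratedDeriv_comp_ofReal isOpen_univ hd.differentiableOn k (Set.mem_univ _)]
  refine (Complex.norm_iteratedDeriv_le_of_forall_mem_sphere_norm_le (C := Real.exp B) k hR
    hd.diffContOnCl fun z hz => ?_).trans_eq (by rw [mul_comm])
  rw [Complex.norm_exp, Real.exp_le_exp, Complex.neg_re, Complex.re_ofReal_mul]
  exact hB z (by simpa [dist_eq_norm] using hz)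

lemma re_sq_ge {y R : ℝ} {z : ℂ} (hz : ‖z - y‖ = R) : (z ^ 2).re = z.re ^ 2 - z.im ^ 2 ∧
    |z.re - y| ≤ R ∧ z.im ^ 2 ≤ R ^ 2 := by
  refine ⟨by rw [sq, Complex.mul_re]; ring, ?_, ?_⟩
  · have := Complex.abs_re_le_norm (z - y)
    rwa [Complex.sub_re, Complex.ofReal_re, hz] at this
  · have := Complex.abs_im_le_norm (z - y)
    rw [Complex.sub_im, Complex.ofReal_im, sub_zero, hz] at this
    rw [← sq_abs]
    exact pow_le_pow_left₀ (abs_nonneg _) this 2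

/-- Everywhere on the real line: on the disc of radius `R`, `Re z² ≥ -R²`. -/
lemma norm_gaussK_le {l R : ℝ} (hl : 0 ≤ l) (hR : 0 < R) (k : ℕ) (y : ℝ) :
    ‖gaussK l k y‖ ≤ Real.exp (l * R ^ 2) * (k ! : ℝ) / R ^ k := by
  refine norm_gaussK_le_of_re hR k fun z hz => ?_
  obtain ⟨h1, -, h3⟩ := re_sq_ge hz
  rw [h1]
  nlinarith [sq_nonneg z.re]

/-- At distance `3 R` from the origin: on the disc of radius `R`, `Re z² ≥ (2 R)² - R²`. -/
lemma norm_gaussK_le_of_far {l R : ℝ} (hl : 0 ≤ l) (hR : 0 < R) (k : ℕ) {y : ℝ} (hy : 3 * R ≤ |y|) :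
    ‖gaussK l k y‖ ≤ Real.exp (-(3 * l * R ^ 2)) * (k ! : ℝ) / R ^ k := by
  refine norm_gaussK_le_of_re hR k fun z hz => ?_
  obtain ⟨h1, h2, h3⟩ := re_sq_ge hz
  have h4 : 2 * R ≤ |z.re| := by
    have := abs_sub_abs_le_abs_sub y z.re
    rw [abs_sub_comm] at this
    linarith
  have h5 : (2 * R) ^ 2 ≤ z.re ^ 2 := by
    rw [← sq_abs z.re]
    exact pow_le_pow_left₀ (by positivity) h4 2
  rw [h1]
  nlinarith

/-- Smooth functions of `(t, x, y)` with compact support. -/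
structure TestFun (V : ℝ × ℝ × ℝ → ℂ) : Prop where
  smooth : ContDiff ℝ ∞ V
  compact : HasCompactSupport V

/-- The derivative in the direction `v`. -/
def pd (v : ℝ × ℝ × ℝ) (V : ℝ × ℝ × ℝ → ℂ) (z : ℝ × ℝ × ℝ) : ℂ := fderiv ℝ V z v

lemma contDiff_pd {V : ℝ × ℝ × ℝ → ℂ} (hV : ContDiff ℝ ∞ V) (v : ℝ × ℝ × ℝ) :
    ContDiff ℝ ∞ (pd v V) :=
  (hV.fderiv_right (m := ∞) (by simp)).clm_apply contDiff_const

lemma TestFun.pd {V : ℝ × ℝ × ℝ → ℂ} (hV : TestFun V) (v : ℝ × ℝ × ℝ) : TestFun (pd v V) :=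
  ⟨contDiff_pd hV.smooth v, hV.compact.fderiv_apply ℝ v⟩

lemma TestFun.bounded {V : ℝ × ℝ × ℝ → ℂ} (hV : TestFun V) : ∃ M, 0 ≤ M ∧ ∀ z, ‖V z‖ ≤ M := by
  obtain ⟨M, hM⟩ := hV.smooth.continuous.bounded_above_of_compact_support hV.compact
  exact ⟨M, (norm_nonneg _).trans (hM 0), hM⟩

lemma TestFun.exists_radius {V : ℝ × ℝ × ℝ → ℂ} (hV : TestFun V) :
    ∃ L, 0 ≤ L ∧ ∀ t x y, y ∉ Set.Icc (-L) L → V (t, x, y) = 0 := by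
  obtain ⟨L, hL⟩ := hV.compact.isCompact.isBounded.exists_norm_le
  refine ⟨max L 0, le_max_right _ _, fun t x y hy => ?_⟩
  by_contra h
  have h1 := hL _ (subset_tsupport V h)
  have h2 : |y| ≤ ‖(t, x, y)‖ := by
    rw [Prod.norm_def, Prod.norm_def, ← Real.norm_eq_abs]
    exact (le_max_right _ _).trans (le_max_right _ _)
  exact hy (abs_le.1 ((h2.trans h1).trans (le_max_left _ _)))

/-- The convolution in `y` with the `k`-th derivative of the Gaussian. -/
def gconv (l : ℝ) (k : ℕ) (y₁ : ℝ) (V : ℝ × ℝ × ℝ → ℂ) (t x : ℝ) : ℂ :=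
  ∫ y, gaussK l k (y₁ - y) * V (t, x, y)

section
variable {V : ℝ × ℝ × ℝ → ℂ} {l y₁ : ℝ} {k : ℕ}

lemma TestFun.continuous_slice (hV : TestFun V) (t x : ℝ) : Continuous fun y => V (t, x, y) :=
  hV.smooth.continuous.comp (by fun_prop)

lemma TestFun.hasCompactSupport_slice (hV : TestFun V) (t x : ℝ) :
    HasCompactSupport fun y => V (t, x, y) := by
  obtain ⟨L, -, hL⟩ := hV.exists_radius
  exact HasCompactSupport.intro isCompact_Icc fun y hy => hL t x y hy

lemma TestFun.integrable (hV : TestFun V) {e : ℝ → ℂ} (he : Continuous e) (t x : ℝ) :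
    Integrable fun y => e y * V (t, x, y) :=
  (he.mul (hV.continuous_slice t x)).integrable_of_hasCompactSupport
    ((hV.hasCompactSupport_slice t x).mul_left)

lemma continuous_gaussK_sub (l : ℝ) (k : ℕ) (y₁ : ℝ) : Continuous fun y => gaussK l k (y₁ - y) :=
  (continuous_gaussK l k).comp (by fun_prop)

/-- Only the values of the kernel on the support of `V` matter for the size of the convolution. -/
lemma TestFun.exists_gconv_le (hV : TestFun V) : ∃ N, 0 ≤ N ∧ ∀ (l : ℝ) (k : ℕ) (y₁ t x B : ℝ),
    0 ≤ B → (∀ y, V (t, x, y) ≠ 0 → ‖gaussK l k (y₁ - y)‖ ≤ B) → ‖gconv l k y₁ V t x‖ ≤ B * N := by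
  obtain ⟨L, hL0, hL⟩ := hV.exists_radius
  obtain ⟨M, hM0, hM⟩ := hV.bounded
  refine ⟨2 * L * M, by positivity, fun l k y₁ t x B hB h => ?_⟩
  have hbd : ∀ y, ‖gaussK l k (y₁ - y) * V (t, x, y)‖ ≤ (Set.Icc (-L) L).indicator (fun _ => B * M) y := by
    intro y
    by_cases hy : y ∈ Set.Icc (-L) L
    · rw [Set.indicator_of_mem hy, norm_mul]
      by_cases hz : V (t, x, y) = 0
      · rw [hz, norm_zero, mul_zero]; positivity
      · exact mul_le_mul (h y hz) (hM _) (norm_nonneg _) hB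
    · rw [hL t x y hy, mul_zero, norm_zero, Set.indicator_of_notMem hy]
  have hint : Integrable ((Set.Icc (-L) L).indicator fun _ => B * M) :=
    (integrable_indicator_iff measurableSet_Icc).2
      (integrableOn_const (isCompact_Icc.measure_lt_top.ne))
  refine (norm_integral_le_of_norm_le hint (Eventually.of_forall hbd)).trans_eq ?_
  rw [integral_indicator_const _ measurableSet_Icc, Measure.real, Real.volume_Icc,
    ENNReal.toReal_ofReal (by linarith), smul_eq_mul]
  ring

/-- Integration by parts: a derivative in `y` falls on the Gaussian. -/
lemma TestFun.gconv_pd_y (hV : TestFun V) (t x : ℝ) :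
    gconv l k y₁ (_root_.pd (0, 0, 1) V) t x = gconv l (k + 1) y₁ V t x := by
  have hu : ∀ y, HasDerivAt (fun y => gaussK l k (y₁ - y)) (-gaussK l (k + 1) (y₁ - y)) y := fun y => by
    have := (hasDerivAt_gaussK l k (y₁ - y)).scomp y ((hasDerivAt_id y).const_sub y₁)
    simpa using! this
  have hv : ∀ y, HasDerivAt (fun y => V (t, x, y)) (_root_.pd (0, 0, 1) V (t, x, y)) y := fun y => by
    have h1 : HasDerivAt (fun y : ℝ => (t, x, y)) ((0 : ℝ), (0 : ℝ), (1 : ℝ)) y :=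
      (hasDerivAt_const y t).prodMk ((hasDerivAt_const y x).prodMk (hasDerivAt_id y))
    exact ((hV.smooth.differentiable (by simp) _).hasFDerivAt).comp_hasDerivAt y h1
  have key := integral_mul_deriv_eq_deriv_mul_of_integrable (fun y _ => hu y) (fun y _ => hv y)
    ((hV.pd _).integrable (continuous_gaussK_sub l k y₁) t x)
    (hV.integrable (continuous_gaussK_sub l (k + 1) y₁).neg t x)
    (hV.integrable (continuous_gaussK_sub l k y₁) t x)
  rw [gconv, key, gconv, ← integral_neg]
  refine integral_congr_ae (Eventually.of_forall fun y => ?_)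
  simp

lemma TestFun.hasDerivAt_gconv (hV : TestFun V) (l : ℝ) (k : ℕ) (y₁ c σ t : ℝ) :
    HasDerivAt (fun t => gconv l k y₁ V t (c + σ * t))
      (gconv l k y₁ (_root_.pd (1, σ, 0) V) t (c + σ * t)) t := by
  have hW := hV.pd (1, σ, 0)
  obtain ⟨L, hL0, hL⟩ := hW.exists_radius
  obtain ⟨M, hM0, hM⟩ := hW.bounded
  have hint : Integrable ((Set.Icc (-L) L).indicator fun y => ‖gaussK l k (y₁ - y)‖ * M) :=
    (integrable_indicator_iff measurableSet_Icc).2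
      (((continuous_gaussK_sub l k y₁).norm.mul continuous_const).continuousOn.integrableOn_compact
        isCompact_Icc)
  refine (hasDerivAt_integral_of_dominated_loc_of_deriv_le (μ := (volume : Measure ℝ))
    (F := fun t y => gaussK l k (y₁ - y) * V (t, c + σ * t, y))
    (F' := fun t y => gaussK l k (y₁ - y) * _root_.pd (1, σ, 0) V (t, c + σ * t, y))
    (x₀ := t) (s := Set.univ) univ_mem
    (Eventually.of_forall fun s => (hV.integrable (continuous_gaussK_sub l k y₁) s _).aestronglyMeasurable)
    (hV.integrable (continuous_gaussK_sub l k y₁) t _)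
    (hW.integrable (continuous_gaussK_sub l k y₁) t _).aestronglyMeasurable
    (Eventually.of_forall fun y s _ => ?_) hint (Eventually.of_forall fun y s _ => ?_)).2
  · by_cases hy : y ∈ Set.Icc (-L) L
    · rw [Set.indicator_of_mem hy, norm_mul]
      gcongr; exact hM _
    · rw [hL _ _ y hy, mul_zero, norm_zero, Set.indicator_of_notMem hy]
  · have h1 : HasDerivAt (fun s : ℝ => (s, c + σ * s, y)) ((1 : ℝ), σ, (0 : ℝ)) s := by
      refine (hasDerivAt_id s).prodMk (HasDerivAt.prodMk ?_ (hasDerivAt_const s y))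
      simpa using ((hasDerivAt_id s).const_mul σ).const_add c
    exact (((hV.smooth.differentiable (by simp) _).hasFDerivAt).comp_hasDerivAt s h1).const_mul _

/-- The Gaussian means concentrate at `y₁`. -/
lemma TestFun.eq_zero_of_gconv_le (hV : TestFun V) {t x C c : ℝ} (hc : 0 < c)
    (h : ∀ l > 0, ‖gconv l 0 y₁ V t x‖ ≤ C * Real.exp (-(c * l))) : V (t, x, y₁) = 0 := by
  have hgi : ∫ y : ℝ, Real.exp (-y ^ 2) / Real.sqrt Real.pi = 1 := by
    rw [integral_div]
    have := integral_gaussian 1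
    simp only [neg_mul, one_mul, div_one] at this
    rw [this, div_self (by positivity)]
  have hdecay : Tendsto (fun y : ℝ => ‖y‖ ^ Module.finrank ℝ ℝ * (Real.exp (-y ^ 2) / Real.sqrt Real.pi))
      (Bornology.cobounded ℝ) (𝓝 0) := by
    have h1 : ∀ y : ℝ, ‖y‖ ^ Module.finrank ℝ ℝ * (Real.exp (-y ^ 2) / Real.sqrt Real.pi)
        ≤ ‖y‖⁻¹ := fun y => by
      rw [Module.finrank_self, pow_one]
      rcases eq_or_ne y 0 with rfl | hy
      · simp
      have hy' : 0 < ‖y‖ := norm_pos_iff.2 hy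
      rw [← one_div, le_div_iff₀ hy', ← mul_div_assoc, div_mul_eq_mul_div, div_le_one (by positivity)]
      have e1 := Real.add_one_le_exp (y ^ 2)
      have e2 : Real.exp (-y ^ 2) * Real.exp (y ^ 2) = 1 := by rw [← Real.exp_add]; simp
      have e3 : ‖y‖ ^ 2 = y ^ 2 := by rw [Real.norm_eq_abs, sq_abs]
      have e4 : 1 ≤ Real.sqrt Real.pi := Real.one_le_sqrt.2 (by linarith [Real.pi_gt_three])
      have e5 := Real.exp_pos (-y ^ 2)
      nlinarith
    refine squeeze_zero (fun y => by positivity) h1 ?_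
    exact tendsto_inv_atTop_zero.comp tendsto_norm_cobounded_atTop
  have hVi : Integrable fun y => V (t, x, y) := by
    simpa using hV.integrable continuous_const (e := fun _ => 1) t x
  have hpos : ∀ y : ℝ, 0 ≤ (fun y : ℝ => Real.exp (-y ^ 2) / Real.sqrt Real.pi) y := fun y => by
    positivity
  -- with `r = √l`, the kernels `r / √π exp (-r² y²)` are an approximate identity
  have key := tendsto_integral_comp_smul_smul_of_integrable' (μ := (volume : Measure ℝ)) hpos hgi
    hdecay hVi (x₀ := y₁) (hV.continuous_slice t x).continuousAt
  have hrw : ∀ r : ℝ, 0 < r → ∫ y : ℝ, (r ^ Module.finrank ℝ ℝ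
      * (Real.exp (-(r • (y₁ - y)) ^ 2) / Real.sqrt Real.pi)) • V (t, x, y)
      = ((r / Real.sqrt Real.pi : ℝ) : ℂ) * gconv (r ^ 2) 0 y₁ V t x := fun r hr => by
    rw [gconv, ← integral_const_mul]
    refine integral_congr_ae (Eventually.of_forall fun y => ?_)
    simp only [Module.finrank_self, pow_one, gaussK, iteratedDeriv_zero, Complex.real_smul, smul_eq_mul]
    rw [mul_pow]
    push_cast
    rw [← neg_mul]
    ring_nf
  have hz : Tendsto (fun r : ℝ => ∫ y : ℝ, (r ^ Module.finrank ℝ ℝ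
      * (Real.exp (-(r • (y₁ - y)) ^ 2) / Real.sqrt Real.pi)) • V (t, x, y)) atTop (𝓝 0) := by
    have hC : 0 ≤ C := by
      have := (norm_nonneg _).trans (h 1 one_pos)
      exact nonneg_of_mul_nonneg_left this (Real.exp_pos _)
    have hlim : Tendsto (fun r : ℝ => (C / (c * Real.sqrt Real.pi)) * r⁻¹) atTop (𝓝 0) := by
      simpa using tendsto_inv_atTop_zero.const_mul (C / (c * Real.sqrt Real.pi))
    refine squeeze_zero_norm' ?_ hlim
    filter_upwards [eventually_gt_atTop 0] with r hr
    rw [hrw r hr, norm_mul, Complex.norm_real, Real.norm_eq_abs, abs_of_pos (by positivity)]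
    have e1 : c * r ^ 2 * Real.exp (-(c * r ^ 2)) ≤ 1 := by
      have e2 := Real.add_one_le_exp (c * r ^ 2)
      rw [Real.exp_neg, ← div_eq_mul_inv, div_le_one (Real.exp_pos _)]
      linarith
    have hpi : 0 < Real.sqrt Real.pi := by positivity
    calc r / Real.sqrt Real.pi * ‖gconv (r ^ 2) 0 y₁ V t x‖
        ≤ r / Real.sqrt Real.pi * (C * Real.exp (-(c * r ^ 2))) := by
          gcongr; exact h _ (by positivity)
      _ = C / (c * Real.sqrt Real.pi) * r⁻¹ * (c * r ^ 2 * Real.exp (-(c * r ^ 2))) := by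
          field_simp
      _ ≤ C / (c * Real.sqrt Real.pi) * r⁻¹ * 1 := by gcongr
      _ = _ := mul_one _
  exact tendsto_nhds_unique key hz

end

end

/-! ### Local uniqueness -/

noncomputable section
open Filter Topology MeasureTheory

section
variable {V V' : ℝ × ℝ × ℝ → ℂ} {Ω : Set (ℝ × ℝ × ℝ)} {z : ℝ × ℝ × ℝ} {b : ℝ}

lemma pd_eqOn (hΩ : IsOpen Ω) (h : Set.EqOn V V' Ω) (v : ℝ × ℝ × ℝ) :
    Set.EqOn (pd v V) (pd v V') Ω := fun z hz => by
  rw [pd, pd, Filter.EventuallyEq.fderiv_eq (h.eventuallyEq_of_mem (hΩ.mem_nhds hz))]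

lemma contDiffOn_pd (hΩ : IsOpen Ω) (hV : ContDiffOn ℝ ∞ V Ω) (v : ℝ × ℝ × ℝ) :
    ContDiffOn ℝ ∞ (pd v V) Ω :=
  (hV.fderiv_of_isOpen hΩ (m := ∞) (by simp)).clm_apply contDiffOn_const

lemma differentiableAt_of_contDiffOn (hΩ : IsOpen Ω) (hV : ContDiffOn ℝ ∞ V Ω) (hz : z ∈ Ω) :
    DifferentiableAt ℝ V z :=
  (hV.differentiableOn (by simp)).differentiableAt (hΩ.mem_nhds hz)

lemma pd_mul (hV : DifferentiableAt ℝ V z) (hV' : DifferentiableAt ℝ V' z) (v : ℝ × ℝ × ℝ) :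
    pd v (fun z => V z * V' z) z = V z * pd v V' z + pd v V z * V' z := by
  rw [pd, fderiv_fun_mul hV hV']
  simp only [add_apply, smul_apply, smul_eq_mul, pd]
  ring

lemma pd_add_vec (v v' : ℝ × ℝ × ℝ) (V : ℝ × ℝ × ℝ → ℂ) (z : ℝ × ℝ × ℝ) :
    pd (v + v') V z = pd v V z + pd v' V z := map_add _ _ _

lemma pd_add (hV : DifferentiableAt ℝ V z) (hV' : DifferentiableAt ℝ V' z) (v : ℝ × ℝ × ℝ) :
    pd v (fun z => V z + V' z) z = pd v V z + pd v V' z := by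
  rw [pd, fderiv_fun_add hV hV', add_apply, pd, pd]

lemma pd_comm (hV : ContDiff ℝ ∞ V) (v v' : ℝ × ℝ × ℝ) (z : ℝ × ℝ × ℝ) :
    pd v (pd v' V) z = pd v' (pd v V) z := by
  have hd : Differentiable ℝ (fderiv ℝ V) :=
    (hV.fderiv_right (m := ∞) (by simp)).differentiable (by simp)
  have h : ∀ v v', pd v (pd v' V) z = fderiv ℝ (fderiv ℝ V) z v v' := fun v v' => by
    have h1 : HasFDerivAt (pd v' V) ((ContinuousLinearMap.apply ℝ ℂ v').comp
        (fderiv ℝ (fderiv ℝ V) z)) z :=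
      (ContinuousLinearMap.apply ℝ ℂ v').hasFDerivAt.comp z (hd z).hasFDerivAt
    rw [pd, h1.fderiv]
    rfl
  rw [h, h]
  exact second_derivative_symmetric
    (fun y => ((hV.differentiable (by simp)) y).hasFDerivAt) (hd z).hasFDerivAt v v'

/-- The wave operator factors into the derivatives along its characteristics. -/
lemma pd_characteristics (hV : ContDiff ℝ ∞ V) (z : ℝ × ℝ × ℝ) :
    pd (1, -1, 0) (pd (1, 1, 0) V) z
      = pd (1, 0, 0) (pd (1, 0, 0) V) z - pd (0, 1, 0) (pd (0, 1, 0) V) z := by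
  have e1 : ((1 : ℝ), (-1 : ℝ), (0 : ℝ)) = (1, 0, 0) + -(0, 1, 0) := by simp
  have e2 : ((1 : ℝ), (1 : ℝ), (0 : ℝ)) = (1, 0, 0) + (0, 1, 0) := by simp
  have h1 : pd (1, 1, 0) V = fun z => pd (1, 0, 0) V z + pd (0, 1, 0) V z := by
    funext z
    rw [e2, pd_add_vec]
  have hneg : ∀ v V z, pd (-v) V z = -pd v V z := fun v V z => map_neg _ _
  have hd : ∀ v, DifferentiableAt ℝ (pd v V) z := fun v =>
    (contDiff_pd hV v).differentiable (by simp) z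
  rw [h1, pd_add (hd _) (hd _), e1, pd_add_vec, pd_add_vec, hneg, hneg, pd_comm hV (0, 1, 0) (1, 0, 0)]
  ring

/-- The principal part of the equation in the variables `(t, x, y)`, without the factors `i`:
`∂ₜ³ - (∂ₓ² + x² ∂_y²) ∂ₜ - b x³ ∂_y³`. -/
def model3 (b : ℝ) (U : ℝ × ℝ × ℝ → ℂ) (z : ℝ × ℝ × ℝ) : ℂ :=
  pd (1, 0, 0) (pd (1, 0, 0) (pd (1, 0, 0) U)) z - pd (0, 1, 0) (pd (0, 1, 0) (pd (1, 0, 0) U)) z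
    - (z.2.1 : ℂ) ^ 2 * pd (0, 0, 1) (pd (0, 0, 1) (pd (1, 0, 0) U)) z
    - b * (z.2.1 : ℂ) ^ 3 * pd (0, 0, 1) (pd (0, 0, 1) (pd (0, 0, 1) U)) z

lemma model3_eqOn (hΩ : IsOpen Ω) (h : Set.EqOn V V' Ω) : Set.EqOn (model3 b V) (model3 b V') Ω :=
  fun z hz => by
  have h2 := fun v v' v'' => pd_eqOn hΩ (pd_eqOn hΩ (pd_eqOn hΩ h v) v') v'' hz
  rw [model3, model3, h2, h2, h2, h2]

lemma contDiff_model3 (hV : ContDiff ℝ ∞ V) : ContDiff ℝ ∞ (model3 b V) := by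
  have h3 := fun v v' v'' => contDiff_pd (contDiff_pd (contDiff_pd hV v) v') v''
  have hx : ContDiff ℝ ∞ fun z : ℝ × ℝ × ℝ => (z.2.1 : ℂ) :=
    Complex.ofRealCLM.contDiff.comp (contDiff_fst.comp contDiff_snd)
  exact (((h3 _ _ _).sub (h3 _ _ _)).sub ((hx.pow 2).mul (h3 _ _ _))).sub
    ((contDiff_const.mul (hx.pow 3)).mul (h3 _ _ _))

lemma TestFun.model3 (hV : TestFun V) : TestFun (model3 b V) := by
  refine ⟨contDiff_model3 hV.smooth, ?_⟩
  have h3 := fun v v' v'' => (((hV.pd v).pd v').pd v'').compact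
  exact ((((h3 _ _ _).sub (h3 _ _ _))).sub ((h3 _ _ _).mul_left)).sub ((h3 _ _ _).mul_left)

/-- Smooth cutoff of a function near a compact set. -/
lemma exists_testFun_cutoff {Q : Set (ℝ × ℝ × ℝ)} (hΩ : IsOpen Ω) (hQ : IsCompact Q) (hQΩ : Q ⊆ Ω)
    {U : ℝ × ℝ × ℝ → ℂ} (hU : ContDiffOn ℝ ∞ U Ω) :
    ∃ χ : ℝ × ℝ × ℝ → ℂ, ContDiff ℝ ∞ χ ∧ TestFun (fun z => χ z * U z) ∧ tsupport χ ⊆ Ω ∧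
      ∃ O, IsOpen O ∧ Q ⊆ O ∧ ∀ z ∈ O, χ z = 1 := by
  obtain ⟨K, hK, hQK, hKΩ⟩ := exists_compact_between hQ hΩ hQΩ
  obtain ⟨g, h1, h0, -⟩ := exists_contMDiffMap_one_nhds_of_subset_interior (n := (⊤ : ℕ∞))
    (modelWithCornersSelf ℝ (ℝ × ℝ × ℝ)) hQ.isClosed hQK
  obtain ⟨O, hO, hQO, hO1⟩ := eventually_nhdsSet_iff_exists.1 h1
  have hg : ContDiff ℝ ∞ fun z => (g z : ℂ) := Complex.ofRealCLM.contDiff.comp g.contMDiff.contDiff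
  have hsub : tsupport (fun z => (g z : ℂ)) ⊆ K :=
    closure_minimal (fun z hz => by
      by_contra hzK
      exact hz (by simp [h0 z hzK])) hK.isClosed
  refine ⟨fun z => (g z : ℂ), hg, ⟨?_, ?_⟩, hsub.trans hKΩ, O, hO, hQO, fun z hz => by simp [hO1 z hz]⟩
  · refine contDiff_iff_contDiffAt.2 fun z => ?_
    by_cases hz : z ∈ Ω
    · exact hg.contDiffAt.mul (hU.contDiffAt (hΩ.mem_nhds hz))
    · have : (fun z => (g z : ℂ) * U z) =ᶠ[𝓝 z] fun _ => 0 := by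
        have h2 : z ∉ tsupport fun z => (g z : ℂ) := fun h => hz (hKΩ (hsub h))
        filter_upwards [notMem_tsupport_iff_eventuallyEq.1 h2] with z' hz'
        simp only [Pi.zero_apply] at hz'
        rw [hz', zero_mul]
      exact contDiffAt_const.congr_of_eventuallyEq this
  · exact HasCompactSupport.mul_right (HasCompactSupport.intro hK fun z hz => by simp [h0 z hz])

end

section
variable {V V' : ℝ × ℝ × ℝ → ℂ} {l y₁ : ℝ} {k : ℕ}

lemma TestFun.gconv_add (hV : TestFun V) (hV' : TestFun V') (t x : ℝ) :
    gconv l k y₁ (fun z => V z + V' z) t x = gconv l k y₁ V t x + gconv l k y₁ V' t x := by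
  rw [gconv, gconv, gconv, ← integral_add (hV.integrable (continuous_gaussK_sub l k y₁) t x)
    (hV'.integrable (continuous_gaussK_sub l k y₁) t x)]
  simp only [mul_add]

lemma gconv_mul_left (c : ℝ → ℝ → ℂ) (t x : ℝ) :
    gconv l k y₁ (fun z => c z.1 z.2.1 * V z) t x = c t x * gconv l k y₁ V t x := by
  rw [gconv, gconv, ← integral_const_mul]
  refine integral_congr_ae (Eventually.of_forall fun y => ?_)
  simp only
  ring

lemma TestFun.mul_left (hV : TestFun V) {c : ℝ × ℝ × ℝ → ℂ} (hc : ContDiff ℝ ∞ c) :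
    TestFun fun z => c z * V z := ⟨hc.mul hV.smooth, hV.compact.mul_left⟩

lemma gconv_eq_zero (t x : ℝ) (h : ∀ y, V (t, x, y) = 0) : gconv l k y₁ V t x = 0 := by
  simp [gconv, h]

/-- The Gaussian means turn the equation into a system in which `∂_y` raises the index `k`. -/
lemma TestFun.gconv_wave (hV : TestFun V) (b t x : ℝ) :
    gconv l k y₁ (_root_.pd (1, -1, 0) (_root_.pd (1, 1, 0) (_root_.pd (1, 0, 0) V))) t x
      = (x : ℂ) ^ 2 * gconv l (k + 2) y₁ (_root_.pd (1, 0, 0) V) t x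
        + b * (x : ℂ) ^ 3 * gconv l (k + 3) y₁ V t x + gconv l k y₁ (_root_.model3 b V) t x := by
  have hx : ContDiff ℝ ∞ fun z : ℝ × ℝ × ℝ => (z.2.1 : ℂ) :=
    Complex.ofRealCLM.contDiff.comp (contDiff_fst.comp contDiff_snd)
  have hT := hV.pd (1, 0, 0)
  have hA := ((hT.pd (0, 0, 1)).pd (0, 0, 1)).mul_left (hx.pow 2)
  have hB := (((hV.pd (0, 0, 1)).pd (0, 0, 1)).pd (0, 0, 1)).mul_left
    ((contDiff_const (c := (b : ℂ))).mul (hx.pow 3))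
  have e : _root_.pd (1, -1, 0) (_root_.pd (1, 1, 0) (_root_.pd (1, 0, 0) V)) = fun z =>
      ((z.2.1 : ℂ) ^ 2 * _root_.pd (0, 0, 1) (_root_.pd (0, 0, 1) (_root_.pd (1, 0, 0) V)) z
        + b * (z.2.1 : ℂ) ^ 3 * _root_.pd (0, 0, 1) (_root_.pd (0, 0, 1) (_root_.pd (0, 0, 1) V)) z)
        + _root_.model3 b V z := by
    funext z
    rw [pd_characteristics hT.smooth, _root_.model3]
    ring
  have hAB : TestFun fun z => (z.2.1 : ℂ) ^ 2 * _root_.pd (0, 0, 1) (_root_.pd (0, 0, 1) (_root_.pd (1, 0, 0) V)) z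
        + b * (z.2.1 : ℂ) ^ 3 * _root_.pd (0, 0, 1) (_root_.pd (0, 0, 1) (_root_.pd (0, 0, 1) V)) z :=
    ⟨hA.smooth.add hB.smooth, hA.compact.add hB.compact⟩
  rw [e, hAB.gconv_add hV.model3, hA.gconv_add hB,
    gconv_mul_left (fun _ x => (x : ℂ) ^ 2), gconv_mul_left (fun _ x => b * (x : ℂ) ^ 3),
    (hT.pd _).gconv_pd_y, hT.gconv_pd_y, ((hV.pd _).pd _).gconv_pd_y, (hV.pd _).gconv_pd_y,
    hV.gconv_pd_y]

/-- The system solved by the Gaussian means of a test function with vanishing data at time `s`. -/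
lemma TestFun.charSystem (hV : TestFun V) (b : ℝ) {s τ x₁ : ℝ} (hτ : 0 < τ)
    (h0 : ∀ x y, |x - x₁| ≤ τ → V (s, x, y) = 0 ∧ _root_.pd (1, 0, 0) V (s, x, y) = 0 ∧
      _root_.pd (1, 0, 0) (_root_.pd (1, 0, 0) V) (s, x, y) = 0) (l y₁ : ℝ) :
    CharSystem b s τ x₁ (fun k => gconv l k y₁ V) (fun k => gconv l k y₁ (_root_.pd (1, 1, 0) (_root_.pd (1, 0, 0) V)))
      (fun k => gconv l k y₁ (_root_.pd (1, 0, 0) V)) (fun k => gconv l k y₁ (_root_.pd (1, -1, 0) (_root_.pd (1, 0, 0) V)))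
      (fun k => gconv l k y₁ (_root_.model3 b V)) := by
  have hT := hV.pd (1, 0, 0)
  have hX : ∀ x y, |x - x₁| ≤ τ → _root_.pd (0, 1, 0) (_root_.pd (1, 0, 0) V) (s, x, y) = 0 := fun x y hx => by
    have hx' : x ∈ Set.Icc (x₁ - τ) (x₁ + τ) := by
      rw [abs_le] at hx
      constructor <;> linarith
    have h1 : HasDerivAt (fun x : ℝ => (s, x, y)) ((0 : ℝ), (1 : ℝ), (0 : ℝ)) x :=
      (hasDerivAt_const x s).prodMk ((hasDerivAt_id x).prodMk (hasDerivAt_const x y))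
    have h2 : HasDerivWithinAt (fun x => _root_.pd (1, 0, 0) V (s, x, y))
        (_root_.pd (0, 1, 0) (_root_.pd (1, 0, 0) V) (s, x, y)) (Set.Icc (x₁ - τ) (x₁ + τ)) x :=
      (((hT.smooth.differentiable (by simp) _).hasFDerivAt).comp_hasDerivAt x h1).hasDerivWithinAt
    have h3 : HasDerivWithinAt (fun x => _root_.pd (1, 0, 0) V (s, x, y)) 0
        (Set.Icc (x₁ - τ) (x₁ + τ)) x := by
      refine (hasDerivWithinAt_const x _ (0 : ℂ)).congr_of_mem (fun x'' hx'' => ?_) hx'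
      exact (h0 x'' y (abs_le.2 ⟨by linarith [hx''.1], by linarith [hx''.2]⟩)).2.1
    exact (uniqueDiffOn_Icc (by linarith) x hx').eq_deriv _ h2 h3
  have hsum : ∀ σ z, _root_.pd (1, σ, 0) (_root_.pd (1, 0, 0) V) z = _root_.pd (1, 0, 0) (_root_.pd (1, 0, 0) V) z
      + σ * _root_.pd (0, 1, 0) (_root_.pd (1, 0, 0) V) z := fun σ z => by
    have e : ((1 : ℝ), σ, (0 : ℝ)) = (1, 0, 0) + σ • (0, 1, 0) := by simp
    rw [e, pd_add_vec, add_right_inj, _root_.pd, map_smul, Complex.real_smul, ← _root_.pd]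
  refine ⟨fun k x hx => gconv_eq_zero _ _ fun y => (h0 x y hx).1,
    fun k x hx => gconv_eq_zero _ _ fun y => (h0 x y hx).2.1,
    fun k x hx => gconv_eq_zero _ _ fun y => ?_, fun k x hx => gconv_eq_zero _ _ fun y => ?_,
    fun k t x => ?_, fun k t x => ?_, fun k t x _ => ?_, fun k t x _ => ?_⟩
  · rw [hsum, (h0 x y hx).2.2, hX x y hx]; simp
  · rw [hsum, (h0 x y hx).2.2, hX x y hx]; simp
  · simpa using hV.hasDerivAt_gconv l k y₁ x 0 t
  · have h1 := hT.hasDerivAt_gconv l k y₁ x 0 t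
    simp only [zero_mul, add_zero] at h1
    refine h1.congr_deriv ?_
    rw [eq_div_iff two_ne_zero, ← (hT.pd _).gconv_add (hT.pd _), mul_comm,
      ← gconv_mul_left (fun _ _ => (2 : ℂ))]
    congr 1
    funext z
    rw [hsum 1, hsum (-1)]
    push_cast
    ring
  · have h1 := (hT.pd (1, 1, 0)).hasDerivAt_gconv l k y₁ (x + t) (-1) t
    simp only [neg_mul, one_mul, ← sub_eq_add_neg, add_sub_cancel_right] at h1
    refine h1.congr_deriv ?_
    exact hV.gconv_wave b t x
  · have h1 := (hT.pd (1, -1, 0)).hasDerivAt_gconv l k y₁ (x - t) 1 t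
    simp only [one_mul, sub_add_cancel] at h1
    refine h1.congr_deriv ?_
    rw [show _root_.pd (1, 1, 0) (_root_.pd (1, -1, 0) (_root_.pd (1, 0, 0) V))
      = _root_.pd (1, -1, 0) (_root_.pd (1, 1, 0) (_root_.pd (1, 0, 0) V)) from
      funext fun z => pd_comm hT.smooth _ _ z]
    exact hV.gconv_wave b t x

/-- **Local uniqueness.** If the equation holds near the prism over the backward light triangle and the
data vanish below it, the function vanishes to second order at the vertex. The Gaussian means of a
cutoff of `U` solve the system up to an error that is exponentially small with respect to `l`. -/
lemma eq_zero_at_vertex {Ω : Set (ℝ × ℝ × ℝ)} (hΩ : IsOpen Ω) {U : ℝ × ℝ × ℝ → ℂ}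
    (hU : ContDiffOn ℝ ∞ U Ω) {b : ℝ} (hb : |b| ≤ 1) (heq : ∀ z ∈ Ω, model3 b U z = 0)
    {s τ x₁ y₁ R : ℝ} (hτ : 0 < τ) (hR : R = 4 * τ) (hR1 : R ≤ 1)
    (hx : ∀ z ∈ triangle s τ x₁, |z.2| ≤ 1)
    (hQ : ∀ t x y, (t, x) ∈ triangle s τ x₁ → |y - y₁| ≤ 3 * R → (t, x, y) ∈ Ω)
    (h0 : ∀ x y, (s, x, y) ∈ Ω → |x - x₁| ≤ τ → |y - y₁| ≤ 4 * R → U (s, x, y) = 0 ∧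
      pd (1, 0, 0) U (s, x, y) = 0 ∧ pd (1, 0, 0) (pd (1, 0, 0) U) (s, x, y) = 0) :
    U (s + τ, x₁, y₁) = 0 ∧ pd (1, 0, 0) U (s + τ, x₁, y₁) = 0 ∧
      pd (1, 0, 0) (pd (1, 0, 0) U) (s + τ, x₁, y₁) = 0 := by
  have hR0 : 0 < R := by linarith
  set Q : Set (ℝ × ℝ × ℝ) := {z | (z.1, z.2.1) ∈ triangle s τ x₁ ∧ |z.2.2 - y₁| ≤ 3 * R} with hQdef
  have hQc : IsCompact Q := by
    refine (isCompact_Icc (a := ((s, x₁ - τ, y₁ - 3 * R) : ℝ × ℝ × ℝ)) (b := (s + τ, x₁ + τ, y₁ + 3 * R))).of_isClosed_subset ?_ ?_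
    · change IsClosed (({z : ℝ × ℝ × ℝ | s ≤ z.1} ∩ {z | |z.2.1 - x₁| ≤ s + τ - z.1})
        ∩ {z | |z.2.2 - y₁| ≤ 3 * R})
      exact ((isClosed_le (by fun_prop) (by fun_prop)).inter
        (isClosed_le (by fun_prop) (by fun_prop))).inter (isClosed_le (by fun_prop) (by fun_prop))
    · rintro ⟨t, x, y⟩ ⟨⟨h1, h2⟩, h3⟩
      simp only at h1 h2 h3
      have h4 := abs_nonneg (x - x₁)
      rw [abs_le] at h2 h3
      refine ⟨⟨h1, ?_, ?_⟩, ⟨?_, ?_, ?_⟩⟩ <;> simp only <;> linarith [h2.1, h2.2, h3.1, h3.2]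
  -- the cutoff is `1` near the prism `Q` and vanishes for `|y - y₁| ≥ 4 R`, so that the initial data
  -- of `V` vanish for all `y`
  set Ω' : Set (ℝ × ℝ × ℝ) := Ω ∩ {z | |z.2.2 - y₁| < 4 * R} with hΩ'
  have hΩo : IsOpen Ω' := hΩ.inter (isOpen_lt (by fun_prop) (by fun_prop))
  have hQΩ : Q ⊆ Ω' := fun z hz => ⟨hQ _ _ _ hz.1 hz.2, hz.2.trans_lt (by linarith)⟩
  have hU' := hU.mono (Set.inter_subset_left : Ω' ⊆ Ω)
  obtain ⟨χ, hχ, hV, hsupp, O, hO, hQO, hO1⟩ := exists_testFun_cutoff hΩo hQc hQΩ hU'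
  set V : ℝ × ℝ × ℝ → ℂ := fun z => χ z * U z with hVdef
  have hVU : Set.EqOn V U O := fun z hz => by simp [hVdef, hO1 z hz]
  have hχd : Differentiable ℝ χ := hχ.differentiable (by simp)
  have hχTd := (contDiff_pd hχ (1, 0, 0)).differentiable (by simp)
  have hT1 : Set.EqOn (pd (1, 0, 0) V) (fun z => χ z * pd (1, 0, 0) U z + pd (1, 0, 0) χ z * U z) Ω' :=
    fun z hz => pd_mul (hχd z) (differentiableAt_of_contDiffOn hΩo hU' hz) _
  have hinit : ∀ x y, |x - x₁| ≤ τ → V (s, x, y) = 0 ∧ pd (1, 0, 0) V (s, x, y) = 0 ∧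
      pd (1, 0, 0) (pd (1, 0, 0) V) (s, x, y) = 0 := by
    intro x y hxy
    by_cases hz : (s, x, y) ∈ Ω'
    · obtain ⟨a0, a1, a2⟩ := h0 x y hz.1 hxy (le_of_lt hz.2)
      refine ⟨by simp [hVdef, a0], by rw [hT1 hz]; simp [a0, a1], ?_⟩
      have d0 := differentiableAt_of_contDiffOn hΩo hU' hz
      have d1 := differentiableAt_of_contDiffOn hΩo (contDiffOn_pd hΩo hU' (1, 0, 0)) hz
      rw [pd_eqOn hΩo hT1 _ hz, pd_add (V := fun z => χ z * pd (1, 0, 0) U z)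
        (V' := fun z => pd (1, 0, 0) χ z * U z) ((hχd _).mul d1) ((hχTd _).mul d0), pd_mul (hχd _) d1,
        pd_mul (hχTd _) d0, a0, a1, a2]
      simp
    · have hO' : IsOpen (tsupport χ)ᶜ := (isClosed_tsupport χ).isOpen_compl
      have hz' : (s, x, y) ∈ (tsupport χ)ᶜ := fun h => hz (hsupp h)
      have hV0 : Set.EqOn V (fun _ => 0) (tsupport χ)ᶜ := fun z hz => by
        simp [hVdef, image_eq_zero_of_notMem_tsupport hz]
      have e0 : ∀ v : ℝ × ℝ × ℝ, pd v (fun _ => (0 : ℂ)) = fun _ => 0 := fun v => by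
        funext z
        simp [pd]
      have hV1 := pd_eqOn hO' hV0 (1, 0, 0)
      rw [e0] at hV1
      have hV2 := pd_eqOn hO' hV1 (1, 0, 0)
      rw [e0] at hV2
      exact ⟨hV0 hz', hV1 hz', hV2 hz'⟩
  obtain ⟨N, hN, hNle⟩ := (hV.model3 (b := b)).exists_gconv_le
  obtain ⟨M, hM, hMle⟩ := (hV.pd (1, 0, 0)).exists_gconv_le
  have hE : ∀ z ∈ Q, model3 b V z = 0 := fun z hz => by
    rw [model3_eqOn hO hVU (hQO hz)]
    exact heq z (hQΩ hz).1
  -- `model3 b V` vanishes on `Q`, hence only the values of the kernel at distance at least `3 R`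
  -- contribute to the error; the a priori bound of size `exp (l R²)` does not enter the result
  have key : ∀ l : ℝ, 0 < l → _ := fun l hl =>
    (hV.charSystem b hτ hinit l y₁).norm_le hτ hR hR1 hb hx
      (ε := Real.exp (-(3 * l * R ^ 2)) * N) (μ := Real.exp (l * R ^ 2) * M) (by positivity)
      (fun k z hz => by
        refine (hNle l k y₁ z.1 z.2 (Real.exp (-(3 * l * R ^ 2)) * (k ! : ℝ) / R ^ k) (by positivity)
          fun y hy => norm_gaussK_le_of_far hl.le hR0 k ?_).trans_eq (by ring)
        by_contra! hlt
        exact hy (hE (z.1, z.2, y) ⟨hz, by rw [abs_sub_comm]; exact hlt.le⟩))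
      (by positivity)
      (fun k z _ => (hMle l k y₁ z.1 z.2 (Real.exp (l * R ^ 2) * (k ! : ℝ) / R ^ k) (by positivity)
          fun y _ => norm_gaussK_le hl.le hR0 k _).trans_eq (by ring))
  have hvO : (s + τ, x₁, y₁) ∈ O := hQO ⟨⟨by simpa using hτ.le, by simp⟩, by simp; positivity⟩
  have hc : 0 < 3 * R ^ 2 := by positivity
  have hform : ∀ l, 32 * (Real.exp (-(3 * l * R ^ 2)) * N) / R ^ 2
      = 32 * N / R ^ 2 * Real.exp (-(3 * R ^ 2 * l)) := fun l => by
    rw [show 3 * l * R ^ 2 = 3 * R ^ 2 * l by ring]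
    ring
  have z0 := hV.eq_zero_of_gconv_le hc fun l hl => (key l hl).1.trans_eq (hform l)
  have z1 := (hV.pd (1, 0, 0)).eq_zero_of_gconv_le hc fun l hl => (key l hl).2.1.trans_eq (hform l)
  -- the sum of the two characteristic derivatives is `2 ∂ₜ² V`
  have z2 := TestFun.eq_zero_of_gconv_le
    (V := fun z => pd (1, 1, 0) (pd (1, 0, 0) V) z + pd (1, -1, 0) (pd (1, 0, 0) V) z)
    ⟨((hV.pd _).pd _).smooth.add ((hV.pd _).pd _).smooth,
      ((hV.pd _).pd _).compact.add ((hV.pd _).pd _).compact⟩ hc fun l hl => by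
    rw [((hV.pd _).pd _).gconv_add ((hV.pd _).pd _)]
    exact (key l hl).2.2.trans_eq (hform l)
  refine ⟨by rw [← hVU hvO]; exact z0, by rw [← pd_eqOn hO hVU _ hvO]; exact z1, ?_⟩
  rw [← pd_eqOn hO (pd_eqOn hO hVU _) _ hvO]
  rw [← pd_add_vec, show ((1 : ℝ), (1 : ℝ), (0 : ℝ)) + (1, -1, 0) = (1, 0, 0) + (1, 0, 0) by
    norm_num, pd_add_vec, ← two_mul] at z2
  exact (mul_eq_zero.1 z2).resolve_left two_ne_zero

end

end

/-! ### Uniqueness in a backward cone -/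

noncomputable section
open Filter Topology MeasureTheory

/-- The part in `t ≥ 0` of the backward cone with vertex `(t₀, x₀, y₀)`, of slope `1` in `x` and `16`
in `y`. -/
def backwardCone (t₀ x₀ y₀ : ℝ) : Set (ℝ × ℝ × ℝ) :=
  {z | 0 ≤ z.1 ∧ |z.2.1 - x₀| ≤ t₀ - z.1 ∧ |z.2.2 - y₀| ≤ 16 * (t₀ - z.1)}

lemma isCompact_backwardCone (t₀ x₀ y₀ : ℝ) : IsCompact (backwardCone t₀ x₀ y₀) := by
  refine (isCompact_Icc (a := ((0, x₀ - t₀, y₀ - 16 * t₀) : ℝ × ℝ × ℝ))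
    (b := (t₀, x₀ + t₀, y₀ + 16 * t₀))).of_isClosed_subset ?_ ?_
  · change IsClosed ({z : ℝ × ℝ × ℝ | 0 ≤ z.1} ∩ ({z | |z.2.1 - x₀| ≤ t₀ - z.1}
      ∩ {z | |z.2.2 - y₀| ≤ 16 * (t₀ - z.1)}))
    exact (isClosed_le (by fun_prop) (by fun_prop)).inter
      ((isClosed_le (by fun_prop) (by fun_prop)).inter (isClosed_le (by fun_prop) (by fun_prop)))
  · rintro ⟨t, x, y⟩ ⟨h1, h2, h3⟩
    simp only at h1 h2 h3
    have h4 := abs_nonneg (x - x₀)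
    rw [abs_le] at h2 h3
    refine ⟨⟨h1, ?_, ?_⟩, ⟨?_, ?_, ?_⟩⟩ <;> simp only <;> linarith [h2.1, h2.2, h3.1, h3.2]

/-- **Uniqueness in a backward cone.** Local uniqueness is applied on thin layers `iτ ≤ t ≤ (i + 1)τ`,
with prisms that stay in a neighbourhood of the cone. -/
lemma eq_zero_of_backwardCone {Ω : Set (ℝ × ℝ × ℝ)} (hΩ : IsOpen Ω) {U : ℝ × ℝ × ℝ → ℂ}
    (hU : ContDiffOn ℝ ∞ U Ω) {b : ℝ} (hb : |b| ≤ 1) (heq : ∀ z ∈ Ω, model3 b U z = 0)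
    (h0 : ∀ x y, (0, x, y) ∈ Ω → U (0, x, y) = 0 ∧ pd (1, 0, 0) U (0, x, y) = 0 ∧
      pd (1, 0, 0) (pd (1, 0, 0) U) (0, x, y) = 0)
    {t₀ x₀ y₀ : ℝ} (ht₀ : 0 ≤ t₀) (hx₀ : |x₀| + t₀ ≤ 1) (hK : backwardCone t₀ x₀ y₀ ⊆ Ω) :
    U (t₀, x₀, y₀) = 0 := by
  rcases ht₀.eq_or_lt with rfl | ht₀
  · exact (h0 x₀ y₀ (hK ⟨le_rfl, by simp, by simp⟩)).1
  obtain ⟨κ, hκ, hκΩ⟩ := (isCompact_backwardCone t₀ x₀ y₀).exists_cthickening_subset_open hΩ hK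
  -- A prism of height `τ` has half width `3 R = 12 τ` in `y`, which has to be at most `κ`; its base
  -- needs vanishing data for `|y - y₁| ≤ 4 R = 16 τ`, whence the slope `16`.
  obtain ⟨m, hm⟩ := exists_nat_gt (max (12 * t₀ / κ) (4 * t₀))
  have hm1 : 12 * t₀ / κ < m := (le_max_left _ _).trans_lt hm
  have hm2 : 4 * t₀ < m := (le_max_right _ _).trans_lt hm
  have hm0 : (0 : ℝ) < m := by linarith
  obtain ⟨τ, hτdef⟩ : ∃ τ, τ = t₀ / m := ⟨_, rfl⟩
  have hτ : 0 < τ := by rw [hτdef]; positivity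
  have hmτ : m * τ = t₀ := by rw [hτdef]; field_simp
  have hκτ : 3 * (4 * τ) ≤ κ := by
    rw [div_lt_iff₀ hκ, ← hmτ] at hm1
    nlinarith
  have hτ1 : 4 * τ ≤ 1 := by
    rw [← hmτ] at hm2
    nlinarith
  have step : ∀ i : ℕ, i ≤ m → ∀ x y, (i * τ, x, y) ∈ backwardCone t₀ x₀ y₀ → U (i * τ, x, y) = 0 ∧
      pd (1, 0, 0) U (i * τ, x, y) = 0 ∧ pd (1, 0, 0) (pd (1, 0, 0) U) (i * τ, x, y) = 0 := by
    intro i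
    induction i with
    | zero =>
      intro _ x y hxy
      rw [Nat.cast_zero, zero_mul] at hxy ⊢
      exact h0 x y (hK hxy)
    | succ i ih =>
      intro hi x y hxy
      obtain ⟨-, h2, h3⟩ := hxy
      have hs : ((i + 1 : ℕ) : ℝ) * τ = i * τ + τ := by push_cast; ring
      have hi0 : 0 ≤ (i : ℝ) * τ := by positivity
      simp only [hs] at h2 h3 ⊢
      refine eq_zero_at_vertex hΩ hU hb heq hτ rfl hτ1 ?_ ?_ ?_
      · rintro ⟨t, x'⟩ ⟨h4, h5⟩
        simp only at h4 h5 ⊢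
        have h6 := abs_sub_le x' x x₀
        have h7 := abs_sub_abs_le_abs_sub x' x₀
        linarith
      · rintro t x' y' ⟨h4, h5⟩ hy'
        simp only at h4 h5
        refine hκΩ (Metric.mem_cthickening_of_dist_le (t, x', y') (t, x', y) _ _ ⟨by linarith, ?_, ?_⟩ ?_)
        · have h6 := abs_sub_le x' x x₀
          simp only
          linarith
        · have h6 := abs_nonneg (x' - x)
          simp only
          linarith
        · rw [Prod.dist_eq, Prod.dist_eq, dist_self, dist_self, Real.dist_eq]
          simp only [max_le_iff]
          exact ⟨hκ.le, hκ.le, hy'.trans hκτ⟩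
      · intro x' y' _ hx' hy'
        refine ih (by omega) x' y' ⟨hi0, ?_, ?_⟩
        · have h6 := abs_sub_le x' x x₀
          simp only
          linarith
        · have h6 := abs_sub_le y' y y₀
          simp only
          linarith
  have := (step m le_rfl x₀ y₀ ⟨by rw [hmτ]; exact ht₀.le, by simp [hmτ], by simp [hmτ]⟩).1
  rwa [hmτ] at this

end

/-! ### Uniqueness in lenses, and the conclusion -/

noncomputable section
open Filter Topology MeasureTheory

section
variable {d : ℕ} {u v : Euc d → ℂ} {U : Set (Euc d)}

lemma contDiffOn_Dx (hU : IsOpen U) (hu : ContDiffOn ℝ ∞ u U) (i : Fin d) :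
    ContDiffOn ℝ ∞ (Dx i u) U :=
  contDiffOn_const.mul ((hu.fderiv_of_isOpen hU (m := ∞) (by simp)).clm_apply contDiffOn_const)

lemma contDiffOn_Dx_iterate (hU : IsOpen U) (hu : ContDiffOn ℝ ∞ u U) (i : Fin d) (m : ℕ) :
    ContDiffOn ℝ ∞ ((Dx i)^[m] u) U := by
  induction m with
  | zero => exact hu
  | succ m ih => rw [Function.iterate_succ_apply']; exact contDiffOn_Dx hU ih i

/-- If `w = u - v` on `U`, then the same holds for the derivatives. -/
lemma Dx_eqOn_sub {w : Euc d → ℂ} (hU : IsOpen U) (hu : ContDiffOn ℝ ∞ u U) (hv : ContDiffOn ℝ ∞ v U)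
    (hw : Set.EqOn w (fun x => u x - v x) U) (i : Fin d) :
    Set.EqOn (Dx i w) (fun x => Dx i u x - Dx i v x) U := fun x hx => by
  have hd : ∀ {u : Euc d → ℂ}, ContDiffOn ℝ ∞ u U → DifferentiableAt ℝ u x := fun hu =>
    (hu.differentiableOn (by simp)).differentiableAt (hU.mem_nhds hx)
  rw [Dx_congr_of_eqOn hU hw i hx]
  simp only [Dx]
  rw [fderiv_fun_sub (hd hu) (hd hv), sub_apply]
  ring

lemma Dx_iterate_eqOn_sub (hU : IsOpen U) (hu : ContDiffOn ℝ ∞ u U) (hv : ContDiffOn ℝ ∞ v U)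
    (i : Fin d) (m : ℕ) :
    Set.EqOn ((Dx i)^[m] fun x => u x - v x) (fun x => (Dx i)^[m] u x - (Dx i)^[m] v x) U := by
  induction m with
  | zero => exact fun x _ => rfl
  | succ m ih =>
    simp only [Function.iterate_succ_apply']
    exact Dx_eqOn_sub hU (contDiffOn_Dx_iterate hU hu i m) (contDiffOn_Dx_iterate hU hv i m) ih i

end

lemma modelOp_sub {n : ℕ} {b : ℝ} {u v : Euc (n + 1) → ℂ} {U : Set (Euc (n + 1))} (hU : IsOpen U)
    (hu : ContDiffOn ℝ ∞ u U) (hv : ContDiffOn ℝ ∞ v U) :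
    Set.EqOn (modelOp n b fun x => u x - v x) (fun x => modelOp n b u x - modelOp n b v x) U :=
  fun x hx => by
  have h := fun i j l => Dx_eqOn_sub hU (contDiffOn_Dx hU (contDiffOn_Dx hU hu i) j)
    (contDiffOn_Dx hU (contDiffOn_Dx hU hv i) j) (Dx_eqOn_sub hU (contDiffOn_Dx hU hu i)
      (contDiffOn_Dx hU hv i) (Dx_eqOn_sub hU hu hv (fun _ _ => rfl) i) j) l hx
  simp only [modelOp, h]
  ring

lemma isOpen_lens (n : ℕ) (δ : ℝ) : IsOpen (lens n δ) :=
  isOpen_lt ((((spaceCLM n).continuous.norm).pow 2).add (continuous_coord 0).abs) continuous_const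

/-- The linear map `(t, x, y) ↦ σ t e_0 + x e_1 + y e_n`. -/
def sliceCLM (n : ℕ) (σ : ℝ) : ℝ × ℝ × ℝ →L[ℝ] Euc (n + 1) :=
  (σ • ContinuousLinearMap.fst ℝ ℝ (ℝ × ℝ)).smulRight (EuclideanSpace.single 0 1)
    + ((ContinuousLinearMap.fst ℝ ℝ ℝ).comp (ContinuousLinearMap.snd ℝ ℝ (ℝ × ℝ))).smulRight
      (EuclideanSpace.single 1 1)
    + ((ContinuousLinearMap.snd ℝ ℝ ℝ).comp (ContinuousLinearMap.snd ℝ ℝ (ℝ × ℝ))).smulRight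
      (EuclideanSpace.single (Fin.last n) 1)

lemma sliceCLM_apply (n : ℕ) (σ : ℝ) (z : ℝ × ℝ × ℝ) : sliceCLM n σ z
    = (σ * z.1) • EuclideanSpace.single 0 1 + z.2.1 • EuclideanSpace.single 1 1
      + z.2.2 • EuclideanSpace.single (Fin.last n) 1 := rfl

section
variable {n : ℕ} {σ : ℝ} {U : Set (Euc (n + 1))} {c : Euc (n + 1)}

/-- A derivative in the variables `(t, x, y)` is a derivative `∂_i = i D_i` of the function on `ℝⁿ⁺¹`. -/
lemma pd_eqOn_slice (hU : IsOpen U) {V : ℝ × ℝ × ℝ → ℂ} {g : Euc (n + 1) → ℂ} {k : ℂ}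
    (hg : ContDiffOn ℝ ∞ g U) (hV : Set.EqOn V (fun z => k * g (c + sliceCLM n σ z))
      ((fun z => c + sliceCLM n σ z) ⁻¹' U)) {v : ℝ × ℝ × ℝ} {s : ℝ} {i : Fin (n + 1)}
    (hv : sliceCLM n σ v = s • EuclideanSpace.single i 1) :
    Set.EqOn (pd v V) (fun z => k * (s * Complex.I) * Dx i g (c + sliceCLM n σ z))
      ((fun z => c + sliceCLM n σ z) ⁻¹' U) := fun z hz => by
  have ho : IsOpen ((fun z => c + sliceCLM n σ z) ⁻¹' U) := hU.preimage (by fun_prop)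
  have hd : DifferentiableAt ℝ g (c + sliceCLM n σ z) :=
    (hg.differentiableOn (by simp)).differentiableAt (hU.mem_nhds hz)
  have h1 : HasFDerivAt (fun z => k * g (c + sliceCLM n σ z))
      (k • (fderiv ℝ g (c + sliceCLM n σ z)).comp (sliceCLM n σ)) z :=
    (hd.hasFDerivAt.comp z ((sliceCLM n σ).hasFDerivAt.const_add c)).const_mul k
  rw [pd_eqOn ho hV v hz, pd, h1.fderiv, smul_apply, ContinuousLinearMap.comp_apply, hv, map_smul,
    Complex.real_smul, smul_eq_mul]
  simp only [Dx]
  linear_combination (k * s * fderiv ℝ g (c + sliceCLM n σ z) (EuclideanSpace.single i 1))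
    * Complex.I_sq

variable {w : Euc (n + 1) → ℂ} {b : ℝ}

/-- Reversal of time changes the sign of `b`. -/
lemma model3_slice (hn : 2 ≤ n) (hσ : σ ^ 2 = 1) (hc : c 1 = 0) (hU : IsOpen U) (hw : ContDiffOn ℝ ∞ w U)
    {z : ℝ × ℝ × ℝ} (hz : c + sliceCLM n σ z ∈ U) :
    model3 (σ * b) (fun z => w (c + sliceCLM n σ z)) z
      = σ * Complex.I ^ 3 * modelOp n b w (c + sliceCLM n σ z) := by
  have hT : sliceCLM n σ (1, 0, 0) = σ • EuclideanSpace.single 0 1 := by simp [sliceCLM_apply]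
  have hX : sliceCLM n σ (0, 1, 0) = (1 : ℝ) • EuclideanSpace.single 1 1 := by simp [sliceCLM_apply]
  have hY : sliceCLM n σ (0, 0, 1) = (1 : ℝ) • EuclideanSpace.single (Fin.last n) 1 := by
    simp [sliceCLM_apply]
  have h0 : Set.EqOn (fun z => w (c + sliceCLM n σ z)) (fun z => (1 : ℂ) * w (c + sliceCLM n σ z))
    ((fun z => c + sliceCLM n σ z) ⁻¹' U) := fun z _ => (one_mul _).symm
  have hD := fun i => contDiffOn_Dx hU hw i
  have hDD := fun i j => contDiffOn_Dx hU (hD i) j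
  have hT1 := pd_eqOn_slice hU hw h0 hT
  have hX1 := pd_eqOn_slice hU (hD _) hT1 hX
  have hY1 := pd_eqOn_slice hU (hD _) hT1 hY
  have hcoord : (c + sliceCLM n σ z) 1 = z.2.1 := by
    have e1 : (1 : Fin (n + 1)) ≠ 0 := by simp [Fin.ext_iff]; omega
    have e2 : (1 : Fin (n + 1)) ≠ Fin.last n := by
      simp only [ne_eq, Fin.ext_iff, Fin.val_last, Fin.val_one']
      rw [Nat.mod_eq_of_lt (by omega)]
      omega
    simp [sliceCLM_apply, hc, e1, e2]
  rw [model3, pd_eqOn_slice hU (hDD _ _) (pd_eqOn_slice hU (hD _) hT1 hT) hT hz,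
    pd_eqOn_slice hU (hDD _ _) hX1 hX hz, pd_eqOn_slice hU (hDD _ _) hY1 hY hz,
    pd_eqOn_slice hU (hDD _ _) (pd_eqOn_slice hU (hD _) (pd_eqOn_slice hU hw h0 hY) hY) hY hz,
    modelOp, hcoord]
  have hσ' : (σ : ℂ) ^ 2 = 1 := by exact_mod_cast hσ
  push_cast
  linear_combination (σ * Complex.I ^ 3 * Dx 0 (Dx 0 (Dx 0 w)) (c + sliceCLM n σ z)) * hσ'

/-- Uniqueness for the homogeneous problem. -/
lemma eq_zero_of_lens (hn : 2 ≤ n) (hb : |b| ≤ 1) {ε : ℝ} (hε : ε ≤ 1 / 2000)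
    (hw : ContDiffOn ℝ ∞ w (lens n ε)) (heq : ∀ x ∈ lens n ε, modelOp n b w x = 0)
    (hinit : ∀ x ∈ lens n ε, x 0 = 0 → ∀ j < 3, (Dx 0)^[j] w x = 0) {p : Euc (n + 1)}
    (hp : p ∈ lens n ε) : w p = 0 := by
  have e1 : (1 : Fin (n + 1)) ≠ 0 := by simp [Fin.ext_iff]; omega
  have e2 : Fin.last n ≠ (0 : Fin (n + 1)) := by simp [Fin.ext_iff]; omega
  have e3 : (1 : Fin (n + 1)) ≠ Fin.last n := by
    simp only [ne_eq, Fin.ext_iff, Fin.val_last, Fin.val_one']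
    rw [Nat.mod_eq_of_lt (by omega)]
    omega
  -- `σ` is the direction of time in which `p` lies, and `c + sliceCLM n σ` parametrizes the slice
  -- through `p`; only the coordinate `x₁`, which occurs in the operator, has to vanish at `c`
  obtain ⟨σ, hσ, hσp⟩ : ∃ σ : ℝ, σ ^ 2 = 1 ∧ σ * p 0 = |p 0| := by
    rcases le_total 0 (p 0) with h | h
    · exact ⟨1, by norm_num, by rw [one_mul, abs_of_nonneg h]⟩
    · exact ⟨-1, by norm_num, by rw [abs_of_nonpos h, neg_one_mul]⟩
  have hσ1 : |σ| = 1 := by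
    rw [← Real.sqrt_sq_eq_abs, hσ, Real.sqrt_one]
  have hU := isOpen_lens n ε
  set c : Euc (n + 1) := p - sliceCLM n σ (|p 0|, p 1, p (Fin.last n)) with hcdef
  have hcz : ∀ z, c + sliceCLM n σ z = p + sliceCLM n σ (z - (|p 0|, p 1, p (Fin.last n))) := fun z => by
    rw [map_sub, hcdef]; abel
  have hvert : c + sliceCLM n σ (|p 0|, p 1, p (Fin.last n)) = p := by rw [hcdef]; abel
  have hc1 : c 1 = 0 := by simp [hcdef, sliceCLM_apply, e1, e3]
  have hc0 : ∀ z, (c + sliceCLM n σ z) 0 = σ * z.1 := fun z => by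
    have : σ * |p 0| = p 0 := by rw [← hσp, ← mul_assoc, ← sq, hσ, one_mul]
    simp [hcdef, sliceCLM_apply, e1.symm, e2.symm, this]
  have hspace : ∀ z : ℝ × ℝ × ℝ, ‖spacePart (c + sliceCLM n σ z)‖
      ≤ ‖spacePart p‖ + |z.2.1 - p 1| + |z.2.2 - p (Fin.last n)| := fun z => by
    have h0 : spaceCLM n (EuclideanSpace.single 0 1) = 0 := by
      ext j
      simp [spaceCLM_apply, spacePart]
    have h1 : ∀ i : Fin (n + 1), ‖spaceCLM n (EuclideanSpace.single i 1)‖ ≤ 1 := fun i => by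
      refine ((spaceCLM n).le_of_opNorm_le (norm_spaceCLM_le n) _).trans ?_
      simp
    rw [hcz, ← spaceCLM_apply, ← spaceCLM_apply, map_add, sliceCLM_apply, map_add, map_add, map_smul,
      map_smul, map_smul, h0, smul_zero, zero_add, add_assoc]
    refine (norm_add_le _ _).trans (add_le_add le_rfl ((norm_add_le _ _).trans (add_le_add ?_ ?_)))
    · rw [norm_smul, Real.norm_eq_abs]
      exact mul_le_of_le_one_right (abs_nonneg _) (h1 _)
    · rw [norm_smul, Real.norm_eq_abs]
      exact mul_le_of_le_one_right (abs_nonneg _) (h1 _)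
  have hp' : ‖spacePart p‖ ^ 2 + |p 0| < ε := hp
  have hpn := norm_nonneg (spacePart p)
  have hp0 := abs_nonneg (p 0)
  have hpa : ‖spacePart p‖ ≤ 1 / 44 :=
    le_of_sq_le_sq (by nlinarith) (by norm_num)
  have hp1 : |p 1| ≤ ‖spacePart p‖ := by
    have h1 : (1 : Fin (n + 1)) = (⟨0, by omega⟩ : Fin n).succ := by
      simp only [Fin.ext_iff, Fin.val_one', Fin.val_succ]
      rw [Nat.mod_eq_of_lt (by omega)]
    rw [h1]
    exact PiLp.norm_apply_le (spacePart p) ⟨0, by omega⟩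
  have hT : sliceCLM n σ (1, 0, 0) = σ • EuclideanSpace.single 0 1 := by simp [sliceCLM_apply]
  have hT1 := pd_eqOn_slice (c := c) (k := 1) (V := fun z => w (c + sliceCLM n σ z)) hU hw
    (fun z _ => (one_mul _).symm) hT
  have hT2 := pd_eqOn_slice hU (contDiffOn_Dx hU hw 0) hT1 hT
  have key := eq_zero_of_backwardCone (Ω := (fun z => c + sliceCLM n σ z) ⁻¹' lens n ε)
    (U := fun z => w (c + sliceCLM n σ z)) (b := σ * b) (hU.preimage (by fun_prop))
    (hw.comp (by fun_prop) fun z hz => hz) (by rw [abs_mul, hσ1, one_mul]; exact hb)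
    (fun z hz => by rw [model3_slice hn hσ hc1 hU hw hz, heq _ hz, mul_zero])
    (fun x y hz => by
      have hz0 : (c + sliceCLM n σ (0, x, y)) 0 = 0 := by rw [hc0]; simp
      have hi := hinit _ hz hz0
      have i1 : Dx 0 w (c + sliceCLM n σ (0, x, y)) = 0 := hi 1 (by norm_num)
      have i2 : Dx 0 (Dx 0 w) (c + sliceCLM n σ (0, x, y)) = 0 := hi 2 (by norm_num)
      exact ⟨hi 0 (by norm_num), (hT1 hz).trans (by simp only [i1, mul_zero]),
        (hT2 hz).trans (by simp only [i2, mul_zero])⟩)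
    (t₀ := |p 0|) (x₀ := p 1) (y₀ := p (Fin.last n)) hp0 (by nlinarith) ?_
  · simpa only [hvert] using key
  · rintro ⟨t, x, y⟩ ⟨h1, h2, h3⟩
    simp only at h1 h2 h3
    have hts : 0 ≤ |p 0| - t := (abs_nonneg _).trans h2
    change ‖spacePart (c + sliceCLM n σ (t, x, y))‖ ^ 2 + |(c + sliceCLM n σ (t, x, y)) 0| < ε
    rw [hc0, abs_mul, hσ1, one_mul, abs_of_nonneg h1]
    have h4 : ‖spacePart (c + sliceCLM n σ (t, x, y))‖ ≤ ‖spacePart p‖ + 17 * (|p 0| - t) := by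
      have := hspace (t, x, y)
      simp only at this
      linarith
    have h5 := pow_le_pow_left₀ (norm_nonneg _) h4 2
    -- the slopes of the cone are small against the curvature of the boundary of the lens
    have h6 : 0 ≤ (|p 0| - t) * (1 - 34 * ‖spacePart p‖ - 289 * (|p 0| - t)) :=
      mul_nonneg hts (by nlinarith [sq_nonneg ‖spacePart p‖])
    nlinarith

end

/-- Smooth solutions of the Cauchy problem in a small lens are unique. -/
theorem eqOn_of_solvesCauchy {n : ℕ} (hn : 2 ≤ n) {b : ℝ} (hb : |b| ≤ 1) {ε : ℝ} (hε : ε ≤ 1 / 2000)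
    {f : Euc (n + 1) → ℂ} {g : Fin 3 → Euc n → ℂ} {u v : Euc (n + 1) → ℂ}
    (hu : SolvesCauchy (modelOp n b) 3 (lens n ε) f g u)
    (hv : SolvesCauchy (modelOp n b) 3 (lens n ε) f g v) : Set.EqOn u v (lens n ε) := fun p hp => by
  have hU := isOpen_lens n ε
  refine sub_eq_zero.1 (eq_zero_of_lens (w := fun x => u x - v x) hn hb hε (hu.smooth.sub hv.smooth)
    (fun x hx => ?_) (fun x hx hx0 j hj => ?_) hp)
  · exact (modelOp_sub hU hu.smooth hv.smooth hx).trans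
      (sub_eq_zero.2 ((hu.eqn x hx).trans (hv.eqn x hx).symm))
  · exact (Dx_iterate_eqOn_sub hU hu.smooth hv.smooth 0 j hx).trans
      (sub_eq_zero.2 ((hu.init x hx hx0 ⟨j, hj⟩).trans (hv.init x hx hx0 ⟨j, hj⟩).symm))

end

theorem theorem1p1 (n : ℕ) (hn : 2 ≤ n) (b₀ : ℝ) (hb_pos : 0 < |b₀|)
    (hb_lt : |b₀| < 2 / (3 * Real.sqrt 3)) :
    GevreyWellPosed (modelOp n b₀) 3 2 := by
  have h3 : 1 ≤ Real.sqrt 3 := Real.one_le_sqrt.2 (by norm_num)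
  have hb' : 3 * Real.sqrt 3 / 2 * |b₀| < 1 := by
    rw [lt_div_iff₀ (by positivity)] at hb_lt
    linarith
  have hb : |b₀| ≤ 1 := by nlinarith
  refine ⟨1 / 2000, by norm_num, fun ε _ hε f g u v hu hv => eqOn_of_solvesCauchy hn hb hε.le hu hv,
    fun h hh r hr => ?_⟩
  obtain ⟨δ, hδ, hδε, A, hA⟩ := exists_cauchy_solution hn hb hb' (ε₀ := 1 / 2000) (by norm_num) hh hr
  refine ⟨δ, hδ, hδε, fun f g hf hg ⟨C, hC⟩ => ?_, fun L _ hL k => ⟨A k, fun f g u C hf hg hC hu x hx => ?_⟩⟩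
  · obtain ⟨u, hu, -⟩ := hA f g C hf.1 (fun j => (hg j).1) hC
    exact ⟨u, hu⟩
  · obtain ⟨v, hv, hvA⟩ := hA f g C hf.1 (fun j => (hg j).1) hC
    have huv := eqOn_of_solvesCauchy hn hb hδε.le hu hv
    have : u =ᶠ[nhds x] v := huv.eventuallyEq_of_mem ((isOpen_lens n δ).mem_nhds (hL hx))
    rw [(this.iteratedFDeriv ℝ k).eq_of_nhds]
    exact hvA k x (hL hx)
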